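/- Let $M$ be a compact smooth $4$-manifold with (possibly empty) smooth boundary, $\omega$ a smooth symplectic form on $M$, and fix a smooth Riemannian metric and a finite atlas of Darboux charts $h_j:U_j\to\mathbb R^4$ (so $\omega=h_j^*(dy_1\wedge dy_3+dy_2\wedge dy_4)$), compact sets $C_j\subset U_j$ covering $M$, and for each $x\in M$ a chart $h_x$ of the atlas around $x$. $C^k(M,\mathbb R)$ denotes the $C^k$ functions that are constant on each connected component of $\partial M$; two of them are $\epsilon$-$C^2$-close if all partial derivatives of order $\le 2$ of their difference, in each chart $h_j$, are smaller than $\epsilon$ in absolute value on $C_j$. For $H\in C^{k}(M,\mathbb R)$, $k\ge2$, $X_H$ is defined by $\omega(X_H,\cdot)=dH$, $\varphi_H^t$ is its flow, $N_x=(\mathbb R X_H(x))^\perp$, $\Pi_x$ is the orthogonal projection of $T_xM$ onto $N_x$, $\mathcal N_x=N_x\cap\ker dH(x)$, and $\Phi_H^t(x)=\Pi_{\varphi_H^t(x)}D\varphi_H^t(x)|_{\mathcal N_x}:\mathcal N_x\to\mathcal N_{\varphi^t_H(x)}$ is the transversal linear Poincaré flow. Normal sections and flowboxes. For $x$ with $dH(x)\neq0$,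 the normal section is $\mathfrak N_x=h_x^{-1}(h_x(x)+Dh_x(x)N_x)$, with coordinates $(u,v,w)$ given by an orthonormal basis of $N_x$ whose first two vectors lie in $\mathcal N_x$; $B(x,r)=\{\sqrt{u^2+v^2}<r,\ |w|<r\}\subset\mathfrak N_x$, and $\overline\mu$ is the measure on $\mathfrak N_x$ induced by $\iota_{X_H}(\omega\wedge\omega)$. For $T>0$, if $\varphi_H^t(x)\ne x$ for all $0<t\le T$ and $r$ is small, the Poincaré map $\mathcal P_H^T(x)$ from $B(x,r)$ to $\mathfrak N_{\varphi_H^T(x)}$ is $y\mapsto\varphi_H^{\tau(y)}(y)$ with $\tau>0$ continuous, $\tau(x)=T$; and for $U\subset B(x,r)$ the flowbox $\mathcal F_H^T(x,U)=\{\varphi_H^t(y): y\in U,\ 0\le t\le\tau(y)\}$ is self-disjoint (for $U=B(x,r)$ the map $(y,t)\mapsto\varphi_H^t(y)$ is injective on $\{0\le t\le\tau(y)\}$). Realizable flows. Let $H\in C^{s+1}(M,\mathbb R)$. A family of linear maps $L^t:\mathcal N_x\to\mathcal N_{\varphi_H^t(x)}$, $0\le t\le T$, preserving $\omega$, is $(\epsilon,\kappa)$-realizable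 of length $T$ at $x$ if for every $\gamma>0$ there is $r>0$, small in the above sense, such that for every relatively open $U\subset B(x,r)$ there are a measurable $K\subset U$ with $\overline\mu(U\setminus K)\le\kappa\,\overline\mu(U)$ and $\widetilde H\in C^s(M,\mathbb R)$, $\epsilon$-$C^2$-close to $H$, such that $\widetilde H=H$ outside $\mathcal F_H^T(x,U)$; $DX_H(y)=DX_{\widetilde H}(y)$ (as maps into $TTM$) for $y\in U\cup\mathcal P_H^T(x)U$; and $\|\Phi_{\widetilde H}^T(y)-L^T\|<\gamma$ for all $y\in K$. Here a linear map defined on a transversal fiber is extended to the tangent space by precomposing with the orthogonal projection onto that fiber, and the two maps are compared, in the operator norm of $\mathbb R^4$, in the charts $h_x$ (source) and $h_{\varphi_H^T(x)}$ (target; $\varphi_{\widetilde H}^T(y)$ is required to lie in its domain). Lemma. Let $s\ge2$ be an integer or $s=\infty$, $H\in C^{s+1}(M,\mathbb R)$, $\epsilon>0$, $0<\kappa<1$ and $C\in\mathbb R$. There is $\alpha_0>0$ such that for every $x\in M$ that is non-periodic or has period larger than $1$ (that is, $\varphi_H^t(x)\neq x$ for all $0<t\le1$), every basis $(e,f)$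 of $\mathcal N_x$ with $\omega(e,f)=1$ and $\|e\|,\|f\|\le C$, and every $0<\alpha\le\alpha_0$, the linear flow $\Phi_H^t(x)\circ R_\alpha$, where $R_\alpha e=\cos\alpha\,e+\sin\alpha\,f$ and $R_\alpha f=-\sin\alpha\,e+\cos\alpha\,f$, is $(\epsilon,\kappa)$-realizable of length $1$ at $x$. -/

import Mathlib

open Set MeasureTheory Bundle Manifold
open scoped ContDiff

noncomputable section

/-! `𝓡∂ 4` is the model of smooth `4`-manifolds with (possibly empty) boundary. -/

section Symplectic

variable {M : Type*} [TopologicalSpace M] [ChartedSpace (EuclideanHalfSpace 4) M]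

instance (x : M) : FiniteDimensional ℝ (TangentSpace (𝓡∂ 4) x) :=
  inferInstanceAs (FiniteDimensional ℝ (EuclideanSpace ℝ (Fin 4)))

/-- The differential `D h(x) : T_x M → ℝ⁴` of a chart `h`. -/
def chartD (h : OpenPartialHomeomorph M (EuclideanHalfSpace 4)) (x : M) :
    TangentSpace (𝓡∂ 4) x →L[ℝ] EuclideanSpace ℝ (Fin 4) :=
  mfderiv (𝓡∂ 4) 𝓘(ℝ, EuclideanSpace ℝ (Fin 4)) (h.extend (𝓡∂ 4)) x

/-- A smooth symplectic form on `M`: a smooth field of nondegenerate alternating bilinear forms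
which is closed. -/
structure SymplecticForm (M : Type*) [TopologicalSpace M]
    [ChartedSpace (EuclideanHalfSpace 4) M] [IsManifold (𝓡∂ 4) ∞ M] where
  form : ∀ x : M, TangentSpace (𝓡∂ 4) x →L[ℝ] TangentSpace (𝓡∂ 4) x →L[ℝ] ℝ
  contMDiff : ContMDiff (𝓡∂ 4) ((𝓡∂ 4).prod 𝓘(ℝ, EuclideanSpace ℝ (Fin 4) →L[ℝ]
      EuclideanSpace ℝ (Fin 4) →L[ℝ] ℝ)) ∞
    (fun x ↦ TotalSpace.mk' (EuclideanSpace ℝ (Fin 4) →L[ℝ] EuclideanSpace ℝ (Fin 4) →L[ℝ] ℝ)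
      (E := fun x : M ↦ TangentSpace (𝓡∂ 4) x →L[ℝ] TangentSpace (𝓡∂ 4) x →L[ℝ] ℝ) x (form x))
  alternating : ∀ (x : M) (v : TangentSpace (𝓡∂ 4) x), form x v v = 0
  nondegenerate : ∀ (x : M) (v : TangentSpace (𝓡∂ 4) x), (∀ w, form x v w = 0) → v = 0
  /-- `dω = 0` in every chart: for constant fields `u, v, w` on `ℝ⁴`,
  `dω(u, v, w) = ∂_u ω(v, w) + ∂_v ω(w, u) + ∂_w ω(u, v)`. -/
  closed : ∀ h ∈ atlas (EuclideanHalfSpace 4) M, ∀ z ∈ (h.extend (𝓡∂ 4)).target,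
    ∀ u v w : EuclideanSpace ℝ (Fin 4),
      let c : EuclideanSpace ℝ (Fin 4) → EuclideanSpace ℝ (Fin 4) → EuclideanSpace ℝ (Fin 4) → ℝ :=
        fun a b y ↦ form ((h.extend (𝓡∂ 4)).symm y)
          ((chartD h ((h.extend (𝓡∂ 4)).symm y)).inverse a)
          ((chartD h ((h.extend (𝓡∂ 4)).symm y)).inverse b)
      fderivWithin ℝ (c v w) (h.extend (𝓡∂ 4)).target z u
        + fderivWithin ℝ (c w u) (h.extend (𝓡∂ 4)).target z v
        + fderivWithin ℝ (c u v) (h.extend (𝓡∂ 4)).target z w = 0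

/-- The canonical symplectic form `dy₁ ∧ dy₃ + dy₂ ∧ dy₄` on `ℝ⁴`. -/
def stdForm (a b : EuclideanSpace ℝ (Fin 4)) : ℝ :=
  (a 0 * b 2 - a 2 * b 0) + (a 1 * b 3 - a 3 * b 1)

/-- `f` belongs to `C^k(M, ℝ)`, the `C^k` Hamiltonians: `C^k` functions which are constant on each
connected component of the boundary `∂M`. -/
def IsHamiltonian (k : ℕ∞) (f : M → ℝ) : Prop :=
  ContMDiff (𝓡∂ 4) 𝓘(ℝ) (k : WithTop ℕ∞) f ∧
    ∀ x ∈ (𝓡∂ 4).boundary M, ∀ y ∈ connectedComponentIn ((𝓡∂ 4).boundary M) x, f y = f x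

/-- The differential `dH(x)`, as a linear form on `T_x M`. -/
def dHam (H : M → ℝ) (x : M) : TangentSpace (𝓡∂ 4) x →ₗ[ℝ] ℝ :=
  (mfderiv (𝓡∂ 4) 𝓘(ℝ) H x).toLinearMap

/-- The flow of a vector field `X` on `M`: `flowOf X t x = γ t` for the integral curve `γ` of `X`
with `γ 0 = x`. -/
def flowOf (X : ∀ x : M, TangentSpace (𝓡∂ 4) x) (t : ℝ) (x : M) : M := by
  classical
  exact if h : ∃ γ : ℝ → M, γ 0 = x ∧ IsMIntegralCurve γ X then h.choose t else x

variable [IsManifold (𝓡∂ 4) ∞ M] (Ω : SymplecticForm M)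

/-- A finite atlas of smooth Darboux charts, together with a chart chosen around each point and
compact pieces of the chart domains which cover `M` (used for the `C²` norm). -/
structure DarbouxAtlas where
  ι : Type
  [fin : Fintype ι]
  chart : ι → OpenPartialHomeomorph M (EuclideanHalfSpace 4)
  mem_maximalAtlas : ∀ j, chart j ∈ IsManifold.maximalAtlas (𝓡∂ 4) ∞ M
  darboux : ∀ j, ∀ x ∈ (chart j).source, ∀ v w : TangentSpace (𝓡∂ 4) x,
    Ω.form x v w = stdForm (chartD (chart j) x v) (chartD (chart j) x w)
  idx : M → ι
  mem_source : ∀ x, x ∈ (chart (idx x)).source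
  core : ι → Set M
  isCompact_core : ∀ j, IsCompact (core j)
  core_subset : ∀ j, core j ⊆ (chart j).source
  iUnion_core : ⋃ j, core j = univ

variable {Ω}

/-- The chosen Darboux chart around `x`, as a map into `ℝ⁴`. -/
def DarbouxAtlas.at (A : DarbouxAtlas Ω) (x : M) : PartialEquiv M (EuclideanSpace ℝ (Fin 4)) :=
  (A.chart (A.idx x)).extend (𝓡∂ 4)

/-- `‖f - g‖_{C²} < ε`: in the charts of the atlas, all partial derivatives of `f - g` of order at
most two are smaller than `ε` in absolute value (over the compact pieces, where for `C²` functions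
the suprema are attained). -/
def DarbouxAtlas.C2Close (A : DarbouxAtlas Ω) (ε : ℝ) (f g : M → ℝ) : Prop :=
  ∀ j, ∀ x ∈ A.core j, ∀ k ≤ 2, ∀ i : Fin k → Fin 4,
    |iteratedFDerivWithin ℝ k
      (fun y ↦ f (((A.chart j).extend (𝓡∂ 4)).symm y) - g (((A.chart j).extend (𝓡∂ 4)).symm y))
      ((A.chart j).extend (𝓡∂ 4)).target ((A.chart j).extend (𝓡∂ 4) x)
      (fun l ↦ EuclideanSpace.single (i l) (1 : ℝ))| < ε

variable (Ω)

/-- `v ↦ ι_v ω(x)` as a linear isomorphism `T_x M ≃ (T_x M)*`. -/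
def SymplecticForm.flat (x : M) :
    TangentSpace (𝓡∂ 4) x ≃ₗ[ℝ] Module.Dual ℝ (TangentSpace (𝓡∂ 4) x) :=
  LinearEquiv.ofInjectiveOfFinrankEq
    ({ toFun := fun v ↦ (Ω.form x v : TangentSpace (𝓡∂ 4) x →ₗ[ℝ] ℝ)
       map_add' := fun v w ↦ by ext u; simp
       map_smul' := fun c v ↦ by ext u; simp } :
      TangentSpace (𝓡∂ 4) x →ₗ[ℝ] Module.Dual ℝ (TangentSpace (𝓡∂ 4) x))
    ((injective_iff_map_eq_zero _).2 fun v hv ↦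
      Ω.nondegenerate x v fun w ↦ by simpa using LinearMap.congr_fun hv w)
    (Subspace.dual_finrank_eq).symm

/-- The Hamiltonian vector field `X_H`, determined by `ω(X_H, ·) = dH`. -/
def hamVF (H : M → ℝ) (x : M) : TangentSpace (𝓡∂ 4) x :=
  (Ω.flat x).symm (dHam H x)

theorem form_hamVF (H : M → ℝ) (x : M) (v : TangentSpace (𝓡∂ 4) x) :
    Ω.form x (hamVF Ω H x) v = dHam H x v := by
  have h : Ω.flat x (hamVF Ω H x) = dHam H x := (Ω.flat x).apply_symm_apply _
  exact LinearMap.congr_fun h v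

/-- The Hamiltonian flow `φ_H^t`. -/
def hamFlow (H : M → ℝ) (t : ℝ) (x : M) : M := flowOf (hamVF Ω H) t x

/-- The tangent flow `Dφ_H^t(x) : T_x M → T_{φ_H^t(x)} M`. -/
def tangentFlow (H : M → ℝ) (t : ℝ) (x : M) :
    TangentSpace (𝓡∂ 4) x →ₗ[ℝ] TangentSpace (𝓡∂ 4) (hamFlow Ω H t x) :=
  (mfderiv (𝓡∂ 4) (𝓡∂ 4) (hamFlow Ω H t) x :
    TangentSpace (𝓡∂ 4) x →L[ℝ] TangentSpace (𝓡∂ 4) (hamFlow Ω H t x))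

/-- The `4`-form `ω ∧ ω` at `x`. -/
def SymplecticForm.wedgeSq (x : M) (a b c d : TangentSpace (𝓡∂ 4) x) : ℝ :=
  2 * (Ω.form x a b * Ω.form x c d - Ω.form x a c * Ω.form x b d + Ω.form x a d * Ω.form x b c)

/-- The vector field `X_H` read in a chart, as a vector field on `ℝ⁴`. -/
def chartVF (h : OpenPartialHomeomorph M (EuclideanHalfSpace 4)) (H : M → ℝ)
    (y : EuclideanSpace ℝ (Fin 4)) : EuclideanSpace ℝ (Fin 4) :=
  chartD h ((h.extend (𝓡∂ 4)).symm y) (hamVF Ω H ((h.extend (𝓡∂ 4)).symm y))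

/-- `DX_H(y) = DX_G(y)` as tangent maps `M → TTM` (so that also `X_H(y) = X_G(y)`), expressed in the
charts of the atlas around `y`. -/
def SameDX (A : DarbouxAtlas Ω) (H G : M → ℝ) (y : M) : Prop :=
  hamVF Ω H y = hamVF Ω G y ∧ ∀ j, y ∈ (A.chart j).source →
    fderivWithin ℝ (chartVF Ω (A.chart j) H) ((A.chart j).extend (𝓡∂ 4)).target
        ((A.chart j).extend (𝓡∂ 4) y) =
      fderivWithin ℝ (chartVF Ω (A.chart j) G) ((A.chart j).extend (𝓡∂ 4)).target
        ((A.chart j).extend (𝓡∂ 4) y)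

end Symplectic

section Poincare

variable {M : Type*} [TopologicalSpace M] [ChartedSpace (EuclideanHalfSpace 4) M]
  [IsManifold (𝓡∂ 4) ∞ M] [RiemannianBundle (fun x : M ↦ TangentSpace (𝓡∂ 4) x)]
  (Ω : SymplecticForm M)

/-- The normal fiber `N_x = (ℝ X_H(x))^⊥`. -/
def normalFiber (H : M → ℝ) (x : M) : Submodule ℝ (TangentSpace (𝓡∂ 4) x) :=
  (ℝ ∙ hamVF Ω H x)ᗮ

/-- The transversal fiber `𝒩_x = N_x ∩ ker dH(x)`. -/
def transFiber (H : M → ℝ) (x : M) : Submodule ℝ (TangentSpace (𝓡∂ 4) x) :=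
  normalFiber Ω H x ⊓ LinearMap.ker (dHam H x)

/-- The transversal linear Poincaré flow `Φ_H^t(x) v = Π_{φ_H^t(x)} Dφ_H^t(x) v`, `v ∈ 𝒩_x`,
where `Π` is the orthogonal projection onto the normal fiber. -/
def transPoincare (H : M → ℝ) (t : ℝ) (x : M) :
    transFiber Ω H x →ₗ[ℝ] TangentSpace (𝓡∂ 4) (hamFlow Ω H t x) :=
  ((normalFiber Ω H (hamFlow Ω H t x)).starProjection :
      TangentSpace (𝓡∂ 4) (hamFlow Ω H t x) →ₗ[ℝ] TangentSpace (𝓡∂ 4) (hamFlow Ω H t x)) ∘ₗ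
    tangentFlow Ω H t x ∘ₗ (transFiber Ω H x).subtype

/-- The rotation `R_α` of `𝒩_x`, in the basis `b`. -/
def transRotation {H : M → ℝ} {x : M} (b : Module.Basis (Fin 2) ℝ (transFiber Ω H x)) (α : ℝ) :
    transFiber Ω H x →ₗ[ℝ] transFiber Ω H x :=
  Matrix.toLin b b !![Real.cos α, -Real.sin α; Real.sin α, Real.cos α]

/-- A canonical (that is, symplectic) basis of `𝒩_x`, whose vectors have norm at most `C`. -/
def IsCanonicalBasis {H : M → ℝ} {x : M} (b : Module.Basis (Fin 2) ℝ (transFiber Ω H x))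
    (C : ℝ) : Prop :=
  Ω.form x (b 0) (b 1) = 1 ∧ ∀ i, ‖(b i : TangentSpace (𝓡∂ 4) x)‖ ≤ C

/-- An orthonormal frame of `N_x` giving the coordinates `(u, v, w)`: the first two vectors
belong to `𝒩_x`. -/
def IsNormalFrame (H : M → ℝ) (x : M) (b : Fin 3 → TangentSpace (𝓡∂ 4) x) : Prop :=
  Orthonormal ℝ b ∧ (∀ i, b i ∈ normalFiber Ω H x) ∧
    b 0 ∈ transFiber Ω H x ∧ b 1 ∈ transFiber Ω H x

variable {Ω} (A : DarbouxAtlas Ω)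

/-- The affine parametrization of the normal section at `x` in `ℝ⁴`. -/
def sectionPt (x : M) (b : Fin 3 → TangentSpace (𝓡∂ 4) x) (c : EuclideanSpace ℝ (Fin 3)) :
    EuclideanSpace ℝ (Fin 4) :=
  A.at x x + chartD (A.chart (A.idx x)) x (∑ i, c i • b i)

/-- The parametrization `(u, v, w) ↦ h⁻¹(h(x) + Dh(x)(u b₀ + v b₁ + w b₂))` of the normal section
at `x`, for the Darboux chart `h` chosen around `x`. -/
def sectionMap (x : M) (b : Fin 3 → TangentSpace (𝓡∂ 4) x) (c : EuclideanSpace ℝ (Fin 3)) : M :=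
  (A.at x).symm (sectionPt A x b c)

/-- The ball `B(x, r)` of the normal section, in the coordinates `(u, v, w)`. (The last condition
says that the point lies in the image of the chart; if `x` is not a boundary point, it holds for all
small `(u, v, w)`.) -/
def sectionBall (x : M) (b : Fin 3 → TangentSpace (𝓡∂ 4) x) (r : ℝ) :
    Set (EuclideanSpace ℝ (Fin 3)) :=
  {c | √(c 0 ^ 2 + c 1 ^ 2) < r ∧ |c 2| < r ∧ sectionPt A x b c ∈ (A.at x).target}

/-- The normal section at `x`, as a subset of `M`. -/
def normalSection (H : M → ℝ) (x : M) : Set M :=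
  {z | z ∈ (A.at x).source ∧
    ∃ v ∈ normalFiber Ω H x, A.at x z = A.at x x + chartD (A.chart (A.idx x)) x v}

/-- The measure on the normal section at `x` induced by the volume form `ι_{X_H} (ω ∧ ω)`, in the
coordinates `(u, v, w)`. The tangent vector `∂_i` of the section at `σ(c)` is
`Dh(σ(c))⁻¹ Dh(x) b_i`. -/
def transMeasure (H : M → ℝ) (x : M) (b : Fin 3 → TangentSpace (𝓡∂ 4) x) :
    Measure (EuclideanSpace ℝ (Fin 3)) :=
  volume.withDensity fun c ↦
    let z := sectionMap A x b c
    let d : Fin 3 → TangentSpace (𝓡∂ 4) z := fun i ↦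
      (chartD (A.chart (A.idx x)) z).inverse (chartD (A.chart (A.idx x)) x (b i))
    ENNReal.ofReal |Ω.wedgeSq z (hamVF Ω H z) (d 0) (d 1) (d 2)|

/-- `τ` is the hitting time of the Poincaré map from `B(x, r)` to the normal section at `φ_H^T(x)`:
it is continuous, takes the value `T` at `x`, and
`P_H^T(x) y = φ_H^{τ(y)}(y)`. Moreover the corresponding flowbox is self-disjoint. -/
def IsPoincareTime (H : M → ℝ) (T : ℝ) (x : M) (b : Fin 3 → TangentSpace (𝓡∂ 4) x) (r : ℝ)
    (τ : EuclideanSpace ℝ (Fin 3) → ℝ) : Prop :=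
  ContinuousOn τ (sectionBall A x b r) ∧ τ 0 = T ∧
  (∀ c ∈ sectionBall A x b r, 0 < τ c ∧
    hamFlow Ω H (τ c) (sectionMap A x b c) ∈ normalSection A H (hamFlow Ω H T x)) ∧
  InjOn (fun p : EuclideanSpace ℝ (Fin 3) × ℝ ↦ hamFlow Ω H p.2 (sectionMap A x b p.1))
    {p | p.1 ∈ sectionBall A x b r ∧ p.2 ∈ Icc 0 (τ p.1)}

/-- The flowbox over `U`: the orbit segments from the points `y` of `U` to `P_H^T(x) y`. -/
def flowbox (H : M → ℝ) (x : M) (b : Fin 3 → TangentSpace (𝓡∂ 4) x)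
    (τ : EuclideanSpace ℝ (Fin 3) → ℝ) (U : Set (EuclideanSpace ℝ (Fin 3))) : Set M :=
  {z | ∃ c ∈ U, ∃ t ∈ Icc 0 (τ c), z = hamFlow Ω H t (sectionMap A x b c)}

/-- A linear map `L : 𝒩_y → T_z M` read in `ℝ⁴` through charts `h` at `y` and `h'` at `z`:
`Dh'(z) ∘ L ∘ π ∘ Dh(y)⁻¹`, where `π` is the orthogonal projection of `T_y M` onto `𝒩_y`. -/
def inCharts (h h' : OpenPartialHomeomorph M (EuclideanHalfSpace 4)) (H : M → ℝ) (y z : M)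
    (L : transFiber Ω H y →ₗ[ℝ] TangentSpace (𝓡∂ 4) z) :
    EuclideanSpace ℝ (Fin 4) →L[ℝ] EuclideanSpace ℝ (Fin 4) :=
  LinearMap.toContinuousLinearMap
    ((chartD h' z : TangentSpace (𝓡∂ 4) z →ₗ[ℝ] EuclideanSpace ℝ (Fin 4)) ∘ₗ L ∘ₗ
      ((transFiber Ω H y).orthogonalProjectionOnto :
        TangentSpace (𝓡∂ 4) y →ₗ[ℝ] transFiber Ω H y) ∘ₗ
      ((chartD h y).inverse : EuclideanSpace ℝ (Fin 4) →ₗ[ℝ] TangentSpace (𝓡∂ 4) y))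

/-- The linear flow `L^t : 𝒩_x → 𝒩_{φ_H^t(x)}`, `0 ≤ t ≤ T`, is `(ε, κ)`-realizable of length `T`
at `x`, for the Hamiltonian `H` and perturbations of class `C^s`. Linear maps over different base
points are compared through the Darboux charts chosen at `x` and at `φ_H^T(x)`. -/
def IsRealizable (H : M → ℝ) (s : ℕ∞) (T ε κ : ℝ) (x : M)
    (L : ∀ t : ℝ, transFiber Ω H x →ₗ[ℝ] TangentSpace (𝓡∂ 4) (hamFlow Ω H t x)) : Prop :=
  (∀ t ∈ Icc 0 T, (∀ v, L t v ∈ transFiber Ω H (hamFlow Ω H t x)) ∧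
    ∀ v w, Ω.form (hamFlow Ω H t x) (L t v) (L t w) = Ω.form x v w) ∧
  ∀ b : Fin 3 → TangentSpace (𝓡∂ 4) x, IsNormalFrame Ω H x b →
  ∀ γ > 0, ∃ r > 0, ∃ τ : EuclideanSpace ℝ (Fin 3) → ℝ, IsPoincareTime A H T x b r τ ∧
    ∀ U, (∃ O : Set (EuclideanSpace ℝ (Fin 3)), IsOpen O ∧ U = O ∩ sectionBall A x b r) →
    ∃ K ⊆ U, MeasurableSet K ∧
      transMeasure A H x b (U \ K) ≤ ENNReal.ofReal κ * transMeasure A H x b U ∧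
    ∃ H' : M → ℝ, IsHamiltonian s H' ∧ A.C2Close ε H' H ∧
      (∀ z ∉ flowbox A H x b τ U, H' z = H z) ∧
      (∀ c ∈ U, SameDX Ω A H H' (sectionMap A x b c) ∧
        SameDX Ω A H H' (hamFlow Ω H (τ c) (sectionMap A x b c))) ∧
      ∀ c ∈ K,
        hamFlow Ω H' T (sectionMap A x b c) ∈ (A.at (hamFlow Ω H T x)).source ∧
        ‖inCharts (A.chart (A.idx x)) (A.chart (A.idx (hamFlow Ω H T x))) H'
            (sectionMap A x b c) (hamFlow Ω H' T (sectionMap A x b c))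
            (transPoincare Ω H' T (sectionMap A x b c)) -
          inCharts (A.chart (A.idx x)) (A.chart (A.idx (hamFlow Ω H T x))) H
            x (hamFlow Ω H T x) (L T)‖ < γ

end Poincare

end

open Metric Filter
open scoped Topology NNReal

set_option linter.unusedSectionVars false
set_option synthInstance.maxHeartbeats 200000

section Nemytskii

universe u

variable {K : Type u} [TopologicalSpace K] [CompactSpace K]
  {E F : Type u} [NormedAddCommGroup E] [NormedSpace ℝ E] [NormedAddCommGroup F] [NormedSpace ℝ F]

/-- Pointwise application of a continuous family of operators to a continuous family of vectors. -/
noncomputable def pointwiseApply (K E F : Type u) [TopologicalSpace K] [CompactSpace K]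
    [NormedAddCommGroup E] [NormedSpace ℝ E] [NormedAddCommGroup F] [NormedSpace ℝ F] :
    C(K, E →L[ℝ] F) →L[ℝ] C(K, E) →L[ℝ] C(K, F) :=
  LinearMap.mkContinuous₂
    (LinearMap.mk₂ ℝ (fun (A : C(K, E →L[ℝ] F)) (γ : C(K, E)) ↦ (⟨fun k ↦ A k (γ k), by fun_prop⟩ : C(K, F)))
      (by intros; ext; simp) (by intros; ext; simp) (by intros; ext; simp) (by intros; ext; simp)) 1
    (by
      intro A γ
      refine (ContinuousMap.norm_le _ (by positivity)).2 fun k ↦ ?_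
      simp only [LinearMap.mk₂_apply, ContinuousMap.coe_mk, one_mul]
      exact (A k).le_of_opNorm_le_of_le (A.norm_coe_le_norm k) (γ.norm_coe_le_norm k))

@[simp] theorem pointwiseApply_apply (A : C(K, E →L[ℝ] F)) (γ : C(K, E)) (k : K) :
    pointwiseApply K E F A γ k = A k (γ k) := rfl

/-- The superposition operator `γ ↦ f ∘ γ`. -/
noncomputable def superposition (K : Type u) [TopologicalSpace K] {f : E → F} (hf : Continuous f)
    (γ : C(K, E)) : C(K, F) :=
  (⟨f, hf⟩ : C(E, F)).comp γ

@[simp] theorem superposition_apply {f : E → F} (hf : Continuous f) (γ : C(K, E)) (k : K) :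
    superposition K hf γ k = f (γ k) := rfl

theorem continuous_superposition {f : E → F} (hf : Continuous f) :
    Continuous (superposition K hf) :=
  ContinuousMap.continuous_postcomp _

theorem hasFDerivAt_superposition {f : E → F} (hf : ContDiff ℝ 1 f) (γ : C(K, E)) :
    HasFDerivAt (superposition K hf.continuous)
      (pointwiseApply K E F (superposition K (hf.continuous_fderiv one_ne_zero) γ)) γ := by
  rw [hasFDerivAt_iff_isLittleO, Asymptotics.isLittleO_iff]
  intro c hc
  obtain ⟨δ, hδ, h⟩ := Metric.continuousAt_iff.1
    ((continuous_superposition (K := K) (hf.continuous_fderiv one_ne_zero)).continuousAt (x := γ)) c hc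
  filter_upwards [Metric.ball_mem_nhds γ hδ] with η hη
  refine (ContinuousMap.norm_le _ (by positivity)).2 fun k ↦ ?_
  have hball : ∀ z ∈ Metric.ball (γ k) δ, ‖fderiv ℝ f z - fderiv ℝ f (γ k)‖ ≤ c := by
    intro z hz
    have h1 : dist (γ + ContinuousMap.const K (z - γ k)) γ < δ := by
      rw [dist_eq_norm, add_sub_cancel_left]
      refine lt_of_le_of_lt ((ContinuousMap.norm_le _ (norm_nonneg (z - γ k))).2 fun _ ↦ le_rfl) ?_
      rwa [← dist_eq_norm]
    have h2 := (ContinuousMap.dist_apply_le_dist k).trans (h h1).le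
    simpa [dist_eq_norm] using h2
  have hk : η k ∈ Metric.ball (γ k) δ :=
    lt_of_le_of_lt (ContinuousMap.dist_apply_le_dist k) hη
  have h3 := (convex_ball (γ k) δ).norm_image_sub_le_of_norm_hasFDerivWithin_le'
    (fun z _ ↦ ((hf.differentiable one_ne_zero) z).hasFDerivAt.hasFDerivWithinAt) hball
    (Metric.mem_ball_self hδ) hk
  refine h3.trans (mul_le_mul_of_nonneg_left ?_ hc.le)
  exact (η - γ).norm_coe_le_norm k

theorem contDiff_superposition_nat (n : ℕ) : ∀ {F : Type u} [NormedAddCommGroup F]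
    [NormedSpace ℝ F] {f : E → F} (hf : ContDiff ℝ n f),
    ContDiff ℝ n (superposition K hf.continuous) := by
  induction n with
  | zero =>
    intro F _ _ f hf
    exact contDiff_zero.2 (continuous_superposition _)
  | succ n ih =>
    intro F _ _ f hf
    have h1 : ContDiff ℝ 1 f := hf.of_le (by exact_mod_cast Nat.succ_le_succ (Nat.zero_le n))
    have h2 : ContDiff ℝ n (fderiv ℝ f) := hf.fderiv_right (by norm_cast)
    have h3 : ContDiff ℝ (n + 1 : WithTop ℕ∞) (superposition K hf.continuous) := by
      refine contDiff_succ_iff_hasFDerivAt.2 ?_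
      have h5 : ContDiff ℝ n (fun γ ↦
          pointwiseApply K E F (superposition K (h1.continuous_fderiv one_ne_zero) γ)) :=
        ContDiff.comp (g := pointwiseApply K E F) (ContinuousLinearMap.contDiff _) (ih h2)
      exact ⟨_, h5, fun γ ↦ hasFDerivAt_superposition h1 γ⟩
    exact_mod_cast h3

theorem contDiff_superposition {n : ℕ∞} {f : E → F} (hf : ContDiff ℝ n f) :
    ContDiff ℝ n (superposition K hf.continuous) := by
  refine contDiff_iff_forall_nat_le.2 fun m hm ↦ ?_
  exact contDiff_superposition_nat m (hf.of_le (by exact_mod_cast hm))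

end Nemytskii

section Flow

variable {E : Type} [NormedAddCommGroup E] [NormedSpace ℝ E] [CompleteSpace E]

/-- `γ ↦ (τ ↦ ∫ σ in 0..τ, γ σ)` on curves over `[0, 1]`. -/
noncomputable def primitiveCLM (E : Type) [NormedAddCommGroup E] [NormedSpace ℝ E] :
    C(Icc (0 : ℝ) 1, E) →L[ℝ] C(Icc (0 : ℝ) 1, E) :=
  LinearMap.mkContinuous
    { toFun := fun γ ↦ ⟨fun τ ↦ ∫ σ in (0 : ℝ)..τ, IccExtend zero_le_one γ σ,
        (intervalIntegral.continuous_primitive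
          (fun a b ↦ (γ.continuous.Icc_extend' (h := zero_le_one)).intervalIntegrable a b) 0).comp
          continuous_subtype_val⟩
      map_add' := fun γ η ↦ by
        ext τ
        simp only [ContinuousMap.coe_mk, ContinuousMap.add_apply]
        rw [← intervalIntegral.integral_add
          ((γ.continuous.Icc_extend' (h := zero_le_one)).intervalIntegrable _ _)
          ((η.continuous.Icc_extend' (h := zero_le_one)).intervalIntegrable _ _)]
        rfl
      map_smul' := fun c γ ↦ by
        ext τ
        simp only [ContinuousMap.coe_mk, ContinuousMap.smul_apply, RingHom.id_apply]
        rw [← intervalIntegral.integral_smul]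
        rfl } 1
    (by
      intro γ
      refine (ContinuousMap.norm_le _ (by positivity)).2 fun τ ↦ ?_
      simp only [LinearMap.coe_mk, AddHom.coe_mk, ContinuousMap.coe_mk]
      refine (intervalIntegral.norm_integral_le_of_norm_le_const (C := ‖γ‖) fun σ _ ↦ ?_).trans ?_
      · exact γ.norm_coe_le_norm _
      · have := τ.2.1; have := τ.2.2
        rw [sub_zero, abs_of_nonneg τ.2.1]; nlinarith [norm_nonneg γ])

theorem primitiveCLM_apply (γ : C(Icc (0 : ℝ) 1, E)) (τ : Icc (0 : ℝ) 1) :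
    primitiveCLM E γ τ = ∫ σ in (0 : ℝ)..τ, IccExtend zero_le_one γ σ := rfl

/-- The iterates of a Volterra operator are small. -/
theorem norm_volterra_pow_apply_le (A : C(Icc (0 : ℝ) 1, E →L[ℝ] E)) (γ : C(Icc (0 : ℝ) 1, E))
    (n : ℕ) (τ : Icc (0 : ℝ) 1) :
    ‖((primitiveCLM E ∘L pointwiseApply _ E E A) ^ n) γ τ‖ ≤
      ‖A‖ ^ n * (τ : ℝ) ^ n / n.factorial * ‖γ‖ := by
  induction n generalizing τ with
  | zero => simpa using γ.norm_coe_le_norm τ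
  | succ n ih =>
    rw [pow_succ', mul_apply_eq_comp, ContinuousLinearMap.comp_apply,
      primitiveCLM_apply]
    set η := ((primitiveCLM E ∘L pointwiseApply _ E E A) ^ n) γ with hη
    have h0 := τ.2.1
    have h1 : ∀ σ ∈ Ioc (0 : ℝ) τ, ‖IccExtend zero_le_one (pointwiseApply _ E E A η) σ‖ ≤
        ‖A‖ ^ (n + 1) / n.factorial * ‖γ‖ * σ ^ n := by
      intro σ hσ
      have hm : σ ∈ Icc (0 : ℝ) 1 := ⟨hσ.1.le, hσ.2.trans τ.2.2⟩
      rw [IccExtend_of_mem _ _ hm, pointwiseApply_apply]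
      refine ((A ⟨σ, hm⟩).le_of_opNorm_le_of_le (A.norm_coe_le_norm _) (ih ⟨σ, hm⟩)).trans
        (le_of_eq ?_)
      simp only []
      ring
    have h2 := intervalIntegral.norm_integral_le_of_norm_le h0 (μ := volume)
      (f := IccExtend zero_le_one (pointwiseApply _ E E A η))
      (g := fun σ ↦ ‖A‖ ^ (n + 1) / n.factorial * ‖γ‖ * σ ^ n)
      (ae_of_all _ h1) ((by fun_prop : Continuous fun σ : ℝ ↦
        ‖A‖ ^ (n + 1) / n.factorial * ‖γ‖ * σ ^ n).intervalIntegrable _ _)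
    refine h2.trans (le_of_eq ?_)
    rw [intervalIntegral.integral_const_mul, integral_pow, Nat.factorial_succ]
    have : ((n : ℝ) + 1) ≠ 0 := by positivity
    push_cast
    field_simp
    ring

theorem isUnit_one_sub_volterra (A : C(Icc (0 : ℝ) 1, E →L[ℝ] E)) :
    IsUnit (1 - primitiveCLM E ∘L pointwiseApply _ E E A) := by
  set B := primitiveCLM E ∘L pointwiseApply _ E E A with hB
  obtain ⟨n, hn⟩ : ∃ n : ℕ, ‖A‖ ^ n / n.factorial < 1 :=
    ((FloorSemiring.tendsto_pow_div_factorial_atTop ‖A‖).eventually (gt_mem_nhds one_pos)).exists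
  have h1 : ‖B ^ n‖ < 1 := by
    refine lt_of_le_of_lt (ContinuousLinearMap.opNorm_le_bound _ (by positivity) fun γ ↦ ?_) hn
    refine (ContinuousMap.norm_le _ (by positivity)).2 fun τ ↦ ?_
    refine (norm_volterra_pow_apply_le A γ n τ).trans ?_
    have : (τ : ℝ) ^ n ≤ 1 := pow_le_one₀ τ.2.1 τ.2.2
    gcongr
    nlinarith [pow_nonneg (norm_nonneg A) n]
  have h2 : IsUnit (1 - B ^ n) := 
    isUnit_one_sub_of_norm_lt_one (R := C(Icc (0 : ℝ) 1, E) →L[ℝ] C(Icc (0 : ℝ) 1, E)) h1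
  have hc : Commute (1 - B) (∑ i ∈ Finset.range n, B ^ i) := by
    rw [Commute, SemiconjBy, mul_neg_geom_sum, geom_sum_mul_neg]
  rw [← mul_neg_geom_sum, hc.isUnit_mul_iff] at h2
  exact h2.1

variable {Y : E → E}

/-- A bounded Lipschitz vector field has a global flow. -/
theorem exists_flow {L : ℝ≥0} {B : ℝ} (hL : LipschitzWith L Y) (hB : ∀ y, ‖Y y‖ ≤ B) :
    ∃ φ : ℝ → E → E, (∀ y, φ 0 y = y) ∧ ∀ t y, HasDerivAt (fun t ↦ φ t y) (Y (φ t y)) t := by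
  have hB0 : 0 ≤ B := (norm_nonneg _).trans (hB 0)
  have hex : ∀ (T : ℝ) (y : E), 0 < T → ∃ α : ℝ → E, α 0 = y ∧
      ∀ t ∈ Ioo (-T) T, HasDerivAt α (Y (α t)) t := by
    intro T y hT
    have h0 : (0 : ℝ) ∈ Icc (-T) T := ⟨by linarith, hT.le⟩
    have hp : IsPicardLindelof (fun _ ↦ Y) (⟨0, h0⟩ : Icc (-T) T) y (⟨B * T, by positivity⟩ : ℝ≥0) 0
        ⟨B, hB0⟩ L :=
      { lipschitzOnWith := fun _ _ ↦ hL.lipschitzOnWith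
        continuousOn := fun _ _ ↦ continuousOn_const
        norm_le := fun _ _ z _ ↦ hB z
        mul_max_le := by
          simp only [sub_zero, zero_sub, neg_neg, max_self, NNReal.coe_zero]
          exact le_rfl }
    obtain ⟨α, h1, h2⟩ := hp.exists_eq_forall_mem_Icc_hasDerivWithinAt₀
    exact ⟨α, h1, fun t ht ↦ (h2 t (Ioo_subset_Icc_self ht)).hasDerivAt (Icc_mem_nhds ht.1 ht.2)⟩
  choose! α hα0 hα using hex
  have huniq : ∀ (T S : ℝ) (y : E), 0 < T → T ≤ S → EqOn (α T y) (α S y) (Ioo (-T) T) := by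
    intro T S y hT hS
    refine ODE_solution_unique_of_mem_Ioo (v := fun _ ↦ Y) (s := fun _ ↦ univ) (K := L) (t₀ := 0)
      (fun _ _ ↦ hL.lipschitzOnWith) ⟨by linarith, hT⟩ (fun t ht ↦ ⟨hα T y hT t ht, trivial⟩)
      (fun t ht ↦ ⟨hα S y (hT.trans_le hS) t ⟨by linarith [ht.1], by linarith [ht.2]⟩, trivial⟩) ?_
    rw [hα0 T y hT, hα0 S y (hT.trans_le hS)]
  refine ⟨fun t y ↦ α (|t| + 1) y t, fun y ↦ ?_, fun t y ↦ ?_⟩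
  · exact hα0 _ _ (by positivity)
  · have h1 := hα (|t| + 2) y (by positivity) t
      ⟨by linarith [neg_abs_le t], by linarith [le_abs_self t]⟩
    have hm : t ∈ Ioo (-(|t| + 1)) (|t| + 1) :=
      ⟨by linarith [neg_abs_le t], by linarith [le_abs_self t]⟩
    have h2 : α (|t| + 1) y t = α (|t| + 2) y t :=
      huniq _ _ y (by positivity) (by linarith) hm
    simp only []
    rw [h2]
    refine h1.congr_of_eventuallyEq ?_
    filter_upwards [Ioo_mem_nhds hm.1 hm.2] with s hs
    have hs' : |s| < |t| + 1 := abs_lt.2 hs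
    exact huniq _ _ y (by positivity) (by linarith)
      ⟨by linarith [neg_abs_le s], by linarith [le_abs_self s]⟩

/-- The flow of a `C^n` Lipschitz vector field is jointly `C^n`. -/
theorem contDiff_flow {L : ℝ≥0} {n : ℕ∞} (hn : 1 ≤ n) (hL : LipschitzWith L Y)
    (hY : ContDiff ℝ n Y) {φ : ℝ → E → E} (h0 : ∀ y, φ 0 y = y)
    (hφ : ∀ t y, HasDerivAt (fun t ↦ φ t y) (Y (φ t y)) t) :
    ContDiff ℝ n (fun p : ℝ × E ↦ φ p.1 p.2) := by
  rw [contDiff_iff_contDiffAt]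
  rintro ⟨t₀, y₀⟩
  have hn0 : (n : WithTop ℕ∞) ≠ 0 := by
    intro h
    have : n = 0 := by exact_mod_cast h
    rw [this] at hn; exact absurd hn (by simp)
  let cst : E →L[ℝ] C(Icc (0 : ℝ) 1, E) := LinearMap.mkContinuous
    { toFun := fun y ↦ ContinuousMap.const _ y, map_add' := fun _ _ ↦ rfl
      map_smul' := fun _ _ ↦ rfl } 1
    (fun y ↦ (ContinuousMap.norm_le _ (by positivity)).2 fun _ ↦ by rw [one_mul]; exact le_rfl)
  let N := superposition (Icc (0 : ℝ) 1) hY.continuous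
  have hN : ContDiff ℝ n N := contDiff_superposition hY
  let f : (ℝ × E) × C(Icc (0 : ℝ) 1, E) → C(Icc (0 : ℝ) 1, E) :=
    fun p ↦ p.2 - cst p.1.2 - p.1.1 • primitiveCLM E (N p.2)
  have hf : ContDiff ℝ n f := by
    refine (contDiff_snd.sub (cst.contDiff.comp (contDiff_snd.comp contDiff_fst))).sub ?_
    exact (contDiff_fst.comp contDiff_fst).smul ((primitiveCLM E).contDiff.comp
      (hN.comp contDiff_snd))
  have hcont : ∀ y, Continuous fun t ↦ φ t y :=
    fun y ↦ continuous_iff_continuousAt.2 fun t ↦ (hφ t y).continuousAt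
  let G : ℝ → E → C(Icc (0 : ℝ) 1, E) := fun t y ↦ ⟨fun τ ↦ φ (t * τ) y, by
    have := hcont y; fun_prop⟩
  have hscale : ∀ t y τ, HasDerivAt (fun τ ↦ φ (t * τ) y) (t • Y (φ (t * τ) y)) τ := by
    intro t y τ
    have h1 : HasDerivAt (fun τ : ℝ ↦ t * τ) t τ := by simpa using (hasDerivAt_id τ).const_mul t
    exact (hφ (t * τ) y).scomp τ h1
  have hG : ∀ t y, f ((t, y), G t y) = 0 := by
    intro t y
    ext τ
    simp only [f, ContinuousMap.sub_apply, ContinuousMap.smul_apply, ContinuousMap.zero_apply,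
      primitiveCLM_apply]
    have h1 : ∫ σ in (0 : ℝ)..τ, t • Y (φ (t * σ) y) = φ (t * τ) y - φ (t * 0) y :=
      intervalIntegral.integral_eq_sub_of_hasDerivAt (fun σ _ ↦ hscale t y σ)
        ((continuous_const.smul (hY.continuous.comp ((hcont y).comp
          (continuous_const.mul continuous_id)))).intervalIntegrable _ _)
    have h2 : ∫ σ in (0 : ℝ)..τ, IccExtend zero_le_one (N (G t y)) σ =
        ∫ σ in (0 : ℝ)..τ, Y (φ (t * σ) y) := by
      refine intervalIntegral.integral_congr fun σ hσ ↦ ?_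
      rw [uIcc_of_le τ.2.1] at hσ
      rw [IccExtend_of_mem _ _ (⟨hσ.1, hσ.2.trans τ.2.2⟩ : σ ∈ Icc (0 : ℝ) 1)]
      rfl
    rw [h2, ← intervalIntegral.integral_smul, h1, mul_zero, h0]
    change φ (t * τ) y - y - (φ (t * τ) y - y) = 0
    abel
  have hGuniq : ∀ t y γ, f ((t, y), γ) = 0 → γ = G t y := by
    intro t y γ hγ
    have hγ' : ∀ τ : Icc (0 : ℝ) 1, γ τ = y + t • ∫ σ in (0 : ℝ)..τ,
        IccExtend zero_le_one (N γ) σ := by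
      intro τ
      have := DFunLike.congr_fun hγ τ
      simp only [f, ContinuousMap.sub_apply, ContinuousMap.smul_apply, ContinuousMap.zero_apply,
        primitiveCLM_apply] at this
      have h3 : cst y τ = y := rfl
      rw [h3, sub_sub, sub_eq_zero] at this
      exact this
    have hc : Continuous (IccExtend zero_le_one (N γ)) := (N γ).continuous.Icc_extend'
    set β : ℝ → E := fun τ ↦ y + t • ∫ σ in (0 : ℝ)..τ, IccExtend zero_le_one (N γ) σ with hβ
    have hβd : ∀ τ, HasDerivAt β (t • IccExtend zero_le_one (N γ) τ) τ := by
      intro τ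
      have := (intervalIntegral.integral_hasDerivAt_right (hc.intervalIntegrable 0 τ)
        (hc.stronglyMeasurableAtFilter _ _) hc.continuousAt).const_smul t
      simpa [hβ] using! this.const_add y
    have hβγ : ∀ τ (hτ : τ ∈ Icc (0 : ℝ) 1), β τ = γ ⟨τ, hτ⟩ := fun τ hτ ↦ (hγ' ⟨τ, hτ⟩).symm
    have hLt : LipschitzWith (‖t‖₊ * L) (fun z ↦ t • Y z) := by
      refine LipschitzWith.of_dist_le_mul fun a b ↦ ?_
      rw [dist_smul₀]
      have := hL.dist_le_mul a b
      push_cast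
      rw [mul_assoc]
      exact mul_le_mul_of_nonneg_left this (norm_nonneg t)
    have key : EqOn β (fun τ ↦ φ (t * τ) y) (Icc 0 1) := by
      refine ODE_solution_unique (v := fun _ z ↦ t • Y z) (fun _ ↦ hLt)
        (fun τ _ ↦ (hβd τ).continuousAt.continuousWithinAt) (fun τ hτ ↦ ?_)
        (fun τ _ ↦ (hscale t y τ).continuousAt.continuousWithinAt)
        (fun τ _ ↦ (hscale t y τ).hasDerivWithinAt) ?_
      · have h4 := (hβd τ).hasDerivWithinAt (s := Ici τ)
        have hm : τ ∈ Icc (0 : ℝ) 1 := ⟨hτ.1, hτ.2.le⟩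
        rw [IccExtend_of_mem _ _ hm] at h4
        rw [hβγ τ hm]
        exact h4
      · simp [hβ, h0]
    ext τ
    exact (hβγ τ τ.2).symm.trans (key τ.2)
  have hcdf : ContDiffAt ℝ n f ((t₀, y₀), G t₀ y₀) := hf.contDiffAt
  have hY1 : ContDiff ℝ 1 Y := hY.of_le (by exact_mod_cast hn)
  have hinv : (fderiv ℝ f ((t₀, y₀), G t₀ y₀) ∘L .inr ℝ (ℝ × E) C(Icc (0 : ℝ) 1, E)).IsInvertible := by
    set A := superposition (Icc (0 : ℝ) 1) (hY1.continuous_fderiv one_ne_zero) (G t₀ y₀)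
    have h5 : HasFDerivAt (fun γ ↦ f ((t₀, y₀), γ))
        (1 - primitiveCLM E ∘L pointwiseApply _ E E (t₀ • A)) (G t₀ y₀) := by
      have h6 := (primitiveCLM E).hasFDerivAt.comp (G t₀ y₀)
        (hasFDerivAt_superposition (K := Icc (0 : ℝ) 1) hY1 (G t₀ y₀))
      have h7 := ((hasFDerivAt_id (G t₀ y₀)).sub_const (cst y₀)).sub (h6.const_smul t₀)
      refine h7.congr_fderiv ?_
      ext γ : 1
      simp [A]
    have h8 : HasFDerivAt (fun γ ↦ f ((t₀, y₀), γ))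
        (fderiv ℝ f ((t₀, y₀), G t₀ y₀) ∘L .inr ℝ (ℝ × E) C(Icc (0 : ℝ) 1, E)) (G t₀ y₀) := by
      have h9 := ((hf.differentiable hn0) ((t₀, y₀), G t₀ y₀)).hasFDerivAt
      exact HasFDerivAt.comp (G t₀ y₀) h9 (hasFDerivAt_prodMk_right (t₀, y₀) (G t₀ y₀))
    rw [h8.unique h5]
    obtain ⟨v, hv⟩ := isUnit_one_sub_volterra (t₀ • A)
    exact ⟨ContinuousLinearEquiv.unitsEquiv ℝ _ v, by ext1; rw [← hv]; rfl⟩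
  have himp := hcdf.contDiffAt_implicitFunction hn0 hinv
  have hev : ∀ᶠ p in 𝓝 (t₀, y₀), φ p.1 p.2 = hcdf.implicitFunction hn0 hinv p ⟨1, by simp⟩ := by
    filter_upwards [hcdf.eventually_apply_implicitFunction hn0 hinv] with p hp
    rw [hG] at hp
    rw [hGuniq p.1 p.2 _ hp]
    simp [G]
  refine ContDiffAt.congr_of_eventuallyEq ?_ hev
  exact (ContinuousMap.evalCLM ℝ (⟨1, by simp⟩ : Icc (0 : ℝ) 1)).contDiff.contDiffAt.comp _ himp

end Flow

section Variational

variable {E : Type} [NormedAddCommGroup E] [NormedSpace ℝ E] [FiniteDimensional ℝ E]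

/-- The variational equation: the spatial derivative of a `C¹` flow solves the linearized ODE. -/
theorem hasDerivAt_fderiv_flow {Y : E → E} (hY : ContDiff ℝ 1 Y) {φ : ℝ → E → E}
    (hφ1 : ContDiff ℝ 1 (fun p : ℝ × E ↦ φ p.1 p.2)) (h0 : ∀ y, φ 0 y = y)
    (hφ : ∀ t y, HasDerivAt (fun t ↦ φ t y) (Y (φ t y)) t) (t : ℝ) (y : E) :
    HasDerivAt (fun t ↦ fderiv ℝ (φ t) y) (fderiv ℝ Y (φ t y) ∘L fderiv ℝ (φ t) y) t := by
  have : CompleteSpace E := FiniteDimensional.complete ℝ E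
  have : ProperSpace E := FiniteDimensional.proper ℝ E
  have hd : ∀ t y, HasFDerivAt (φ t)
      (fderiv ℝ (fun p : ℝ × E ↦ φ p.1 p.2) (t, y) ∘L .inr ℝ ℝ E) y := fun t y ↦
    HasFDerivAt.comp y ((hφ1.differentiable one_ne_zero) (t, y)).hasFDerivAt
      (hasFDerivAt_prodMk_right t y)
  have hV : Continuous fun p : ℝ × E ↦ fderiv ℝ (φ p.1) p.2 := by
    have h1 : (fun p : ℝ × E ↦ fderiv ℝ (φ p.1) p.2) =
        fun p ↦ fderiv ℝ (fun p : ℝ × E ↦ φ p.1 p.2) p ∘L .inr ℝ ℝ E := by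
      ext1 p; exact (hd p.1 p.2).fderiv
    rw [h1]
    exact (hφ1.continuous_fderiv one_ne_zero).clm_comp continuous_const
  set g : ℝ × E → E →L[ℝ] E := fun p ↦ fderiv ℝ Y (φ p.1 p.2) ∘L fderiv ℝ (φ p.1) p.2 with hg
  have hgc : Continuous g :=
    ((hY.continuous_fderiv one_ne_zero).comp hφ1.continuous).clm_comp hV
  have hint : ∀ t z, φ t z = z + ∫ s in (0 : ℝ)..t, Y (φ s z) := by
    intro t z
    have hc : Continuous fun s ↦ Y (φ s z) :=
      hY.continuous.comp (hφ1.continuous.comp (continuous_id.prodMk continuous_const))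
    rw [intervalIntegral.integral_eq_sub_of_hasDerivAt (fun s _ ↦ hφ s z)
      (hc.intervalIntegrable _ _), h0]
    abel
  have key : ∀ t, fderiv ℝ (φ t) y = ContinuousLinearMap.id ℝ E + ∫ s in (0 : ℝ)..t, g (s, y) := by
    intro t
    refine HasFDerivAt.fderiv ?_
    have hfun : φ t = fun z ↦ z + ∫ s in (0 : ℝ)..t, Y (φ s z) := funext (hint t)
    rw [hfun]
    refine (hasFDerivAt_id y).add ?_
    obtain ⟨C, hC⟩ := ((isCompact_uIcc (a := (0 : ℝ)) (b := t)).prod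
      (isCompact_closedBall y 1)).exists_bound_of_continuousOn hgc.continuousOn
    refine intervalIntegral.hasFDerivAt_integral_of_dominated_of_fderiv_le
      (F' := fun z s ↦ g (s, z)) (bound := fun _ ↦ C) (Metric.ball_mem_nhds y one_pos) ?_ ?_ ?_ ?_
      (by simp) ?_
    · exact Eventually.of_forall fun z ↦ (hY.continuous.comp (hφ1.continuous.comp
        (continuous_id.prodMk continuous_const))).aestronglyMeasurable
    · exact (hY.continuous.comp (hφ1.continuous.comp
        (continuous_id.prodMk continuous_const))).intervalIntegrable _ _
    · exact (hgc.comp (continuous_id.prodMk continuous_const)).aestronglyMeasurable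
    · exact ae_of_all _ fun s hs z hz ↦ hC (s, z) ⟨uIoc_subset_uIcc hs, ball_subset_closedBall hz⟩
    · refine ae_of_all _ fun s _ z _ ↦ ?_
      have h2 := (hd s z)
      rw [← h2.fderiv] at h2
      exact ((hY.differentiable one_ne_zero) (φ s z)).hasFDerivAt.comp z h2
  rw [funext key]
  have hc : Continuous fun s ↦ g (s, y) := hgc.comp (continuous_id.prodMk continuous_const)
  have := (intervalIntegral.integral_hasDerivAt_right (hc.intervalIntegrable 0 t)
    (hc.stronglyMeasurableAtFilter _ _) hc.continuousAt).const_add (ContinuousLinearMap.id ℝ E)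
  refine this.congr_deriv ?_
  simp only [hg]

end Variational

section Extension

theorem exists_cutoff {E F : Type*} [NormedAddCommGroup E] [NormedSpace ℝ E]
    [FiniteDimensional ℝ E] [NormedAddCommGroup F] [NormedSpace ℝ F] {f : E → F} {n : ℕ∞} {c : E}
    {R : ℝ} (hR : 0 < R) (hf : ContDiffOn ℝ n f (ball c R)) :
    ∃ Y : E → F, ContDiff ℝ n Y ∧ HasCompactSupport Y ∧ EqOn Y f (ball c (R / 2)) ∧
      ∀ y, ∃ k : ℝ, Y y = k • f y ∧ (k ≠ 0 → y ∈ ball c R) := by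
  let χ : ContDiffBump c := ⟨R / 2, 3 * R / 4, by positivity, by linarith⟩
  have : ProperSpace E := FiniteDimensional.proper ℝ E
  refine ⟨fun y ↦ χ y • f y, ?_, ?_, ?_, fun y ↦ ⟨χ y, rfl, fun h ↦ ?_⟩⟩
  · rw [contDiff_iff_contDiffAt]
    intro y
    by_cases hy : y ∈ ball c R
    · exact (χ.contDiff.contDiffAt).smul (hf.contDiffAt (isOpen_ball.mem_nhds hy))
    · have hy' : y ∈ (closedBall c (3 * R / 4))ᶜ := by
        simp only [mem_ball, not_lt, mem_compl_iff, mem_closedBall, not_le] at hy ⊢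
        linarith
      refine (contDiffAt_const (c := (0 : F))).congr_of_eventuallyEq ?_
      filter_upwards [isClosed_closedBall.isOpen_compl.mem_nhds hy'] with z hz
      have : χ z = 0 := χ.zero_of_le_dist (by simpa using (not_le.1 (by simpa using hz)).le)
      rw [this, zero_smul]
  · exact χ.hasCompactSupport.smul_right
  · intro y hy
    have : χ y = 1 := χ.one_of_mem_closedBall (ball_subset_closedBall hy)
    simp only [this, one_smul]
  · have h1 : y ∈ Function.support χ := h
    rw [χ.support_eq] at h1
    exact ball_subset_ball (by change 3 * R / 4 ≤ R; linarith) h1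

/-- The model vector space `ℝ⁴`. -/
abbrev E4 := EuclideanSpace ℝ (Fin 4)

/-- The coordinate function `y ↦ y 0`. -/
noncomputable def coordZero : E4 →L[ℝ] ℝ := EuclideanSpace.proj 0

/-- The projection onto the hyperplane `y 0 = 0`. -/
noncomputable def hyperProj : E4 →L[ℝ] E4 :=
  ContinuousLinearMap.id ℝ E4 - coordZero.smulRight (EuclideanSpace.single 0 1)

/-- The reflection in the hyperplane `y 0 = 0`. -/
noncomputable def hyperRefl : E4 →L[ℝ] E4 :=
  ContinuousLinearMap.id ℝ E4 - (2 : ℝ) • coordZero.smulRight (EuclideanSpace.single 0 1)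

@[simp] theorem coordZero_apply (y : E4) : coordZero y = y 0 := rfl

theorem hyperProj_apply (y : E4) : hyperProj y = y - y 0 • EuclideanSpace.single 0 1 := rfl

theorem hyperRefl_apply (y : E4) : hyperRefl y = y - (2 : ℝ) • y 0 • EuclideanSpace.single 0 1 :=
  rfl

@[simp] theorem hyperProj_zero (y : E4) : hyperProj y 0 = 0 := by simp [hyperProj_apply]

@[simp] theorem hyperRefl_zero (y : E4) : hyperRefl y 0 = -y 0 := by
  simp [hyperRefl_apply]; ring

theorem hyperProj_of_zero {y : E4} (h : y 0 = 0) : hyperProj y = y := by simp [hyperProj_apply, h]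

theorem hyperRefl_of_zero {y : E4} (h : y 0 = 0) : hyperRefl y = y := by simp [hyperRefl_apply, h]

theorem two_smul_hyperProj_sub_hyperRefl :
    (2 : ℝ) • hyperProj - hyperRefl = ContinuousLinearMap.id ℝ E4 := by
  ext1 y
  simp only [sub_apply, smul_apply, hyperProj_apply,
    hyperRefl_apply, smul_sub, ContinuousLinearMap.id_apply, two_smul]
  abel

theorem norm_sub_hyperProj (y : E4) : ‖y - hyperProj y‖ = |y 0| := by
  simp [hyperProj_apply, norm_smul]

theorem hyperProj_mem_ball {c y : E4} {R : ℝ} (hc : 0 ≤ c 0) (hy : y 0 ≤ 0) (h : y ∈ ball c R) :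
    hyperProj y ∈ ball c R := by
  rw [mem_ball] at h ⊢
  refine lt_of_le_of_lt ?_ h
  rw [EuclideanSpace.dist_eq, EuclideanSpace.dist_eq]
  refine Real.sqrt_le_sqrt (Finset.sum_le_sum fun i _ ↦ ?_)
  by_cases hi : i = 0
  · subst hi
    rw [Real.dist_eq, Real.dist_eq, sq_abs, sq_abs, hyperProj_zero]
    nlinarith
  · simp [hyperProj_apply, hi]

theorem hyperRefl_mem_ball {c y : E4} {R : ℝ} (hc : 0 ≤ c 0) (hy : y 0 ≤ 0) (h : y ∈ ball c R) :
    hyperRefl y ∈ ball c R := by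
  rw [mem_ball] at h ⊢
  refine lt_of_le_of_lt ?_ h
  rw [EuclideanSpace.dist_eq, EuclideanSpace.dist_eq]
  refine Real.sqrt_le_sqrt (Finset.sum_le_sum fun i _ ↦ ?_)
  by_cases hi : i = 0
  · subst hi
    rw [Real.dist_eq, Real.dist_eq, sq_abs, sq_abs, hyperRefl_zero]
    nlinarith
  · simp [hyperRefl_apply, hi]

/-- Reflection extends `C¹` maps across the boundary of a half-space. -/
theorem contDiffOn_reflect {F : Type*} [NormedAddCommGroup F] [NormedSpace ℝ F] {X : E4 → F}
    {c : E4} {R : ℝ} (hc : 0 ≤ c 0) (hX : ContDiffOn ℝ 1 X (ball c R ∩ {y | 0 ≤ y 0})) :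
    ContDiffOn ℝ 1 (fun y ↦ if 0 ≤ y 0 then X y else (2 : ℝ) • X (hyperProj y) - X (hyperRefl y))
      (ball c R) := by
  classical
  set P : Set E4 := ball c R ∩ {y | 0 ≤ y 0} with hP
  set Q : Set E4 := ball c R ∩ {y | y 0 ≤ 0} with hQ
  have hcont0 : Continuous fun y : E4 ↦ y 0 := coordZero.continuous
  have hu : UniqueDiffOn ℝ P := by
    rw [hP, inter_comm]
    refine UniqueDiffOn.inter ?_ isOpen_ball
    refine uniqueDiffOn_convex (convex_halfSpace_ge coordZero.isLinear 0) ?_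
    refine ⟨EuclideanSpace.single 0 1, interior_maximal (t := {y : E4 | 0 < y 0}) ?_
      (isOpen_lt continuous_const hcont0) ?_⟩
    · intro y hy; exact le_of_lt (show (0 : ℝ) < y 0 from hy)
    · simp
  set D := fderivWithin ℝ X P with hD
  have hDc : ContinuousOn D P := hX.continuousOn_fderivWithin hu le_rfl
  have hXd : ∀ y ∈ P, HasFDerivWithinAt X (D y) P y := fun y hy ↦
    (hX.differentiableOn one_ne_zero y hy).hasFDerivWithinAt
  have hpQ : MapsTo hyperProj Q P := fun y hy ↦ ⟨hyperProj_mem_ball hc hy.2 hy.1, by simp⟩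
  have hrQ : MapsTo hyperRefl Q P := fun y hy ↦
    ⟨hyperRefl_mem_ball hc hy.2 hy.1, by simpa using hy.2⟩
  set f := fun y : E4 ↦ if 0 ≤ y 0 then X y else (2 : ℝ) • X (hyperProj y) - X (hyperRefl y) with hf
  have hfP : EqOn f X P := fun y hy ↦ if_pos hy.2
  have hfQ : EqOn f (fun y ↦ (2 : ℝ) • X (hyperProj y) - X (hyperRefl y)) Q := by
    intro y hy
    by_cases h : 0 ≤ y 0
    · have h0 : y 0 = 0 := le_antisymm hy.2 h
      simp only [hf, if_pos h, hyperProj_of_zero h0, hyperRefl_of_zero h0, two_smul]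
      abel
    · simp only [hf, if_neg h]
  set D' : E4 → E4 →L[ℝ] F :=
    fun y ↦ (2 : ℝ) • (D (hyperProj y) ∘L hyperProj) - D (hyperRefl y) ∘L hyperRefl with hD'
  have hXQ : ∀ y ∈ Q, HasFDerivWithinAt f (D' y) Q y := by
    intro y hy
    refine HasFDerivWithinAt.congr ?_ hfQ (hfQ hy)
    exact (((hXd _ (hpQ hy)).comp y hyperProj.hasFDerivWithinAt hpQ).const_smul (2 : ℝ)).sub
      ((hXd _ (hrQ hy)).comp y hyperRefl.hasFDerivWithinAt hrQ)
  have hDD' : ∀ y, y 0 = 0 → D' y = D y := by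
    intro y hy
    simp only [hD', hyperProj_of_zero hy, hyperRefl_of_zero hy]
    rw [← ContinuousLinearMap.comp_smul, ← ContinuousLinearMap.comp_sub,
      two_smul_hyperProj_sub_hyperRefl, ContinuousLinearMap.comp_id]
  set G : E4 → E4 →L[ℝ] F := fun y ↦ if 0 ≤ y 0 then D y else D' y with hG
  have hPQ : ball c R = P ∪ Q := by
    rw [hP, hQ, ← inter_union_distrib_left]
    refine (inter_eq_left.2 fun y _ ↦ ?_).symm
    exact le_total 0 (y 0)
  have hGP : EqOn G D P := fun y hy ↦ if_pos hy.2
  have hGQ : EqOn G D' Q := by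
    intro y hy
    by_cases h : 0 ≤ y 0
    · simp only [hG, if_pos h]; exact (hDD' y (le_antisymm hy.2 h)).symm
    · simp only [hG, if_neg h]
  have hclP : ∀ y, y ∈ ball c R → y ∉ P → y ∉ closure P := by
    intro y hy hyP hcl
    have h1 : closure P ⊆ {y | 0 ≤ y 0} :=
      closure_minimal inter_subset_right (isClosed_le continuous_const hcont0)
    exact hyP ⟨hy, h1 hcl⟩
  have hclQ : ∀ y, y ∈ ball c R → y ∉ Q → y ∉ closure Q := by
    intro y hy hyQ hcl
    have h1 : closure Q ⊆ {y | y 0 ≤ 0} :=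
      closure_minimal inter_subset_right (isClosed_le hcont0 continuous_const)
    exact hyQ ⟨hy, h1 hcl⟩
  have hfd : ∀ y ∈ ball c R, HasFDerivAt f (G y) y := by
    intro y hy
    have h1 : HasFDerivWithinAt f (G y) P y := by
      by_cases hyP : y ∈ P
      · rw [hGP hyP]; exact (hXd y hyP).congr hfP (hfP hyP)
      · exact HasFDerivWithinAt.of_notMem_closure (hclP y hy hyP)
    have h2 : HasFDerivWithinAt f (G y) Q y := by
      by_cases hyQ : y ∈ Q
      · rw [hGQ hyQ]; exact hXQ y hyQ
      · exact HasFDerivWithinAt.of_notMem_closure (hclQ y hy hyQ)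
    have h3 := h1.union h2
    rw [← hPQ] at h3
    exact h3.hasFDerivAt (isOpen_ball.mem_nhds hy)
  have hGc : ContinuousOn G (ball c R) := by
    intro y hy
    have hnb : ∀ S : Set E4, y ∉ closure S → ContinuousWithinAt G S y := by
      intro S hS
      rw [ContinuousWithinAt, notMem_closure_iff_nhdsWithin_eq_bot.1 hS]
      exact tendsto_bot
    rw [hPQ]
    refine ContinuousWithinAt.union ?_ ?_
    · by_cases hyP : y ∈ P
      · exact (hDc y hyP).congr hGP (hGP hyP)
      · exact hnb P (hclP y hy hyP)
    · by_cases hyQ : y ∈ Q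
      · refine ContinuousWithinAt.congr ?_ hGQ (hGQ hyQ)
        have h1 : ContinuousWithinAt (fun y ↦ D (hyperProj y)) Q y :=
          (hDc _ (hpQ hyQ)).comp hyperProj.continuous.continuousWithinAt hpQ
        have h2 : ContinuousWithinAt (fun y ↦ D (hyperRefl y)) Q y :=
          (hDc _ (hrQ hyQ)).comp hyperRefl.continuous.continuousWithinAt hrQ
        exact ((h1.clm_comp continuousWithinAt_const).const_smul (2 : ℝ)).sub
          (h2.clm_comp continuousWithinAt_const)
      · exact hnb Q (hclQ y hy hyQ)
  have h1 : ContDiffOn ℝ (0 + 1) f (ball c R) := by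
    rw [contDiffOn_succ_iff_hasFDerivWithinAt_of_uniqueDiffOn isOpen_ball.uniqueDiffOn]
    exact ⟨by simp, G, contDiffOn_zero.2 hGc, fun y hy ↦ (hfd y hy).hasFDerivWithinAt⟩
  simpa using h1

/-- A `C¹` vector field on a half-ball, tangent to the boundary, agrees on a smaller half-ball with a
compactly supported `C¹` vector field on the whole space, tangent to the hyperplane. -/
theorem exists_extension_of_halfBall {X : E4 → E4} {c : E4} {R : ℝ} (hR : 0 < R) (hc : 0 ≤ c 0)
    (hX : ContDiffOn ℝ 1 X (ball c R ∩ {y | 0 ≤ y 0}))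
    (htan : ∀ y ∈ ball c R, y 0 = 0 → X y 0 = 0) :
    ∃ Y : E4 → E4, ContDiff ℝ 1 Y ∧ HasCompactSupport Y ∧
      (∀ y ∈ ball c (R / 2), 0 ≤ y 0 → Y y = X y) ∧ ∀ y, y 0 = 0 → Y y 0 = 0 := by
  obtain ⟨Y, h1, h2, h3, h4⟩ := exists_cutoff (n := 1) hR (contDiffOn_reflect hc hX)
  refine ⟨Y, h1, h2, fun y hy h0 ↦ ?_, fun y h0 ↦ ?_⟩
  · rw [h3 hy]; exact if_pos h0
  · obtain ⟨k, hk, hk'⟩ := h4 y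
    rw [hk, if_pos h0.ge]
    by_cases hk0 : k = 0
    · simp [hk0]
    · simp [htan y (hk' hk0) h0]

theorem exists_lipschitz_bound {E F : Type*} [NormedAddCommGroup E] [NormedSpace ℝ E]
    [NormedAddCommGroup F] [NormedSpace ℝ F] {Y : E → F} (hY : ContDiff ℝ 1 Y)
    (hs : HasCompactSupport Y) : (∃ L, LipschitzWith L Y) ∧ ∃ B, ∀ y, ‖Y y‖ ≤ B :=
  ⟨hY.lipschitzWith_of_hasCompactSupport hs one_ne_zero,
    hs.exists_bound_of_continuous hY.continuous⟩

/-- The sign of the coordinate `y 0` is preserved by the flow of a Lipschitz field tangent to the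
hyperplane. -/
theorem coord_sign_invariant {Y : E4 → E4} {L : ℝ≥0} (hL : LipschitzWith L Y)
    (htan : ∀ y, y 0 = 0 → Y y 0 = 0) {α : ℝ → E4} (hα : ∀ t, HasDerivAt α (Y (α t)) t) (t : ℝ) :
    (0 ≤ α 0 0 → 0 ≤ α t 0) ∧ (0 < α 0 0 → 0 < α t 0) := by
  have hbound : ∀ y, |Y y 0| ≤ L * |y 0| := by
    intro y
    have h1 := hL.dist_le_mul y (hyperProj y)
    rw [dist_eq_norm, dist_eq_norm, norm_sub_hyperProj] at h1
    refine le_trans ?_ h1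
    have h2 := PiLp.norm_apply_le (Y y - Y (hyperProj y)) 0
    simpa [htan (hyperProj y) (hyperProj_zero y)] using h2
  have hu : ∀ t, HasDerivAt (fun t ↦ α t 0) (Y (α t) 0) t := fun t ↦
    coordZero.hasFDerivAt.comp_hasDerivAt t (hα t)
  have hfwd : ∀ (β : ℝ → ℝ) (β' : ℝ → ℝ), (∀ t, HasDerivAt β (β' t) t) →
      (∀ t, |β' t| ≤ L * |β t|) → β 0 = 0 → ∀ t, 0 ≤ t → β t = 0 := by
    intro β β' hβ hb h0 t ht
    refine eq_zero_of_abs_deriv_le_mul_abs_self_of_eq_zero_right (f' := β') (K := L) (a := 0)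
      (b := t) (fun s _ ↦ (hβ s).continuousAt.continuousWithinAt)
      (fun s _ ↦ (hβ s).hasDerivWithinAt) h0 (fun s _ ↦ hb s) t ⟨ht, le_rfl⟩
  have hzero : ∀ s t : ℝ, α s 0 = 0 → α t 0 = 0 := by
    intro s t hs
    rcases le_total s t with h | h
    · have := hfwd (fun r ↦ α (s + r) 0) (fun r ↦ Y (α (s + r)) 0)
        (fun r ↦ (hu (s + r)).comp_const_add s r) (fun r ↦ hbound _) (by simpa using hs) (t - s)
        (by linarith)
      simpa using this
    · have := hfwd (fun r ↦ α (s - r) 0) (fun r ↦ -Y (α (s - r)) 0)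
        (fun r ↦ (hu (s - r)).comp_const_sub s r) (fun r ↦ by rw [abs_neg]; exact hbound _)
        (by simpa using hs) (s - t) (by linarith)
      simpa using this
  have hpos : 0 < α 0 0 → 0 < α t 0 := by
    intro h
    by_contra hneg
    have hc : Continuous fun t ↦ α t 0 := continuous_iff_continuousAt.2 fun t ↦ (hu t).continuousAt
    have h2 : (0 : ℝ) ∈ range fun t ↦ α t 0 :=
      mem_range_of_exists_le_of_exists_ge hc ⟨t, not_lt.1 hneg⟩ ⟨0, h.le⟩
    obtain ⟨s, hs⟩ := h2
    exact h.ne' (hzero s 0 hs)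
  refine ⟨fun h ↦ ?_, hpos⟩
  rcases h.eq_or_lt with h | h
  · exact (hzero 0 t h.symm).ge
  · exact (hpos h).le

end Extension

section Charts

variable {M : Type*} [TopologicalSpace M] [ChartedSpace (EuclideanHalfSpace 4) M]

theorem mem_range_model {y : E4} : y ∈ range (𝓡∂ 4) ↔ 0 ≤ y 0 := by
  rw [range_modelWithCornersEuclideanHalfSpace]; rfl

theorem extend_target_nonneg (h : OpenPartialHomeomorph M (EuclideanHalfSpace 4)) {y : E4}
    (hy : y ∈ (h.extend (𝓡∂ 4)).target) : 0 ≤ y 0 :=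
  mem_range_model.1 (h.extend_target_subset_range hy)

theorem extend_symm_mem_source (h : OpenPartialHomeomorph M (EuclideanHalfSpace 4)) {y : E4}
    (hy : y ∈ (h.extend (𝓡∂ 4)).target) : (h.extend (𝓡∂ 4)).symm y ∈ h.source := by
  rw [← h.extend_source (I := 𝓡∂ 4)]
  exact (h.extend (𝓡∂ 4)).map_target hy

theorem extend_mem_target (h : OpenPartialHomeomorph M (EuclideanHalfSpace 4)) {x : M}
    (hx : x ∈ h.source) : h.extend (𝓡∂ 4) x ∈ (h.extend (𝓡∂ 4)).target := by
  rw [← h.extend_source (I := 𝓡∂ 4)] at hx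
  exact (h.extend (𝓡∂ 4)).map_source hx

theorem uniqueDiffOn_extend_target (h : OpenPartialHomeomorph M (EuclideanHalfSpace 4)) :
    UniqueDiffOn ℝ (h.extend (𝓡∂ 4)).target := by
  rw [h.extend_target, inter_comm]
  exact (𝓡∂ 4).uniqueDiffOn.inter (h.open_target.preimage (𝓡∂ 4).continuous_symm)

theorem exists_halfBall_subset_target (h : OpenPartialHomeomorph M (EuclideanHalfSpace 4)) {y : E4}
    (hy : y ∈ (h.extend (𝓡∂ 4)).target) :
    ∃ R > 0, ball y R ∩ {z | 0 ≤ z 0} ⊆ (h.extend (𝓡∂ 4)).target := by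
  have h1 := h.extend_target (I := 𝓡∂ 4)
  have h2 : IsOpen ((𝓡∂ 4).symm ⁻¹' h.target) := h.open_target.preimage (𝓡∂ 4).continuous_symm
  rw [h1] at hy
  obtain ⟨R, hR, hb⟩ := Metric.isOpen_iff.1 h2 y hy.1
  refine ⟨R, hR, ?_⟩
  rw [h1]
  exact fun z hz ↦ ⟨hb hz.1, mem_range_model.2 hz.2⟩

variable [IsManifold (𝓡∂ 4) ∞ M] {h : OpenPartialHomeomorph M (EuclideanHalfSpace 4)}

theorem hasMFDerivAt_extend (hh : h ∈ IsManifold.maximalAtlas (𝓡∂ 4) ∞ M) {x : M}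
    (hx : x ∈ h.source) :
    HasMFDerivAt (𝓡∂ 4) 𝓘(ℝ, E4) (h.extend (𝓡∂ 4)) x (chartD h x) :=
  ((h.contMDiffAt_extend hh hx).mdifferentiableAt (by simp)).hasMFDerivAt

theorem exists_hasMFDerivWithinAt_extend_symm (hh : h ∈ IsManifold.maximalAtlas (𝓡∂ 4) ∞ M) {y : E4}
    (hy : y ∈ (h.extend (𝓡∂ 4)).target) :
    ∃ e : TangentSpace (𝓡∂ 4) ((h.extend (𝓡∂ 4)).symm y) ≃L[ℝ] E4,
      (e : TangentSpace (𝓡∂ 4) ((h.extend (𝓡∂ 4)).symm y) →L[ℝ] E4) =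
        chartD h ((h.extend (𝓡∂ 4)).symm y) ∧
      HasMFDerivWithinAt 𝓘(ℝ, E4) (𝓡∂ 4) (h.extend (𝓡∂ 4)).symm (h.extend (𝓡∂ 4)).target y
        (e.symm : E4 →L[ℝ] TangentSpace (𝓡∂ 4) ((h.extend (𝓡∂ 4)).symm y)) := by
  set x := (h.extend (𝓡∂ 4)).symm y with hxdef
  have hx : x ∈ h.source := extend_symm_mem_source h hy
  have hxy : h.extend (𝓡∂ 4) x = y := (h.extend (𝓡∂ 4)).right_inv hy
  have h1 := contMDiffOn_extend_symm hh
  rw [← h.extend_target'] at h1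
  have h2 := ((h1 y hy).mdifferentiableWithinAt (by simp)).hasMFDerivWithinAt
  set S : E4 →L[ℝ] TangentSpace (𝓡∂ 4) x :=
    mfderivWithin 𝓘(ℝ, E4) (𝓡∂ 4) (h.extend (𝓡∂ 4)).symm (h.extend (𝓡∂ 4)).target y with hS
  have h3 : HasMFDerivWithinAt (𝓡∂ 4) 𝓘(ℝ, E4) (h.extend (𝓡∂ 4)) univ x (chartD h x) :=
    (hasMFDerivAt_extend hh hx).hasMFDerivWithinAt
  have hu : UniqueMDiffWithinAt 𝓘(ℝ, E4) (h.extend (𝓡∂ 4)).target y :=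
    (uniqueDiffOn_extend_target h y hy).uniqueMDiffWithinAt
  have h4 : (chartD h x).comp S = ContinuousLinearMap.id ℝ E4 := by
    have h5 := HasMFDerivWithinAt.comp y h3 h2 (subset_univ _)
    have h6 : HasMFDerivWithinAt 𝓘(ℝ, E4) 𝓘(ℝ, E4) id (h.extend (𝓡∂ 4)).target y
        (ContinuousLinearMap.id ℝ E4) := (hasMFDerivAt_id y).hasMFDerivWithinAt
    have h7 := h5.congr_mono (f₁ := id) (fun z hz ↦ ((h.extend (𝓡∂ 4)).right_inv hz).symm)
      ((h.extend (𝓡∂ 4)).right_inv hy).symm subset_rfl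
    exact UniqueMDiffWithinAt.eq hu h7 h6
  have h8 : S.comp (chartD h x) = ContinuousLinearMap.id ℝ (TangentSpace (𝓡∂ 4) x) := by
    have hS' : HasMFDerivWithinAt 𝓘(ℝ, E4) (𝓡∂ 4) (h.extend (𝓡∂ 4)).symm
        (h.extend (𝓡∂ 4)).target (h.extend (𝓡∂ 4) x) S := by
      rw [hxy]; exact h2
    have h5 := HasMFDerivWithinAt.comp x hS' ((hasMFDerivAt_extend hh hx).hasMFDerivWithinAt
      (s := h.source)) (fun z hz ↦ extend_mem_target h hz)
    have h6 : HasMFDerivWithinAt (𝓡∂ 4) (𝓡∂ 4) id h.source x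
        (ContinuousLinearMap.id ℝ (TangentSpace (𝓡∂ 4) x)) :=
      (hasMFDerivAt_id x).hasMFDerivWithinAt
    have h7 := h5.congr_mono (f₁ := id) (fun z hz ↦ (h.extend_left_inv hz).symm)
      (h.extend_left_inv hx).symm subset_rfl
    exact UniqueMDiffWithinAt.eq (h.open_source.uniqueMDiffWithinAt hx) h7 h6
  refine ⟨ContinuousLinearEquiv.equivOfInverse (chartD h x) S
    (fun v ↦ congrArg (fun L ↦ L v) h8) (fun v ↦ congrArg (fun L ↦ L v) h4), ?_, ?_⟩
  · ext v : 1; rfl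
  · exact h2

theorem chartD_isInvertible (hh : h ∈ IsManifold.maximalAtlas (𝓡∂ 4) ∞ M) {x : M}
    (hx : x ∈ h.source) : (chartD h x).IsInvertible := by
  have key : ∀ z, z = x → (chartD h z).IsInvertible → (chartD h x).IsInvertible := by
    rintro z rfl hz; exact hz
  obtain ⟨e, he, -⟩ := exists_hasMFDerivWithinAt_extend_symm hh (extend_mem_target h hx)
  exact key _ (h.extend_left_inv hx) ⟨e, he⟩

theorem chartD_inverse_apply (hh : h ∈ IsManifold.maximalAtlas (𝓡∂ 4) ∞ M) {x : M}
    (hx : x ∈ h.source) (v : TangentSpace (𝓡∂ 4) x) : (chartD h x).inverse (chartD h x v) = v := by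
  obtain ⟨e, he⟩ := chartD_isInvertible hh hx
  rw [← he, ContinuousLinearMap.inverse_equiv]
  exact e.symm_apply_apply v

theorem chartD_apply_inverse (hh : h ∈ IsManifold.maximalAtlas (𝓡∂ 4) ∞ M) {x : M}
    (hx : x ∈ h.source) (v : E4) : chartD h x ((chartD h x).inverse v) = v := by
  obtain ⟨e, he⟩ := chartD_isInvertible hh hx
  rw [← he, ContinuousLinearMap.inverse_equiv]
  exact e.apply_symm_apply v

theorem hasMFDerivWithinAt_extend_symm (hh : h ∈ IsManifold.maximalAtlas (𝓡∂ 4) ∞ M) {y : E4}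
    (hy : y ∈ (h.extend (𝓡∂ 4)).target) :
    HasMFDerivWithinAt 𝓘(ℝ, E4) (𝓡∂ 4) (h.extend (𝓡∂ 4)).symm (h.extend (𝓡∂ 4)).target y
      ((chartD h ((h.extend (𝓡∂ 4)).symm y)).inverse) := by
  obtain ⟨e, he, h1⟩ := exists_hasMFDerivWithinAt_extend_symm hh hy
  rw [← he, ContinuousLinearMap.inverse_equiv]
  exact h1

/-- The derivative of a vector-valued function on `M`, read in a chart. -/
theorem HasMFDerivAt.hasFDerivWithinAt_chart {F : Type*} [NormedAddCommGroup F] [NormedSpace ℝ F]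
    (hh : h ∈ IsManifold.maximalAtlas (𝓡∂ 4) ∞ M) {u : M → F} {x : M} (hx : x ∈ h.source)
    {u' : TangentSpace (𝓡∂ 4) x →L[ℝ] F} (hu : HasMFDerivAt (𝓡∂ 4) 𝓘(ℝ, F) u x u') :
    HasFDerivWithinAt (u ∘ (h.extend (𝓡∂ 4)).symm) (u' ∘L (chartD h x).inverse)
      (h.extend (𝓡∂ 4)).target (h.extend (𝓡∂ 4) x) := by
  have h1 := hasMFDerivWithinAt_extend_symm hh (extend_mem_target h hx)
  have hx' := h.extend_left_inv (I := 𝓡∂ 4) hx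
  have h2 : HasMFDerivWithinAt 𝓘(ℝ, E4) (𝓡∂ 4) (h.extend (𝓡∂ 4)).symm
      (h.extend (𝓡∂ 4)).target (h.extend (𝓡∂ 4) x) ((chartD h x).inverse) := by
    convert h1 using 2; rw [hx']
  have h3 : HasMFDerivAt (𝓡∂ 4) 𝓘(ℝ, F) u ((h.extend (𝓡∂ 4)).symm (h.extend (𝓡∂ 4) x)) u' := by
    rw [hx']; exact hu
  exact (HasMFDerivAt.comp_hasMFDerivWithinAt _ h3 h2).hasFDerivWithinAt

/-- A differentiable curve on `M`, read in a chart. -/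
theorem HasMFDerivAt.hasDerivAt_chart (hh : h ∈ IsManifold.maximalAtlas (𝓡∂ 4) ∞ M) {γ : ℝ → M}
    {t : ℝ} (hx : γ t ∈ h.source) {v : TangentSpace (𝓡∂ 4) (γ t)}
    (hγ : HasMFDerivAt 𝓘(ℝ, ℝ) (𝓡∂ 4) γ t ((1 : ℝ →L[ℝ] ℝ).smulRight v)) :
    HasDerivAt (h.extend (𝓡∂ 4) ∘ γ) (chartD h (γ t) v) t := by
  have h1 := (hasMFDerivAt_extend hh hx).comp t hγ
  have h2 : HasFDerivAt (h.extend (𝓡∂ 4) ∘ γ)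
      ((1 : ℝ →L[ℝ] ℝ).smulRight (chartD h (γ t) v) : ℝ →L[ℝ] E4) t := by
    refine h1.hasFDerivAt.congr_fderiv ?_
    ext1
    exact map_smul (chartD h (γ t)) _ v
  simpa using! h2.hasDerivAt

/-- A curve in the image of a chart, as a curve on `M`. -/
theorem HasDerivAt.hasMFDerivAt_extend_symm (hh : h ∈ IsManifold.maximalAtlas (𝓡∂ 4) ∞ M)
    {β : ℝ → E4} {t : ℝ} {w : E4} (hβ : HasDerivAt β w t)
    (hmem : ∀ᶠ s in 𝓝 t, β s ∈ (h.extend (𝓡∂ 4)).target) :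
    HasMFDerivAt 𝓘(ℝ, ℝ) (𝓡∂ 4) ((h.extend (𝓡∂ 4)).symm ∘ β) t
      ((1 : ℝ →L[ℝ] ℝ).smulRight ((chartD h ((h.extend (𝓡∂ 4)).symm (β t))).inverse w)) := by
  have hy : β t ∈ (h.extend (𝓡∂ 4)).target := hmem.self_of_nhds
  have h1 := hasMFDerivWithinAt_extend_symm hh hy
  have h2 : HasMFDerivWithinAt 𝓘(ℝ, ℝ) 𝓘(ℝ, E4) β {s | β s ∈ (h.extend (𝓡∂ 4)).target} t
      ((1 : ℝ →L[ℝ] ℝ).smulRight w) :=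
    (hasMFDerivAt_iff_hasFDerivAt.2 hβ.hasFDerivAt).hasMFDerivWithinAt
  have h3 := (HasMFDerivWithinAt.comp t h1 h2 (fun s hs ↦ hs)).hasMFDerivAt hmem
  refine h3.congr_mfderiv ?_
  ext1
  exact map_smul (chartD h _).inverse _ w

theorem isInteriorPoint_iff_chart (hh : h ∈ IsManifold.maximalAtlas (𝓡∂ 4) ∞ M) {x : M}
    (hx : x ∈ h.source) : (𝓡∂ 4).IsInteriorPoint x ↔ 0 < h.extend (𝓡∂ 4) x 0 := by
  have hmem : ∀ y : EuclideanHalfSpace 4, (𝓡∂ 4).IsInteriorPoint y ↔ 0 < y.val 0 := by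
    intro y
    rw [ModelWithCorners.isInteriorPoint_iff_of_mem_atlas (n := ∞) (by simp)
      (e := OpenPartialHomeomorph.refl _) (by simp) (by simp)]
    have : ((OpenPartialHomeomorph.refl (EuclideanHalfSpace 4)).extend (𝓡∂ 4)).target =
        range (𝓡∂ 4) := by
      rw [OpenPartialHomeomorph.extend_target']; simp
    rw [this, interior_range_modelWithCornersEuclideanHalfSpace]
    rfl
  have h1 : HasMFDerivAt (𝓡∂ 4) (𝓡∂ 4) h x (mfderiv (𝓡∂ 4) (𝓡∂ 4) h x) :=
    ((contMDiffAt_of_mem_maximalAtlas hh hx).mdifferentiableAt (by simp)).hasMFDerivAt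
  have h2 : HasMFDerivAt (𝓡∂ 4) (𝓡∂ 4) h.symm (h x) (mfderiv (𝓡∂ 4) (𝓡∂ 4) h.symm (h x)) :=
    ((contMDiffAt_symm_of_mem_maximalAtlas hh (h.map_source hx)).mdifferentiableAt
      (by simp)).hasMFDerivAt
  have h3 : HasMFDerivAt (𝓡∂ 4) (𝓡∂ 4) h (h.symm (h x)) (mfderiv (𝓡∂ 4) (𝓡∂ 4) h x) := by
    rw [h.left_inv hx]; exact h1
  have h4 := (h3.comp (h x) h2).congr_of_eventuallyEq (f₁ := id)
    (by filter_upwards [h.open_target.mem_nhds (h.map_source hx)] with z hz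
        exact (h.right_inv hz).symm)
  have h5 := hasMFDerivAt_unique h4 (hasMFDerivAt_id (h x))
  have h6 := (h2.comp x h1).congr_of_eventuallyEq (f₁ := id)
    (by filter_upwards [h.open_source.mem_nhds hx] with z hz
        exact (h.left_inv hz).symm)
  have h7 := hasMFDerivAt_unique h6 (hasMFDerivAt_id x)
  have hval : h.extend (𝓡∂ 4) x 0 = (h x).val 0 := rfl
  rw [hval, ← hmem]
  constructor
  · intro hi
    refine h1.mdifferentiableAt.isInteriorPoint_of_surjective_mfderiv (fun v ↦ ?_) hi
    exact ⟨mfderiv (𝓡∂ 4) (𝓡∂ 4) h.symm (h x) v, congrArg (fun L ↦ L v) h5⟩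
  · intro hi
    have := h2.mdifferentiableAt.isInteriorPoint_of_surjective_mfderiv (fun v ↦ ?_) hi
    · rwa [h.left_inv hx] at this
    · exact ⟨mfderiv (𝓡∂ 4) (𝓡∂ 4) h x v, congrArg (fun L ↦ L v) h7⟩

end Charts

section HamiltonianCharts

/-- The standard symplectic form as a continuous bilinear map. -/
noncomputable def stdFormL : E4 →L[ℝ] E4 →L[ℝ] ℝ :=
  ((EuclideanSpace.proj 0 : E4 →L[ℝ] ℝ).smulRight (EuclideanSpace.proj 2 : E4 →L[ℝ] ℝ) -
    (EuclideanSpace.proj 2 : E4 →L[ℝ] ℝ).smulRight (EuclideanSpace.proj 0 : E4 →L[ℝ] ℝ)) +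
  ((EuclideanSpace.proj 1 : E4 →L[ℝ] ℝ).smulRight (EuclideanSpace.proj 3 : E4 →L[ℝ] ℝ) -
    (EuclideanSpace.proj 3 : E4 →L[ℝ] ℝ).smulRight (EuclideanSpace.proj 1 : E4 →L[ℝ] ℝ))

theorem stdFormL_apply (a b : E4) : stdFormL a b = stdForm a b := by
  simp [stdFormL, stdForm]

/-- The inverse of `a ↦ stdForm a ·`. -/
noncomputable def stdSharp : (E4 →L[ℝ] ℝ) →L[ℝ] E4 :=
  (ContinuousLinearMap.apply ℝ ℝ (EuclideanSpace.single 2 1 : E4)).smulRight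
      (EuclideanSpace.single 0 1 : E4) +
    (ContinuousLinearMap.apply ℝ ℝ (EuclideanSpace.single 3 1 : E4)).smulRight
      (EuclideanSpace.single 1 1 : E4) +
    (ContinuousLinearMap.apply ℝ ℝ (EuclideanSpace.single 0 1 : E4)).smulRight
      (EuclideanSpace.single 2 (-1) : E4) +
    (ContinuousLinearMap.apply ℝ ℝ (EuclideanSpace.single 1 1 : E4)).smulRight
      (EuclideanSpace.single 3 (-1) : E4)

theorem stdSharp_apply (β : E4 →L[ℝ] ℝ) : stdSharp β =
    β (EuclideanSpace.single 2 1) • (EuclideanSpace.single 0 1 : E4) +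
    β (EuclideanSpace.single 3 1) • (EuclideanSpace.single 1 1 : E4) +
    β (EuclideanSpace.single 0 1) • (EuclideanSpace.single 2 (-1) : E4) +
    β (EuclideanSpace.single 1 1) • (EuclideanSpace.single 3 (-1) : E4) := rfl

theorem stdSharp_zero_apply (β : E4 →L[ℝ] ℝ) : stdSharp β 0 = β (EuclideanSpace.single 2 1) := by
  simp [stdSharp_apply]

theorem stdForm_stdSharp (β : E4 →L[ℝ] ℝ) (b : E4) : stdForm (stdSharp β) b = β b := by
  have hb : b = ∑ i, b i • (EuclideanSpace.single i (1 : ℝ) : E4) := by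
    ext j; simp [Finset.sum_apply, Pi.single_apply]
  conv_rhs => rw [hb]
  simp [stdSharp_apply, stdForm, Fin.sum_univ_four]
  ring

theorem eq_of_stdForm_eq {a a' : E4} (h : ∀ b, stdForm a b = stdForm a' b) : a = a' := by
  have h0 := h (EuclideanSpace.single 0 1)
  have h1 := h (EuclideanSpace.single 1 1)
  have h2 := h (EuclideanSpace.single 2 1)
  have h3 := h (EuclideanSpace.single 3 1)
  simp [stdForm] at h0 h1 h2 h3
  ext i
  fin_cases i <;> simp [*]

variable {M : Type*} [TopologicalSpace M] [ChartedSpace (EuclideanHalfSpace 4) M]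
  [IsManifold (𝓡∂ 4) ∞ M] {Ω : SymplecticForm M} {h : OpenPartialHomeomorph M (EuclideanHalfSpace 4)}
  {H : M → ℝ} {k : ℕ∞}

/-- A smooth chart in which `ω` is the standard symplectic form. -/
structure IsDarbouxChart (Ω : SymplecticForm M)
    (h : OpenPartialHomeomorph M (EuclideanHalfSpace 4)) : Prop where
  mem : h ∈ IsManifold.maximalAtlas (𝓡∂ 4) ∞ M
  form_eq : ∀ x ∈ h.source, ∀ v w : TangentSpace (𝓡∂ 4) x,
    Ω.form x v w = stdForm (chartD h x v) (chartD h x w)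

theorem DarbouxAtlas.isDarbouxChart (A : DarbouxAtlas Ω) (j : A.ι) : IsDarbouxChart Ω (A.chart j) :=
  ⟨A.mem_maximalAtlas j, A.darboux j⟩

theorem IsHamiltonian.mdifferentiableAt (hH : IsHamiltonian k H) (hk : 1 ≤ k) (x : M) :
    MDifferentiableAt (𝓡∂ 4) 𝓘(ℝ) H x :=
  (hH.1 x).mdifferentiableAt (by
    have : (1 : WithTop ℕ∞) ≤ (k : WithTop ℕ∞) := by exact_mod_cast hk
    intro h0; rw [h0] at this; simp at this)

theorem IsHamiltonian.of_le (hH : IsHamiltonian k H) {m : ℕ∞} (hm : m ≤ k) : IsHamiltonian m H :=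
  ⟨hH.1.of_le (by exact_mod_cast hm), hH.2⟩

theorem chartD_hamVF (hh : IsDarbouxChart Ω h) {x : M} (hx : x ∈ h.source) :
    chartD h x (hamVF Ω H x) =
      stdSharp ((mfderiv (𝓡∂ 4) 𝓘(ℝ) H x : TangentSpace (𝓡∂ 4) x →L[ℝ] ℝ) ∘L
        (chartD h x).inverse) := by
  refine eq_of_stdForm_eq fun b ↦ ?_
  rw [stdForm_stdSharp]
  have h1 := hh.form_eq x hx (hamVF Ω H x) ((chartD h x).inverse b)
  rw [chartD_apply_inverse hh.mem hx] at h1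
  rw [← h1, form_hamVF]
  rfl

theorem fderivWithin_chart (hh : IsDarbouxChart Ω h) {x : M} (hx : x ∈ h.source)
    (hH : MDifferentiableAt (𝓡∂ 4) 𝓘(ℝ) H x) :
    fderivWithin ℝ (H ∘ (h.extend (𝓡∂ 4)).symm) (h.extend (𝓡∂ 4)).target (h.extend (𝓡∂ 4) x) =
      (mfderiv (𝓡∂ 4) 𝓘(ℝ) H x : TangentSpace (𝓡∂ 4) x →L[ℝ] ℝ) ∘L (chartD h x).inverse :=
  (hH.hasMFDerivAt.hasFDerivWithinAt_chart hh.mem hx).fderivWithin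
    (uniqueDiffOn_extend_target h _ (extend_mem_target h hx))

theorem chartVF_eq (hh : IsDarbouxChart Ω h) {y : E4} (hy : y ∈ (h.extend (𝓡∂ 4)).target)
    (hH : MDifferentiableAt (𝓡∂ 4) 𝓘(ℝ) H ((h.extend (𝓡∂ 4)).symm y)) :
    chartVF Ω h H y =
      stdSharp (fderivWithin ℝ (H ∘ (h.extend (𝓡∂ 4)).symm) (h.extend (𝓡∂ 4)).target y) := by
  have h1 := fderivWithin_chart hh (extend_symm_mem_source h hy) hH
  rw [(h.extend (𝓡∂ 4)).right_inv hy] at h1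
  rw [h1, chartVF, chartD_hamVF hh (extend_symm_mem_source h hy)]
  rfl

theorem chartVF_extend {x : M} (hx : x ∈ h.source) :
    chartVF Ω h H (h.extend (𝓡∂ 4) x) = chartD h x (hamVF Ω H x) := by
  rw [chartVF, h.extend_left_inv hx]

theorem IsHamiltonian.contDiffOn_chart (hH : IsHamiltonian k H) (hh : IsDarbouxChart Ω h) :
    ContDiffOn ℝ k (H ∘ (h.extend (𝓡∂ 4)).symm) (h.extend (𝓡∂ 4)).target := by
  have h1 := (contMDiffOn_extend_symm hh.mem).of_le (show (k : WithTop ℕ∞) ≤ ∞ by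
    exact_mod_cast le_top)
  rw [← h.extend_target'] at h1
  exact (hH.1.comp_contMDiffOn h1).contDiffOn

theorem IsHamiltonian.contDiffOn_chartVF (hH : IsHamiltonian k H) (hh : IsDarbouxChart Ω h)
    {m : ℕ∞} (hm : m + 1 ≤ k) : ContDiffOn ℝ m (chartVF Ω h H) (h.extend (𝓡∂ 4)).target := by
  have h1 := (hH.contDiffOn_chart hh).fderivWithin (uniqueDiffOn_extend_target h)
    (m := m) (by exact_mod_cast hm)
  refine (stdSharp.contDiff.comp_contDiffOn h1).congr fun y hy ↦ ?_
  exact chartVF_eq hh hy (hH.mdifferentiableAt (le_trans (by simp) hm) _)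

theorem IsHamiltonian.chartVF_tangent (hH : IsHamiltonian k H) (hk : 1 ≤ k)
    (hh : IsDarbouxChart Ω h) {y : E4} (hy : y ∈ (h.extend (𝓡∂ 4)).target) (hy0 : y 0 = 0) :
    chartVF Ω h H y 0 = 0 := by
  have hd := (hH.mdifferentiableAt hk ((h.extend (𝓡∂ 4)).symm y))
  have h1 := hd.hasMFDerivAt.hasFDerivWithinAt_chart hh.mem (extend_symm_mem_source h hy)
  rw [(h.extend (𝓡∂ 4)).right_inv hy] at h1
  rw [chartVF_eq hh hy hd, stdSharp_zero_apply]
  have h1 := h1.differentiableWithinAt.hasFDerivWithinAt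
  obtain ⟨R, hR, hb⟩ := exists_halfBall_subset_target h hy
  set c : ℝ → E4 := fun t ↦ y + t • EuclideanSpace.single 2 (1 : ℝ) with hc
  have hc0 : c 0 = y := by simp [hc]
  have hc00 : ∀ t, c t 0 = 0 := fun t ↦ by simp [hc, hy0]
  have hcT : ∀ t ∈ Ioo (-R) R, c t ∈ (h.extend (𝓡∂ 4)).target := by
    intro t ht
    refine hb ⟨?_, (hc00 t).ge⟩
    rw [mem_ball, dist_eq_norm]
    simpa [hc, norm_smul] using abs_lt.2 ht
  have hcd : HasDerivAt c (EuclideanSpace.single 2 (1 : ℝ)) 0 := by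
    simpa [hc] using ((hasDerivAt_id (0 : ℝ)).smul_const
      (EuclideanSpace.single 2 (1 : ℝ) : E4)).const_add y
  have hcb : ∀ t ∈ Ioo (-R) R, (h.extend (𝓡∂ 4)).symm (c t) ∈ (𝓡∂ 4).boundary M := by
    intro t ht
    have hs := extend_symm_mem_source h (hcT t ht)
    rw [← ModelWithCorners.compl_interior]
    intro hi
    have := (isInteriorPoint_iff_chart hh.mem hs).1 hi
    rw [(h.extend (𝓡∂ 4)).right_inv (hcT t ht), hc00] at this
    exact lt_irrefl _ this
  have hI0 : (0 : ℝ) ∈ Ioo (-R) R := ⟨by linarith, hR⟩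
  have hcc : ContinuousOn (fun t ↦ (h.extend (𝓡∂ 4)).symm (c t)) (Ioo (-R) R) := by
    refine (h.continuousOn_extend_symm (I := 𝓡∂ 4)).comp ?_ hcT
    exact (continuous_const.add (continuous_id.smul continuous_const)).continuousOn
  have hpre := (isPreconnected_Ioo (a := -R) (b := R)).image _ hcc
  have hsub : (fun t ↦ (h.extend (𝓡∂ 4)).symm (c t)) '' Ioo (-R) R ⊆
      connectedComponentIn ((𝓡∂ 4).boundary M) ((h.extend (𝓡∂ 4)).symm y) :=
    hpre.subset_connectedComponentIn ⟨0, hI0, by simp only [hc0]⟩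
      (by rintro _ ⟨t, ht, rfl⟩; exact hcb t ht)
  have hconst : ∀ t ∈ Ioo (-R) R, (H ∘ (h.extend (𝓡∂ 4)).symm) (c t) =
      H ((h.extend (𝓡∂ 4)).symm y) := fun t ht ↦
    hH.2 _ (by simpa [hc0] using hcb 0 hI0) _ (hsub ⟨t, ht, rfl⟩)
  have hcomp : HasDerivWithinAt ((H ∘ (h.extend (𝓡∂ 4)).symm) ∘ c)
      (fderivWithin ℝ (H ∘ (h.extend (𝓡∂ 4)).symm) (h.extend (𝓡∂ 4)).target y
        (EuclideanSpace.single 2 1)) (Ioo (-R) R) 0 :=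
    HasFDerivWithinAt.comp_hasDerivWithinAt (t := (h.extend (𝓡∂ 4)).target) 0
      (by rw [hc0]; exact h1) hcd.hasDerivWithinAt hcT
  have h2 := hcomp.hasDerivAt (Ioo_mem_nhds hI0.1 hI0.2)
  have h3 : HasDerivAt ((H ∘ (h.extend (𝓡∂ 4)).symm) ∘ c) 0 0 := by
    refine (hasDerivAt_const (0 : ℝ) (H ((h.extend (𝓡∂ 4)).symm y))).congr_of_eventuallyEq ?_
    filter_upwards [Ioo_mem_nhds hI0.1 hI0.2] with t ht using hconst t ht
  exact h2.unique h3

/-- Near any point the Hamiltonian vector field, read in a Darboux chart, extends to a compactly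
supported `C¹` field on `ℝ⁴` which is tangent to the boundary hyperplane. -/
theorem IsHamiltonian.exists_chartVF_extension (hH : IsHamiltonian k H) (hk : 2 ≤ k)
    (hh : IsDarbouxChart Ω h) {y : E4} (hy : y ∈ (h.extend (𝓡∂ 4)).target) :
    ∃ R > 0, ∃ Y : E4 → E4, ContDiff ℝ 1 Y ∧ HasCompactSupport Y ∧
      (∀ z, z 0 = 0 → Y z 0 = 0) ∧
      ∀ z ∈ ball y R, 0 ≤ z 0 → z ∈ (h.extend (𝓡∂ 4)).target ∧ Y z = chartVF Ω h H z := by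
  obtain ⟨R, hR, hb⟩ := exists_halfBall_subset_target h hy
  obtain ⟨Y, h1, h2, h3, h4⟩ := exists_extension_of_halfBall (X := chartVF Ω h H) hR
    (extend_target_nonneg h hy)
    ((hH.contDiffOn_chartVF hh (m := 1) (by simpa [one_add_one_eq_two] using hk)).mono hb)
    (fun z hz hz0 ↦ hH.chartVF_tangent (le_trans (by simp) hk) hh (hb ⟨hz, hz0.ge⟩) hz0)
  exact ⟨R / 2, half_pos hR, Y, h1, h2, h4, fun z hz hz0 ↦
    ⟨hb ⟨ball_subset_ball (by linarith) hz, hz0⟩, h3 z hz hz0⟩⟩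

end HamiltonianCharts

section IntegralCurves

variable {M : Type*} [TopologicalSpace M] [ChartedSpace (EuclideanHalfSpace 4) M]
  [IsManifold (𝓡∂ 4) ∞ M] [T2Space M] {v : (x : M) → TangentSpace (𝓡∂ 4) x} {γ γ' : ℝ → M} {t₀ : ℝ}

/-- Integral curves of `v` are locally determined by their value at one time. -/
def LocallyUniqueIntegralCurves (v : (x : M) → TangentSpace (𝓡∂ 4) x) : Prop :=
  ∀ (γ γ' : ℝ → M) (t : ℝ), IsMIntegralCurveAt γ v t → IsMIntegralCurveAt γ' v t → γ t = γ' t →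
    γ =ᶠ[𝓝 t] γ'

theorem LocallyUniqueIntegralCurves.eqOn_Ioo (hu : LocallyUniqueIntegralCurves v) {a b : ℝ}
    (ht₀ : t₀ ∈ Ioo a b) (hγ : IsMIntegralCurveOn γ v (Ioo a b))
    (hγ' : IsMIntegralCurveOn γ' v (Ioo a b)) (h : γ t₀ = γ' t₀) : EqOn γ γ' (Ioo a b) := by
  have hs : IsPreconnected (Ioo a b) := isPreconnected_Ioo
  intro t ht
  have h1 : Ioo a b ⊆ {t | t ∈ Ioo a b → γ t = γ' t} := by
    refine hs.subset_of_closure_inter_subset (u := {t | γ t = γ' t} ∩ Ioo a b) ?_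
      ⟨t₀, ht₀, h, ht₀⟩ ?_ |>.trans fun t ht _ ↦ ht.1
    · rw [isOpen_iff_mem_nhds]
      intro t₁ ht₁
      have hmem := Ioo_mem_nhds ht₁.2.1 ht₁.2.2
      exact ((hu γ γ' t₁ (hγ.isMIntegralCurveAt hmem) (hγ'.isMIntegralCurveAt hmem) ht₁.1).and
        hmem).mono fun _ ht ↦ ht
    · rintro t₁ ⟨hc, ht₁⟩
      refine ⟨?_, ht₁⟩
      have hmem := Ioo_mem_nhds ht₁.1 ht₁.2
      have c1 := (hγ.continuousOn t₁ ht₁).continuousAt hmem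
      have c2 := (hγ'.continuousOn t₁ ht₁).continuousAt hmem
      rw [mem_closure_iff_frequently] at hc
      by_contra hne
      exact hc (((c1.prodMk c2).eventually (isClosed_diagonal.isOpen_compl.mem_nhds hne)).mono
        fun z hz hz' ↦ hz hz'.1)
  exact h1 ht ht

/-- This is the uniqueness theorem of integral curves applied to a real-indexed family of integral
curves with the same starting point. -/
theorem LocallyUniqueIntegralCurves.eqOn_of_isMIntegralCurveOn_Ioo
    (hu : LocallyUniqueIntegralCurves v) {x : M}
    (γ : ℝ → ℝ → M) (hγx : ∀ a, γ a 0 = x) (hγ : ∀ a > 0, IsMIntegralCurveOn (γ a) v (Ioo (-a) a))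
    {a a' : ℝ} (hpos : 0 < a') (hle : a' ≤ a) :
    EqOn (γ a') (γ a) (Ioo (-a') a') := by
  apply hu.eqOn_Ioo _
    (hγ a' (by positivity)) ((hγ a (lt_of_lt_of_le hpos hle)).mono _)
    (by rw [hγx a, hγx a'])
  · rw [mem_Ioo]
    exact ⟨neg_lt_zero.mpr hpos, by positivity⟩
  · apply Ioo_subset_Ioo <;> linarith

/-- For a family of integral curves `γ : ℝ → ℝ → M` with the same starting point `γ 0 = x` such that
each `γ a` is defined on `Ioo (-a) a`, the global curve `γ_ext := fun t ↦ γ (|t| + 1) t` agrees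
with each `γ a` on `Ioo (-a) a`. This will help us show that `γ_ext` is a global integral curve. -/
theorem LocallyUniqueIntegralCurves.eqOn_abs_add_one_of_isMIntegralCurveOn_Ioo
    (hu : LocallyUniqueIntegralCurves v) {x : M}
    (γ : ℝ → ℝ → M) (hγx : ∀ a, γ a 0 = x) (hγ : ∀ a > 0, IsMIntegralCurveOn (γ a) v (Ioo (-a) a))
    {a : ℝ} : EqOn (fun t ↦ γ (|t| + 1) t) (γ a) (Ioo (-a) a) := by
  intro t ht
  by_cases! hlt : |t| + 1 < a
  · exact LocallyUniqueIntegralCurves.eqOn_of_isMIntegralCurveOn_Ioo hu γ hγx hγ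
      (by positivity) hlt.le (abs_lt.mp <| lt_add_one _)
  · exact LocallyUniqueIntegralCurves.eqOn_of_isMIntegralCurveOn_Ioo hu γ hγx hγ
      (neg_lt_self_iff.mp <| lt_trans ht.1 ht.2) hlt ht |>.symm

/-- For a family of integral curves `γ : ℝ → ℝ → M` with the same starting point `γ 0 = x` such that
each `γ a` is defined on `Ioo (-a) a`, the function `γ_ext := fun t ↦ γ (|t| + 1) t` is a global
integral curve. -/
theorem LocallyUniqueIntegralCurves.isMIntegralCurve_abs_add_one_of_isMIntegralCurveOn_Ioo
    (hu : LocallyUniqueIntegralCurves v) {x : M}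
    (γ : ℝ → ℝ → M) (hγx : ∀ a, γ a 0 = x) (hγ : ∀ a > 0, IsMIntegralCurveOn (γ a) v (Ioo (-a) a)) :
    IsMIntegralCurve (fun t ↦ γ (|t| + 1) t) v := by
  intro t
  have ht : t ∈ Ioo (-(|t| + 1)) (|t| + 1) := by
    rw [mem_Ioo, ← abs_lt]
    exact lt_add_one _
  apply HasMFDerivAt.congr_of_eventuallyEq (f := γ (|t| + 1))
  · exact hγ (|t| + 1) (by positivity) _ ht |>.hasMFDerivAt (Ioo_mem_nhds ht.1 ht.2)
  · rw [Filter.eventuallyEq_iff_exists_mem]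
    refine ⟨Ioo (-(|t| + 1)) (|t| + 1), ?_,
      LocallyUniqueIntegralCurves.eqOn_abs_add_one_of_isMIntegralCurveOn_Ioo hu γ hγx hγ⟩
    have : |t| < |t| + 1 := lt_add_of_pos_right |t| zero_lt_one
    rw [abs_lt] at this
    exact Ioo_mem_nhds this.1 this.2

/-- The existence of a global integral curve is equivalent to the existence of a family of local
integral curves `γ : ℝ → ℝ → M` with the same starting point `γ 0 = x` such that each `γ a` is
defined on `Ioo (-a) a`. -/
theorem LocallyUniqueIntegralCurves.exists_isMIntegralCurve_iff_exists_isMIntegralCurveOn_Ioo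
    (hu : LocallyUniqueIntegralCurves v) (x : M) :
    (∃ γ, γ 0 = x ∧ IsMIntegralCurve γ v) ↔
      ∀ a, ∃ γ, γ 0 = x ∧ IsMIntegralCurveOn γ v (Ioo (-a) a) := by
  refine ⟨fun ⟨γ, h1, h2⟩ _ ↦ ⟨γ, h1, h2.isMIntegralCurveOn _⟩, fun h ↦ ?_⟩
  choose γ hγx hγ using h
  exact ⟨fun t ↦ γ (|t| + 1) t, hγx (|0| + 1),
    LocallyUniqueIntegralCurves.isMIntegralCurve_abs_add_one_of_isMIntegralCurveOn_Ioo hu γ hγx (fun a _ ↦  hγ a)⟩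

/-- Let `γ` and `γ'` be integral curves defined on `Ioo a b` and `Ioo a' b'`, respectively. Then,
`piecewise (Ioo a b) γ γ'` is equal to `γ` and `γ'` in their respective domains.
`Set.piecewise_eqOn` shows the equality for `γ` by definition, while this lemma shows the equality
for `γ'` by the uniqueness of integral curves. -/
theorem LocallyUniqueIntegralCurves.eqOn_piecewise_of_isMIntegralCurveOn_Ioo
    (hu : LocallyUniqueIntegralCurves v)
    {a b a' b' : ℝ} (hγ : IsMIntegralCurveOn γ v (Ioo a b))
    (hγ' : IsMIntegralCurveOn γ' v (Ioo a' b'))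
    (ht₀ : t₀ ∈ Ioo a b ∩ Ioo a' b') (h : γ t₀ = γ' t₀) :
    EqOn (piecewise (Ioo a b) γ γ') γ' (Ioo a' b') := by
  intro t ht
  suffices H : EqOn γ γ' (Ioo (max a a') (min b b')) by
    by_cases hmem : t ∈ Ioo a b
    · rw [piecewise, if_pos hmem]
      apply H
      simp [ht.1, ht.2, hmem.1, hmem.2]
    · rw [piecewise, if_neg hmem]
  apply hu.eqOn_Ioo _
    (hγ.mono (Ioo_subset_Ioo (le_max_left ..) (min_le_left ..)))
    (hγ'.mono (Ioo_subset_Ioo (le_max_right ..) (min_le_right ..))) h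
  exact ⟨max_lt ht₀.1.1 ht₀.2.1, lt_min ht₀.1.2 ht₀.2.2⟩

/-- The extension of an integral curve by another integral curve is an integral curve.

If two integral curves are defined on overlapping open intervals, and they agree at a point in
their common domain, then they can be patched together to form a longer integral curve. -/
theorem LocallyUniqueIntegralCurves.isMIntegralCurveOn_piecewise
    (hu : LocallyUniqueIntegralCurves v)
    {a b a' b' : ℝ} (hγ : IsMIntegralCurveOn γ v (Ioo a b))
    (hγ' : IsMIntegralCurveOn γ' v (Ioo a' b')) {t₀ : ℝ}
    (ht₀ : t₀ ∈ Ioo a b ∩ Ioo a' b') (h : γ t₀ = γ' t₀) :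
    IsMIntegralCurveOn (piecewise (Ioo a b) γ γ') v (Ioo a b ∪ Ioo a' b') := by
  intro t ht
  by_cases hmem : t ∈ Ioo a b
  · rw [piecewise, if_pos hmem]
    apply hγ t hmem |>.hasMFDerivAt (Ioo_mem_nhds hmem.1 hmem.2) |>.hasMFDerivWithinAt
      (s := Ioo a b ∪ Ioo a' b') |>.congr_of_eventuallyEq _ (by rw [piecewise, if_pos hmem])
    rw [Filter.eventuallyEq_iff_exists_mem]
    refine ⟨Ioo a b, ?_, fun _ ht' ↦ by rw [piecewise, if_pos ht']⟩
    rw [(isOpen_Ioo.union isOpen_Ioo).nhdsWithin_eq ht]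
    exact Ioo_mem_nhds hmem.1 hmem.2
  · have ht' := ht
    rw [mem_union, or_iff_not_imp_left] at ht
    rw [piecewise, if_neg hmem]
    apply hγ' t (ht hmem) |>.hasMFDerivAt (Ioo_mem_nhds (ht hmem).1 (ht hmem).2)
      |>.hasMFDerivWithinAt (s := Ioo a b ∪ Ioo a' b')
      |>.congr_of_eventuallyEq _ (by rw [piecewise, if_neg hmem])
    rw [Filter.eventuallyEq_iff_exists_mem]
    refine ⟨Ioo a' b', ?_,
      LocallyUniqueIntegralCurves.eqOn_piecewise_of_isMIntegralCurveOn_Ioo hu hγ hγ' ht₀ h⟩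
    rw [(isOpen_Ioo.union isOpen_Ioo).nhdsWithin_eq ht']
    exact Ioo_mem_nhds (ht hmem).1 (ht hmem).2

/-- If there exists `ε > 0` such that the local integral curve at each point `x : M` is defined at
least on an open interval `Ioo (-ε) ε`, then every point on `M` has a global integral curve
passing through it.

See Lemma 9.15, [J.M. Lee (2012)][lee2012]. -/
theorem LocallyUniqueIntegralCurves.exists_isMIntegralCurve_of_isMIntegralCurveOn
    {v : (x : M) → TangentSpace (𝓡∂ 4) x}
    (hu : LocallyUniqueIntegralCurves v)
    {ε : ℝ} (hε : 0 < ε) (h : ∀ x : M, ∃ γ : ℝ → M, γ 0 = x ∧ IsMIntegralCurveOn γ v (Ioo (-ε) ε))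
    (x : M) : ∃ γ : ℝ → M, γ 0 = x ∧ IsMIntegralCurve γ v := by
  let s := { a | ∃ γ, γ 0 = x ∧ IsMIntegralCurveOn γ v (Ioo (-a) a) }
  suffices hbdd : ¬BddAbove s by
    rw [not_bddAbove_iff] at hbdd
    rw [LocallyUniqueIntegralCurves.exists_isMIntegralCurve_iff_exists_isMIntegralCurveOn_Ioo hu]
    intro a
    obtain ⟨y, ⟨γ, hγ1, hγ2⟩, hlt⟩ := hbdd a
    exact ⟨γ, hγ1, hγ2.mono <| Ioo_subset_Ioo (neg_le_neg hlt.le) hlt.le⟩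
  intro hbdd
  set asup := sSup s with hasup
  -- we will obtain two integral curves, one centred at some `t₀ > 0` with
  -- `0 ≤ asup - ε < t₀ < asup`; let `t₀ = asup - ε / 2`
  -- another centred at 0 with domain up to `a ∈ S` with `t₀ < a < asup`
  obtain ⟨a, ha, hlt⟩ := Real.add_neg_lt_sSup (⟨ε, h x⟩ : Set.Nonempty s) (ε := - (ε / 2))
    (by rw [neg_lt, neg_zero]; exact half_pos hε)
  rw [mem_ofPred] at ha
  rw [← hasup, ← sub_eq_add_neg] at hlt
  -- integral curve defined on `Ioo (-a) a`
  obtain ⟨γ, h0, hγ⟩ := ha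
  -- integral curve starting at `-(asup - ε / 2)` with radius `ε`
  obtain ⟨γ1_aux, h1_aux, hγ1⟩ := h (γ (-(asup - ε / 2)))
  rw [← isMIntegralCurveOn_comp_add (dt := asup - ε / 2)] at hγ1
  set γ1 := γ1_aux ∘ (· + (asup - ε / 2)) with γ1_def
  have heq1 : γ1 (-(asup - ε / 2)) = γ (-(asup - ε / 2)) := by simp [γ1_def, h1_aux]
  -- integral curve starting at `asup - ε / 2` with radius `ε`
  obtain ⟨γ2_aux, h2_aux, hγ2⟩ := h (γ (asup - ε / 2))
  rw [← isMIntegralCurveOn_comp_sub (dt := asup - ε / 2)] at hγ2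
  set γ2 := γ2_aux ∘ (· - (asup - ε / 2)) with γ2_def
  have heq2 : γ2 (asup - ε / 2) = γ (asup - ε / 2) := by simp [γ2_def, h2_aux]
  -- rewrite shifted Ioo as Ioo
  simp_rw [Set.mem_Ioo, ← sub_lt_iff_lt_add, ← lt_sub_iff_add_lt, ← Set.mem_Ioo] at hγ1
  simp_rw [Set.mem_Ioo, lt_sub_iff_add_lt, sub_lt_iff_lt_add, ← Set.mem_Ioo] at hγ2
  -- to help `linarith`
  have hεle : ε ≤ asup := le_csSup hbdd (h x)
  -- extend `γ` on the left by `γ1` and on the right by `γ2`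
  set γ_ext : ℝ → M := piecewise (Ioo (-(asup + ε / 2)) a)
    (piecewise (Ioo (-a) a) γ γ1) γ2 with γ_ext_def
  have heq_ext : γ_ext 0 = x := by
    rw [γ_ext_def, piecewise, if_pos ⟨by linarith, by linarith⟩, piecewise,
      if_pos ⟨by linarith, by linarith⟩, h0]
  -- `asup + ε / 2` is an element of `s` greater than `asup`, a contradiction
  suffices hext : IsMIntegralCurveOn γ_ext v (Ioo (-(asup + ε / 2)) (asup + ε / 2)) from
    (not_lt.mpr <| le_csSup hbdd ⟨γ_ext, heq_ext, hext⟩) <| lt_add_of_pos_right asup (half_pos hε)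
  apply (LocallyUniqueIntegralCurves.isMIntegralCurveOn_piecewise (t₀ := asup - ε / 2) hu _ hγ2
      ⟨⟨by linarith, hlt⟩, ⟨by linarith, by linarith⟩⟩
      (by rw [piecewise, if_pos ⟨by linarith, hlt⟩, ← heq2])).mono
    (Ioo_subset_Ioo_union_Ioo le_rfl (by linarith) (by linarith))
  exact (LocallyUniqueIntegralCurves.isMIntegralCurveOn_piecewise (t₀ := -(asup - ε / 2)) hu hγ hγ1
      ⟨⟨neg_lt_neg hlt, by linarith⟩, ⟨by linarith, by linarith⟩⟩ heq1.symm).mono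
    (union_comm _ _ ▸ Ioo_subset_Ioo_union_Ioo (by linarith) (by linarith) le_rfl)


end IntegralCurves

section HamiltonianFlow

variable {M : Type*} [TopologicalSpace M] [ChartedSpace (EuclideanHalfSpace 4) M]
  [IsManifold (𝓡∂ 4) ∞ M] {Ω : SymplecticForm M} {h : OpenPartialHomeomorph M (EuclideanHalfSpace 4)}
  {H : M → ℝ} {k : ℕ∞}

theorem eventually_hasDerivAt_chartVF (hh : IsDarbouxChart Ω h) {γ : ℝ → M} {t : ℝ}
    (hγ : IsMIntegralCurveAt γ (hamVF Ω H) t) (ht : γ t ∈ h.source) :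
    ∀ᶠ s in 𝓝 t, γ s ∈ h.source ∧
      HasDerivAt (h.extend (𝓡∂ 4) ∘ γ) (chartVF Ω h H (h.extend (𝓡∂ 4) (γ s))) s := by
  have h1 : ∀ᶠ s in 𝓝 t, γ s ∈ h.source :=
    hγ.continuousAt.eventually (h.open_source.mem_nhds ht)
  filter_upwards [h1, hγ] with s hs hs'
  refine ⟨hs, ?_⟩
  rw [chartVF_extend hs]
  exact HasMFDerivAt.hasDerivAt_chart hh.mem hs hs'

theorem IsHamiltonian.locallyUnique (A : DarbouxAtlas Ω) (hH : IsHamiltonian k H) (hk : 2 ≤ k) :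
    LocallyUniqueIntegralCurves (hamVF Ω H) := by
  intro γ γ' t hγ hγ' heq
  set h := A.chart (A.idx (γ t)) with hdef
  have hh : IsDarbouxChart Ω h := A.isDarbouxChart _
  have hx : γ t ∈ h.source := A.mem_source _
  have hx' : γ' t ∈ h.source := heq ▸ hx
  obtain ⟨R, hR, Y, hY1, hY2, -, hY⟩ := hH.exists_chartVF_extension hk hh (extend_mem_target h hx)
  obtain ⟨⟨L, hL⟩, -⟩ := exists_lipschitz_bound hY1 hY2
  have key : ∀ δ : ℝ → M, IsMIntegralCurveAt δ (hamVF Ω H) t → δ t = γ t →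
      ∀ᶠ s in 𝓝 t, HasDerivAt (h.extend (𝓡∂ 4) ∘ δ) (Y ((h.extend (𝓡∂ 4) ∘ δ) s)) s ∧
        (h.extend (𝓡∂ 4) ∘ δ) s ∈ (univ : Set E4) := by
    intro δ hδ hδt
    have hs : δ t ∈ h.source := hδt ▸ hx
    have h1 := eventually_hasDerivAt_chartVF hh hδ hs
    have h2 : ∀ᶠ s in 𝓝 t, h.extend (𝓡∂ 4) (δ s) ∈ ball (h.extend (𝓡∂ 4) (γ t)) R := by
      have hc : ContinuousAt (h.extend (𝓡∂ 4) ∘ δ) t := h1.self_of_nhds.2.continuousAt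
      refine hc.eventually (isOpen_ball.mem_nhds ?_)
      simp [hδt, hR]
    filter_upwards [h1, h2] with s hs1 hs2
    refine ⟨?_, mem_univ _⟩
    have h3 := (hY _ hs2 (extend_target_nonneg h (extend_mem_target h hs1.1))).2
    rw [Function.comp_apply, h3]
    exact hs1.2
  have h3 := ODE_solution_unique_of_eventually (v := fun _ ↦ Y) (s := fun _ ↦ univ) (K := L)
    (Eventually.of_forall fun _ ↦ hL.lipschitzOnWith) (key γ hγ rfl) (key γ' hγ' heq.symm)
    (by simp [heq])
  filter_upwards [h3, hγ.continuousAt.eventually (h.open_source.mem_nhds hx),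
    hγ'.continuousAt.eventually (h.open_source.mem_nhds hx')] with s hs h4 h5
  have := congrArg (h.extend (𝓡∂ 4)).symm hs
  simpa only [Function.comp_apply, h.extend_left_inv h4, h.extend_left_inv h5] using this

/-- The flow of an extension to `ℝ⁴` of the Hamiltonian field gives its integral curves for small
times. -/
theorem exists_chart_flow (hh : IsDarbouxChart Ω h) {x : M} (hx : x ∈ h.source) {R : ℝ} (hR : 0 < R)
    {Y : E4 → E4} {n : ℕ∞} (hn : 1 ≤ n) (hY : ContDiff ℝ n Y) (hYs : HasCompactSupport Y)
    (htan : ∀ z, z 0 = 0 → Y z 0 = 0)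
    (hYX : ∀ z ∈ ball (h.extend (𝓡∂ 4) x) R, 0 ≤ z 0 →
      z ∈ (h.extend (𝓡∂ 4)).target ∧ Y z = chartVF Ω h H z) :
    ∃ φ : ℝ → E4 → E4, ContDiff ℝ n (fun p : ℝ × E4 ↦ φ p.1 p.2) ∧ (∀ y, φ 0 y = y) ∧
      (∀ t y, HasDerivAt (fun t ↦ φ t y) (Y (φ t y)) t) ∧
      ∃ ε > 0, ∃ V, IsOpen V ∧ x ∈ V ∧ V ⊆ h.source ∧ ∀ z ∈ V, ∀ t ∈ Ioo (-ε) ε,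
        φ t (h.extend (𝓡∂ 4) z) ∈ ball (h.extend (𝓡∂ 4) x) R ∧
        φ t (h.extend (𝓡∂ 4) z) ∈ (h.extend (𝓡∂ 4)).target ∧
        HasMFDerivAt 𝓘(ℝ, ℝ) (𝓡∂ 4)
          (fun t ↦ (h.extend (𝓡∂ 4)).symm (φ t (h.extend (𝓡∂ 4) z))) t
          ((1 : ℝ →L[ℝ] ℝ).smulRight
            (hamVF Ω H ((h.extend (𝓡∂ 4)).symm (φ t (h.extend (𝓡∂ 4) z))))) := by
  have hY1 : ContDiff ℝ 1 Y := hY.of_le (by exact_mod_cast hn)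
  obtain ⟨⟨L, hL⟩, B, hB⟩ := exists_lipschitz_bound hY1 hYs
  obtain ⟨φ, h0, hφ⟩ := exists_flow hL hB
  have hφn := contDiff_flow hn hL hY h0 hφ
  refine ⟨φ, hφn, h0, hφ, ?_⟩
  have hev : ∀ᶠ p in 𝓝 ((0 : ℝ), x), p.2 ∈ h.source ∧
      φ p.1 (h.extend (𝓡∂ 4) p.2) ∈ ball (h.extend (𝓡∂ 4) x) R := by
    have c1 : ContinuousAt (fun p : ℝ × M ↦ φ p.1 (h.extend (𝓡∂ 4) p.2)) (0, x) := by
      have : ContinuousAt (fun p : ℝ × M ↦ (p.1, h.extend (𝓡∂ 4) p.2)) (0, x) :=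
        continuousAt_fst.prodMk ((h.continuousAt_extend hx).comp (x := ((0 : ℝ), x)) continuousAt_snd)
      exact hφn.continuous.continuousAt.comp this
    refine (continuousAt_snd.eventually (h.open_source.mem_nhds hx)).and
      (c1.eventually (isOpen_ball.mem_nhds ?_))
    simp [h0, hR]
  rw [nhds_prod_eq, eventually_prod_iff] at hev
  obtain ⟨p, hp, q, hq, hpq⟩ := hev
  obtain ⟨ε, hε, hεp⟩ := Metric.eventually_nhds_iff_ball.1 hp
  obtain ⟨V, hVq, hV, hxV⟩ := mem_nhds_iff.1 hq
  refine ⟨ε, hε, V, hV, hxV, fun z hz ↦ (hpq hp.self_of_nhds (hVq hz)).1, fun z hz t ht ↦ ?_⟩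
  have hball : ∀ s ∈ Ioo (-ε) ε, φ s (h.extend (𝓡∂ 4) z) ∈ ball (h.extend (𝓡∂ 4) x) R :=
    fun s hs ↦ (hpq (hεp s (by rw [Real.ball_eq_Ioo]; simpa using hs)) (hVq hz)).2
  have hzs : z ∈ h.source := (hpq hp.self_of_nhds (hVq hz)).1
  have hsign : ∀ s, 0 ≤ φ s (h.extend (𝓡∂ 4) z) 0 := fun s ↦
    (coord_sign_invariant hL htan (fun t ↦ hφ t (h.extend (𝓡∂ 4) z)) s).1
      (by rw [h0]; exact extend_target_nonneg h (extend_mem_target h hzs))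
  have hT : ∀ s ∈ Ioo (-ε) ε, φ s (h.extend (𝓡∂ 4) z) ∈ (h.extend (𝓡∂ 4)).target :=
    fun s hs ↦ (hYX _ (hball s hs) (hsign s)).1
  refine ⟨hball t ht, hT t ht, ?_⟩
  have h2 := HasDerivAt.hasMFDerivAt_extend_symm hh.mem (hφ t (h.extend (𝓡∂ 4) z))
    (by filter_upwards [Ioo_mem_nhds ht.1 ht.2] with s hs using hT s hs)
  refine h2.congr_mfderiv ?_
  rw [(hYX _ (hball t ht) (hsign t)).2, chartVF,
    chartD_inverse_apply hh.mem (extend_symm_mem_source h (hT t ht))]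

variable [CompactSpace M] [T2Space M]

theorem IsHamiltonian.exists_integralCurve (A : DarbouxAtlas Ω) (hH : IsHamiltonian k H)
    (hk : 2 ≤ k) (x : M) : ∃ γ : ℝ → M, γ 0 = x ∧ IsMIntegralCurve γ (hamVF Ω H) := by
  have hloc : ∀ x : M, ∃ ε > 0, ∃ V ∈ 𝓝 x, ∀ z ∈ V, ∃ γ : ℝ → M, γ 0 = z ∧
      IsMIntegralCurveOn γ (hamVF Ω H) (Ioo (-ε) ε) := by
    intro x
    have hx := A.mem_source x
    have hh := A.isDarbouxChart (A.idx x)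
    obtain ⟨R, hR, Y, hY1, hY2, hY3, hY⟩ :=
      hH.exists_chartVF_extension hk hh (extend_mem_target _ hx)
    obtain ⟨φ, -, h0, -, ε, hε, V, hV, hxV, hVs, hφ⟩ :=
      exists_chart_flow (n := 1) hh hx hR le_rfl hY1 hY2 hY3 hY
    refine ⟨ε, hε, V, hV.mem_nhds hxV, fun z hz ↦ ⟨_, ?_, fun t ht ↦
      (hφ z hz t ht).2.2.hasMFDerivWithinAt⟩⟩
    change ((A.chart (A.idx x)).extend (𝓡∂ 4)).symm (φ 0 _) = z
    rw [h0]
    exact OpenPartialHomeomorph.extend_left_inv _ (hVs hz)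
  choose ε hε V hV hγ using hloc
  obtain ⟨t, -, ht⟩ := isCompact_univ.elim_nhds_subcover V (fun x _ ↦ hV x)
  have hcov : ∀ z : M, ∃ x ∈ t, z ∈ V x := fun z ↦ by simpa using ht (mem_univ z)
  have hne : t.Nonempty := by obtain ⟨y, hy, -⟩ := hcov x; exact ⟨y, hy⟩
  refine LocallyUniqueIntegralCurves.exists_isMIntegralCurve_of_isMIntegralCurveOn
    (hH.locallyUnique A hk) (ε := t.inf' hne ε) ((Finset.lt_inf'_iff hne).2 fun y _ ↦ hε y)
    (fun z ↦ ?_) x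
  obtain ⟨y, hy, hzy⟩ := hcov z
  obtain ⟨γ, h1, h2⟩ := hγ y z hzy
  have := Finset.inf'_le ε hy
  exact ⟨γ, h1, h2.mono (Ioo_subset_Ioo (by linarith) this)⟩

theorem IsHamiltonian.hamFlow_spec (A : DarbouxAtlas Ω) (hH : IsHamiltonian k H) (hk : 2 ≤ k)
    (x : M) : hamFlow Ω H 0 x = x ∧ IsMIntegralCurve (fun t ↦ hamFlow Ω H t x) (hamVF Ω H) := by
  have hex := hH.exists_integralCurve A hk x
  have : (fun t ↦ hamFlow Ω H t x) = hex.choose := by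
    funext t
    simp only [hamFlow, flowOf]
    rw [dif_pos hex]
  rw [this]
  exact ⟨(congrFun this 0).trans hex.choose_spec.1, hex.choose_spec.2⟩

theorem IsHamiltonian.hamFlow_zero (A : DarbouxAtlas Ω) (hH : IsHamiltonian k H) (hk : 2 ≤ k)
    (x : M) : hamFlow Ω H 0 x = x := (hH.hamFlow_spec A hk x).1

theorem IsHamiltonian.isMIntegralCurve_hamFlow (A : DarbouxAtlas Ω) (hH : IsHamiltonian k H)
    (hk : 2 ≤ k) (x : M) : IsMIntegralCurve (fun t ↦ hamFlow Ω H t x) (hamVF Ω H) :=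
  (hH.hamFlow_spec A hk x).2

theorem IsHamiltonian.eq_hamFlow_of_Ioo (A : DarbouxAtlas Ω) (hH : IsHamiltonian k H) (hk : 2 ≤ k)
    {γ : ℝ → M} {a b t : ℝ} (hγ : IsMIntegralCurveOn γ (hamVF Ω H) (Ioo a b))
    (h0 : (0 : ℝ) ∈ Ioo a b) (ht : t ∈ Ioo a b) : γ t = hamFlow Ω H t (γ 0) :=
  (hH.locallyUnique A hk).eqOn_Ioo h0 hγ
    ((hH.isMIntegralCurve_hamFlow A hk (γ 0)).isMIntegralCurveOn _)
    (hH.hamFlow_zero A hk (γ 0)).symm ht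

theorem IsHamiltonian.hamFlow_add (A : DarbouxAtlas Ω) (hH : IsHamiltonian k H) (hk : 2 ≤ k)
    (t s : ℝ) (x : M) : hamFlow Ω H (t + s) x = hamFlow Ω H t (hamFlow Ω H s x) := by
  have h1 := (hH.isMIntegralCurve_hamFlow A hk x).comp_add s
  have h2 := hH.eq_hamFlow_of_Ioo A hk (a := -(|t| + 1)) (b := |t| + 1) (t := t)
    (h1.isMIntegralCurveOn _) ⟨by linarith [abs_nonneg t], by linarith [abs_nonneg t]⟩
    ⟨by linarith [neg_abs_le t], by linarith [le_abs_self t]⟩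
  simpa using h2

theorem IsHamiltonian.hamFlow_neg_hamFlow (A : DarbouxAtlas Ω) (hH : IsHamiltonian k H)
    (hk : 2 ≤ k) (t : ℝ) (x : M) : hamFlow Ω H (-t) (hamFlow Ω H t x) = x := by
  rw [← hH.hamFlow_add A hk, neg_add_cancel, hH.hamFlow_zero A hk]

/-- The flow read in a chart: smoothness for small times near a point. -/
theorem IsHamiltonian.contMDiffOn_hamFlow_of_chart (A : DarbouxAtlas Ω) (hH : IsHamiltonian k H)
    (hk : 2 ≤ k) (hh : IsDarbouxChart Ω h) {x : M} (hx : x ∈ h.source) {R : ℝ} (hR : 0 < R)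
    {Y : E4 → E4} {n : ℕ∞} (hn : 1 ≤ n) (hY : ContDiff ℝ n Y) (hYs : HasCompactSupport Y)
    (htan : ∀ z, z 0 = 0 → Y z 0 = 0)
    (hYX : ∀ z ∈ ball (h.extend (𝓡∂ 4) x) R, 0 ≤ z 0 →
      z ∈ (h.extend (𝓡∂ 4)).target ∧ Y z = chartVF Ω h H z) :
    ∃ ε > 0, ∃ V, IsOpen V ∧ x ∈ V ∧ ContMDiffOn (𝓘(ℝ, ℝ).prod (𝓡∂ 4)) (𝓡∂ 4) n
      (fun p : ℝ × M ↦ hamFlow Ω H p.1 p.2) (Ioo (-ε) ε ×ˢ V) := by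
  obtain ⟨φ, hφn, h0, -, ε, hε, V, hV, hxV, hVs, hφ⟩ :=
    exists_chart_flow hh hx hR hn hY hYs htan hYX
  refine ⟨ε, hε, V, hV, hxV, ?_⟩
  have heq : ∀ p ∈ Ioo (-ε) ε ×ˢ V, hamFlow Ω H p.1 p.2 =
      (h.extend (𝓡∂ 4)).symm (φ p.1 (h.extend (𝓡∂ 4) p.2)) := by
    rintro ⟨t, z⟩ ⟨ht, hz⟩
    have h1 := hH.eq_hamFlow_of_Ioo A hk (fun t ht ↦ (hφ z hz t ht).2.2.hasMFDerivWithinAt)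
      ⟨by linarith, hε⟩ ht
    rw [h0, h.extend_left_inv (hVs hz)] at h1
    exact h1.symm
  refine ContMDiffOn.congr ?_ heq
  have hn' : (n : WithTop ℕ∞) ≤ ∞ := by exact_mod_cast le_top
  have c1 := (contMDiffOn_extend_symm hh.mem).of_le hn'
  rw [← h.extend_target'] at c1
  have c2 : ContMDiffOn (𝓘(ℝ, ℝ).prod (𝓡∂ 4)) 𝓘(ℝ, E4) n
      (fun p : ℝ × M ↦ φ p.1 (h.extend (𝓡∂ 4) p.2)) (Ioo (-ε) ε ×ˢ V) := by
    have e1 : ContMDiffOn (𝓘(ℝ, ℝ).prod (𝓡∂ 4)) 𝓘(ℝ, E4) n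
        (fun p : ℝ × M ↦ h.extend (𝓡∂ 4) p.2) (Ioo (-ε) ε ×ˢ V) :=
      fun p hp ↦ ((h.contMDiffAt_extend hh.mem (hVs hp.2)).of_le hn').comp_contMDiffWithinAt p
        contMDiffWithinAt_snd
    exact (hφn.contMDiff (n := n)).comp_contMDiffOn (contMDiffOn_fst.prodMk_space e1)
  exact c1.comp c2 fun p hp ↦ (hφ p.2 hp.2 p.1 hp.1).2.1

/-- If the flow is `C^n` for small times near each point of an invariant set, it is so for all
times. -/
theorem IsHamiltonian.contMDiffOn_hamFlow_of_local (A : DarbouxAtlas Ω) (hH : IsHamiltonian k H)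
    (hk : 2 ≤ k) {n : WithTop ℕ∞} {S : Set M} (hS : ∀ t, ∀ x ∈ S, hamFlow Ω H t x ∈ S)
    (hloc : ∀ x ∈ S, ∃ ε > 0, ∃ V, IsOpen V ∧ x ∈ V ∧ ContMDiffOn (𝓘(ℝ, ℝ).prod (𝓡∂ 4)) (𝓡∂ 4) n
      (fun p : ℝ × M ↦ hamFlow Ω H p.1 p.2) (Ioo (-ε) ε ×ˢ V)) (t : ℝ) {x : M} (hx : x ∈ S) :
    ∃ ε > 0, ∃ V, IsOpen V ∧ x ∈ V ∧ ContMDiffOn (𝓘(ℝ, ℝ).prod (𝓡∂ 4)) (𝓡∂ 4) n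
      (fun p : ℝ × M ↦ hamFlow Ω H p.1 p.2) (Ioo (t - ε) (t + ε) ×ˢ V) := by
  set T : Set ℝ := {t | ∃ ε > 0, ∃ V, IsOpen V ∧ x ∈ V ∧
    ContMDiffOn (𝓘(ℝ, ℝ).prod (𝓡∂ 4)) (𝓡∂ 4) n
      (fun p : ℝ × M ↦ hamFlow Ω H p.1 p.2) (Ioo (t - ε) (t + ε) ×ˢ V)} with hT
  have hTo : IsOpen T := by
    rw [Metric.isOpen_iff]
    rintro t ⟨ε, hε, V, hV, hxV, hc⟩
    refine ⟨ε / 2, half_pos hε, fun t' ht' ↦ ⟨ε / 2, half_pos hε, V, hV, hxV, hc.mono ?_⟩⟩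
    rw [Real.ball_eq_Ioo] at ht'
    exact prod_mono (Ioo_subset_Ioo (by linarith [ht'.1]) (by linarith [ht'.2])) subset_rfl
  have hTc : IsClosed T := by
    refine isClosed_of_closure_subset fun t ht ↦ ?_
    obtain ⟨ε, hε, V, hV, hzV, hc⟩ := hloc (hamFlow Ω H t x) (hS t x hx)
    have hcont : Continuous fun t ↦ hamFlow Ω H t x :=
      (hH.isMIntegralCurve_hamFlow A hk x).continuous
    have hnb : (fun t ↦ hamFlow Ω H t x) ⁻¹' V ∩ Ioo (t - ε / 2) (t + ε / 2) ∈ 𝓝 t :=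
      inter_mem (hcont.continuousAt (hV.mem_nhds hzV)) (Ioo_mem_nhds (by linarith) (by linarith))
    obtain ⟨t', ht', hTt'⟩ := mem_closure_iff_nhds.1 ht _ hnb
    obtain ⟨ε', hε', V', hV', hxV', hc'⟩ := hTt'
    have hsl : ContMDiffOn (𝓡∂ 4) (𝓡∂ 4) n (fun z ↦ hamFlow Ω H t' z) V' :=
      hc'.comp (contMDiff_const.prodMk contMDiff_id : ContMDiff (𝓡∂ 4) (𝓘(ℝ, ℝ).prod (𝓡∂ 4)) n
        fun z : M ↦ (t', z)).contMDiffOn fun z hz ↦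
        ⟨⟨by linarith [hε'], by linarith [hε']⟩, hz⟩
    refine ⟨ε / 2, half_pos hε, V' ∩ (fun z ↦ hamFlow Ω H t' z) ⁻¹' V,
      hsl.continuousOn.isOpen_inter_preimage hV' hV, ⟨hxV', ht'.1⟩, ?_⟩
    have heq : ∀ p : ℝ × M, hamFlow Ω H p.1 p.2 =
        hamFlow Ω H (p.1 - t') (hamFlow Ω H t' p.2) := fun p ↦ by
      rw [← hH.hamFlow_add A hk, sub_add_cancel]
    refine ContMDiffOn.congr ?_ fun p _ ↦ heq p
    have e1 : ContMDiffOn (𝓘(ℝ, ℝ).prod (𝓡∂ 4)) (𝓘(ℝ, ℝ).prod (𝓡∂ 4)) n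
        (fun p : ℝ × M ↦ (p.1 - t', hamFlow Ω H t' p.2))
        (Ioo (t - ε / 2) (t + ε / 2) ×ˢ (V' ∩ (fun z ↦ hamFlow Ω H t' z) ⁻¹' V)) := by
      refine ContMDiffOn.prodMk ?_ (hsl.comp contMDiffOn_snd fun p hp ↦ hp.2.1)
      exact ((contDiff_id.sub contDiff_const).contMDiff (n := n)).comp_contMDiffOn
        (f := fun p : ℝ × M ↦ p.1) contMDiffOn_fst
    exact hc.comp e1 fun p hp ↦ ⟨⟨by linarith [hp.1.1, ht'.2.2], by linarith [hp.1.2, ht'.2.1]⟩,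
      hp.2.2⟩
  have h0 : (0 : ℝ) ∈ T := by
    obtain ⟨ε, hε, V, hV, hxV, hc⟩ := hloc x hx
    exact ⟨ε, hε, V, hV, hxV, by simpa using hc⟩
  have := IsClopen.eq_univ ⟨hTc, hTo⟩ ⟨0, h0⟩
  exact (eq_univ_iff_forall.1 this) t

theorem IsHamiltonian.contMDiff_hamFlow (A : DarbouxAtlas Ω) (hH : IsHamiltonian k H)
    (hk : 2 ≤ k) : ContMDiff (𝓘(ℝ, ℝ).prod (𝓡∂ 4)) (𝓡∂ 4) 1
      (fun p : ℝ × M ↦ hamFlow Ω H p.1 p.2) := by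
  rintro ⟨t, x⟩
  obtain ⟨ε, hε, V, hV, hxV, hc⟩ := hH.contMDiffOn_hamFlow_of_local A hk (S := univ) (n := 1)
    (fun _ _ _ ↦ mem_univ _) (fun x _ ↦ by
      obtain ⟨R, hR, Y, hY1, hY2, hY3, hY⟩ :=
        hH.exists_chartVF_extension hk (A.isDarbouxChart (A.idx x))
          (extend_mem_target _ (A.mem_source x))
      exact hH.contMDiffOn_hamFlow_of_chart A hk (A.isDarbouxChart (A.idx x)) (A.mem_source x)
        (n := 1) hR le_rfl hY1 hY2 hY3 hY) t (mem_univ x)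
  exact hc.contMDiffAt ((isOpen_Ioo.prod hV).mem_nhds ⟨⟨by linarith, by linarith⟩, hxV⟩)

theorem IsHamiltonian.continuous_hamFlow (A : DarbouxAtlas Ω) (hH : IsHamiltonian k H)
    (hk : 2 ≤ k) : Continuous (fun p : ℝ × M ↦ hamFlow Ω H p.1 p.2) :=
  (hH.contMDiff_hamFlow A hk).continuous

theorem IsHamiltonian.contMDiff_hamFlow_right (A : DarbouxAtlas Ω) (hH : IsHamiltonian k H)
    (hk : 2 ≤ k) (t : ℝ) : ContMDiff (𝓡∂ 4) (𝓡∂ 4) 1 (hamFlow Ω H t) :=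
  (hH.contMDiff_hamFlow A hk).comp (contMDiff_const.prodMk contMDiff_id)

theorem IsHamiltonian.mdifferentiableAt_hamFlow (A : DarbouxAtlas Ω) (hH : IsHamiltonian k H)
    (hk : 2 ≤ k) (t : ℝ) (x : M) : MDifferentiableAt (𝓡∂ 4) (𝓡∂ 4) (hamFlow Ω H t) x :=
  (hH.contMDiff_hamFlow_right A hk t x).mdifferentiableAt (by simp)

theorem IsHamiltonian.mfderiv_hamFlow_comp_neg (A : DarbouxAtlas Ω) (hH : IsHamiltonian k H)
    (hk : 2 ≤ k) (t : ℝ) (x : M) (v : TangentSpace (𝓡∂ 4) x) :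
    mfderiv (𝓡∂ 4) (𝓡∂ 4) (hamFlow Ω H (-t)) (hamFlow Ω H t x)
      (mfderiv (𝓡∂ 4) (𝓡∂ 4) (hamFlow Ω H t) x v) = v := by
  have h1 := (hH.mdifferentiableAt_hamFlow A hk (-t) (hamFlow Ω H t x)).hasMFDerivAt.comp x
    (hH.mdifferentiableAt_hamFlow A hk t x).hasMFDerivAt
  have h2 : hamFlow Ω H (-t) ∘ hamFlow Ω H t = id :=
    funext fun x ↦ hH.hamFlow_neg_hamFlow A hk t x
  rw [h2] at h1
  exact congrArg (fun L ↦ L v) (hasMFDerivAt_unique h1 (hasMFDerivAt_id x))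

theorem IsHamiltonian.isInteriorPoint_hamFlow (A : DarbouxAtlas Ω) (hH : IsHamiltonian k H)
    (hk : 2 ≤ k) (t : ℝ) {x : M} (hx : (𝓡∂ 4).IsInteriorPoint x) :
    (𝓡∂ 4).IsInteriorPoint (hamFlow Ω H t x) := by
  refine (hH.mdifferentiableAt_hamFlow A hk t x).isInteriorPoint_of_surjective_mfderiv
    (fun w ↦ ?_) hx
  have h1 := hH.mfderiv_hamFlow_comp_neg A hk (-t) (hamFlow Ω H t x)
  have key : ∀ z, z = x → ∀ w : TangentSpace (𝓡∂ 4) (hamFlow Ω H t x),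
      (∃ u : TangentSpace (𝓡∂ 4) z, (mfderiv (𝓡∂ 4) (𝓡∂ 4) (hamFlow Ω H t) z u : E4) = w) →
      ∃ u, mfderiv (𝓡∂ 4) (𝓡∂ 4) (hamFlow Ω H t) x u = w := by
    rintro z rfl w hw; exact hw
  refine key _ (hH.hamFlow_neg_hamFlow A hk t x) w
    ⟨mfderiv (𝓡∂ 4) (𝓡∂ 4) (hamFlow Ω H (-t)) (hamFlow Ω H t x) w, ?_⟩
  rw [neg_neg] at h1
  exact h1 w

/-- At interior points the flow of a `C^{n+1}` Hamiltonian is of class `C^n`. -/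
theorem IsHamiltonian.exists_contMDiffOn_hamFlow (A : DarbouxAtlas Ω) {n : ℕ∞} (hn : 1 ≤ n)
    (hH : IsHamiltonian (n + 1) H) (t : ℝ) {x : M} (hx : (𝓡∂ 4).IsInteriorPoint x) :
    ∃ ε > 0, ∃ V, IsOpen V ∧ x ∈ V ∧ ContMDiffOn (𝓘(ℝ, ℝ).prod (𝓡∂ 4)) (𝓡∂ 4) n
      (fun p : ℝ × M ↦ hamFlow Ω H p.1 p.2) (Ioo (t - ε) (t + ε) ×ˢ V) := by
  have hk : 2 ≤ n + 1 := by
    rw [← one_add_one_eq_two]; exact add_le_add_left hn 1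
  refine hH.contMDiffOn_hamFlow_of_local A hk (S := {x | (𝓡∂ 4).IsInteriorPoint x})
    (fun t x hx ↦ hH.isInteriorPoint_hamFlow A hk t hx) (fun x hx ↦ ?_) t hx
  set h := A.chart (A.idx x)
  have hh : IsDarbouxChart Ω h := A.isDarbouxChart _
  have hs : x ∈ h.source := A.mem_source x
  have hpos := (isInteriorPoint_iff_chart hh.mem hs).1 hx
  obtain ⟨R, hR, hb⟩ := exists_halfBall_subset_target h (extend_mem_target h hs)
  obtain ⟨R', hR', hb'⟩ := Metric.isOpen_iff.1
    (isOpen_lt continuous_const (EuclideanSpace.proj (𝕜 := ℝ) (0 : Fin 4)).continuous :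
      IsOpen {y : E4 | (0 : ℝ) < y 0}) _ hpos
  have hρ : 0 < min R R' := lt_min hR hR'
  have hsub : ball (h.extend (𝓡∂ 4) x) (min R R') ⊆ (h.extend (𝓡∂ 4)).target := fun y hy ↦
    hb ⟨ball_subset_ball (min_le_left _ _) hy,
      le_of_lt (α := ℝ) (hb' (ball_subset_ball (min_le_right _ _) hy))⟩
  obtain ⟨Y, hY1, hY2, hY3, hY4⟩ := exists_cutoff hρ
    ((hH.contDiffOn_chartVF hh le_rfl).mono hsub)
  refine hH.contMDiffOn_hamFlow_of_chart A hk hh hs (half_pos hρ) hn hY1 hY2 (fun z hz ↦ ?_)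
    (fun z hz _ ↦ ⟨hsub (ball_subset_ball (by linarith) hz), hY3 hz⟩)
  obtain ⟨k, hk1, hk2⟩ := hY4 z
  by_cases hk0 : k = 0
  · simp [hk1, hk0]
  · have : 0 < z 0 := hb' (ball_subset_ball (min_le_right _ _) (hk2 hk0))
    exact absurd hz this.ne'

end HamiltonianFlow

section TangentFlow

variable {M : Type*} [TopologicalSpace M] [ChartedSpace (EuclideanHalfSpace 4) M]

theorem extend_target_subset_closure_interior
    (h : OpenPartialHomeomorph M (EuclideanHalfSpace 4)) :
    (h.extend (𝓡∂ 4)).target ⊆ closure (interior (h.extend (𝓡∂ 4)).target) := by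
  have hO : IsOpen ((𝓡∂ 4).symm ⁻¹' h.target) := h.open_target.preimage (𝓡∂ 4).continuous_symm
  rw [h.extend_target, interior_inter, hO.interior_eq]
  exact fun y hy ↦ hO.inter_closure ⟨hy.1, (𝓡∂ 4).range_subset_closure_interior hy.2⟩

variable [IsManifold (𝓡∂ 4) ∞ M] {Ω : SymplecticForm M}
  {h h' : OpenPartialHomeomorph M (EuclideanHalfSpace 4)} {H : M → ℝ} {k : ℕ∞}

/-- The derivative of a Hamiltonian vector field is infinitesimally symplectic. -/
theorem IsHamiltonian.stdForm_fderivWithin_chartVF (hH : IsHamiltonian k H) (hk : 2 ≤ k)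
    (hh : IsDarbouxChart Ω h) {y : E4} (hy : y ∈ (h.extend (𝓡∂ 4)).target) (u w : E4) :
    stdForm (fderivWithin ℝ (chartVF Ω h H) (h.extend (𝓡∂ 4)).target y u) w +
      stdForm u (fderivWithin ℝ (chartVF Ω h H) (h.extend (𝓡∂ 4)).target y w) = 0 := by
  have hu := uniqueDiffOn_extend_target h
  have hc := (hH.contDiffOn_chart hh).of_le (show ((2 : ℕ∞) : WithTop ℕ∞) ≤ k from WithTop.coe_le_coe.2 hk)
  have hsym := (hc y hy).isSymmSndFDerivWithinAt (by simp) hu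
    (extend_target_subset_closure_interior h hy) hy
  set f := H ∘ (h.extend (𝓡∂ 4)).symm with hf
  have hd : DifferentiableWithinAt ℝ (fderivWithin ℝ f (h.extend (𝓡∂ 4)).target)
      (h.extend (𝓡∂ 4)).target y :=
    ((hc y hy).fderivWithin_right (m := 1) hu (by norm_num [one_add_one_eq_two]) hy).differentiableWithinAt
      (by simp)
  have h1 : HasFDerivWithinAt (chartVF Ω h H)
      (stdSharp ∘L fderivWithin ℝ (fderivWithin ℝ f (h.extend (𝓡∂ 4)).target)
        (h.extend (𝓡∂ 4)).target y) (h.extend (𝓡∂ 4)).target y :=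
    (stdSharp.hasFDerivAt.comp_hasFDerivWithinAt y hd.hasFDerivWithinAt).congr
      (fun z hz ↦ chartVF_eq hh hz (hH.mdifferentiableAt (le_trans (by simp) hk) _))
      (chartVF_eq hh hy (hH.mdifferentiableAt (le_trans (by simp) hk) _))
  rw [h1.fderivWithin (hu y hy)]
  have h2 : ∀ a b, stdForm a b = - stdForm b a := fun a b ↦ by simp [stdForm]; ring
  rw [h2 u]
  simp only [ContinuousLinearMap.comp_apply, stdForm_stdSharp]
  rw [hsym u w]
  ring

variable [CompactSpace M] [T2Space M]

theorem IsHamiltonian.hasMFDerivAt_hamFlow (A : DarbouxAtlas Ω) (hH : IsHamiltonian k H)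
    (hk : 2 ≤ k) (t : ℝ) (x : M) : HasMFDerivAt (𝓡∂ 4) (𝓡∂ 4) (hamFlow Ω H t) x
      (mfderiv (𝓡∂ 4) (𝓡∂ 4) (hamFlow Ω H t) x) :=
  (hH.mdifferentiableAt_hamFlow A hk t x).hasMFDerivAt

theorem IsHamiltonian.mfderiv_hamFlow_hamVF (A : DarbouxAtlas Ω) (hH : IsHamiltonian k H)
    (hk : 2 ≤ k) (t : ℝ) (x : M) :
    mfderiv (𝓡∂ 4) (𝓡∂ 4) (hamFlow Ω H t) x (hamVF Ω H x) = hamVF Ω H (hamFlow Ω H t x) := by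
  have h0 := hH.isMIntegralCurve_hamFlow A hk x 0
  have h1 := hH.hasMFDerivAt_hamFlow A hk t x
  have key : ∀ z, z = x → HasMFDerivAt 𝓘(ℝ, ℝ) (𝓡∂ 4) (fun s ↦ hamFlow Ω H s x) 0
      ((1 : ℝ →L[ℝ] ℝ).smulRight (hamVF Ω H z) : ℝ →L[ℝ] E4) →
      HasMFDerivAt 𝓘(ℝ, ℝ) (𝓡∂ 4) (fun s ↦ hamFlow Ω H t (hamFlow Ω H s x)) 0
        (((mfderiv (𝓡∂ 4) (𝓡∂ 4) (hamFlow Ω H t) z : E4 →L[ℝ] E4)).comp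
          ((1 : ℝ →L[ℝ] ℝ).smulRight (hamVF Ω H z) : ℝ →L[ℝ] E4)) := by
    rintro z rfl hz
    refine HasMFDerivAt.comp (f := fun s ↦ hamFlow Ω H s z) (g := hamFlow Ω H t) 0 ?_ hz
    have := hH.hasMFDerivAt_hamFlow A hk t (hamFlow Ω H 0 z)
    rwa [hH.hamFlow_zero A hk] at this ⊢
  have hz := hH.hamFlow_zero A hk x
  have h2 : HasMFDerivAt 𝓘(ℝ, ℝ) (𝓡∂ 4) (fun s ↦ hamFlow Ω H s x) 0
      ((1 : ℝ →L[ℝ] ℝ).smulRight (hamVF Ω H x) : ℝ →L[ℝ] E4) := by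
    refine h0.congr_mfderiv ?_
    have aux : ∀ z, z = x → ((1 : ℝ →L[ℝ] ℝ).smulRight (hamVF Ω H z) : ℝ →L[ℝ] E4) =
      ((1 : ℝ →L[ℝ] ℝ).smulRight (hamVF Ω H x) : ℝ →L[ℝ] E4) := by rintro z rfl; rfl
    exact aux _ hz
  have h3 := key x rfl h2
  have h4 := hH.isMIntegralCurve_hamFlow A hk (hamFlow Ω H t x) 0
  have h5 : (fun s ↦ hamFlow Ω H t (hamFlow Ω H s x)) =
      fun s ↦ hamFlow Ω H s (hamFlow Ω H t x) := by
    funext s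
    rw [← hH.hamFlow_add A hk, ← hH.hamFlow_add A hk, add_comm]
  rw [h5] at h3
  have h6 : (hamFlow Ω H 0 (hamFlow Ω H t x)) = hamFlow Ω H t x := hH.hamFlow_zero A hk _
  have aux : ∀ z, z = hamFlow Ω H t x → ((1 : ℝ →L[ℝ] ℝ).smulRight (hamVF Ω H z) : ℝ →L[ℝ] E4) =
      ((1 : ℝ →L[ℝ] ℝ).smulRight (hamVF Ω H (hamFlow Ω H t x)) : ℝ →L[ℝ] E4) := by
    rintro z rfl; rfl
  have h7 := (hasMFDerivAt_unique h3 h4).trans (aux _ h6)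
  have h8 := congrArg (fun L : ℝ →L[ℝ] E4 ↦ L 1) h7
  have h9 : (mfderiv (𝓡∂ 4) (𝓡∂ 4) (hamFlow Ω H t) x : E4 →L[ℝ] E4) ((1 : ℝ) • (hamVF Ω H x : E4)) =
      (1 : ℝ) • (hamVF Ω H (hamFlow Ω H t x) : E4) := h8
  rw [one_smul, one_smul] at h9
  exact h9

theorem form_self (x : M) (v : TangentSpace (𝓡∂ 4) x) : Ω.form x v v = 0 := Ω.alternating x v

theorem IsHamiltonian.hamFlow_energy (A : DarbouxAtlas Ω) (hH : IsHamiltonian k H)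
    (hk : 2 ≤ k) (t : ℝ) (x : M) : H (hamFlow Ω H t x) = H x := by
  have h1 : ∀ t, HasDerivAt (fun t ↦ H (hamFlow Ω H t x)) 0 t := by
    intro t
    have h2 := (hH.mdifferentiableAt (le_trans (by simp) hk) (hamFlow Ω H t x)).hasMFDerivAt.comp t
      (hH.isMIntegralCurve_hamFlow A hk x t)
    have h3 : HasFDerivAt (fun t ↦ H (hamFlow Ω H t x)) (0 : ℝ →L[ℝ] ℝ) t := by
      refine h2.hasFDerivAt.congr_fderiv ?_
      ext
      have h4 := form_hamVF Ω H (hamFlow Ω H t x) (hamVF Ω H (hamFlow Ω H t x))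
      rw [form_self] at h4
      have h5 : (mfderiv (𝓡∂ 4) 𝓘(ℝ) H (hamFlow Ω H t x) : E4 →L[ℝ] ℝ)
          ((1 : ℝ) • (hamVF Ω H (hamFlow Ω H t x) : E4)) = 0 := by
        rw [one_smul]; exact h4.symm
      exact h5
    simpa using! h3.hasDerivAt
  have h2 := is_const_of_deriv_eq_zero (fun t ↦ (h1 t).differentiableAt) (fun t ↦ (h1 t).deriv) t 0
  rwa [hH.hamFlow_zero A hk] at h2

theorem IsHamiltonian.dHam_mfderiv_hamFlow (A : DarbouxAtlas Ω) (hH : IsHamiltonian k H)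
    (hk : 2 ≤ k) (t : ℝ) (x : M) (v : TangentSpace (𝓡∂ 4) x) :
    dHam H (hamFlow Ω H t x) (mfderiv (𝓡∂ 4) (𝓡∂ 4) (hamFlow Ω H t) x v) = dHam H x v := by
  have h1 : 1 ≤ k := le_trans (by simp) hk
  have h2 := (hH.mdifferentiableAt h1 (hamFlow Ω H t x)).hasMFDerivAt.comp x
    (hH.hasMFDerivAt_hamFlow A hk t x)
  have h3 : H ∘ hamFlow Ω H t = H := funext fun z ↦ hH.hamFlow_energy A hk t z
  rw [h3] at h2
  exact congrArg (fun L ↦ L v) (hasMFDerivAt_unique h2 (hH.mdifferentiableAt h1 x).hasMFDerivAt)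

/-- For small times the tangent flow read in a chart is the derivative of a flow on `ℝ⁴`. -/
theorem IsHamiltonian.form_mfderiv_hamFlow_local (A : DarbouxAtlas Ω) (hH : IsHamiltonian k H)
    (hk : 2 ≤ k) (x : M) (v w : TangentSpace (𝓡∂ 4) x) : ∃ ε > 0, ∀ t ∈ Ioo (-ε) ε,
      Ω.form (hamFlow Ω H t x) (mfderiv (𝓡∂ 4) (𝓡∂ 4) (hamFlow Ω H t) x v)
        (mfderiv (𝓡∂ 4) (𝓡∂ 4) (hamFlow Ω H t) x w) = Ω.form x v w := by
  set h := A.chart (A.idx x)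
  have hh : IsDarbouxChart Ω h := A.isDarbouxChart _
  have hx : x ∈ h.source := A.mem_source x
  obtain ⟨R, hR, Y, hY1, hY2, hY3, hY⟩ := hH.exists_chartVF_extension hk hh (extend_mem_target h hx)
  obtain ⟨φ, hφ1, h0, hφ, ε, hε, V, hV, hxV, hVs, hflow⟩ :=
    exists_chart_flow (n := 1) hh hx hR le_rfl hY1 hY2 hY3 hY
  refine ⟨ε, hε, ?_⟩
  have heq : ∀ z ∈ V, ∀ t ∈ Ioo (-ε) ε, hamFlow Ω H t z =
      (h.extend (𝓡∂ 4)).symm (φ t (h.extend (𝓡∂ 4) z)) := by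
    intro z hz t ht
    have h1 := hH.eq_hamFlow_of_Ioo A hk (fun t ht ↦ (hflow z hz t ht).2.2.hasMFDerivWithinAt)
      ⟨by linarith, hε⟩ ht
    rw [h0, h.extend_left_inv (hVs hz)] at h1
    exact h1.symm
  have hsrc : ∀ t ∈ Ioo (-ε) ε, hamFlow Ω H t x ∈ h.source := fun t ht ↦ by
    rw [heq x hxV t ht]; exact extend_symm_mem_source h (hflow x hxV t ht).2.1
  have hval : ∀ z ∈ V, ∀ t ∈ Ioo (-ε) ε, h.extend (𝓡∂ 4) (hamFlow Ω H t z) =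
      φ t (h.extend (𝓡∂ 4) z) := fun z hz t ht ↦ by
    rw [heq z hz t ht, (h.extend (𝓡∂ 4)).right_inv (hflow z hz t ht).2.1]
  have hder : ∀ t ∈ Ioo (-ε) ε, ∀ u : TangentSpace (𝓡∂ 4) x,
      chartD h (hamFlow Ω H t x) (mfderiv (𝓡∂ 4) (𝓡∂ 4) (hamFlow Ω H t) x u) =
        fderiv ℝ (φ t) (h.extend (𝓡∂ 4) x) (chartD h x u) := by
    intro t ht u
    have h1 := (hasMFDerivAt_extend hh.mem (hsrc t ht)).comp x (hH.hasMFDerivAt_hamFlow A hk t x)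
    have hφt : HasMFDerivAt 𝓘(ℝ, E4) 𝓘(ℝ, E4) (φ t) (h.extend (𝓡∂ 4) x)
        (fderiv ℝ (φ t) (h.extend (𝓡∂ 4) x)) := by
      refine hasMFDerivAt_iff_hasFDerivAt.2 (DifferentiableAt.hasFDerivAt ?_)
      have : ContDiff ℝ 1 (φ t) := hφ1.comp (contDiff_const.prodMk contDiff_id)
      exact this.differentiable (by simp) _
    have h2 := hφt.comp x (hasMFDerivAt_extend hh.mem hx)
    have h3 := h2.congr_of_eventuallyEq (f₁ := h.extend (𝓡∂ 4) ∘ hamFlow Ω H t) (by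
      filter_upwards [hV.mem_nhds hxV] with z hz using hval z hz t ht)
    exact congrArg (fun L ↦ L u) (hasMFDerivAt_unique h1 h3)
  have hcalc : ∀ t ∈ Ioo (-ε) ε, HasDerivAt (fun t ↦
      stdFormL (fderiv ℝ (φ t) (h.extend (𝓡∂ 4) x) (chartD h x v))
        (fderiv ℝ (φ t) (h.extend (𝓡∂ 4) x) (chartD h x w))) 0 t := by
    intro t ht
    have h1 := hasDerivAt_fderiv_flow hY1 hφ1 h0 hφ t (h.extend (𝓡∂ 4) x)
    have h2 := fun a : E4 ↦ h1.clm_apply (hasDerivAt_const t a)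
    have h3 := (stdFormL.hasFDerivAt.comp_hasDerivAt t (h2 (chartD h x v))).clm_apply
      (h2 (chartD h x w))
    refine h3.congr_deriv ?_
    set p := φ t (h.extend (𝓡∂ 4) x) with hp
    have hpT := (hflow x hxV t ht).2.1
    have hDY : fderiv ℝ Y p = fderivWithin ℝ (chartVF Ω h H) (h.extend (𝓡∂ 4)).target p := by
      have e1 : HasFDerivWithinAt Y (fderiv ℝ Y p) (h.extend (𝓡∂ 4)).target p :=
        (hY1.differentiable (by simp) p).hasFDerivAt.hasFDerivWithinAt
      have e2 : HasFDerivWithinAt (chartVF Ω h H) (fderiv ℝ Y p) (h.extend (𝓡∂ 4)).target p := by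
        refine e1.congr_of_eventuallyEq ?_ ?_
        · filter_upwards [self_mem_nhdsWithin, mem_nhdsWithin_of_mem_nhds
            (isOpen_ball.mem_nhds (hflow x hxV t ht).1)] with z hz1 hz2
          exact ((hY z hz2 (extend_target_nonneg h hz1)).2).symm
        · exact ((hY p (hflow x hxV t ht).1 (extend_target_nonneg h hpT)).2).symm
      exact (e2.fderivWithin (uniqueDiffOn_extend_target h p hpT)).symm
    have h4 := hH.stdForm_fderivWithin_chartVF hk hh hpT
      (fderiv ℝ (φ t) (h.extend (𝓡∂ 4) x) (chartD h x v))
      (fderiv ℝ (φ t) (h.extend (𝓡∂ 4) x) (chartD h x w))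
    rw [← hDY, ← stdFormL_apply, ← stdFormL_apply] at h4
    simpa using h4
  intro t ht
  have h00 : (0 : ℝ) ∈ Ioo (-ε) ε := ⟨by linarith, hε⟩
  have hconst := (convex_Ioo (-ε) ε).is_const_of_fderivWithin_eq_zero (𝕜 := ℝ) (f := fun t ↦
      stdFormL (fderiv ℝ (φ t) (h.extend (𝓡∂ 4) x) (chartD h x v))
        (fderiv ℝ (φ t) (h.extend (𝓡∂ 4) x) (chartD h x w)))
    (fun t ht ↦ (hcalc t ht).differentiableAt.differentiableWithinAt)
    (fun t ht ↦ by
      rw [fderivWithin_of_isOpen isOpen_Ioo ht]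
      ext; simpa using (hcalc t ht).deriv) ht h00
  rw [hh.form_eq _ (hsrc t ht), hder t ht, hder t ht, hh.form_eq x hx, ← stdFormL_apply,
    ← stdFormL_apply]
  refine hconst.trans ?_
  have : φ 0 = id := funext h0
  simp [this]

theorem IsHamiltonian.mfderiv_hamFlow_add (A : DarbouxAtlas Ω) (hH : IsHamiltonian k H)
    (hk : 2 ≤ k) (t s : ℝ) (x : M) (v : TangentSpace (𝓡∂ 4) x) :
    (mfderiv (𝓡∂ 4) (𝓡∂ 4) (hamFlow Ω H (t + s)) x v : E4) =
      mfderiv (𝓡∂ 4) (𝓡∂ 4) (hamFlow Ω H t) (hamFlow Ω H s x)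
        (mfderiv (𝓡∂ 4) (𝓡∂ 4) (hamFlow Ω H s) x v) := by
  have h1 := (hH.hasMFDerivAt_hamFlow A hk t (hamFlow Ω H s x)).comp x
    (hH.hasMFDerivAt_hamFlow A hk s x)
  have h2 : hamFlow Ω H t ∘ hamFlow Ω H s = hamFlow Ω H (t + s) :=
    funext fun z ↦ (hH.hamFlow_add A hk t s z).symm
  rw [h2] at h1
  exact congrArg (fun L : E4 →L[ℝ] E4 ↦ L v)
    (hasMFDerivAt_unique (hH.hasMFDerivAt_hamFlow A hk (t + s) x) h1)

theorem IsHamiltonian.form_mfderiv_hamFlow (A : DarbouxAtlas Ω) (hH : IsHamiltonian k H)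
    (hk : 2 ≤ k) (t : ℝ) (x : M) (v w : TangentSpace (𝓡∂ 4) x) :
    Ω.form (hamFlow Ω H t x) (mfderiv (𝓡∂ 4) (𝓡∂ 4) (hamFlow Ω H t) x v)
        (mfderiv (𝓡∂ 4) (𝓡∂ 4) (hamFlow Ω H t) x w) = Ω.form x v w := by
  set g : ℝ → ℝ := fun t ↦ Ω.form (hamFlow Ω H t x) (mfderiv (𝓡∂ 4) (𝓡∂ 4) (hamFlow Ω H t) x v)
        (mfderiv (𝓡∂ 4) (𝓡∂ 4) (hamFlow Ω H t) x w) with hg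
  have hloc : IsLocallyConstant g := by
    rw [IsLocallyConstant.iff_eventually_eq]
    intro s
    obtain ⟨ε, hε, h1⟩ := hH.form_mfderiv_hamFlow_local A hk (hamFlow Ω H s x)
      (mfderiv (𝓡∂ 4) (𝓡∂ 4) (hamFlow Ω H s) x v) (mfderiv (𝓡∂ 4) (𝓡∂ 4) (hamFlow Ω H s) x w)
    filter_upwards [Ioo_mem_nhds (show s - ε < s by linarith) (show s < s + ε by linarith)]
      with r hr
    refine Eq.trans ?_ (h1 (r - s) ⟨by linarith [hr.1], by linarith [hr.2]⟩)
    have hv := hH.mfderiv_hamFlow_add A hk (r - s) s x v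
    have hw := hH.mfderiv_hamFlow_add A hk (r - s) s x w
    rw [sub_add_cancel] at hv hw
    have hp : hamFlow Ω H r x = hamFlow Ω H (r - s) (hamFlow Ω H s x) := by
      rw [← hH.hamFlow_add A hk, sub_add_cancel]
    have key : ∀ (z z' : M) (a b a' b' : E4), z = z' → a = a' → b = b' →
        Ω.form z (a : TangentSpace (𝓡∂ 4) z) (b : TangentSpace (𝓡∂ 4) z) =
        Ω.form z' (a' : TangentSpace (𝓡∂ 4) z') (b' : TangentSpace (𝓡∂ 4) z') := by
      rintro z _ a b _ _ rfl rfl rfl; rfl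
    exact key _ _ _ _ _ _ hp hv hw
  have h2 := hloc.apply_eq_of_isPreconnected isPreconnected_univ (mem_univ t) (mem_univ 0)
  refine h2.trans ?_
  obtain ⟨ε, hε, h1⟩ := hH.form_mfderiv_hamFlow_local A hk x v w
  exact h1 0 ⟨by linarith, hε⟩

/-- The tangent flow read in a chart at the source and a chart at the target. -/
noncomputable def chartJac (Ω : SymplecticForm M)
    (h h' : OpenPartialHomeomorph M (EuclideanHalfSpace 4)) (H : M → ℝ) (t : ℝ) (z : M) :
    E4 →L[ℝ] E4 :=
  (chartD h' (hamFlow Ω H t z)) ∘L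
    (mfderiv (𝓡∂ 4) (𝓡∂ 4) (hamFlow Ω H t) z :
      TangentSpace (𝓡∂ 4) z →L[ℝ] TangentSpace (𝓡∂ 4) (hamFlow Ω H t z)) ∘L
    (chartD h z).inverse

theorem IsHamiltonian.continuousAt_chartJac (A : DarbouxAtlas Ω) (hH : IsHamiltonian k H)
    (hk : 2 ≤ k) (hh : h ∈ IsManifold.maximalAtlas (𝓡∂ 4) ∞ M)
    (hh' : h' ∈ IsManifold.maximalAtlas (𝓡∂ 4) ∞ M) {t : ℝ} {x : M} (hx : x ∈ h.source)
    (hx' : hamFlow Ω H t x ∈ h'.source) :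
    ContinuousAt (fun p : ℝ × M ↦ chartJac Ω h h' H p.1 p.2) (t, x) := by
  set T := (h.extend (𝓡∂ 4)).target with hT
  set G : ℝ × E4 → E4 := fun p ↦ h'.extend (𝓡∂ 4) (hamFlow Ω H p.1 ((h.extend (𝓡∂ 4)).symm p.2))
    with hG
  have hu : UniqueDiffOn ℝ ((univ : Set ℝ) ×ˢ T) :=
    uniqueDiffOn_univ.prod (uniqueDiffOn_extend_target h)
  have hGw : ∀ s z, z ∈ h.source → hamFlow Ω H s z ∈ h'.source →
      ContDiffWithinAt ℝ 1 G (univ ×ˢ T) (s, h.extend (𝓡∂ 4) z) := by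
    intro s z hz hz'
    have c1 := (contMDiffOn_extend_symm hh).of_le (show (1 : WithTop ℕ∞) ≤ ∞ by simp)
    rw [← h.extend_target'] at c1
    have c2 : ContMDiffWithinAt 𝓘(ℝ, ℝ × E4) (𝓘(ℝ, ℝ).prod (𝓡∂ 4)) 1
        (fun p : ℝ × E4 ↦ (p.1, (h.extend (𝓡∂ 4)).symm p.2)) (univ ×ˢ T) (s, h.extend (𝓡∂ 4) z) :=
      contDiff_fst.contDiffWithinAt.contMDiffWithinAt.prodMk (ContMDiffWithinAt.comp (t := T) (f := fun p : ℝ × E4 ↦ p.2)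
        (s, h.extend (𝓡∂ 4) z) (c1 _ (extend_mem_target h hz))
        contDiff_snd.contDiffWithinAt.contMDiffWithinAt
        fun p hp ↦ hp.2)
    have c3 := (hH.contMDiff_hamFlow A hk).contMDiffAt.comp_contMDiffWithinAt (s, h.extend (𝓡∂ 4) z) c2
    have hz'' : hamFlow Ω H s ((h.extend (𝓡∂ 4)).symm (h.extend (𝓡∂ 4) z)) ∈ h'.source := by
      rwa [h.extend_left_inv hz]
    have c4 := ((h'.contMDiffAt_extend hh' hz'').of_le
      (show (1 : WithTop ℕ∞) ≤ ∞ by simp)).comp_contMDiffWithinAt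
        (s, h.extend (𝓡∂ 4) z) c3
    exact c4.contDiffWithinAt
  have hformula : ∀ s z, z ∈ h.source → hamFlow Ω H s z ∈ h'.source →
      chartJac Ω h h' H s z = fderivWithin ℝ G (univ ×ˢ T) (s, h.extend (𝓡∂ 4) z) ∘L
        ContinuousLinearMap.inr ℝ ℝ E4 := by
    intro s z hz hz'
    have d1 := ((hGw s z hz hz').differentiableWithinAt (by simp)).hasFDerivWithinAt
    have d2 : HasFDerivWithinAt (fun y : E4 ↦ (s, y)) (ContinuousLinearMap.inr ℝ ℝ E4) T
        (h.extend (𝓡∂ 4) z) := (hasFDerivAt_prodMk_right s _).hasFDerivWithinAt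
    have d3 := HasFDerivWithinAt.comp (t := univ ×ˢ T) (h.extend (𝓡∂ 4) z) d1 d2
      fun y hy ↦ ⟨mem_univ _, hy⟩
    have d4 := (hasMFDerivAt_extend hh' hz').comp z (hH.hasMFDerivAt_hamFlow A hk s z)
    have d5 := d4.hasFDerivWithinAt_chart hh hz
    exact (uniqueDiffOn_extend_target h _ (extend_mem_target h hz)).eq d5 d3
  have hev : ∀ᶠ p in 𝓝 (t, x), p.2 ∈ h.source ∧ hamFlow Ω H p.1 p.2 ∈ h'.source :=
    (continuousAt_snd.eventually (h.open_source.mem_nhds hx)).and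
      ((hH.continuous_hamFlow A hk).continuousAt.eventually (h'.open_source.mem_nhds hx'))
  have hcont : ContinuousAt (fun p : ℝ × M ↦
      fderivWithin ℝ G (univ ×ˢ T) (p.1, h.extend (𝓡∂ 4) p.2) ∘L
        ContinuousLinearMap.inr ℝ ℝ E4) (t, x) := by
    have e1 := ((hGw t x hx hx').fderivWithin_right (m := 0) hu (by simp)
      ⟨mem_univ _, extend_mem_target h hx⟩).continuousWithinAt
    have e2 : Tendsto (fun p : ℝ × M ↦ (p.1, h.extend (𝓡∂ 4) p.2)) (𝓝 (t, x))
        (𝓝[univ ×ˢ T] (t, h.extend (𝓡∂ 4) x)) := by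
      refine tendsto_nhdsWithin_iff.2 ⟨?_, hev.mono fun p hp ↦
        ⟨mem_univ _, extend_mem_target h hp.1⟩⟩
      exact continuousAt_fst.prodMk
        ((h.continuousAt_extend hx).comp (x := (t, x)) continuousAt_snd)
    exact (((ContinuousLinearMap.compL ℝ E4 (ℝ × E4) E4).flip
      (ContinuousLinearMap.inr ℝ ℝ E4)).continuous.tendsto _).comp (e1.tendsto.comp e2)
  exact hcont.congr (hev.mono fun p hp ↦ (hformula p.1 p.2 hp.1 hp.2).symm)

end TangentFlow

section BilinearForms

variable {X E : Type*} [TopologicalSpace X] [NormedAddCommGroup E] [NormedSpace ℝ E]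
  {G : X → E →L[ℝ] E →L[ℝ] ℝ} {x : X}

theorem eventually_quadratic_bounds [FiniteDimensional ℝ E] [Nontrivial E] {g : X → E → ℝ}
    (hc : ∀ a, ContinuousAt (fun p : X × E ↦ g p.1 p.2) (x, a))
    (hg : ∀ z (c : ℝ) a, g z (c • a) = c ^ 2 * g z a) (hpos : ∀ a, a ≠ 0 → 0 < g x a) :
    ∃ C > 0, ∀ᶠ z in 𝓝 x, ∀ a, g z a ≤ C ^ 2 * ‖a‖ ^ 2 ∧ ‖a‖ ^ 2 ≤ C ^ 2 * g z a := by
  have := FiniteDimensional.proper_real E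
  have hK := isCompact_sphere (0 : E) 1
  have hgx : Continuous (g x) := continuous_iff_continuousAt.2 fun a ↦
    (hc a).comp (x := a) (continuousAt_const.prodMk continuousAt_id)
  have hne : (sphere (0 : E) 1).Nonempty := NormedSpace.sphere_nonempty.2 zero_le_one
  obtain ⟨a, ha, hmin⟩ := hK.exists_isMinOn hne hgx.continuousOn
  obtain ⟨b, hb, hmax⟩ := hK.exists_isMaxOn hne hgx.continuousOn
  have hm : 0 < g x a := hpos a (by rintro rfl; simp at ha)
  have hM : 0 < g x b := hpos b (by rintro rfl; simp at hb)
  have hev := hK.eventually_forall_of_forall_eventually (x₀ := x)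
    (P := fun z c ↦ g x a / 2 < g z c ∧ g z c < g x b + 1) fun c hc' ↦ by
      have h1 : g x a ≤ g x c := hmin hc'
      have h2 : g x c ≤ g x b := hmax hc'
      exact ((hc c).eventually (lt_mem_nhds (by simp; linarith))).and
        ((hc c).eventually (gt_mem_nhds (by simp; linarith)))
  refine ⟨√(2 / g x a + (g x b + 1)), by positivity, hev.mono fun z hz c ↦ ?_⟩
  rw [Real.sq_sqrt (by positivity)]
  rcases eq_or_ne c 0 with rfl | hc0
  · have := hg z 0 0
    simp only [zero_smul] at this
    rw [this]; simp
  have hn : 0 < ‖c‖ := norm_pos_iff.2 hc0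
  have h1 := hz (‖c‖⁻¹ • c) (by simp [norm_smul, hn.ne'])
  have h2 : g z c = ‖c‖ ^ 2 * g z (‖c‖⁻¹ • c) := by rw [hg]; field_simp
  set w := g z (‖c‖⁻¹ • c)
  rw [h2]
  constructor
  · rw [mul_comm]
    refine mul_le_mul_of_nonneg_right ?_ (by positivity)
    have : 0 < 2 / g x a := by positivity
    linarith [h1.2]
  · have h3 : 1 ≤ (2 / g x a + (g x b + 1)) * w := by
      have h4 : 1 ≤ 2 / g x a * w := by rw [div_mul_eq_mul_div, le_div_iff₀ hm]; linarith [h1.1]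
      have : 0 < w := by linarith [h1.1]
      have : 0 < (g x b + 1) * w := by positivity
      linarith
    nlinarith [sq_nonneg ‖c‖]

/-- The orthogonal projection along `X`, for the metric `G`. -/
noncomputable def projN (G : E →L[ℝ] E →L[ℝ] ℝ) (X : E) : E →L[ℝ] E :=
  ContinuousLinearMap.id ℝ E - (G X X)⁻¹ • (G X).smulRight X

/-- The orthogonal projection, for the metric `G`, onto the intersection of the kernel of `β` and
the orthogonal of `X`, where `β X = 0`. -/
noncomputable def projT (G : E →L[ℝ] E →L[ℝ] ℝ) (X : E) (β : E →L[ℝ] ℝ) : E →L[ℝ] E :=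
  projN G X - (β (G.inverse β))⁻¹ • β.smulRight (G.inverse β)

theorem ContinuousAt.projN {v : X → E} (hG : ContinuousAt G x) (hv : ContinuousAt v x)
    (h0 : G x (v x) (v x) ≠ 0) : ContinuousAt (fun z ↦ projN (G z) (v z)) x := by
  have h1 : ContinuousAt (fun z ↦ G z (v z)) x := hG.clm_apply hv
  refine continuousAt_const.sub (((h1.clm_apply hv).inv₀ h0).smul ?_)
  exact ((ContinuousLinearMap.smulRightL ℝ E E).continuous.continuousAt.comp h1).clm_apply hv

theorem ContinuousAt.projT [CompleteSpace E] {v : X → E} {β : X → E →L[ℝ] ℝ}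
    (hG : ContinuousAt G x) (hv : ContinuousAt v x) (hβ : ContinuousAt β x)
    (h0 : G x (v x) (v x) ≠ 0) (hi : (G x).IsInvertible) (h1 : β x ((G x).inverse (β x)) ≠ 0) :
    ContinuousAt (fun z ↦ projT (G z) (v z) (β z)) x := by
  have h2 : ContinuousAt (fun z ↦ (G z).inverse (β z)) x :=
    (ContinuousAt.comp (f := G) (g := ContinuousLinearMap.inverse)
      (hi.contDiffAt_map_inverse (n := 0)).continuousAt hG).clm_apply hβ
  refine (hG.projN hv h0).sub (((hβ.clm_apply h2).inv₀ h1).smul ?_)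
  exact ((ContinuousLinearMap.smulRightL ℝ E E).continuous.continuousAt.comp hβ).clm_apply h2

end BilinearForms

section RiemannianCharts

open scoped RealInnerProductSpace

variable {M : Type*} [TopologicalSpace M] [ChartedSpace (EuclideanHalfSpace 4) M]
  [IsManifold (𝓡∂ 4) ∞ M] {h h' : OpenPartialHomeomorph M (EuclideanHalfSpace 4)}

/-- The constant vector field `a` of a chart is a continuous vector field. -/
theorem continuousOn_chartD_inverse (hh : h ∈ IsManifold.maximalAtlas (𝓡∂ 4) ∞ M) (a : E4) :
    ContinuousOn (fun z ↦ (TotalSpace.mk' E4 (E := fun x : M ↦ TangentSpace (𝓡∂ 4) x) z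
      ((chartD h z).inverse a))) h.source := by
  have h1 := contMDiffOn_extend_symm hh
  rw [← h.extend_target'] at h1
  have hu : UniqueMDiffOn 𝓘(ℝ, E4) (h.extend (𝓡∂ 4)).target :=
    (uniqueDiffOn_extend_target h).uniqueMDiffOn
  have h2 := h1.continuousOn_tangentMapWithin (by simp) hu
  have h3 : ContinuousOn (fun z ↦ (⟨h.extend (𝓡∂ 4) z, a⟩ : TangentBundle 𝓘(ℝ, E4) E4)) h.source := by
    have e : Continuous (fun y : E4 ↦ (⟨y, a⟩ : TangentBundle 𝓘(ℝ, E4) E4)) := by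
      have h5 := (tangentBundleModelSpaceHomeomorph (𝓘(ℝ, E4) : ModelWithCorners ℝ E4 E4)).symm.continuous
      have h6 : Continuous fun y : E4 ↦ ((y, a) : E4 × E4) := by fun_prop
      exact Continuous.comp (g := (tangentBundleModelSpaceHomeomorph
        (𝓘(ℝ, E4) : ModelWithCorners ℝ E4 E4)).symm) h5 h6
    exact e.comp_continuousOn (fun z hz ↦ (h.continuousAt_extend hz).continuousWithinAt)
  have h4 := h2.comp h3 (fun z hz ↦ extend_mem_target h hz)
  refine h4.congr fun z hz ↦ ?_
  have key : ∀ z', z' = z → (TotalSpace.mk' E4 (E := fun x : M ↦ TangentSpace (𝓡∂ 4) x) z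
      ((chartD h z).inverse a)) = TotalSpace.mk' E4 (E := fun x : M ↦ TangentSpace (𝓡∂ 4) x) z'
      ((chartD h z').inverse a) := by
    rintro _ rfl; rfl
  rw [key _ (h.extend_left_inv (I := 𝓡∂ 4) hz)]
  simp only [Function.comp_apply, tangentMapWithin]
  rw [(hasMFDerivWithinAt_extend_symm hh (extend_mem_target h hz)).mfderivWithin
    (hu _ (extend_mem_target h hz))]
  rfl

variable [RiemannianBundle (fun x : M ↦ TangentSpace (𝓡∂ 4) x)]

/-- The metric read in a chart. -/
noncomputable def gram (h : OpenPartialHomeomorph M (EuclideanHalfSpace 4)) (z : M) :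
    E4 →L[ℝ] E4 →L[ℝ] ℝ :=
  LinearMap.toContinuousLinearMap ((LinearMap.toContinuousLinearMap :
    (E4 →ₗ[ℝ] ℝ) ≃ₗ[ℝ] (E4 →L[ℝ] ℝ)).toLinearMap ∘ₗ LinearMap.mk₂ ℝ
      (fun a b ↦ (⟪(chartD h z).inverse a, (chartD h z).inverse b⟫ : ℝ))
      (fun a a' b ↦ by simp [inner_add_left]) (fun c a b ↦ by simp [inner_smul_left])
      (fun a b b' ↦ by simp [inner_add_right]) (fun c a b ↦ by simp [inner_smul_right]))

theorem gram_apply (z : M) (a b : E4) :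
    gram h z a b = ⟪(chartD h z).inverse a, (chartD h z).inverse b⟫ := rfl

theorem gram_chartD (hh : h ∈ IsManifold.maximalAtlas (𝓡∂ 4) ∞ M) {z : M} (hz : z ∈ h.source)
    (v w : TangentSpace (𝓡∂ 4) z) : gram h z (chartD h z v) (chartD h z w) = ⟪v, w⟫ := by
  rw [gram_apply, chartD_inverse_apply hh hz, chartD_inverse_apply hh hz]

theorem gram_self_pos (hh : h ∈ IsManifold.maximalAtlas (𝓡∂ 4) ∞ M) {z : M} (hz : z ∈ h.source)
    {a : E4} (ha : a ≠ 0) : 0 < gram h z a a := by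
  rw [gram_apply, real_inner_self_eq_norm_sq]
  have : (chartD h z).inverse a ≠ 0 := fun h0 ↦ ha (by
    rw [← chartD_apply_inverse hh hz a, h0, map_zero])
  positivity

theorem gram_isInvertible (hh : h ∈ IsManifold.maximalAtlas (𝓡∂ 4) ∞ M) {z : M}
    (hz : z ∈ h.source) : (gram h z).IsInvertible := by
  have hinj : Function.Injective (gram h z : E4 →ₗ[ℝ] (E4 →L[ℝ] ℝ)) := by
    rw [injective_iff_map_eq_zero]
    intro a ha
    by_contra h0
    have := gram_self_pos hh hz h0
    rw [show gram h z a = 0 from ha] at this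
    simp at this
  have hfr : Module.finrank ℝ E4 = Module.finrank ℝ (E4 →L[ℝ] ℝ) := by
    rw [← LinearEquiv.finrank_eq (LinearMap.toContinuousLinearMap :
      (E4 →ₗ[ℝ] ℝ) ≃ₗ[ℝ] (E4 →L[ℝ] ℝ))]
    exact (Subspace.dual_finrank_eq (K := ℝ) (V := E4)).symm
  refine ⟨(LinearEquiv.ofInjectiveOfFinrankEq (gram h z : E4 →ₗ[ℝ] (E4 →L[ℝ] ℝ)) hinj
    hfr).toContinuousLinearEquiv, ?_⟩
  ext a b
  rfl

theorem continuousOn_gram [IsContMDiffRiemannianBundle (𝓡∂ 4) ∞ (EuclideanSpace ℝ (Fin 4))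
      (fun x : M ↦ TangentSpace (𝓡∂ 4) x)] (hh : h ∈ IsManifold.maximalAtlas (𝓡∂ 4) ∞ M) :
    ContinuousOn (gram h) h.source := by
  have : IsContinuousRiemannianBundle E4 (fun x : M ↦ TangentSpace (𝓡∂ 4) x) := by
    obtain ⟨g, hg, hg'⟩ := IsContMDiffRiemannianBundle.exists_contMDiff (IB := 𝓡∂ 4) (n := ∞)
      (F := EuclideanSpace ℝ (Fin 4)) (E := fun x : M ↦ TangentSpace (𝓡∂ 4) x)
    exact ⟨g, hg.continuous, hg'⟩
  refine continuousOn_clm_apply.2 fun a ↦ continuousOn_clm_apply.2 fun b ↦ ?_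
  exact ContinuousOn.inner_bundle (continuousOn_chartD_inverse hh a)
    (continuousOn_chartD_inverse hh b)

variable [IsContMDiffRiemannianBundle (𝓡∂ 4) ∞ (EuclideanSpace ℝ (Fin 4))
      (fun x : M ↦ TangentSpace (𝓡∂ 4) x)]

theorem norm_sq_eq_gram (hh : h ∈ IsManifold.maximalAtlas (𝓡∂ 4) ∞ M) {z : M}
    (hz : z ∈ h.source) (v : TangentSpace (𝓡∂ 4) z) :
    ‖v‖ ^ 2 = gram h z (chartD h z v) (chartD h z v) := by
  rw [gram_chartD hh hz, real_inner_self_eq_norm_sq]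

theorem eventually_norm_chartD_bounds (hh : h ∈ IsManifold.maximalAtlas (𝓡∂ 4) ∞ M) {x : M}
    (hx : x ∈ h.source) : ∃ C > 0, ∀ᶠ z in 𝓝 x, ∀ v : TangentSpace (𝓡∂ 4) z,
      ‖v‖ ≤ C * ‖chartD h z v‖ ∧ ‖chartD h z v‖ ≤ C * ‖v‖ := by
  have hc := (continuousOn_gram hh x hx).continuousAt (h.open_source.mem_nhds hx)
  obtain ⟨C, hC, h1⟩ := eventually_quadratic_bounds (x := x) (g := fun z a ↦ gram h z a a)
    (fun a ↦ ((hc.comp (x := (x, a)) continuousAt_fst).clm_apply continuousAt_snd).clm_apply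
      continuousAt_snd)
    (fun z c a ↦ by simp only [map_smul, smul_apply, smul_eq_mul]; ring)
    (fun a ha ↦ gram_self_pos hh hx ha)
  refine ⟨C, hC, ?_⟩
  filter_upwards [h1, h.open_source.mem_nhds hx] with z hz1 hz v
  refine ⟨(sq_le_sq₀ (norm_nonneg _) (by positivity)).1 ?_,
    (sq_le_sq₀ (norm_nonneg _) (by positivity)).1 ?_⟩ <;> rw [mul_pow, norm_sq_eq_gram hh hz]
  exacts [(hz1 _).1, (hz1 _).2]

variable {Ω : SymplecticForm M} {H : M → ℝ}

theorem chartD_starProjection_normalFiber (hh : h ∈ IsManifold.maximalAtlas (𝓡∂ 4) ∞ M) {z : M}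
    (hz : z ∈ h.source) (v : TangentSpace (𝓡∂ 4) z) :
    chartD h z ((normalFiber Ω H z).starProjection v) =
      projN (gram h z) (chartD h z (hamVF Ω H z)) (chartD h z v) := by
  have h1 : (normalFiber Ω H z).starProjection v =
      v - (⟪hamVF Ω H z, hamVF Ω H z⟫⁻¹ * ⟪hamVF Ω H z, v⟫ : ℝ) • hamVF Ω H z := by
    rw [normalFiber, Submodule.starProjection_orthogonal_val, Submodule.starProjection_singleton,
      real_inner_self_eq_norm_sq, div_eq_inv_mul]
    rfl
  rw [h1, map_sub, map_smul]
  simp [projN, gram_chartD hh hz, smul_smul]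

theorem dHam_hamVF (z : M) : dHam H z (hamVF Ω H z) = 0 := by
  rw [← form_hamVF Ω H z]; exact Ω.alternating z _

theorem dHam_ne_zero {z : M} (hz : hamVF Ω H z ≠ 0) : dHam H z ≠ 0 := by
  intro h0
  refine hz (Ω.nondegenerate z _ fun w ↦ ?_)
  rw [form_hamVF, h0]; rfl

/-- The differential of `H` read in a chart. -/
noncomputable def chartForm (h : OpenPartialHomeomorph M (EuclideanHalfSpace 4)) (H : M → ℝ)
    (z : M) : E4 →L[ℝ] ℝ :=
  (mfderiv (𝓡∂ 4) 𝓘(ℝ) H z : TangentSpace (𝓡∂ 4) z →L[ℝ] ℝ) ∘L (chartD h z).inverse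

theorem chartForm_chartD (hh : h ∈ IsManifold.maximalAtlas (𝓡∂ 4) ∞ M) {z : M}
    (hz : z ∈ h.source) (v : TangentSpace (𝓡∂ 4) z) :
    chartForm h H z (chartD h z v) = dHam H z v := by
  change dHam H z ((chartD h z).inverse (chartD h z v)) = _
  rw [chartD_inverse_apply hh hz]

theorem chartForm_inverse_pos (hh : h ∈ IsManifold.maximalAtlas (𝓡∂ 4) ∞ M) {z : M}
    (hz : z ∈ h.source) (hX : hamVF Ω H z ≠ 0) :
    0 < chartForm h H z ((gram h z).inverse (chartForm h H z)) := by
  obtain ⟨e, he⟩ := gram_isInvertible hh hz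
  have h1 : gram h z ((gram h z).inverse (chartForm h H z)) = chartForm h H z := by
    rw [← he, ContinuousLinearMap.inverse_equiv]; exact e.apply_symm_apply _
  rw [show chartForm h H z ((gram h z).inverse (chartForm h H z)) =
    gram h z ((gram h z).inverse (chartForm h H z)) ((gram h z).inverse (chartForm h H z)) by
      rw [h1]]
  refine gram_self_pos hh hz fun h0 ↦ ?_
  rw [h0, map_zero] at h1
  refine dHam_ne_zero hX (LinearMap.ext fun v ↦ ?_)
  rw [← chartForm_chartD hh hz, ← h1]; rfl

theorem chartD_projection_transFiber (hh : h ∈ IsManifold.maximalAtlas (𝓡∂ 4) ∞ M) {z : M}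
    (hz : z ∈ h.source) (hX : hamVF Ω H z ≠ 0) (v : TangentSpace (𝓡∂ 4) z) :
    chartD h z ((transFiber Ω H z).orthogonalProjectionOnto v : TangentSpace (𝓡∂ 4) z) =
      projT (gram h z) (chartD h z (hamVF Ω H z)) (chartForm h H z) (chartD h z v) := by
  set X := hamVF Ω H z with hXdef
  set β := chartForm h H z with hβ
  set g := (gram h z).inverse β with hg
  have hgβ : gram h z g = β := by
    obtain ⟨e, he⟩ := gram_isInvertible hh hz
    rw [hg, ← he, ContinuousLinearMap.inverse_equiv]; exact e.apply_symm_apply _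
  have hpos : 0 < β g := chartForm_inverse_pos hh hz hX
  set ξ : TangentSpace (𝓡∂ 4) z := (chartD h z).inverse g with hξ
  have hξg : chartD h z ξ = g := chartD_apply_inverse hh hz g
  have hin : ∀ w : TangentSpace (𝓡∂ 4) z, ⟪ξ, w⟫ = dHam H z w := fun w ↦ by
    rw [← gram_chartD hh hz, hξg, hgβ, hβ, chartForm_chartD hh hz]
  have hξX : ⟪ξ, X⟫ = 0 := by rw [hin, dHam_hamVF]
  have hξξ : ⟪ξ, ξ⟫ = β g := by rw [hin, ← chartForm_chartD hh hz, hξg]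
  have hXX : ⟪X, X⟫ ≠ 0 := by rw [real_inner_self_eq_norm_sq]; positivity
  set u := v - (⟪X, X⟫⁻¹ * ⟪X, v⟫ : ℝ) • X - ((β g)⁻¹ * dHam H z v : ℝ) • ξ with hu
  have h1 : (transFiber Ω H z).starProjection v = u := by
    refine Submodule.eq_starProjection_of_mem_of_inner_eq_zero ?_ ?_
    · refine Submodule.mem_inf.2 ⟨Submodule.mem_orthogonal_singleton_iff_inner_right.2 ?_, ?_⟩
      · rw [hu, inner_sub_right, inner_sub_right, inner_smul_right, inner_smul_right,
          real_inner_comm ξ X, hξX]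
        field_simp; ring
      · rw [LinearMap.mem_ker, hu, map_sub, map_sub, map_smul, map_smul, dHam_hamVF, ← hin ξ, hξξ]
        simp only [smul_eq_mul]; field_simp; ring
    · intro w hw
      obtain ⟨hw1, hw2⟩ := Submodule.mem_inf.1 hw
      have hw1 := Submodule.mem_orthogonal_singleton_iff_inner_right.1 hw1
      have hw2 : dHam H z w = 0 := hw2
      rw [hu, sub_sub, sub_sub_cancel, inner_add_left, inner_smul_left, inner_smul_left, hin, hw2,
        hw1]
      simp
  have h2 : ((transFiber Ω H z).orthogonalProjectionOnto v : TangentSpace (𝓡∂ 4) z) = u := h1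
  rw [h2, hu, map_sub, map_sub, map_smul, map_smul, hξg]
  have h3 : β (chartD h z v) = dHam H z v := chartForm_chartD hh hz v
  simp [projT, projN, gram_chartD hh hz, smul_smul, h3, ← hg]

end RiemannianCharts

section Packing

/-- The space of coordinates on a normal section. -/
abbrev E3 := EuclideanSpace ℝ (Fin 3)

theorem exists_finset_disjoint_balls {W : Set E3} (hW : IsOpen W) (hfin : volume W ≠ ⊤)
    {l δ R : ℝ} (hl : 0 < l) (hl1 : l ≤ 1) (hδ : 0 < δ) (hδ1 : δ ≤ 1) (hR : 0 < R) :
    ∃ (t : Finset E3) (r : E3 → ℝ), (∀ c ∈ t, 0 < r c ∧ r c < R ∧ closedBall c (r c) ⊆ W) ∧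
      (t : Set E3).PairwiseDisjoint (fun c ↦ closedBall c (r c)) ∧
      volume (W \ ⋃ c ∈ t, ball c (l * r c)) ≤ ENNReal.ofReal (1 - l ^ 3 * (1 - δ)) * volume W := by
  have hrad : ∀ c ∈ W, ∃ ρ > 0, closedBall c ρ ⊆ W := fun c hc ↦
    nhds_basis_closedBall.mem_iff.1 (hW.mem_nhds hc)
  choose! ρ hρ hρW using hrad
  obtain ⟨T, r, hTc, hTW, hTr, hT0, hTd⟩ := Besicovitch.exists_disjoint_closedBall_covering_ae
    (volume : Measure E3) (fun _ ↦ Ioi 0) W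
    (fun c _ d hd ↦ ⟨d / 2, mem_Ioi.2 (by positivity), by positivity, by linarith⟩)
    (fun c ↦ min (ρ c) R) (fun c hc ↦ lt_min (hρ c hc) hR)
  have hball : ∀ c ∈ T, 0 < r c ∧ r c < R ∧ closedBall c (r c) ⊆ W := fun c hc ↦
    ⟨(hTr c hc).2.1, (hTr c hc).2.2.trans_le (min_le_right _ _),
      (closedBall_subset_closedBall ((hTr c hc).2.2.le.trans (min_le_left _ _))).trans
        (hρW c (hTW hc))⟩
  have hcount : Countable T := hTc.to_subtype
  have hsum : volume W = ∑' c : T, volume (closedBall (c : E3) (r c)) := by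
    rw [← measure_biUnion hTc hTd (fun c _ ↦ measurableSet_closedBall)]
    refine le_antisymm ?_ (measure_mono (iUnion₂_subset fun c hc ↦ (hball c hc).2.2))
    calc volume W ≤ volume ((⋃ c ∈ T, closedBall c (r c)) ∪ W \ ⋃ c ∈ T, closedBall c (r c)) :=
          measure_mono fun z hz ↦ by
            by_cases h : z ∈ ⋃ c ∈ T, closedBall c (r c)
            · exact Or.inl h
            · exact Or.inr ⟨hz, h⟩
      _ ≤ _ := (measure_union_le _ _).trans (by rw [hT0, add_zero])
  obtain ⟨t', ht'⟩ : ∃ t' : Finset T, ENNReal.ofReal (1 - δ) * volume W ≤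
      ∑ c ∈ t', volume (closedBall (c : E3) (r c)) := by
    rcases eq_or_ne (volume W) 0 with h0 | h0
    · exact ⟨∅, by simp [h0]⟩
    have hlt : ENNReal.ofReal (1 - δ) * volume W < volume W := by
      conv_rhs => rw [← one_mul (volume W)]
      refine ENNReal.mul_lt_mul_left h0 hfin ?_
      rw [← ENNReal.ofReal_one]
      exact (ENNReal.ofReal_lt_ofReal_iff one_pos).2 (by linarith)
    obtain ⟨t', h⟩ := lt_iSup_iff.1 (hlt.trans_eq (hsum.trans ENNReal.tsum_eq_iSup_sum))
    exact ⟨t', h.le⟩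
  classical
  refine ⟨t'.image Subtype.val, r, ?_, ?_, ?_⟩
  · intro c hc
    obtain ⟨⟨c', hc'⟩, -, rfl⟩ := Finset.mem_image.1 hc
    exact hball c' hc'
  · refine hTd.subset fun c hc ↦ ?_
    obtain ⟨⟨c', hc'⟩, -, rfl⟩ := Finset.mem_image.1 (Finset.mem_coe.1 hc)
    exact hc'
  have hU : (⋃ c ∈ t'.image Subtype.val, ball c (l * r c)) =
      ⋃ c ∈ t', ball (c : E3) (l * r (c : E3)) := by
    ext z; simp
  rw [hU]
  have hsub : ∀ c : T, ball (c : E3) (l * r c) ⊆ closedBall (c : E3) (r c) := fun c ↦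
    ball_subset_closedBall.trans (closedBall_subset_closedBall (by
      have := (hball c c.2).1; nlinarith))
  have hdisj : (t' : Set T).PairwiseDisjoint fun c : T ↦ ball (c : E3) (l * r c) := by
    intro c _ c' _ hne
    exact (hTd c.2 c'.2 (fun h ↦ hne (Subtype.ext h))).mono (hsub c) (hsub c')
  have hm : volume (⋃ c ∈ t', ball (c : E3) (l * r (c : E3))) =
      ENNReal.ofReal (l ^ 3) * ∑ c ∈ t', volume (closedBall (c : E3) (r c)) := by
    rw [measure_biUnion_finset hdisj fun c _ ↦ measurableSet_ball, Finset.mul_sum]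
    refine Finset.sum_congr rfl fun c _ ↦ ?_
    rw [Measure.addHaar_ball_mul_of_pos _ _ hl, Measure.addHaar_closedBall_eq_addHaar_ball,
      ← Measure.addHaar_ball_center (volume : Measure E3) (c : E3)]
    simp
  have hWsub : (⋃ c ∈ t', ball (c : E3) (l * r (c : E3))) ⊆ W :=
    iUnion₂_subset fun c _ ↦ (hsub c).trans (hball c c.2).2.2
  rw [measure_diff hWsub (MeasurableSet.biUnion t'.countable_toSet
    fun c _ ↦ measurableSet_ball).nullMeasurableSet (ne_top_of_le_ne_top hfin (measure_mono hWsub)),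
    hm, ENNReal.ofReal_sub _ (by have := pow_pos hl 3; nlinarith),
    ENNReal.sub_mul (fun _ _ ↦ hfin), ENNReal.ofReal_one, one_mul, ENNReal.ofReal_mul (by positivity),
    mul_assoc]
  gcongr

/-- The function `ζ ↦ r² g ((ζ - c) / r)`. -/
noncomputable def rescaled (g : E3 → ℝ) (c : E3) (r : ℝ) (ζ : E3) : ℝ := r ^ 2 * g (r⁻¹ • (ζ - c))

variable {g : E3 → ℝ} {C : ℝ}

theorem contDiff_rescaled (hg : ContDiff ℝ ∞ g) (c : E3) (r : ℝ) :
    ContDiff ℝ ∞ (rescaled g c r) :=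
  contDiff_const.mul (hg.comp ((contDiff_id.sub contDiff_const).const_smul _))

theorem fderiv_rescaled (hg : ContDiff ℝ ∞ g) (c : E3) {r : ℝ} (hr : r ≠ 0) :
    fderiv ℝ (rescaled g c r) = fun ζ ↦ r • fderiv ℝ g (r⁻¹ • (ζ - c)) := by
  funext ζ
  have h1 : HasFDerivAt (fun ζ : E3 ↦ r⁻¹ • (ζ - c)) (r⁻¹ • ContinuousLinearMap.id ℝ E3) ζ :=
    ((hasFDerivAt_id ζ).sub_const c).const_smul r⁻¹
  have h2 := ((hg.differentiable (by simp) (r⁻¹ • (ζ - c))).hasFDerivAt.comp ζ h1).const_mul (r ^ 2)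
  refine h2.fderiv.trans ?_
  ext a
  simp only [smul_apply, ContinuousLinearMap.comp_apply, ContinuousLinearMap.id_apply, map_smul,
    smul_eq_mul]
  field_simp

theorem fderiv_fderiv_rescaled (hg : ContDiff ℝ ∞ g) (c : E3) {r : ℝ} (hr : r ≠ 0) (ζ a : E3) :
    fderiv ℝ (fderiv ℝ (rescaled g c r)) ζ a = fderiv ℝ (fderiv ℝ g) (r⁻¹ • (ζ - c)) a := by
  rw [fderiv_rescaled hg c hr]
  have h1 : HasFDerivAt (fun ζ : E3 ↦ r⁻¹ • (ζ - c)) (r⁻¹ • ContinuousLinearMap.id ℝ E3) ζ :=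
    ((hasFDerivAt_id ζ).sub_const c).const_smul r⁻¹
  have h0 : Differentiable ℝ (fderiv ℝ g) :=
    (hg.fderiv_right (m := 1) (WithTop.coe_le_coe.2 (le_top (a := (2 : ℕ∞))))).differentiable (by simp)
  have h2 : HasFDerivAt (fun ζ : E3 ↦ r • fderiv ℝ g (r⁻¹ • (ζ - c)))
      (r • ((fderiv ℝ (fderiv ℝ g) (r⁻¹ • (ζ - c))).comp
        (r⁻¹ • ContinuousLinearMap.id ℝ E3))) ζ :=
    ((h0 (r⁻¹ • (ζ - c))).hasFDerivAt.comp ζ h1).const_smul r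
  rw [h2.fderiv]
  change r • fderiv ℝ (fderiv ℝ g) (r⁻¹ • (ζ - c)) (r⁻¹ • a) = _
  rw [map_smul, smul_smul, mul_inv_cancel₀ hr, one_smul]

theorem rescaled_eq_zero (hs : tsupport g ⊆ closedBall 0 1) {c ζ : E3} {r : ℝ} (hr : 0 < r)
    (hζ : ζ ∉ closedBall c r) : rescaled g c r ζ = 0 := by
  have : r⁻¹ • (ζ - c) ∉ closedBall (0 : E3) 1 := by
    rw [mem_closedBall, dist_eq_norm] at hζ
    rw [mem_closedBall_zero_iff, norm_smul, norm_inv, Real.norm_of_nonneg hr.le, not_le] at *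
    rwa [inv_mul_eq_div, one_lt_div hr]
  rw [rescaled, image_eq_zero_of_notMem_tsupport fun h ↦ this (hs h), mul_zero]

/-- A function which has prescribed second derivatives (those of the rescalings of a given `g`) on
disjoint balls filling most of `W`, and which is small in the `C¹` sense. -/
theorem exists_packed_function (hg : ContDiff ℝ ∞ g) (hs : tsupport g ⊆ closedBall 0 1)
    (h0 : ∀ ζ, |g ζ| ≤ C) (h1 : ∀ ζ, ‖fderiv ℝ g ζ‖ ≤ C)
    (h2 : ∀ ζ a, ‖fderiv ℝ (fderiv ℝ g) ζ a‖ ≤ C * ‖a‖)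
    {W : Set E3} (hW : IsOpen W) (hfin : volume W ≠ ⊤)
    {l δ R : ℝ} (hl : 0 < l) (hl1 : l ≤ 1) (hδ : 0 < δ) (hδ1 : δ ≤ 1) (hR : 0 < R) :
    ∃ (𝒢 : E3 → ℝ) (t : Finset E3) (r : E3 → ℝ), ContDiff ℝ ∞ 𝒢 ∧ HasCompactSupport 𝒢 ∧
      tsupport 𝒢 ⊆ W ∧ (∀ ζ, |𝒢 ζ| ≤ C * R ^ 2) ∧ (∀ ζ, ‖fderiv ℝ 𝒢 ζ‖ ≤ C * R) ∧
      (∀ ζ a, ‖fderiv ℝ (fderiv ℝ 𝒢) ζ a‖ ≤ C * ‖a‖) ∧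
      (∀ c ∈ t, 0 < r c ∧ r c < R ∧ closedBall c (r c) ⊆ W ∧ ∀ ζ ∈ closedBall c (r c),
        |𝒢 ζ| ≤ C * r c ^ 2 ∧ ‖fderiv ℝ 𝒢 ζ‖ ≤ C * r c ∧
          ∀ a, fderiv ℝ (fderiv ℝ 𝒢) ζ a = fderiv ℝ (fderiv ℝ g) ((r c)⁻¹ • (ζ - c)) a) ∧
      volume (W \ ⋃ c ∈ t, ball c (l * r c)) ≤ ENNReal.ofReal (1 - l ^ 3 * (1 - δ)) * volume W := by
  obtain ⟨t, r, hr, hd, hv⟩ := exists_finset_disjoint_balls hW hfin hl hl1 hδ hδ1 hR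
  have hC : 0 ≤ C := (abs_nonneg _).trans (h0 0)
  set 𝒢 : E3 → ℝ := fun ζ ↦ ∑ c ∈ t, rescaled g c (r c) ζ with h𝒢
  have hK : IsCompact (⋃ c ∈ t, closedBall c (r c)) :=
    t.isCompact_biUnion fun c _ ↦ isCompact_closedBall c (r c)
  have hloc0 : ∀ ζ, ζ ∉ (⋃ c ∈ t, closedBall c (r c)) → 𝒢 =ᶠ[𝓝 ζ] fun _ ↦ 0 := by
    intro ζ hζ
    filter_upwards [hK.isClosed.isOpen_compl.mem_nhds hζ] with ξ hξ
    exact Finset.sum_eq_zero fun c hc ↦ rescaled_eq_zero hs (hr c hc).1 fun h ↦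
      hξ (mem_biUnion (s := (t : Set E3)) hc h)
  have hloc : ∀ c ∈ t, ∀ ζ ∈ closedBall c (r c), 𝒢 =ᶠ[𝓝 ζ] rescaled g c (r c) := by
    classical
    intro c hc ζ hζ
    have hK' : IsCompact (⋃ c' ∈ t.erase c, closedBall c' (r c')) :=
      (t.erase c).isCompact_biUnion fun c _ ↦ isCompact_closedBall c (r c)
    have hn : ζ ∉ ⋃ c' ∈ t.erase c, closedBall c' (r c') := by
      rw [mem_iUnion₂]
      rintro ⟨c', hc', h⟩
      exact (disjoint_left.1 (hd hc (Finset.mem_of_mem_erase hc') (Finset.ne_of_mem_erase hc').symm))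
        hζ h
    filter_upwards [hK'.isClosed.isOpen_compl.mem_nhds hn] with ξ hξ
    refine Finset.sum_eq_single_of_mem c hc fun c' hc' hne ↦ ?_
    exact rescaled_eq_zero hs (hr c' hc').1 fun h ↦
      hξ (mem_biUnion (s := ((t.erase c : Finset E3) : Set E3)) (Finset.mem_erase.2 ⟨hne, hc'⟩) h)
  have hin : ∀ c ∈ t, ∀ ζ ∈ closedBall c (r c), |𝒢 ζ| ≤ C * r c ^ 2 ∧ ‖fderiv ℝ 𝒢 ζ‖ ≤ C * r c ∧
      ∀ a, fderiv ℝ (fderiv ℝ 𝒢) ζ a = fderiv ℝ (fderiv ℝ g) ((r c)⁻¹ • (ζ - c)) a := by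
    intro c hc ζ hζ
    have hrc := (hr c hc).1
    refine ⟨?_, ?_, fun a ↦ ?_⟩
    · rw [(hloc c hc ζ hζ).eq_of_nhds, rescaled, abs_mul, abs_of_pos (by positivity), mul_comm]
      gcongr; exact h0 _
    · rw [(hloc c hc ζ hζ).fderiv_eq, fderiv_rescaled hg c hrc.ne', norm_smul,
        Real.norm_of_nonneg hrc.le, mul_comm]
      gcongr; exact h1 _
    · rw [(hloc c hc ζ hζ).fderiv.fderiv_eq, fderiv_fderiv_rescaled hg c hrc.ne']
  have hdich : ∀ ζ, 𝒢 =ᶠ[𝓝 ζ] (fun _ ↦ 0) ∨ ∃ c ∈ t, ζ ∈ closedBall c (r c) := by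
    intro ζ
    by_cases h : ζ ∈ ⋃ c ∈ t, closedBall c (r c)
    · obtain ⟨c, hc, h⟩ := mem_iUnion₂.1 h
      exact Or.inr ⟨c, hc, h⟩
    · exact Or.inl (hloc0 ζ h)
  have hts : tsupport 𝒢 ⊆ ⋃ c ∈ t, closedBall c (r c) := by
    refine closure_minimal (fun ζ hζ ↦ ?_) hK.isClosed
    by_contra h
    exact hζ (hloc0 ζ h).eq_of_nhds
  refine ⟨𝒢, t, r, ContDiff.sum fun c _ ↦ contDiff_rescaled hg c (r c),
    hK.of_isClosed_subset (isClosed_tsupport _) hts,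
    hts.trans (iUnion₂_subset fun c hc ↦ (hr c hc).2.2), fun ζ ↦ ?_, fun ζ ↦ ?_, fun ζ a ↦ ?_,
    fun c hc ↦ ⟨(hr c hc).1, (hr c hc).2.1, (hr c hc).2.2, hin c hc⟩, hv⟩
  · rcases hdich ζ with h | ⟨c, hc, h⟩
    · rw [h.eq_of_nhds, abs_zero]; positivity
    · have := hr c hc
      exact (hin c hc ζ h).1.trans (by gcongr; exacts [this.1.le, this.2.1.le])
  · rcases hdich ζ with h | ⟨c, hc, h⟩
    · rw [h.fderiv_eq]; simp; positivity
    · have := hr c hc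
      exact (hin c hc ζ h).2.1.trans (by gcongr; exact this.2.1.le)
  · rcases hdich ζ with h | ⟨c, hc, h⟩
    · have h3 : fderiv ℝ 𝒢 =ᶠ[𝓝 ζ] fun _ ↦ 0 := h.fderiv.trans (by simp; rfl)
      rw [h3.fderiv_eq]; simp; positivity
    · rw [(hin c hc ζ h).2.2 a]; exact h2 _ _

theorem exists_weighted_bound {F : Type*} [NormedAddCommGroup F] {f : E3 → F}
    (hs : HasCompactSupport f) (hf : Continuous f) :
    ∃ C, 0 ≤ C ∧ ∀ ζ, (1 + ‖ζ‖) ^ 2 * ‖f ζ‖ ≤ C := by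
  obtain ⟨C, hC⟩ := (hs.norm.mul_left (f := fun ζ : E3 ↦ (1 + ‖ζ‖) ^ 2)).exists_bound_of_continuous
    ((by fun_prop : Continuous fun ζ : E3 ↦ (1 + ‖ζ‖) ^ 2).mul hf.norm)
  have h : ∀ ζ, (1 + ‖ζ‖) ^ 2 * ‖f ζ‖ ≤ C := fun ζ ↦ (le_abs_self _).trans (hC ζ)
  exact ⟨C, le_trans (by positivity) (h 0), h⟩

theorem exists_weighted_bound_apply {F : Type*} [NormedAddCommGroup F] [NormedSpace ℝ F]
    {f : E3 → E3 →L[ℝ] F} (hs : HasCompactSupport f) (hf : Continuous f) :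
    ∃ C, 0 ≤ C ∧ ∀ ζ a, (1 + ‖ζ‖) ^ 2 * ‖f ζ a‖ ≤ C * ‖a‖ := by
  obtain ⟨C, hC, h⟩ := exists_weighted_bound hs hf
  refine ⟨C, hC, fun ζ a ↦ ?_⟩
  calc _ ≤ (1 + ‖ζ‖) ^ 2 * (‖f ζ‖ * ‖a‖) := by gcongr; exact (f ζ).le_opNorm a
    _ = (1 + ‖ζ‖) ^ 2 * ‖f ζ‖ * ‖a‖ := by ring
    _ ≤ C * ‖a‖ := by gcongr; exact h ζ

section

variable {q : E3 →L[ℝ] E3 →L[ℝ] ℝ} {χ : E3 → ℝ}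

theorem hasFDerivAt_half_quadratic (hsym : ∀ a b, q a b = q b a) (ζ : E3) :
    HasFDerivAt (fun ζ ↦ (1 / 2) * q ζ ζ) (q ζ) ζ := by
  have h1 := (q.hasFDerivAt (x := ζ)).clm_apply (hasFDerivAt_id ζ)
  refine (h1.const_mul (1 / 2)).congr_fderiv ?_
  ext a
  change (1 / 2) * (q ζ a + q a ζ) = q ζ a
  rw [hsym a ζ]
  ring

theorem fderiv_quadratic_mul (hsym : ∀ a b, q a b = q b a) (hχ : Differentiable ℝ χ) :
    fderiv ℝ (fun ζ ↦ (1 / 2) * q ζ ζ * χ ζ) =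
      fun ζ ↦ ((1 / 2) * q ζ ζ) • fderiv ℝ χ ζ + χ ζ • q ζ := by
  funext ζ
  exact ((hasFDerivAt_half_quadratic hsym ζ).mul (hχ ζ).hasFDerivAt).fderiv

theorem fderiv_fderiv_quadratic_mul (hsym : ∀ a b, q a b = q b a) (hχ : Differentiable ℝ χ)
    (hχ' : Differentiable ℝ (fderiv ℝ χ)) (ζ a : E3) :
    fderiv ℝ (fderiv ℝ (fun ζ ↦ (1 / 2) * q ζ ζ * χ ζ)) ζ a =
      (((1 / 2) * q ζ ζ) • fderiv ℝ (fderiv ℝ χ) ζ a + q ζ a • fderiv ℝ χ ζ) +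
        (χ ζ • q a + fderiv ℝ χ ζ a • q ζ) := by
  rw [fderiv_quadratic_mul hsym hχ]
  have e1 := (hasFDerivAt_half_quadratic hsym ζ).smul (hχ' ζ).hasFDerivAt
  have e2 := (hχ ζ).hasFDerivAt.smul (q.hasFDerivAt (x := ζ))
  exact congrArg (fun L ↦ L a) (e1.add e2).fderiv

end

/-- A compactly supported function with the Hessian `q` near the origin; the bounds only depend
on the size of `q`. -/
theorem exists_quadratic_bump {η : ℝ} (hη : 0 < η) (hη1 : η < 1) : ∃ C₀ > 0, ∀ (Q : ℝ)
    (q : E3 →L[ℝ] E3 →L[ℝ] ℝ), (∀ a b, q a b = q b a) → (∀ a b, |q a b| ≤ Q * ‖a‖ * ‖b‖) →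
    ∃ g : E3 → ℝ, ContDiff ℝ ∞ g ∧ tsupport g ⊆ closedBall 0 1 ∧ (∀ ζ, |g ζ| ≤ C₀ * Q) ∧
      (∀ ζ, ‖fderiv ℝ g ζ‖ ≤ C₀ * Q) ∧ (∀ ζ a, ‖fderiv ℝ (fderiv ℝ g) ζ a‖ ≤ C₀ * Q * ‖a‖) ∧
      ∀ ζ ∈ ball (0 : E3) (1 - η), ∀ a, fderiv ℝ (fderiv ℝ g) ζ a = q a := by
  obtain ⟨χ, hχs, hχt, hχc, hχ1⟩ : ∃ χ : E3 → ℝ, HasCompactSupport χ ∧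
      tsupport χ ⊆ closedBall 0 1 ∧ ContDiff ℝ ∞ χ ∧ ∀ ζ ∈ ball (0 : E3) (1 - η), χ ζ = 1 := by
    let χ : ContDiffBump (0 : E3) := ⟨1 - η, 1, by linarith, by linarith⟩
    exact ⟨χ, χ.hasCompactSupport, χ.tsupport_eq.le, χ.contDiff,
      fun ζ hζ ↦ χ.one_of_mem_closedBall (ball_subset_closedBall hζ)⟩
  have hD1 : ContDiff ℝ 1 (fderiv ℝ χ) :=
    hχc.fderiv_right (WithTop.coe_le_coe.2 (le_top (a := (2 : ℕ∞))))
  have hχd : Differentiable ℝ χ := hχc.differentiable (by simp)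
  have hχd' : Differentiable ℝ (fderiv ℝ χ) := hD1.differentiable (by simp)
  obtain ⟨C1, hC1p, hC1⟩ := exists_weighted_bound hχs hχc.continuous
  obtain ⟨C2, hC2p, hC2⟩ := exists_weighted_bound (hχs.fderiv (𝕜 := ℝ)) hD1.continuous
  obtain ⟨C3, hC3p, hC3⟩ := exists_weighted_bound_apply ((hχs.fderiv (𝕜 := ℝ)).fderiv (𝕜 := ℝ))
    (hD1.continuous_fderiv (by simp))
  refine ⟨C1 + 2 * C2 + C3 + 1, by positivity, fun Q q hsym hq ↦ ?_⟩
  have hQ : 0 ≤ Q := by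
    have := (abs_nonneg _).trans (hq (EuclideanSpace.single 0 1) (EuclideanSpace.single 0 1))
    simpa using this
  have hqn : ∀ ζ, ‖q ζ‖ ≤ Q * ‖ζ‖ := fun ζ ↦
    ContinuousLinearMap.opNorm_le_bound _ (by positivity) fun b ↦ hq ζ b
  have hw1 : ∀ ζ : E3, 1 ≤ (1 + ‖ζ‖) ^ 2 := fun ζ ↦ by nlinarith [norm_nonneg ζ]
  have hw2 : ∀ ζ : E3, ‖ζ‖ ≤ (1 + ‖ζ‖) ^ 2 := fun ζ ↦ by nlinarith [norm_nonneg ζ]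
  have hw3 : ∀ ζ : E3, ‖ζ‖ ^ 2 ≤ (1 + ‖ζ‖) ^ 2 := fun ζ ↦ by nlinarith [norm_nonneg ζ]
  have hfb : ∀ ζ, |(1 / 2) * q ζ ζ| ≤ Q * (1 + ‖ζ‖) ^ 2 := fun ζ ↦ by
    have h1 := hq ζ ζ
    have h2 := mul_le_mul_of_nonneg_left (hw3 ζ) hQ
    have h3 := abs_nonneg (q ζ ζ)
    rw [abs_mul, abs_of_pos (by norm_num)]
    nlinarith
  refine ⟨fun ζ ↦ (1 / 2) * q ζ ζ * χ ζ,
    (contDiff_const.mul (q.contDiff.clm_apply contDiff_id)).mul hχc, ?_, fun ζ ↦ ?_, fun ζ ↦ ?_,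
    fun ζ a ↦ ?_, fun ζ hζ a ↦ ?_⟩
  · exact (tsupport_mul_subset_right (f := fun ζ ↦ (1 / 2) * q ζ ζ) (g := χ)).trans hχt
  · rw [abs_mul]
    have h1 : |(1 / 2) * q ζ ζ| * |χ ζ| ≤ Q * C1 :=
      calc _ ≤ Q * (1 + ‖ζ‖) ^ 2 * |χ ζ| := mul_le_mul_of_nonneg_right (hfb ζ) (abs_nonneg _)
        _ = Q * ((1 + ‖ζ‖) ^ 2 * ‖χ ζ‖) := by rw [mul_assoc, Real.norm_eq_abs]
        _ ≤ Q * C1 := mul_le_mul_of_nonneg_left (hC1 ζ) hQ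
    have := mul_nonneg hC2p hQ
    have := mul_nonneg hC3p hQ
    linarith
  · rw [fderiv_quadratic_mul hsym hχd]
    refine (norm_add_le _ _).trans ?_
    rw [norm_smul, norm_smul, Real.norm_eq_abs ((1 / 2) * q ζ ζ)]
    have h1 : |(1 / 2) * q ζ ζ| * ‖fderiv ℝ χ ζ‖ ≤ Q * C2 :=
      calc _ ≤ Q * (1 + ‖ζ‖) ^ 2 * ‖fderiv ℝ χ ζ‖ :=
            mul_le_mul_of_nonneg_right (hfb ζ) (norm_nonneg _)
        _ = Q * ((1 + ‖ζ‖) ^ 2 * ‖fderiv ℝ χ ζ‖) := mul_assoc _ _ _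
        _ ≤ Q * C2 := mul_le_mul_of_nonneg_left (hC2 ζ) hQ
    have h2 : ‖χ ζ‖ * ‖q ζ‖ ≤ Q * C1 :=
      calc _ ≤ ‖χ ζ‖ * (Q * ‖ζ‖) := mul_le_mul_of_nonneg_left (hqn ζ) (norm_nonneg _)
        _ = Q * (‖ζ‖ * ‖χ ζ‖) := by ring
        _ ≤ Q * ((1 + ‖ζ‖) ^ 2 * ‖χ ζ‖) := mul_le_mul_of_nonneg_left
            (mul_le_mul_of_nonneg_right (hw2 ζ) (norm_nonneg _)) hQ
        _ ≤ Q * C1 := mul_le_mul_of_nonneg_left (hC1 ζ) hQ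
    have := mul_nonneg hC2p hQ
    have := mul_nonneg hC3p hQ
    linarith
  · rw [fderiv_fderiv_quadratic_mul hsym hχd hχd']
    have hna := norm_nonneg a
    have h1 : ‖((1 / 2) * q ζ ζ) • fderiv ℝ (fderiv ℝ χ) ζ a‖ ≤ Q * (C3 * ‖a‖) :=
      calc _ = |(1 / 2) * q ζ ζ| * ‖fderiv ℝ (fderiv ℝ χ) ζ a‖ := norm_smul _ _
        _ ≤ Q * (1 + ‖ζ‖) ^ 2 * ‖fderiv ℝ (fderiv ℝ χ) ζ a‖ :=
          mul_le_mul_of_nonneg_right (hfb ζ) (norm_nonneg _)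
        _ = Q * ((1 + ‖ζ‖) ^ 2 * ‖fderiv ℝ (fderiv ℝ χ) ζ a‖) := mul_assoc _ _ _
        _ ≤ Q * (C3 * ‖a‖) := mul_le_mul_of_nonneg_left (hC3 ζ a) hQ
    have hzD : ‖ζ‖ * ‖fderiv ℝ χ ζ‖ ≤ C2 :=
      (mul_le_mul_of_nonneg_right (hw2 ζ) (norm_nonneg _)).trans (hC2 ζ)
    have h5 : (Q * ‖a‖) * (‖ζ‖ * ‖fderiv ℝ χ ζ‖) ≤ Q * ‖a‖ * C2 :=
      mul_le_mul_of_nonneg_left hzD (mul_nonneg hQ hna)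
    have h2 : ‖q ζ a • fderiv ℝ χ ζ‖ ≤ Q * ‖a‖ * C2 := by
      rw [norm_smul, Real.norm_eq_abs]
      have := mul_le_mul_of_nonneg_right (hq ζ a) (norm_nonneg (fderiv ℝ χ ζ))
      linarith
    have h3 : ‖χ ζ • q a‖ ≤ C1 * (Q * ‖a‖) := by
      rw [norm_smul]
      exact mul_le_mul ((le_mul_of_one_le_left (norm_nonneg _) (hw1 ζ)).trans (hC1 ζ)) (hqn a)
        (norm_nonneg _) hC1p
    have h4 : ‖fderiv ℝ χ ζ a • q ζ‖ ≤ Q * ‖a‖ * C2 := by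
      rw [norm_smul]
      have := mul_le_mul ((fderiv ℝ χ ζ).le_opNorm a) (hqn ζ) (norm_nonneg _) (by positivity)
      linarith
    refine (norm_add_le _ _).trans ((add_le_add (norm_add_le _ _) (norm_add_le _ _)).trans ?_)
    have : 0 ≤ Q * ‖a‖ := by positivity
    linarith
  · rw [fderiv_fderiv_quadratic_mul hsym hχd hχd']
    have h1 : χ =ᶠ[𝓝 ζ] fun _ ↦ 1 := by
      filter_upwards [isOpen_ball.mem_nhds hζ] with ξ hξ using hχ1 ξ hξ
    have h2 : fderiv ℝ χ =ᶠ[𝓝 ζ] fun _ ↦ 0 := h1.fderiv.trans (by simp; rfl)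
    rw [h2.fderiv_eq, h2.eq_of_nhds, h1.eq_of_nhds]
    simp

/-- Flowbox coordinates: the time and the point of the section. -/
abbrev E13 := ℝ × E3

/-- `β ↦ β ∘ snd`. -/
noncomputable def pullSnd : (E3 →L[ℝ] ℝ) →L[ℝ] E13 →L[ℝ] ℝ :=
  (ContinuousLinearMap.compL ℝ E13 E3 ℝ).flip (ContinuousLinearMap.snd ℝ ℝ E3)

theorem pullSnd_apply (β : E3 →L[ℝ] ℝ) (v : E13) : pullSnd β v = β v.2 := rfl

theorem norm_pullSnd_le (β : E3 →L[ℝ] ℝ) : ‖pullSnd β‖ ≤ ‖β‖ :=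
  ContinuousLinearMap.opNorm_le_bound _ (norm_nonneg _) fun v ↦
    (β.le_opNorm v.2).trans (by gcongr; exact norm_snd_le v)

/-- The differential of `(θ, c) ↦ α ψ(θ) 𝒢(c)`. -/
noncomputable def dPert (α : ℝ) (ψ : ℝ → ℝ) (𝒢 : E3 → ℝ) (a : E13) : E13 →L[ℝ] ℝ :=
  α • ((deriv ψ a.1 * 𝒢 a.2) • ContinuousLinearMap.fst ℝ ℝ E3 + ψ a.1 • pullSnd (fderiv ℝ 𝒢 a.2))

section

variable {α : ℝ} {ψ : ℝ → ℝ} {𝒢 : E3 → ℝ}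

theorem hasFDerivAt_pert (hψ : Differentiable ℝ ψ) (h𝒢 : Differentiable ℝ 𝒢) (a : E13) :
    HasFDerivAt (fun a : E13 ↦ α * (ψ a.1 * 𝒢 a.2)) (dPert α ψ 𝒢 a) a := by
  have h1 : HasFDerivAt (fun a : E13 ↦ ψ a.1) (deriv ψ a.1 • ContinuousLinearMap.fst ℝ ℝ E3) a :=
    (hψ a.1).hasDerivAt.comp_hasFDerivAt a hasFDerivAt_fst
  have h2 : HasFDerivAt (fun a : E13 ↦ 𝒢 a.2) (pullSnd (fderiv ℝ 𝒢 a.2)) a :=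
    (h𝒢 a.2).hasFDerivAt.comp a hasFDerivAt_snd
  refine ((h1.mul h2).const_mul α).congr_fderiv ?_
  refine ContinuousLinearMap.ext fun w ↦ ?_
  change α * (ψ a.1 * fderiv ℝ 𝒢 a.2 w.2 + 𝒢 a.2 * (deriv ψ a.1 * w.1)) =
    α * (deriv ψ a.1 * 𝒢 a.2 * w.1 + ψ a.1 * fderiv ℝ 𝒢 a.2 w.2)
  ring

theorem differentiable_deriv_of_contDiff (hψ : ContDiff ℝ ∞ ψ) : Differentiable ℝ (deriv ψ) :=
  (contDiff_infty_iff_deriv.1 hψ).2.differentiable (by simp)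

theorem contDiff_fderiv_infty (h𝒢 : ContDiff ℝ ∞ 𝒢) : ContDiff ℝ ∞ (fderiv ℝ 𝒢) :=
  (contDiff_infty_iff_fderiv.1 h𝒢).2

theorem contDiff_dPert (hψ : ContDiff ℝ ∞ ψ) (h𝒢 : ContDiff ℝ ∞ 𝒢) :
    ContDiff ℝ ∞ (dPert α ψ 𝒢) := by
  have h1 := (contDiff_infty_iff_deriv.1 hψ).2
  have h2 := contDiff_fderiv_infty h𝒢
  exact ((((h1.comp contDiff_fst).mul (h𝒢.comp contDiff_snd)).smul
    (contDiff_const (c := ContinuousLinearMap.fst ℝ ℝ E3))).add ((hψ.comp contDiff_fst).smul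
    (pullSnd.contDiff.comp (h2.comp contDiff_snd)))).const_smul α

theorem fderiv_dPert_apply (hψ : ContDiff ℝ ∞ ψ) (h𝒢 : ContDiff ℝ ∞ 𝒢) (a v : E13) :
    fderiv ℝ (dPert α ψ 𝒢) a v = α • (
      ((deriv (deriv ψ) a.1 * v.1 * 𝒢 a.2 + deriv ψ a.1 * fderiv ℝ 𝒢 a.2 v.2) •
        ContinuousLinearMap.fst ℝ ℝ E3 + (deriv ψ a.1 * v.1) • pullSnd (fderiv ℝ 𝒢 a.2)) +
      ψ a.1 • pullSnd (fderiv ℝ (fderiv ℝ 𝒢) a.2 v.2)) := by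
  have hψ1 := hψ.differentiable (by simp)
  have hψ2 := differentiable_deriv_of_contDiff hψ
  have h𝒢1 := h𝒢.differentiable (by simp)
  have h𝒢2 := (contDiff_fderiv_infty h𝒢).differentiable (by simp)
  have h1 : HasFDerivAt (fun a : E13 ↦ ψ a.1) (deriv ψ a.1 • ContinuousLinearMap.fst ℝ ℝ E3) a :=
    (hψ1 a.1).hasDerivAt.comp_hasFDerivAt a hasFDerivAt_fst
  have h1' : HasFDerivAt (fun a : E13 ↦ deriv ψ a.1)
      (deriv (deriv ψ) a.1 • ContinuousLinearMap.fst ℝ ℝ E3) a :=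
    (hψ2 a.1).hasDerivAt.comp_hasFDerivAt a hasFDerivAt_fst
  have h2 : HasFDerivAt (fun a : E13 ↦ 𝒢 a.2) (pullSnd (fderiv ℝ 𝒢 a.2)) a :=
    (h𝒢1 a.2).hasFDerivAt.comp a hasFDerivAt_snd
  have h3 : HasFDerivAt (fun a : E13 ↦ pullSnd (fderiv ℝ 𝒢 a.2))
      (pullSnd.comp ((fderiv ℝ (fderiv ℝ 𝒢) a.2).comp (ContinuousLinearMap.snd ℝ ℝ E3))) a :=
    pullSnd.hasFDerivAt.comp a ((h𝒢2 a.2).hasFDerivAt.comp a hasFDerivAt_snd)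
  have h4 := (((h1'.mul h2).smul_const (ContinuousLinearMap.fst ℝ ℝ E3)).add
    (h1.smul h3)).const_smul α
  refine (congrArg (fun L ↦ L v) h4.fderiv).trans ?_
  refine ContinuousLinearMap.ext fun w ↦ ?_
  change α * ((deriv ψ a.1 * (fderiv ℝ 𝒢 a.2 v.2) + 𝒢 a.2 * (deriv (deriv ψ) a.1 * v.1)) * w.1 +
      (ψ a.1 * (fderiv ℝ (fderiv ℝ 𝒢) a.2 v.2 w.2) +
        (deriv ψ a.1 * v.1) * (fderiv ℝ 𝒢 a.2 w.2))) =
    α * (((deriv (deriv ψ) a.1 * v.1 * 𝒢 a.2 + deriv ψ a.1 * fderiv ℝ 𝒢 a.2 v.2) * w.1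
      + (deriv ψ a.1 * v.1) * (fderiv ℝ 𝒢 a.2 w.2))
      + ψ a.1 * (fderiv ℝ (fderiv ℝ 𝒢) a.2 v.2 w.2))
  ring

end

theorem hasFDerivAt_comp_snd {F : Type*} [NormedAddCommGroup F] [NormedSpace ℝ F] {f : E3 → F}
    {a : E13} (h : DifferentiableAt ℝ f a.2) : HasFDerivAt (fun a : E13 ↦ f a.2)
      ((fderiv ℝ f a.2).comp (ContinuousLinearMap.snd ℝ ℝ E3)) a :=
  h.hasFDerivAt.comp a hasFDerivAt_snd

/-- The Hamiltonian vector field of `θ`-translation plus `α ψ 𝒢`, in flowbox coordinates, for the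
Poisson tensor `𝓑`. -/
noncomputable def flatVF (𝓑 : E3 → (E13 →L[ℝ] ℝ) →L[ℝ] E13) (α : ℝ) (ψ : ℝ → ℝ) (𝒢 : E3 → ℝ)
    (a : E13) : E13 :=
  (1, 0) + 𝓑 a.2 (dPert α ψ 𝒢 a)

/-- The linearization of the perturbation at the origin. -/
noncomputable def flatGen (𝓑 : E3 → (E13 →L[ℝ] ℝ) →L[ℝ] E13) (q : E3 →L[ℝ] E3 →L[ℝ] ℝ) :
    E13 →L[ℝ] E13 :=
  𝓑 0 ∘L pullSnd ∘L q ∘L ContinuousLinearMap.snd ℝ ℝ E3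

/-- The bounds on the data of the perturbation which the estimates of the perturbed flow use. -/
structure FlatBounds (𝓑 : E3 → (E13 →L[ℝ] ℝ) →L[ℝ] E13) (q : E3 →L[ℝ] E3 →L[ℝ] ℝ) (ψ : ℝ → ℝ)
    (r₁ B Q C m α Ψ : ℝ) : Prop where
  contDiff : ContDiffOn ℝ 1 𝓑 (ball 0 r₁)
  hB : 0 ≤ B
  hQ : 0 ≤ Q
  hC : 0 ≤ C
  hα : 0 ≤ α
  norm_le : ∀ c ∈ ball (0 : E3) r₁, ∀ β, ‖𝓑 c β‖ ≤ B * ‖β‖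
  norm_fderiv_le : ∀ c ∈ ball (0 : E3) r₁, ∀ v β, ‖fderiv ℝ 𝓑 c v β‖ ≤ B * ‖v‖ * ‖β‖
  norm_sub_le : ∀ c ∈ ball (0 : E3) r₁, ∀ β, ‖𝓑 c β - 𝓑 0 β‖ ≤ B * ‖c‖ * ‖β‖
  norm_mixed_le : ∀ β, ‖(𝓑 0 (pullSnd β)).2‖ ≤ m * ‖β‖
  norm_q_le : ∀ a, ‖q a‖ ≤ Q * ‖a‖
  contDiff_bump : ContDiff ℝ ∞ ψ
  bump_le : ∀ θ, |ψ θ| ≤ Ψ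
  deriv_bump_le : ∀ θ, |deriv ψ θ| ≤ Ψ
  deriv2_bump_le : ∀ θ, |deriv (deriv ψ) θ| ≤ Ψ

namespace FlatBounds

variable {𝓑 : E3 → (E13 →L[ℝ] ℝ) →L[ℝ] E13} {q : E3 →L[ℝ] E3 →L[ℝ] ℝ} {ψ : ℝ → ℝ}
  {r₁ B Q C m α Ψ ρ : ℝ} {𝒢 : E3 → ℝ}

theorem bump_nonneg (h : FlatBounds 𝓑 q ψ r₁ B Q C m α Ψ) : 0 ≤ Ψ :=
  (abs_nonneg _).trans (h.bump_le 0)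

theorem abs_bump_sub_le (h : FlatBounds 𝓑 q ψ r₁ B Q C m α Ψ) (θ t : ℝ) :
    |ψ θ - ψ t| ≤ Ψ * |θ - t| := by
  have := convex_univ.norm_image_sub_le_of_norm_deriv_le (f := ψ) (C := Ψ) (x := t) (y := θ)
    (fun x _ ↦ h.contDiff_bump.differentiable (by simp) x) (fun x _ ↦ h.deriv_bump_le x)
    (mem_univ _) (mem_univ _)
  simpa [Real.norm_eq_abs] using this

theorem norm_dPert_le (h : FlatBounds 𝓑 q ψ r₁ B Q C m α Ψ) (hρ : 0 ≤ ρ) (hρ1 : ρ ≤ 1) {a : E13}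
    (h0 : |𝒢 a.2| ≤ C * ρ ^ 2) (h1 : ‖fderiv ℝ 𝒢 a.2‖ ≤ C * ρ) :
    ‖dPert α ψ 𝒢 a‖ ≤ 2 * α * Ψ * C * ρ := by
  have hΨ := h.bump_nonneg
  have hα := h.hα
  have hC := h.hC
  have e1 : ‖(deriv ψ a.1 * 𝒢 a.2) • ContinuousLinearMap.fst ℝ ℝ E3‖ ≤ Ψ * (C * ρ) := by
    rw [norm_smul, norm_mul, Real.norm_eq_abs, Real.norm_eq_abs]
    calc _ ≤ Ψ * (C * ρ ^ 2) * 1 := by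
          gcongr
          exacts [h.deriv_bump_le _, ContinuousLinearMap.norm_fst_le _ _ _]
      _ ≤ Ψ * (C * ρ) := by rw [mul_one]; gcongr; nlinarith
  have e2 : ‖ψ a.1 • pullSnd (fderiv ℝ 𝒢 a.2)‖ ≤ Ψ * (C * ρ) := by
    rw [norm_smul, Real.norm_eq_abs]
    exact mul_le_mul (h.bump_le _) ((norm_pullSnd_le _).trans h1) (norm_nonneg _) hΨ
  rw [dPert, norm_smul, Real.norm_of_nonneg hα]
  calc _ ≤ α * (Ψ * (C * ρ) + Ψ * (C * ρ)) := by
        gcongr; exact (norm_add_le _ _).trans (add_le_add e1 e2)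
    _ = _ := by ring

theorem norm_flatVF_sub_le (h : FlatBounds 𝓑 q ψ r₁ B Q C m α Ψ) (hρ : 0 ≤ ρ) (hρ1 : ρ ≤ 1)
    {a : E13} (ha : a.2 ∈ ball 0 r₁) (h0 : |𝒢 a.2| ≤ C * ρ ^ 2)
    (h1 : ‖fderiv ℝ 𝒢 a.2‖ ≤ C * ρ) :
    ‖flatVF 𝓑 α ψ 𝒢 a - (1, 0)‖ ≤ B * (2 * α * Ψ * C * ρ) := by
  rw [flatVF, add_sub_cancel_left]
  exact (h.norm_le _ ha _).trans
    (mul_le_mul_of_nonneg_left (h.norm_dPert_le hρ hρ1 h0 h1) h.hB)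

theorem norm_flatVF_snd_le (h : FlatBounds 𝓑 q ψ r₁ B Q C m α Ψ) (hρ : 0 ≤ ρ)
    {a : E13} (ha : a.2 ∈ ball 0 r₁) (h0 : |𝒢 a.2| ≤ C * ρ ^ 2)
    (h1 : ‖fderiv ℝ 𝒢 a.2‖ ≤ C * ρ) (hm : 0 ≤ m) :
    ‖(flatVF 𝓑 α ψ 𝒢 a).2‖ ≤ (α * Ψ * C * m + α * Ψ * C * B * (ρ + ‖a.2‖)) * ρ := by
  have hΨ := h.bump_nonneg
  have hα := h.hα
  have hC := h.hC
  have hB := h.hB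
  set β := fderiv ℝ 𝒢 a.2
  have e : (flatVF 𝓑 α ψ 𝒢 a).2 = (α * (deriv ψ a.1 * 𝒢 a.2)) •
      (𝓑 a.2 (ContinuousLinearMap.fst ℝ ℝ E3)).2 + (α * ψ a.1) • ((𝓑 0 (pullSnd β)).2 +
      (𝓑 a.2 (pullSnd β) - 𝓑 0 (pullSnd β)).2) := by
    simp only [flatVF, dPert, map_smul, map_add, Prod.snd_add, Prod.smul_snd, Prod.snd_sub, zero_add,
      add_sub_cancel, smul_add, smul_smul, β]
  have e1 : ‖(𝓑 a.2 (ContinuousLinearMap.fst ℝ ℝ E3)).2‖ ≤ B :=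
    ((norm_snd_le _).trans (h.norm_le _ ha _)).trans
      (mul_le_of_le_one_right hB (ContinuousLinearMap.norm_fst_le _ _ _))
  have e2 : ‖(𝓑 0 (pullSnd β)).2‖ ≤ m * (C * ρ) := (h.norm_mixed_le β).trans (by gcongr)
  have e3 : ‖(𝓑 a.2 (pullSnd β) - 𝓑 0 (pullSnd β)).2‖ ≤ B * ‖a.2‖ * (C * ρ) :=
    ((norm_snd_le _).trans (h.norm_sub_le _ ha _)).trans
      (by gcongr; exact (norm_pullSnd_le _).trans h1)
  rw [e]
  refine (norm_add_le _ _).trans ?_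
  rw [norm_smul, norm_smul, norm_mul, norm_mul, norm_mul, Real.norm_of_nonneg hα,
    Real.norm_eq_abs, Real.norm_eq_abs, Real.norm_eq_abs]
  calc _ ≤ α * (Ψ * (C * ρ ^ 2)) * B + α * Ψ * (m * (C * ρ) + B * ‖a.2‖ * (C * ρ)) := by
        gcongr
        exacts [h.deriv_bump_le _, h.bump_le _, (norm_add_le _ _).trans (add_le_add e2 e3)]
    _ = _ := by ring

theorem hasFDerivAt_flatVF (h : FlatBounds 𝓑 q ψ r₁ B Q C m α Ψ) (h𝒢 : ContDiff ℝ ∞ 𝒢)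
    {a : E13} (ha : a.2 ∈ ball 0 r₁) (v : E13) :
    DifferentiableAt ℝ (flatVF 𝓑 α ψ 𝒢) a ∧ fderiv ℝ (flatVF 𝓑 α ψ 𝒢) a v =
      𝓑 a.2 (fderiv ℝ (dPert α ψ 𝒢) a v) + fderiv ℝ 𝓑 a.2 v.2 (dPert α ψ 𝒢 a) := by
  have h2 := hasFDerivAt_comp_snd (a := a)
    ((h.contDiff.contDiffAt (isOpen_ball.mem_nhds ha)).differentiableAt (by simp))
  have h3 := (((contDiff_dPert (α := α) h.contDiff_bump h𝒢).differentiable (by simp)) a).hasFDerivAt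
  have h4 := (h2.clm_apply h3).const_add (1, 0)
  exact ⟨h4.differentiableAt, congrArg (fun L ↦ L v) h4.fderiv⟩

theorem norm_fderiv_flatVF_sub_le (h : FlatBounds 𝓑 q ψ r₁ B Q C m α Ψ) (h𝒢 : ContDiff ℝ ∞ 𝒢)
    (hρ : 0 ≤ ρ) (hρ1 : ρ ≤ 1) {a : E13} (ha : a.2 ∈ ball 0 r₁) (h0 : |𝒢 a.2| ≤ C * ρ ^ 2)
    (h1 : ‖fderiv ℝ 𝒢 a.2‖ ≤ C * ρ) (h2 : ∀ ξ, fderiv ℝ (fderiv ℝ 𝒢) a.2 ξ = q ξ) (t : ℝ) :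
    ‖fderiv ℝ (flatVF 𝓑 α ψ 𝒢) a - (α * ψ t) • flatGen 𝓑 q‖ ≤
      α * Ψ * B * (5 * C + Q) * (ρ + ‖a.2‖ + |a.1 - t|) := by
  have hΨ := h.bump_nonneg
  have hα := h.hα
  have hC := h.hC
  have hB := h.hB
  have hQ := h.hQ
  refine ContinuousLinearMap.opNorm_le_bound _ (by positivity) fun v ↦ ?_
  have hv1 : |v.1| ≤ ‖v‖ := norm_fst_le v
  have hv2 : ‖v.2‖ ≤ ‖v‖ := norm_snd_le v
  have hv := norm_nonneg v
  set β := fderiv ℝ 𝒢 a.2 with hβ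
  set χ : E13 →L[ℝ] ℝ := (deriv (deriv ψ) a.1 * v.1 * 𝒢 a.2 + deriv ψ a.1 * β v.2) •
    ContinuousLinearMap.fst ℝ ℝ E3 + (deriv ψ a.1 * v.1) • pullSnd β with hχ
  have e : (fderiv ℝ (flatVF 𝓑 α ψ 𝒢) a - (α * ψ t) • flatGen 𝓑 q) v =
      fderiv ℝ 𝓑 a.2 v.2 (dPert α ψ 𝒢 a) + α • 𝓑 a.2 χ +
      ((α * ψ a.1) • (𝓑 a.2 (pullSnd (q v.2)) - 𝓑 0 (pullSnd (q v.2))) +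
        (α * (ψ a.1 - ψ t)) • 𝓑 0 (pullSnd (q v.2))) := by
    have e0 : (fderiv ℝ (flatVF 𝓑 α ψ 𝒢) a - (α * ψ t) • flatGen 𝓑 q) v =
      fderiv ℝ (flatVF 𝓑 α ψ 𝒢) a v - (α * ψ t) • 𝓑 0 (pullSnd (q v.2)) := rfl
    rw [e0, (h.hasFDerivAt_flatVF h𝒢 ha v).2, fderiv_dPert_apply h.contDiff_bump h𝒢, h2, map_smul,
      map_add, map_smul]
    module
  have b1 : ‖fderiv ℝ 𝓑 a.2 v.2 (dPert α ψ 𝒢 a)‖ ≤ B * ‖v‖ * (2 * α * Ψ * C * ρ) :=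
    (h.norm_fderiv_le _ ha _ _).trans (by gcongr; exact h.norm_dPert_le hρ hρ1 h0 h1)
  have bχ : ‖χ‖ ≤ 3 * Ψ * C * ρ * ‖v‖ := by
    have c1 : ‖(deriv (deriv ψ) a.1 * v.1 * 𝒢 a.2 + deriv ψ a.1 * β v.2)‖ ≤
        Ψ * ‖v‖ * (C * ρ) + Ψ * (C * ρ * ‖v‖) := by
      refine (norm_add_le _ _).trans ?_
      rw [norm_mul, norm_mul, norm_mul]
      simp only [Real.norm_eq_abs]
      have : |𝒢 a.2| ≤ C * ρ := h0.trans (by gcongr; nlinarith)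
      have h3 : |β v.2| ≤ C * ρ * ‖v‖ := (β.le_opNorm v.2).trans (by gcongr)
      gcongr
      exacts [h.deriv2_bump_le _, h.deriv_bump_le _]
    have c2 : ‖(deriv ψ a.1 * v.1) • pullSnd β‖ ≤ Ψ * ‖v‖ * (C * ρ) := by
      rw [norm_smul, norm_mul, Real.norm_eq_abs, Real.norm_eq_abs]
      gcongr
      exacts [h.deriv_bump_le _, (norm_pullSnd_le _).trans h1]
    refine (norm_add_le _ _).trans ((add_le_add ?_ c2).trans (b := Ψ * ‖v‖ * (C * ρ) +
      Ψ * (C * ρ * ‖v‖) + Ψ * ‖v‖ * (C * ρ)) (by linarith))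
    rw [norm_smul]
    exact (mul_le_of_le_one_right (norm_nonneg _) (ContinuousLinearMap.norm_fst_le _ _ _)).trans c1
  have bq : ‖pullSnd (q v.2)‖ ≤ Q * ‖v‖ :=
    (norm_pullSnd_le _).trans ((h.norm_q_le _).trans (by gcongr))
  have b2 : ‖α • 𝓑 a.2 χ‖ ≤ α * (B * (3 * Ψ * C * ρ * ‖v‖)) := by
    rw [norm_smul, Real.norm_of_nonneg hα]
    gcongr
    exact (h.norm_le _ ha _).trans (by gcongr)
  have b3 : ‖(α * ψ a.1) • (𝓑 a.2 (pullSnd (q v.2)) - 𝓑 0 (pullSnd (q v.2)))‖ ≤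
      α * Ψ * (B * ‖a.2‖ * (Q * ‖v‖)) := by
    rw [norm_smul, norm_mul, Real.norm_of_nonneg hα, Real.norm_eq_abs]
    gcongr
    exacts [h.bump_le _, (h.norm_sub_le _ ha _).trans (by gcongr)]
  have b4 : ‖(α * (ψ a.1 - ψ t)) • 𝓑 0 (pullSnd (q v.2))‖ ≤
      α * (Ψ * |a.1 - t|) * (B * (Q * ‖v‖)) := by
    rw [norm_smul, norm_mul, Real.norm_of_nonneg hα, Real.norm_eq_abs]
    have hr₁ : (0 : E3) ∈ ball 0 r₁ := by
      rw [mem_ball_zero_iff] at ha ⊢; rw [norm_zero]; exact (norm_nonneg _).trans_lt ha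
    gcongr
    exacts [h.abs_bump_sub_le _ _, (h.norm_le _ hr₁ _).trans (by gcongr)]
  rw [e]
  refine (norm_add_le _ _).trans ((add_le_add ((norm_add_le _ _).trans (add_le_add b1 b2))
    ((norm_add_le _ _).trans (add_le_add b3 b4))).trans ?_)
  have p1 : 0 ≤ α * Ψ * B * ‖v‖ * (Q * ρ) := by positivity
  have p2 : 0 ≤ α * Ψ * B * ‖v‖ * (5 * C * (‖a.2‖ + |a.1 - t|)) := by positivity
  linarith

end FlatBounds

/-- The solution of `V' = α ψ N V` at the time where `∫ ψ = s / α`, if `N ^ 3 = -N`. -/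
noncomputable def rotExp (N : E13 →L[ℝ] E13) (s : ℝ) : E13 →L[ℝ] E13 :=
  1 + Real.sin s • N + (1 - Real.cos s) • (N * N)

theorem rotExp_zero (N : E13 →L[ℝ] E13) : rotExp N 0 = 1 := by
  refine ContinuousLinearMap.ext fun v ↦ ?_
  change v + Real.sin 0 • N v + (1 - Real.cos 0) • N (N v) = v
  simp

theorem hasDerivAt_rotExp {N : E13 →L[ℝ] E13} (hN : N * (N * N) = -N) {σ : ℝ → ℝ} {σ' t : ℝ}
    (hσ : HasDerivAt σ σ' t) :
    HasDerivAt (fun t ↦ rotExp N (σ t)) (σ' • (N * rotExp N (σ t))) t := by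
  have h1 := ((hσ.sin.smul_const N).const_add 1).add ((hσ.cos.const_sub 1).smul_const (N * N))
  refine h1.congr_deriv ?_
  have h2 : N * rotExp N (σ t) =
      Real.cos (σ t) • N + Real.sin (σ t) • (N * N) := by
    refine ContinuousLinearMap.ext fun v ↦ ?_
    have h3 : N (N (N v)) = -N v := congrArg (fun L ↦ L v) hN
    change N (v + Real.sin (σ t) • N v + (1 - Real.cos (σ t)) • N (N v)) =
      Real.cos (σ t) • N v + Real.sin (σ t) • N (N v)
    rw [map_add, map_add, map_smul, map_smul, h3]
    module
  rw [h2]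
  module

theorem norm_rotExp_le (N : E13 →L[ℝ] E13) (s : ℝ) : ‖rotExp N s‖ ≤ 1 + ‖N‖ + 2 * ‖N‖ ^ 2 := by
  refine (norm_add_le _ _).trans (add_le_add ((norm_add_le _ _).trans (add_le_add ?_ ?_)) ?_)
  · exact ContinuousLinearMap.norm_id_le
  · rw [norm_smul, Real.norm_eq_abs]
    exact mul_le_of_le_one_left (norm_nonneg _) (Real.abs_sin_le_one s)
  · rw [norm_smul, Real.norm_eq_abs, sq]
    have : |1 - Real.cos s| ≤ 2 := by
      rw [abs_le]; constructor <;> linarith [Real.neg_one_le_cos s, Real.cos_le_one s]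
    gcongr
    exact norm_mul_le _ _

theorem norm_sub_rotExp_le {N : E13 →L[ℝ] E13} (hN : N * (N * N) = -N) {σ σ' : ℝ → ℝ}
    (hσ : ∀ t, HasDerivAt σ (σ' t) t) (hσ0 : σ 0 = 0) {D V : ℝ → E13 →L[ℝ] E13} (hV0 : V 0 = 1)
    (hV : ∀ t, HasDerivAt V (D t ∘L V t) t) {κ₀ δ : ℝ} (hκ : 0 < κ₀)
    (hD : ∀ t ∈ Icc (0 : ℝ) 1, ‖D t‖ ≤ κ₀) (hDN : ∀ t ∈ Icc (0 : ℝ) 1, ‖D t - σ' t • N‖ ≤ δ) :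
    ‖V 1 - rotExp N (σ 1)‖ ≤ δ * ((1 + ‖N‖ + 2 * ‖N‖ ^ 2) / κ₀ * Real.exp κ₀) := by
  have hδ : 0 ≤ δ := (norm_nonneg _).trans (hDN 0 (by simp))
  have hd : ∀ t, HasDerivAt (fun t ↦ V t - rotExp N (σ t))
      (D t * V t - σ' t • (N * rotExp N (σ t))) t := fun t ↦
    (hV t).sub (hasDerivAt_rotExp hN (hσ t))
  have hgr := norm_le_gronwallBound_of_norm_deriv_right_le (δ := 0) (K := κ₀)
    (ε := δ * (1 + ‖N‖ + 2 * ‖N‖ ^ 2))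
    (a := 0) (b := 1) (fun t _ ↦ (hd t).continuousAt.continuousWithinAt)
    (fun t _ ↦ (hd t).hasDerivWithinAt) (by rw [hV0, hσ0, rotExp_zero, sub_self, norm_zero]) (fun t ht ↦ ?_) 1 (by simp)
  · rw [gronwallBound_of_K_ne_0 hκ.ne'] at hgr
    refine hgr.trans ?_
    simp only [zero_mul, zero_add, sub_zero, mul_one]
    have : δ * (1 + ‖N‖ + 2 * ‖N‖ ^ 2) / κ₀ * (Real.exp κ₀ - 1) ≤
      δ * (1 + ‖N‖ + 2 * ‖N‖ ^ 2) / κ₀ * Real.exp κ₀ := by gcongr; linarith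
    exact this.trans_eq (by ring)
  · have ht' : t ∈ Icc (0 : ℝ) 1 := ⟨ht.1, ht.2.le⟩
    have e1 : D t * V t - σ' t • (N * rotExp N (σ t)) =
        D t * (V t - rotExp N (σ t)) + (D t - σ' t • N) * rotExp N (σ t) := by
      refine ContinuousLinearMap.ext fun v ↦ ?_
      change D t (V t v) - σ' t • N (rotExp N (σ t) v) =
        D t (V t v - rotExp N (σ t) v) + (D t (rotExp N (σ t) v) - σ' t • N (rotExp N (σ t) v))
      rw [map_sub]
      abel
    rw [e1]
    refine (norm_add_le _ _).trans (add_le_add ?_ ?_)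
    · exact (norm_mul_le _ _).trans (by gcongr; exact hD t ht')
    · exact (norm_mul_le _ _).trans
        (mul_le_mul (hDN t ht') (norm_rotExp_le N _) (norm_nonneg _) hδ)

namespace FlatBounds

variable {𝓑 : E3 → (E13 →L[ℝ] ℝ) →L[ℝ] E13} {q : E3 →L[ℝ] E3 →L[ℝ] ℝ} {ψ : ℝ → ℝ}
  {r₁ B Q C m α Ψ η : ℝ}

/-- A solution which starts at a good point stays near its starting point in the section, and
moves with almost unit speed. -/
theorem exists_confinement (h : FlatBounds 𝓑 q ψ r₁ B Q C m α Ψ) (hr₁ : 0 < r₁) (hm : 0 ≤ m)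
    (hη : 0 < η) (hη1 : η < 1) (hαη : α * Ψ * C * m ≤ η / 4) :
    ∃ r₀ > 0, ∀ (𝒢 : E3 → ℝ) (c₀ : E3) (ρ : ℝ), ‖c₀‖ < r₀ → 0 < ρ → ρ < r₀ →
      (∀ ζ ∈ closedBall c₀ (η * ρ), |𝒢 ζ| ≤ C * ρ ^ 2 ∧ ‖fderiv ℝ 𝒢 ζ‖ ≤ C * ρ) →
      ∀ a : ℝ → E13, a 0 = (0, c₀) → (∀ t, HasDerivAt a (flatVF 𝓑 α ψ 𝒢 (a t)) t) →
        ∀ t ∈ Icc (0 : ℝ) 1, ‖(a t).2 - c₀‖ ≤ η * ρ / 2 ∧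
          |(a t).1 - t| ≤ B * (2 * α * Ψ * C * ρ) := by
  have hΨ := h.bump_nonneg
  have hα := h.hα
  have hC := h.hC
  have hB := h.hB
  set k : ℝ := α * Ψ * C * B with hk
  have hk0 : 0 ≤ k := by positivity
  refine ⟨min (min (1 / 2) (r₁ / 2)) (η / (16 * (k + 1))), by positivity, ?_⟩
  intro 𝒢 c₀ ρ hc₀ hρ hρ0 h𝒢 a ha0 ha
  obtain ⟨⟨hc1, hc2⟩, hc3⟩ := (lt_min_iff.1 hc₀).imp_left lt_min_iff.1
  obtain ⟨⟨hρ1, hρ2⟩, hρ3⟩ := (lt_min_iff.1 hρ0).imp_left lt_min_iff.1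
  have hηρ : η * ρ < ρ := mul_lt_of_lt_one_left hρ hη1
  have hηρ0 : 0 < η * ρ := by positivity
  have hball : ∀ ζ ∈ closedBall c₀ (η * ρ), ζ ∈ ball (0 : E3) r₁ ∧ ‖ζ‖ ≤ ‖c₀‖ + ρ := by
    intro ζ hζ
    have h2 : ‖ζ - c₀‖ ≤ η * ρ := by rwa [mem_closedBall, dist_eq_norm] at hζ
    have h3 : ‖ζ‖ ≤ ‖ζ - c₀‖ + ‖c₀‖ := by simpa using norm_add_le (ζ - c₀) c₀
    rw [mem_ball_zero_iff]
    constructor <;> linarith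
  have hd2 : ∀ t, HasDerivAt (fun t ↦ (a t).2 - c₀) (flatVF 𝓑 α ψ 𝒢 (a t)).2 t := fun t ↦
    ((ContinuousLinearMap.snd ℝ ℝ E3).hasFDerivAt.comp_hasDerivAt t (ha t)).sub_const c₀
  have hconf : ∀ t ∈ Icc (0 : ℝ) 1, ‖(a t).2 - c₀‖ ≤ η * ρ / 2 * t := by
    refine image_norm_le_of_norm_deriv_right_lt_deriv_boundary (B' := fun _ ↦ η * ρ / 2)
      (fun t _ ↦ (hd2 t).continuousAt.continuousWithinAt)
      (fun t _ ↦ (hd2 t).hasDerivWithinAt) (by simp [ha0]) (fun t ↦ ?_) fun t ht hB ↦ ?_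
    · simpa using (hasDerivAt_id t).const_mul (η * ρ / 2)
    · have hmem : (a t).2 ∈ closedBall c₀ (η * ρ) := by
        rw [mem_closedBall, dist_eq_norm, hB]
        nlinarith [ht.1, ht.2]
      obtain ⟨h1, h2⟩ := hball _ hmem
      obtain ⟨h3, h4⟩ := h𝒢 _ hmem
      refine (h.norm_flatVF_snd_le hρ.le h1 h3 h4 hm).trans_lt ?_
      have h5 : α * Ψ * C * B * (ρ + ‖(a t).2‖) < η / 4 := by
        rw [← hk]
        have e1 : (16 * (k + 1)) * ρ < η := by rwa [mul_comm, ← lt_div_iff₀ (by positivity)]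
        have e2 : (16 * (k + 1)) * ‖c₀‖ < η := by rwa [mul_comm, ← lt_div_iff₀ (by positivity)]
        have e3 : k * (ρ + ‖(a t).2‖) ≤ k * (ρ + (‖c₀‖ + ρ)) := by gcongr
        nlinarith [norm_nonneg c₀]
      calc _ < (η / 4 + η / 4) * ρ := by
            apply mul_lt_mul_of_pos_right _ hρ; linarith
        _ = _ := by ring
  have hmem : ∀ t ∈ Icc (0 : ℝ) 1, (a t).2 ∈ closedBall c₀ (η * ρ) := fun t ht ↦ by
    rw [mem_closedBall, dist_eq_norm]
    exact (hconf t ht).trans (by nlinarith [ht.1, ht.2])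
  intro t ht
  refine ⟨(hconf t ht).trans (by nlinarith [ht.1, ht.2]), ?_⟩
  have hd1 : ∀ t, HasDerivAt (fun t ↦ (a t).1 - t) ((flatVF 𝓑 α ψ 𝒢 (a t)).1 - 1) t := fun t ↦
    ((ContinuousLinearMap.fst ℝ ℝ E3).hasFDerivAt.comp_hasDerivAt t (ha t)).sub (hasDerivAt_id t)
  have h6 := (convex_Icc (0 : ℝ) 1).norm_image_sub_le_of_norm_hasDerivWithin_le
    (f := fun t ↦ (a t).1 - t) (C := B * (2 * α * Ψ * C * ρ)) (x := 0) (y := t)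
    (fun u _ ↦ (hd1 u).hasDerivWithinAt) (fun u hu ↦ ?_) ⟨le_rfl, zero_le_one⟩ ht
  · simp only [ha0, sub_zero, Real.norm_eq_abs] at h6
    refine h6.trans ?_
    rw [abs_of_nonneg ht.1]
    exact mul_le_of_le_one_right (by positivity) ht.2
  · obtain ⟨h1, -⟩ := hball _ (hmem u hu)
    obtain ⟨h3, h4⟩ := h𝒢 _ (hmem u hu)
    exact (norm_fst_le (flatVF 𝓑 α ψ 𝒢 (a u) - (1, 0))).trans
      (h.norm_flatVF_sub_le hρ.le (by linarith) h1 h3 h4)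

/-- The linearization along a solution which starts at a good point is almost a rotation. -/
theorem exists_linearization (h : FlatBounds 𝓑 q ψ r₁ B Q C m α Ψ) (hr₁ : 0 < r₁) (hm : 0 ≤ m)
    (hη : 0 < η) (hη1 : η < 1) (hαη : α * Ψ * C * m ≤ η / 4)
    (hN : flatGen 𝓑 q * (flatGen 𝓑 q * flatGen 𝓑 q) = -flatGen 𝓑 q)
    (hψ : ∫ t in (0 : ℝ)..1, ψ t = 1) {δ : ℝ} (hδ : 0 < δ) :
    ∃ r₀ > 0, ∀ (𝒢 : E3 → ℝ) (c₀ : E3) (ρ : ℝ), ContDiff ℝ ∞ 𝒢 → ‖c₀‖ < r₀ → 0 < ρ → ρ < r₀ →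
      (∀ ζ ∈ closedBall c₀ (η * ρ), |𝒢 ζ| ≤ C * ρ ^ 2 ∧ ‖fderiv ℝ 𝒢 ζ‖ ≤ C * ρ) →
      (∀ ζ ∈ ball c₀ (η * ρ), ∀ ξ, fderiv ℝ (fderiv ℝ 𝒢) ζ ξ = q ξ) →
      ∀ (a : ℝ → E13) (V : ℝ → E13 →L[ℝ] E13), a 0 = (0, c₀) →
        (∀ t, HasDerivAt a (flatVF 𝓑 α ψ 𝒢 (a t)) t) → V 0 = 1 →
        (∀ t, HasDerivAt V (fderiv ℝ (flatVF 𝓑 α ψ 𝒢) (a t) ∘L V t) t) →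
        (∀ t ∈ Icc (0 : ℝ) 1, (a t).2 ∈ ball c₀ (η * ρ) ∧ |(a t).1 - t| ≤ δ) ∧
          ‖V 1 - rotExp (flatGen 𝓑 q) α‖ ≤ δ := by
  have hΨ := h.bump_nonneg
  have hα := h.hα
  have hC := h.hC
  have hB := h.hB
  have hQ := h.hQ
  obtain ⟨r₂, hr₂, hconf⟩ := h.exists_confinement hr₁ hm hη hη1 hαη
  set N := flatGen 𝓑 q with hNdef
  set k : ℝ := α * Ψ * B * (5 * C + Q) with hk
  have hk0 : 0 ≤ k := by positivity
  set k₁ : ℝ := B * (2 * α * Ψ * C) with hk₁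
  have hk₁0 : 0 ≤ k₁ := by positivity
  set e₀ : ℝ := 1 + ‖N‖ + 2 * ‖N‖ ^ 2 with he₀
  have he₀0 : 0 < e₀ := by positivity
  set κ₀ : ℝ := α * Ψ * ‖N‖ + 1 with hκ₀
  have hκ₀0 : 0 < κ₀ := by positivity
  set δ₁ : ℝ := min 1 (δ / (e₀ / κ₀ * Real.exp κ₀)) with hδ₁
  have hδ₁0 : 0 < δ₁ := by positivity
  set r₃ : ℝ := min (δ / (k₁ + 1)) (δ₁ / ((k + 1) * (k₁ + 3))) with hr₃
  refine ⟨min (min r₂ r₃) (min (1 / 2) (r₁ / 2)), by positivity, ?_⟩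
  intro 𝒢 c₀ ρ h𝒢 hc₀ hρ hρ0 hb hq a V ha0 ha hV0 hV
  obtain ⟨⟨hc1, hc2⟩, hc3, hc4⟩ := (lt_min_iff.1 hc₀).imp lt_min_iff.1 lt_min_iff.1
  obtain ⟨⟨hρ1, hρ2⟩, hρ3, hρ4⟩ := (lt_min_iff.1 hρ0).imp lt_min_iff.1 lt_min_iff.1
  have hcf := hconf 𝒢 c₀ ρ hc1 hρ hρ1 hb a ha0 ha
  have hηρ : η * ρ < ρ := mul_lt_of_lt_one_left hρ hη1
  have hηρ0 : 0 < η * ρ := by positivity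
  have hin : ∀ t ∈ Icc (0 : ℝ) 1, (a t).2 ∈ ball c₀ (η * ρ) := fun t ht ↦ by
    rw [mem_ball, dist_eq_norm]; linarith [(hcf t ht).1]
  have hka : ∀ t ∈ Icc (0 : ℝ) 1, |(a t).1 - t| ≤ k₁ * ρ := fun t ht ↦
    (hcf t ht).2.trans_eq (by rw [hk₁]; ring)
  obtain ⟨hρ5, hρ6⟩ := lt_min_iff.1 hρ2
  obtain ⟨hc5, hc6⟩ := lt_min_iff.1 hc2
  have hA : ∀ t ∈ Icc (0 : ℝ) 1,
      ‖fderiv ℝ (flatVF 𝓑 α ψ 𝒢) (a t) - (α * ψ t) • N‖ ≤ δ₁ := by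
    intro t ht
    have hcl := ball_subset_closedBall (hin t ht)
    have h2 : ‖(a t).2 - c₀‖ < η * ρ := by simpa [dist_eq_norm] using hin t ht
    have h3 : ‖(a t).2‖ ≤ ‖(a t).2 - c₀‖ + ‖c₀‖ := by simpa using norm_add_le ((a t).2 - c₀) c₀
    have hmem : (a t).2 ∈ ball (0 : E3) r₁ := by rw [mem_ball_zero_iff]; linarith
    refine (h.norm_fderiv_flatVF_sub_le h𝒢 hρ.le (by linarith) hmem (hb _ hcl).1 (hb _ hcl).2
      (hq _ (hin t ht)) t).trans ?_
    set r := δ₁ / ((k + 1) * (k₁ + 3)) with hr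
    have hr0 : 0 < r := by positivity
    have hrr : (k + 1) * (k₁ + 3) * r = δ₁ := by rw [hr]; field_simp
    have h4 : ρ + ‖(a t).2‖ + |(a t).1 - t| ≤ (k₁ + 3) * r := by
      have := hka t ht
      have e5 : k₁ * ρ ≤ k₁ * r := mul_le_mul_of_nonneg_left hρ6.le hk₁0
      linarith
    calc k * (ρ + ‖(a t).2‖ + |(a t).1 - t|) ≤ (k + 1) * ((k₁ + 3) * r) := by 
          refine mul_le_mul (by linarith) h4 (by positivity) (by positivity)
      _ = δ₁ := by rw [← hrr]; ring
  refine ⟨fun t ht ↦ ⟨hin t ht, (hka t ht).trans ?_⟩, ?_⟩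
  · rw [lt_div_iff₀ (by positivity)] at hρ5
    nlinarith
  set σ : ℝ → ℝ := fun t ↦ α * ∫ u in (0 : ℝ)..t, ψ u with hσ
  have hσd : ∀ t, HasDerivAt σ (α * ψ t) t := fun t ↦
    ((h.contDiff_bump.continuous.integral_hasStrictDerivAt 0 t).hasDerivAt).const_mul α
  have hD : ∀ t ∈ Icc (0 : ℝ) 1, ‖fderiv ℝ (flatVF 𝓑 α ψ 𝒢) (a t)‖ ≤ κ₀ := by
    intro t ht
    have e2 : ‖(α * ψ t) • N‖ ≤ α * Ψ * ‖N‖ := by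
      rw [norm_smul, norm_mul, Real.norm_of_nonneg hα, Real.norm_eq_abs]
      gcongr
      exact h.bump_le t
    have e3 := norm_sub_norm_le (fderiv ℝ (flatVF 𝓑 α ψ 𝒢) (a t)) ((α * ψ t) • N)
    have e4 : δ₁ ≤ 1 := min_le_left _ _
    linarith [hA t ht]
  have hσ1 : σ 1 = α := by simp only [hσ]; rw [hψ, mul_one]
  have hfin := norm_sub_rotExp_le hN hσd (by simp [hσ]) hV0 hV hκ₀0 hD hA
  rw [hσ1] at hfin
  have h7 : δ₁ * (e₀ / κ₀ * Real.exp κ₀) ≤ δ := by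
    have := min_le_right 1 (δ / (e₀ / κ₀ * Real.exp κ₀))
    rwa [← hδ₁, le_div_iff₀ (by positivity)] at this
  exact hfin.trans h7

end FlatBounds

section LinearFrames

/-- The linear map `(τ, ζ) ↦ τ w + B ζ`. -/
noncomputable def secFrame (B : E3 →L[ℝ] E4) (w : E4) : E13 →L[ℝ] E4 :=
  (ContinuousLinearMap.fst ℝ ℝ E3).smulRight w + B ∘L ContinuousLinearMap.snd ℝ ℝ E3

theorem secFrame_apply (B : E3 →L[ℝ] E4) (w : E4) (v : E13) :
    secFrame B w v = v.1 • w + B v.2 := rfl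

theorem contDiff_secFrame (B : E3 →L[ℝ] E4) {n : WithTop ℕ∞} : ContDiff ℝ n (secFrame B) :=
  (ContinuousLinearMap.smulRightL ℝ E13 E4 (ContinuousLinearMap.fst ℝ ℝ E3)).contDiff.add
    contDiff_const

/-- The Poisson tensor of the pullback of the canonical form by a linear isomorphism `S`. -/
noncomputable def secPoisson (S : E13 →L[ℝ] E4) : (E13 →L[ℝ] ℝ) →L[ℝ] E13 :=
  S.inverse ∘L stdSharp ∘L (ContinuousLinearMap.compL ℝ E4 E13 ℝ).flip S.inverse

theorem secPoisson_apply (S : E13 →L[ℝ] E4) (β : E13 →L[ℝ] ℝ) :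
    secPoisson S β = S.inverse (stdSharp (β ∘L S.inverse)) := rfl

theorem ContinuousLinearMap.IsInvertible.apply_inverse {E F : Type*} [NormedAddCommGroup E]
    [NormedSpace ℝ E] [NormedAddCommGroup F] [NormedSpace ℝ F] {S : E →L[ℝ] F}
    (hS : S.IsInvertible) (w : F) : S (S.inverse w) = w := by
  obtain ⟨e, rfl⟩ := hS
  rw [ContinuousLinearMap.inverse_equiv]; exact e.apply_symm_apply w

theorem ContinuousLinearMap.IsInvertible.inverse_apply {E F : Type*} [NormedAddCommGroup E]
    [NormedSpace ℝ E] [NormedAddCommGroup F] [NormedSpace ℝ F] {S : E →L[ℝ] F}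
    (hS : S.IsInvertible) (w : E) : S.inverse (S w) = w := by
  obtain ⟨e, rfl⟩ := hS
  rw [ContinuousLinearMap.inverse_equiv]; exact e.symm_apply_apply w

theorem stdForm_secPoisson {S : E13 →L[ℝ] E4} (hS : S.IsInvertible) (β : E13 →L[ℝ] ℝ) (w : E13) :
    stdForm (S (secPoisson S β)) (S w) = β w := by
  rw [secPoisson_apply, hS.apply_inverse, stdForm_stdSharp]
  exact congrArg β (hS.inverse_apply w)

theorem isOpen_isInvertible : IsOpen {S : E13 →L[ℝ] E4 | S.IsInvertible} :=
  ContinuousLinearEquiv.isOpen (𝕜 := ℝ) (E := E13) (F := E4)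

theorem contDiffOn_secPoisson {n : WithTop ℕ∞} :
    ContDiffOn ℝ n secPoisson {S : E13 →L[ℝ] E4 | S.IsInvertible} := by
  rw [contDiffOn_clm_apply]
  rintro β S hS
  have h1 : ContDiffAt ℝ n (fun S : E13 →L[ℝ] E4 ↦ S.inverse) S := by
    obtain ⟨e, rfl⟩ := hS
    exact contDiffAt_map_inverse e
  have h2 : ContDiffAt ℝ n (fun S : E13 →L[ℝ] E4 ↦ β ∘L S.inverse) S := contDiffAt_const.clm_comp h1
  have h3 : ContDiffAt ℝ n (fun S : E13 →L[ℝ] E4 ↦ stdSharp (β ∘L S.inverse)) S :=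
    contDiffAt_const.clm_apply h2
  exact (h1.clm_apply h3).contDiffWithinAt

end LinearFrames

theorem IsCompact.exists_bound_of_local {X : Type*} [TopologicalSpace X] {K : Set X}
    (hK : IsCompact K) {P : ℝ → X → Prop} (hP : ∀ C C' z, C ≤ C' → P C z → P C' z)
    (h : ∀ x ∈ K, ∃ C, ∀ᶠ z in 𝓝[K] x, P C z) : ∃ C, ∀ z ∈ K, P C z := by
  refine hK.induction_on (p := fun s ↦ ∃ C, ∀ z ∈ s, P C z) ⟨0, by simp⟩
    (fun s t hst ⟨C, hC⟩ ↦ ⟨C, fun z hz ↦ hC z (hst hz)⟩) ?_ fun x hx ↦ ?_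
  · rintro s t ⟨C, hC⟩ ⟨C', hC'⟩
    refine ⟨max C C', fun z hz ↦ hz.elim (fun h ↦ ?_) fun h ↦ ?_⟩
    · exact hP _ _ _ (le_max_left _ _) (hC z h)
    · exact hP _ _ _ (le_max_right _ _) (hC' z h)
  · obtain ⟨C, hC⟩ := h x hx
    exact ⟨_, hC, C, fun z hz ↦ hz⟩

section Frames

variable {M : Type*} [TopologicalSpace M] [ChartedSpace (EuclideanHalfSpace 4) M]
  [IsManifold (𝓡∂ 4) ∞ M] [RiemannianBundle (fun x : M ↦ TangentSpace (𝓡∂ 4) x)]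
  {Ω : SymplecticForm M} {A : DarbouxAtlas Ω} {H : M → ℝ} {x : M}
  {b : Fin 3 → TangentSpace (𝓡∂ 4) x}

theorem IsCompact.exists_form_bound [CompactSpace M]
    [IsContMDiffRiemannianBundle (𝓡∂ 4) ∞ (EuclideanSpace ℝ (Fin 4))
      (fun x : M ↦ TangentSpace (𝓡∂ 4) x)] (A : DarbouxAtlas Ω) :
    ∃ K : ℝ, 0 ≤ K ∧ ∀ x : M, (∀ v w : TangentSpace (𝓡∂ 4) x, |Ω.form x v w| ≤ K * ‖v‖ * ‖w‖) ∧
      ∀ (v : TangentSpace (𝓡∂ 4) x) (k : ℝ), 0 ≤ k → (∀ w, |Ω.form x v w| ≤ k * ‖w‖) →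
        ‖v‖ ≤ K * k := by
  have key := (isCompact_univ (X := M)).exists_bound_of_local
    (P := fun K x ↦ 0 ≤ K ∧ (∀ v w : TangentSpace (𝓡∂ 4) x, |Ω.form x v w| ≤ K * ‖v‖ * ‖w‖) ∧
      ∀ (v : TangentSpace (𝓡∂ 4) x) (k : ℝ), 0 ≤ k → (∀ w, |Ω.form x v w| ≤ k * ‖w‖) →
        ‖v‖ ≤ K * k) ?_ fun x _ ↦ ?_
  · obtain ⟨K, hK⟩ := key
    refine ⟨max K 0, le_max_right _ _, fun x ↦ ?_⟩
    have := hK x (mem_univ x)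
    rw [max_eq_left this.1]
    exact this.2
  · rintro K K' z hKK ⟨h0, h1, h2⟩
    refine ⟨h0.trans hKK, fun v w ↦ (h1 v w).trans (by gcongr), fun v k hk h ↦ (h2 v k hk h).trans
      (by gcongr)⟩
  · have hx := A.mem_source x
    have hd := A.isDarbouxChart (A.idx x)
    set h := A.chart (A.idx x)
    obtain ⟨C, hC, hev⟩ := eventually_norm_chartD_bounds hd.mem hx
    refine ⟨max (‖stdFormL‖ * C * C) (C * ‖stdSharp‖ * C), ?_⟩
    rw [nhdsWithin_univ]
    filter_upwards [hev, h.open_source.mem_nhds hx] with z hz hzs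
    have hle : ∀ v w : TangentSpace (𝓡∂ 4) z,
        |Ω.form z v w| ≤ ‖stdFormL‖ * ‖chartD h z v‖ * ‖chartD h z w‖ := fun v w ↦ by
      rw [hd.form_eq z hzs, ← stdFormL_apply]
      exact stdFormL.le_opNorm₂ _ _
    refine ⟨le_max_of_le_left (by positivity), fun v w ↦ ?_, fun v k hk hw ↦ ?_⟩
    · calc _ ≤ ‖stdFormL‖ * ‖chartD h z v‖ * ‖chartD h z w‖ := hle v w
        _ ≤ ‖stdFormL‖ * (C * ‖v‖) * (C * ‖w‖) := by
          gcongr; exacts [(hz v).2, (hz w).2]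
        _ = ‖stdFormL‖ * C * C * ‖v‖ * ‖w‖ := by ring
        _ ≤ _ := by gcongr; exact le_max_left _ _
    · have h1 : ‖stdFormL (chartD h z v)‖ ≤ k * C := by
        refine ContinuousLinearMap.opNorm_le_bound _ (by positivity) fun a ↦ ?_
        have h2 := hw ((chartD h z).inverse a)
        have h3 := (hz ((chartD h z).inverse a)).1
        rw [hd.form_eq z hzs, chartD_apply_inverse hd.mem hzs] at h2
        rw [chartD_apply_inverse hd.mem hzs] at h3
        rw [stdFormL_apply, Real.norm_eq_abs]
        calc _ ≤ _ := h2
          _ ≤ k * (C * ‖a‖) := by gcongr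
          _ = _ := by ring
      have h4 : chartD h z v = stdSharp (stdFormL (chartD h z v)) :=
        eq_of_stdForm_eq fun a ↦ by rw [stdForm_stdSharp, stdFormL_apply]
      calc ‖v‖ ≤ C * ‖chartD h z v‖ := (hz v).1
        _ ≤ C * (‖stdSharp‖ * ‖stdFormL (chartD h z v)‖) := by
          gcongr; conv_lhs => rw [h4]
          exact stdSharp.le_opNorm _
        _ ≤ C * (‖stdSharp‖ * (k * C)) := by gcongr
        _ = C * ‖stdSharp‖ * C * k := by ring
        _ ≤ _ := by gcongr; exact le_max_right _ _

/-- The vector with coordinates `ζ` in the frame `b`. -/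
noncomputable def frameVec (b : Fin 3 → TangentSpace (𝓡∂ 4) x) : E3 →ₗ[ℝ] TangentSpace (𝓡∂ 4) x where
  toFun ζ := ∑ i, ζ i • b i
  map_add' ζ ξ := by simp [add_smul, Finset.sum_add_distrib]
  map_smul' c ζ := by simp [Finset.smul_sum, mul_smul]

theorem frameVec_apply (ζ : E3) : frameVec b ζ = ∑ i, ζ i • b i := rfl

theorem IsNormalFrame.inner_frameVec (hb : IsNormalFrame Ω H x b) (ζ : E3) :
    inner ℝ (hamVF Ω H x) (frameVec b ζ) = 0 := by
  have h : frameVec b ζ ∈ normalFiber Ω H x := by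
    rw [frameVec_apply]
    exact Submodule.sum_mem _ fun i _ ↦ Submodule.smul_mem _ _ (hb.2.1 i)
  exact Submodule.mem_orthogonal_singleton_iff_inner_right.1 h

theorem IsNormalFrame.norm_frameVec (hb : IsNormalFrame Ω H x b) (ζ : E3) :
    ‖frameVec b ζ‖ = ‖ζ‖ := by
  have h : ‖frameVec b ζ‖ ^ 2 = ‖ζ‖ ^ 2 := by
    rw [← real_inner_self_eq_norm_sq, frameVec_apply, hb.1.inner_sum, EuclideanSpace.norm_sq_eq]
    simp [sq]
  exact (pow_left_inj₀ (norm_nonneg _) (norm_nonneg _) two_ne_zero).1 h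

/-- `(τ, ζ) ↦ τ X_H(x) + ∑ ζ_i b_i`. -/
noncomputable def flowFrame (Ω : SymplecticForm M) (H : M → ℝ) (b : Fin 3 → TangentSpace (𝓡∂ 4) x) :
    E13 →ₗ[ℝ] TangentSpace (𝓡∂ 4) x :=
  (LinearMap.fst ℝ ℝ E3).smulRight (hamVF Ω H x) + frameVec b ∘ₗ LinearMap.snd ℝ ℝ E3

theorem flowFrame_apply (v : E13) : flowFrame Ω H b v = v.1 • hamVF Ω H x + frameVec b v.2 := rfl

theorem IsNormalFrame.norm_flowFrame_sq (hb : IsNormalFrame Ω H x b) (v : E13) :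
    ‖flowFrame Ω H b v‖ ^ 2 = v.1 ^ 2 * ‖hamVF Ω H x‖ ^ 2 + ‖v.2‖ ^ 2 := by
  rw [flowFrame_apply, norm_add_sq_real, inner_smul_left, hb.inner_frameVec, hb.norm_frameVec,
    norm_smul, mul_pow, Real.norm_eq_abs, sq_abs]
  simp

theorem IsNormalFrame.norm_snd_le (hb : IsNormalFrame Ω H x b) (v : E13) :
    ‖v.2‖ ≤ ‖flowFrame Ω H b v‖ := by
  refine (pow_le_pow_iff_left₀ (norm_nonneg _) (norm_nonneg _) two_ne_zero).1 ?_
  rw [hb.norm_flowFrame_sq]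
  have : 0 ≤ v.1 ^ 2 * ‖hamVF Ω H x‖ ^ 2 := by positivity
  linarith

theorem IsNormalFrame.flowFrame_bijective (hb : IsNormalFrame Ω H x b) (hX : hamVF Ω H x ≠ 0) :
    Function.Bijective (flowFrame Ω H b) := by
  have hinj : Function.Injective (flowFrame Ω H b) := by
    refine (injective_iff_map_eq_zero _).2 fun v hv ↦ ?_
    have h1 := hb.norm_flowFrame_sq v
    rw [hv, norm_zero] at h1
    have h2 : 0 < ‖hamVF Ω H x‖ := norm_pos_iff.2 hX
    have h3 : 0 ≤ v.1 ^ 2 * ‖hamVF Ω H x‖ ^ 2 := by positivity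
    have h4 : ‖v.2‖ ^ 2 = 0 := by nlinarith [sq_nonneg ‖v.2‖]
    have h5 : v.1 ^ 2 * ‖hamVF Ω H x‖ ^ 2 = 0 := by nlinarith
    refine Prod.ext ?_ ?_
    · simpa [h2.ne', hX] using h5
    · simpa using h4
  refine ⟨hinj, ?_⟩
  have hf : Module.finrank ℝ E13 = Module.finrank ℝ (TangentSpace (𝓡∂ 4) x) := by
    have : Module.finrank ℝ (TangentSpace (𝓡∂ 4) x) = 4 := finrank_euclideanSpace_fin (𝕜 := ℝ)
    rw [this]; simp
  exact (LinearMap.injective_iff_surjective_of_finrank_eq_finrank hf).1 hinj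

/-- The linear part of the parametrization of the normal section. -/
noncomputable def sectionLin (A : DarbouxAtlas Ω) (x : M) (b : Fin 3 → TangentSpace (𝓡∂ 4) x) :
    E3 →L[ℝ] E4 :=
  LinearMap.toContinuousLinearMap
    ((chartD (A.chart (A.idx x)) x : TangentSpace (𝓡∂ 4) x →ₗ[ℝ] E4) ∘ₗ frameVec b)

theorem sectionLin_apply (ζ : E3) :
    sectionLin A x b ζ = chartD (A.chart (A.idx x)) x (frameVec b ζ) := rfl

theorem sectionPt_eq (c : E3) : sectionPt A x b c = A.at x x + sectionLin A x b c := rfl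

theorem sectionPt_zero : sectionPt A x b 0 = A.at x x := by rw [sectionPt_eq, map_zero, add_zero]

theorem contDiff_sectionPt {n : WithTop ℕ∞} : ContDiff ℝ n (sectionPt A x b) :=
  contDiff_const.add (sectionLin A x b).contDiff

theorem secFrame_sectionLin (v : E13) :
    secFrame (sectionLin A x b) (chartD (A.chart (A.idx x)) x (hamVF Ω H x)) v =
      chartD (A.chart (A.idx x)) x (flowFrame Ω H b v) := by
  rw [secFrame_apply, sectionLin_apply, flowFrame_apply, map_add, map_smul]

theorem IsNormalFrame.secFrame_isInvertible (hb : IsNormalFrame Ω H x b) (hX : hamVF Ω H x ≠ 0) :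
    (secFrame (sectionLin A x b) (chartD (A.chart (A.idx x)) x (hamVF Ω H x))).IsInvertible := by
  have hd := (A.isDarbouxChart (A.idx x)).mem
  have hx := A.mem_source x
  obtain ⟨e, he⟩ := chartD_isInvertible hd hx
  have hbij : Function.Bijective
      (secFrame (sectionLin A x b) (chartD (A.chart (A.idx x)) x (hamVF Ω H x))) := by
    have : (secFrame (sectionLin A x b) (chartD (A.chart (A.idx x)) x (hamVF Ω H x)) : E13 → E4) =
        e ∘ flowFrame Ω H b := by
      funext v
      rw [secFrame_sectionLin, ← he]; rfl
    rw [this]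
    exact e.bijective.comp (hb.flowFrame_bijective hX)
  exact ⟨(LinearEquiv.ofBijective (secFrame (sectionLin A x b)
    (chartD (A.chart (A.idx x)) x (hamVF Ω H x)) : E13 →ₗ[ℝ] E4) hbij).toContinuousLinearEquiv, rfl⟩

end Frames

theorem exists_C1_bounds {V : Type*} [NormedAddCommGroup V] [NormedSpace ℝ V] {f : E3 → V}
    {U : Set E3} (hU : IsOpen U) (h0 : 0 ∈ U) (hf : ContDiffOn ℝ 1 f U) :
    ∃ r > 0, ∃ B, 0 ≤ B ∧ ball 0 r ⊆ U ∧ ∀ c ∈ ball (0 : E3) r,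
      ‖f c‖ ≤ B ∧ ‖fderiv ℝ f c‖ ≤ B ∧ ‖f c - f 0‖ ≤ B * ‖c‖ := by
  have h1 := hf.continuousOn.continuousAt (hU.mem_nhds h0)
  have h2 := ((hf.continuousOn_fderiv_of_isOpen hU le_rfl).continuousAt (hU.mem_nhds h0))
  obtain ⟨r, hr, hsub⟩ := Metric.mem_nhds_iff.1 (inter_mem (hU.mem_nhds h0)
    (inter_mem (h1.norm.eventually_lt_const (lt_add_one ‖f 0‖))
      (h2.norm.eventually_lt_const (lt_add_one ‖fderiv ℝ f 0‖))))
  refine ⟨r, hr, max (‖f 0‖ + 1) (‖fderiv ℝ f 0‖ + 1), by positivity, fun c hc ↦ (hsub hc).1,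
    fun c hc ↦ ⟨(hsub hc).2.1.le.trans (le_max_left _ _),
      (hsub hc).2.2.le.trans (le_max_right _ _), ?_⟩⟩
  have := (convex_ball (0 : E3) r).norm_image_sub_le_of_norm_fderiv_le (𝕜 := ℝ) (f := f)
    (C := max (‖f 0‖ + 1) (‖fderiv ℝ f 0‖ + 1)) (x := 0) (y := c)
    (fun z hz ↦ (hf.contDiffAt (hU.mem_nhds (hsub hz).1)).differentiableAt (by simp))
    (fun z hz ↦ (hsub hz).2.2.le.trans (le_max_right _ _)) (mem_ball_self hr) hc
  simpa using this

section Rotation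

variable {M : Type*} [TopologicalSpace M] [ChartedSpace (EuclideanHalfSpace 4) M]
  [IsManifold (𝓡∂ 4) ∞ M] [RiemannianBundle (fun x : M ↦ TangentSpace (𝓡∂ 4) x)]
  {Ω : SymplecticForm M} {A : DarbouxAtlas Ω} {H : M → ℝ} {x : M}
  {b : Fin 3 → TangentSpace (𝓡∂ 4) x}

/-- The Poisson tensor of the symplectic form in flowbox coordinates, where `Y` is the Hamiltonian
vector field in the chart at `x`. -/
noncomputable def flowPoisson (A : DarbouxAtlas Ω) (x : M) (b : Fin 3 → TangentSpace (𝓡∂ 4) x)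
    (Y : E4 → E4) (c : E3) : (E13 →L[ℝ] ℝ) →L[ℝ] E13 :=
  secPoisson (secFrame (sectionLin A x b) (Y (sectionPt A x b c)))

theorem exists_flowPoisson_bounds {Y : E4 → E4} (hY : ContDiff ℝ 1 Y)
    (hS : (secFrame (sectionLin A x b) (Y (A.at x x))).IsInvertible) :
    ∃ r > 0, ∃ B, 0 ≤ B ∧
      (∀ c ∈ ball (0 : E3) r,
        (secFrame (sectionLin A x b) (Y (sectionPt A x b c))).IsInvertible) ∧
      ContDiffOn ℝ 1 (flowPoisson A x b Y) (ball 0 r) ∧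
      (∀ c ∈ ball (0 : E3) r, ∀ β, ‖flowPoisson A x b Y c β‖ ≤ B * ‖β‖) ∧
      (∀ c ∈ ball (0 : E3) r, ∀ v β, ‖fderiv ℝ (flowPoisson A x b Y) c v β‖ ≤ B * ‖v‖ * ‖β‖) ∧
      ∀ c ∈ ball (0 : E3) r, ∀ β,
        ‖flowPoisson A x b Y c β - flowPoisson A x b Y 0 β‖ ≤ B * ‖c‖ * ‖β‖ := by
  have hc : ContDiff ℝ 1 fun c : E3 ↦ secFrame (sectionLin A x b) (Y (sectionPt A x b c)) :=
    (contDiff_secFrame _).comp (hY.comp contDiff_sectionPt)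
  have hU : IsOpen {c : E3 | (secFrame (sectionLin A x b) (Y (sectionPt A x b c))).IsInvertible} :=
    isOpen_isInvertible.preimage hc.continuous
  have hf : ContDiffOn ℝ 1 (flowPoisson A x b Y)
      {c : E3 | (secFrame (sectionLin A x b) (Y (sectionPt A x b c))).IsInvertible} :=
    contDiffOn_secPoisson.comp hc.contDiffOn fun c hc ↦ hc
  obtain ⟨r, hr, B, hB, hsub, hb⟩ := exists_C1_bounds hU
    (by rw [mem_setOf_eq, sectionPt_zero]; exact hS) hf
  refine ⟨r, hr, B, hB, hsub, hf.mono hsub, fun c hc β ↦ ?_, fun c hc v β ↦ ?_, fun c hc β ↦ ?_⟩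
  · exact (ContinuousLinearMap.le_opNorm _ _).trans (by gcongr; exact (hb c hc).1)
  · refine (ContinuousLinearMap.le_opNorm _ _).trans ?_
    gcongr
    exact (ContinuousLinearMap.le_opNorm _ _).trans (by gcongr; exact (hb c hc).2.1)
  · exact (ContinuousLinearMap.le_opNorm (flowPoisson A x b Y c - flowPoisson A x b Y 0) β).trans
      (by gcongr; exact (hb c hc).2.2)

/-- `ζ ↦ ω(∑ ζ_i b_i, e)`. -/
noncomputable def frameForm (Ω : SymplecticForm M) (b : Fin 3 → TangentSpace (𝓡∂ 4) x)
    (e : TangentSpace (𝓡∂ 4) x) : E3 →L[ℝ] ℝ :=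
  LinearMap.toContinuousLinearMap
    ((Ω.form x).toLinearMap₁₂.flip e ∘ₗ frameVec b)

theorem frameForm_apply (e : TangentSpace (𝓡∂ 4) x) (ζ : E3) :
    frameForm Ω b e ζ = Ω.form x (frameVec b ζ) e := rfl

/-- The Hessian of the Hamiltonian which generates the rotations in the plane of `e` and `f`. -/
noncomputable def rotHessian (Ω : SymplecticForm M) (b : Fin 3 → TangentSpace (𝓡∂ 4) x)
    (e f : TangentSpace (𝓡∂ 4) x) : E3 →L[ℝ] E3 →L[ℝ] ℝ :=
  -((frameForm Ω b e).smulRight (frameForm Ω b e) + (frameForm Ω b f).smulRight (frameForm Ω b f))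

theorem rotHessian_apply (e f : TangentSpace (𝓡∂ 4) x) (ζ ξ : E3) :
    rotHessian Ω b e f ζ ξ = -(frameForm Ω b e ζ * frameForm Ω b e ξ +
      frameForm Ω b f ζ * frameForm Ω b f ξ) := rfl

theorem rotHessian_comm (e f : TangentSpace (𝓡∂ 4) x) (ζ ξ : E3) :
    rotHessian Ω b e f ζ ξ = rotHessian Ω b e f ξ ζ := by
  rw [rotHessian_apply, rotHessian_apply]; ring

theorem IsNormalFrame.abs_rotHessian_le (hb : IsNormalFrame Ω H x b) {K C : ℝ} (hK : 0 ≤ K)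
    (hω : ∀ v w : TangentSpace (𝓡∂ 4) x, |Ω.form x v w| ≤ K * ‖v‖ * ‖w‖)
    {e f : TangentSpace (𝓡∂ 4) x} (he : ‖e‖ ≤ C) (hf : ‖f‖ ≤ C) (ζ ξ : E3) :
    |rotHessian Ω b e f ζ ξ| ≤ 2 * (K * C) ^ 2 * ‖ζ‖ * ‖ξ‖ := by
  have hC : 0 ≤ C := (norm_nonneg e).trans he
  have h : ∀ g : TangentSpace (𝓡∂ 4) x, ‖g‖ ≤ C → ∀ ζ, |frameForm Ω b g ζ| ≤ K * C * ‖ζ‖ := by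
    intro g hg ζ
    rw [frameForm_apply]
    refine (hω _ _).trans ?_
    rw [hb.norm_frameVec]
    calc K * ‖ζ‖ * ‖g‖ ≤ K * ‖ζ‖ * C := by gcongr
      _ = _ := by ring
  have h2 : ∀ g : TangentSpace (𝓡∂ 4) x, ‖g‖ ≤ C →
      |frameForm Ω b g ζ * frameForm Ω b g ξ| ≤ K * C * ‖ζ‖ * (K * C * ‖ξ‖) := fun g hg ↦ by
    rw [abs_mul]
    exact mul_le_mul (h g hg ζ) (h g hg ξ) (abs_nonneg _) (by positivity)
  rw [rotHessian_apply, abs_neg]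
  refine (abs_add_le _ _).trans ((add_le_add (h2 e he) (h2 f hf)).trans_eq (by ring))

variable {Y : E4 → E4}

theorem form_flowFrame_flowPoisson (hY : Y (A.at x x) = chartD (A.chart (A.idx x)) x (hamVF Ω H x))
    (hS : (secFrame (sectionLin A x b) (Y (A.at x x))).IsInvertible) (β : E13 →L[ℝ] ℝ) (w : E13) :
    Ω.form x (flowFrame Ω H b (flowPoisson A x b Y 0 β)) (flowFrame Ω H b w) = β w := by
  rw [(A.isDarbouxChart (A.idx x)).form_eq x (A.mem_source x), ← secFrame_sectionLin,
    ← secFrame_sectionLin, flowPoisson, sectionPt_zero, ← hY, stdForm_secPoisson hS]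

theorem IsNormalFrame.norm_flowPoisson_snd_le (hb : IsNormalFrame Ω H x b)
    (hX : hamVF Ω H x ≠ 0)
    (hY : Y (A.at x x) = chartD (A.chart (A.idx x)) x (hamVF Ω H x)) {K : ℝ}
    (hω : ∀ (v : TangentSpace (𝓡∂ 4) x) (k : ℝ), 0 ≤ k → (∀ w, |Ω.form x v w| ≤ k * ‖w‖) →
        ‖v‖ ≤ K * k) (β : E3 →L[ℝ] ℝ) :
    ‖(flowPoisson A x b Y 0 (pullSnd β)).2‖ ≤ K * ‖β‖ := by
  have hS := hb.secFrame_isInvertible (A := A) hX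
  rw [← hY] at hS
  refine (hb.norm_snd_le _).trans (hω _ _ (norm_nonneg _) fun w ↦ ?_)
  obtain ⟨w, rfl⟩ := (hb.flowFrame_bijective hX).2 w
  rw [form_flowFrame_flowPoisson hY hS, pullSnd_apply]
  exact (β.le_opNorm _).trans (by gcongr; exact hb.norm_snd_le w)

theorem IsNormalFrame.flowFrame_flatGen (hb : IsNormalFrame Ω H x b) (hX : hamVF Ω H x ≠ 0)
    (hY : Y (A.at x x) = chartD (A.chart (A.idx x)) x (hamVF Ω H x))
    {e f : TangentSpace (𝓡∂ 4) x} (he : dHam H x e = 0) (hf : dHam H x f = 0) (v : E13) :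
    flowFrame Ω H b (flatGen (flowPoisson A x b Y) (rotHessian Ω b e f) v) =
      Ω.form x (flowFrame Ω H b v) e • e + Ω.form x (flowFrame Ω H b v) f • f := by
  have hS := hb.secFrame_isInvertible (A := A) hX
  rw [← hY] at hS
  have hskew : ∀ v w : TangentSpace (𝓡∂ 4) x, Ω.form x v w = -Ω.form x w v := fun v w ↦ by
    have := Ω.alternating x (v + w)
    simp only [map_add, add_apply, Ω.alternating] at this
    linarith
  have hform : ∀ g : TangentSpace (𝓡∂ 4) x, dHam H x g = 0 → ∀ v : E13,
      Ω.form x (flowFrame Ω H b v) g = frameForm Ω b g v.2 := fun g hg v ↦ by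
    rw [flowFrame_apply, map_add, map_smul, add_apply, smul_apply, form_hamVF, hg, smul_zero,
      zero_add, frameForm_apply]
  rw [← sub_eq_zero]
  refine Ω.nondegenerate x _ fun w ↦ ?_
  obtain ⟨w, rfl⟩ := (hb.flowFrame_bijective hX).2 w
  rw [map_sub, sub_apply, sub_eq_zero]
  refine (form_flowFrame_flowPoisson hY hS _ w).trans ?_
  change rotHessian Ω b e f v.2 w.2 = _
  rw [map_add, add_apply, map_smul, map_smul, smul_apply, smul_apply, hskew e,
    hskew f, hform e he, hform f hf, hform e he, hform f hf, rotHessian_apply]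
  simp only [smul_eq_mul]
  ring

theorem IsNormalFrame.flatGen_cube (hb : IsNormalFrame Ω H x b) (hX : hamVF Ω H x ≠ 0)
    (hY : Y (A.at x x) = chartD (A.chart (A.idx x)) x (hamVF Ω H x))
    {e f : TangentSpace (𝓡∂ 4) x} (he : dHam H x e = 0) (hf : dHam H x f = 0)
    (hef : Ω.form x e f = 1) (hfe : Ω.form x f e = -1) :
    flatGen (flowPoisson A x b Y) (rotHessian Ω b e f) *
      (flatGen (flowPoisson A x b Y) (rotHessian Ω b e f) *
        flatGen (flowPoisson A x b Y) (rotHessian Ω b e f)) =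
      -flatGen (flowPoisson A x b Y) (rotHessian Ω b e f) := by
  refine ContinuousLinearMap.ext fun v ↦ (hb.flowFrame_bijective hX).1 ?_
  set N := flatGen (flowPoisson A x b Y) (rotHessian Ω b e f) with hN
  have key := hb.flowFrame_flatGen hX hY he hf
  rw [← hN] at key
  change flowFrame Ω H b (N (N (N v))) = flowFrame Ω H b (-N v)
  rw [map_neg, key, key, key]
  simp only [map_add, map_smul, add_apply, smul_apply, hef, hfe, Ω.alternating, smul_eq_mul]
  module

theorem IsNormalFrame.flowFrame_rotExp (hb : IsNormalFrame Ω H x b) (hX : hamVF Ω H x ≠ 0)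
    (hY : Y (A.at x x) = chartD (A.chart (A.idx x)) x (hamVF Ω H x))
    (B : Module.Basis (Fin 2) ℝ (transFiber Ω H x)) (hB : Ω.form x (B 0) (B 1) = 1) (α : ℝ)
    (w : transFiber Ω H x) (v : E13) (hv : flowFrame Ω H b v = w) :
    flowFrame Ω H b (rotExp (flatGen (flowPoisson A x b Y)
      (rotHessian Ω b (B 0 : TangentSpace (𝓡∂ 4) x) (B 1 : TangentSpace (𝓡∂ 4) x))) α v) =
      transRotation Ω B α w := by
  have hskew : Ω.form x (B 1) (B 0) = -1 := by
    have := Ω.alternating x ((B 0 : TangentSpace (𝓡∂ 4) x) + B 1)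
    simp only [map_add, add_apply, Ω.alternating] at this
    linarith
  have hd : ∀ i, dHam H x (B i : TangentSpace (𝓡∂ 4) x) = 0 := fun i ↦
    (Submodule.mem_inf.1 (B i).2).2
  have key := hb.flowFrame_flatGen hX hY (hd 0) (hd 1)
  set N := flatGen (flowPoisson A x b Y)
    (rotHessian Ω b (B 0 : TangentSpace (𝓡∂ 4) x) (B 1 : TangentSpace (𝓡∂ 4) x))
  change flowFrame Ω H b (v + Real.sin α • N v + (1 - Real.cos α) • N (N v)) = _
  have h0 : (transRotation Ω B α (B 0) : TangentSpace (𝓡∂ 4) x) =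
      Real.cos α • (B 0 : TangentSpace (𝓡∂ 4) x) + Real.sin α • (B 1 : TangentSpace (𝓡∂ 4) x) := by
    rw [transRotation, Matrix.toLin_self]
    simp
  have h1 : (transRotation Ω B α (B 1) : TangentSpace (𝓡∂ 4) x) =
      -Real.sin α • (B 0 : TangentSpace (𝓡∂ 4) x) + Real.cos α • (B 1 : TangentSpace (𝓡∂ 4) x) := by
    rw [transRotation, Matrix.toLin_self]
    simp
  have hw : w = B.repr w 0 • B 0 + B.repr w 1 • B 1 := by
    conv_lhs => rw [← B.sum_repr w]
    rw [Fin.sum_univ_two]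
  have hw' : (w : TangentSpace (𝓡∂ 4) x) = B.repr w 0 • (B 0 : TangentSpace (𝓡∂ 4) x) +
      B.repr w 1 • (B 1 : TangentSpace (𝓡∂ 4) x) := by
    conv_lhs => rw [hw]
    simp
  have hR : (transRotation Ω B α w : TangentSpace (𝓡∂ 4) x) =
      B.repr w 0 • (transRotation Ω B α (B 0) : TangentSpace (𝓡∂ 4) x) +
      B.repr w 1 • (transRotation Ω B α (B 1) : TangentSpace (𝓡∂ 4) x) := by
    conv_lhs => rw [hw, map_add, map_smul, map_smul]
    simp
  rw [hR, h0, h1, map_add, map_add, map_smul, map_smul, key (N v), key v, hv, hw']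
  simp only [map_add, map_smul, add_apply, smul_apply, hB, hskew, Ω.alternating, smul_eq_mul]
  module

end Rotation

theorem exists_continuousOn_zero {X : Type*} [TopologicalSpace X] {G : ℝ → X → ℝ} {S : Set X}
    {a b : ℝ} (hab : a < b) (hmono : ∀ c ∈ S, StrictMonoOn (fun t ↦ G t c) (Icc a b))
    (hcont : ContinuousOn (fun p : ℝ × X ↦ G p.1 p.2) (Icc a b ×ˢ S))
    (ha : ∀ c ∈ S, G a c < 0) (hb : ∀ c ∈ S, 0 < G b c) :
    ∃ τ : X → ℝ, ContinuousOn τ S ∧ ∀ c ∈ S, τ c ∈ Ioo a b ∧ G (τ c) c = 0 := by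
  have hex : ∀ c ∈ S, ∃ t ∈ Ioo a b, G t c = 0 := fun c hc ↦ by
    have h1 : ContinuousOn (fun t ↦ G t c) (Icc a b) :=
      hcont.comp (f := fun t ↦ (t, c)) (by fun_prop) fun t ht ↦ ⟨ht, hc⟩
    obtain ⟨t, ht, h⟩ := intermediate_value_Ioo hab.le h1 (mem_Ioo.2 ⟨ha c hc, hb c hc⟩)
    exact ⟨t, ht, h⟩
  choose! τ hτ hτ0 using hex
  refine ⟨τ, fun c₀ hc₀ ↦ ?_, fun c hc ↦ ⟨hτ c hc, hτ0 c hc⟩⟩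
  have hG : ∀ m ∈ Icc a b, ContinuousWithinAt (fun c ↦ G m c) S c₀ := fun m hm ↦
    (hcont (m, c₀) ⟨hm, hc₀⟩).comp (f := fun c ↦ (m, c)) (t := Icc a b ×ˢ S)
      (by fun_prop) fun c hc ↦ ⟨hm, hc⟩
  refine tendsto_order.2 ⟨fun m hm ↦ ?_, fun m hm ↦ ?_⟩
  · have hm' : max m a ∈ Icc a b :=
      ⟨le_max_right _ _, max_le (hm.le.trans (hτ c₀ hc₀).2.le) hab.le⟩
    have hlt : max m a < τ c₀ := max_lt hm (hτ c₀ hc₀).1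
    have h1 : G (max m a) c₀ < 0 := by
      have := hmono c₀ hc₀ hm' (Ioo_subset_Icc_self (hτ c₀ hc₀)) hlt
      simpa only [hτ0 c₀ hc₀] using this
    filter_upwards [(hG _ hm').eventually_lt_const h1, self_mem_nhdsWithin] with c hc hcS
    by_contra! hle
    have := (hmono c hcS).monotoneOn (Ioo_subset_Icc_self (hτ c hcS)) hm'
      (hle.trans (le_max_left _ _))
    simp only [hτ0 c hcS] at this
    linarith
  · have hm' : min m b ∈ Icc a b :=
      ⟨le_min ((hτ c₀ hc₀).1.le.trans hm.le) hab.le, min_le_right _ _⟩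
    have hlt : τ c₀ < min m b := lt_min hm (hτ c₀ hc₀).2
    have h1 : 0 < G (min m b) c₀ := by
      have := hmono c₀ hc₀ (Ioo_subset_Icc_self (hτ c₀ hc₀)) hm' hlt
      simpa only [hτ0 c₀ hc₀] using this
    filter_upwards [(hG _ hm').eventually_const_lt h1, self_mem_nhdsWithin] with c hc hcS
    by_contra! hle
    have := (hmono c hcS).monotoneOn hm' (Ioo_subset_Icc_self (hτ c hcS))
      ((min_le_left _ _).trans hle)
    simp only [hτ0 c hcS] at this
    linarith

section Sections

variable {M : Type*} [TopologicalSpace M] [ChartedSpace (EuclideanHalfSpace 4) M]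
  [IsManifold (𝓡∂ 4) ∞ M] [RiemannianBundle (fun x : M ↦ TangentSpace (𝓡∂ 4) x)]
  {Ω : SymplecticForm M} {A : DarbouxAtlas Ω} {H : M → ℝ} {x : M}
  {b : Fin 3 → TangentSpace (𝓡∂ 4) x} {k : ℕ∞}

theorem norm_lt_of_mem_sectionBall {r : ℝ} {c : E3} (hc : c ∈ sectionBall A x b r) :
    ‖c‖ < 2 * r := by
  obtain ⟨h1, h2, -⟩ := hc
  have hr : 0 < r := (Real.sqrt_nonneg _).trans_lt h1
  rw [Real.sqrt_lt' hr] at h1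
  have h3 : c 2 ^ 2 < r ^ 2 := by rw [← sq_abs]; gcongr
  refine (pow_lt_pow_iff_left₀ (norm_nonneg _) (by positivity) two_ne_zero).1 ?_
  rw [EuclideanSpace.norm_sq_eq, Fin.sum_univ_three]
  simp only [Real.norm_eq_abs, sq_abs]
  nlinarith

theorem sectionPt_mem_of_mem_sectionBall {r : ℝ} {c : E3} (hc : c ∈ sectionBall A x b r) :
    sectionPt A x b c ∈ (A.at x).target := hc.2.2

theorem sectionBall_mono {r r' : ℝ} (h : r ≤ r') : sectionBall A x b r ⊆ sectionBall A x b r' :=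
  fun _ hc ↦ ⟨hc.1.trans_le h, hc.2.1.trans_le h, hc.2.2⟩

theorem zero_mem_sectionBall {r : ℝ} (hr : 0 < r) : (0 : E3) ∈ sectionBall A x b r := by
  refine ⟨by simpa using hr, by simpa using hr, ?_⟩
  rw [sectionPt_zero]
  exact extend_mem_target _ (A.mem_source x)

theorem sectionMap_zero : sectionMap A x b 0 = x := by
  rw [sectionMap, sectionPt_zero]
  exact (A.chart (A.idx x)).extend_left_inv (I := 𝓡∂ 4) (A.mem_source x)

theorem sectionMap_mem_source {c : E3} (hc : sectionPt A x b c ∈ (A.at x).target) :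
    sectionMap A x b c ∈ (A.chart (A.idx x)).source :=
  extend_symm_mem_source _ hc

theorem extend_sectionMap {c : E3} (hc : sectionPt A x b c ∈ (A.at x).target) :
    (A.chart (A.idx x)).extend (𝓡∂ 4) (sectionMap A x b c) = sectionPt A x b c :=
  (A.at x).right_inv hc

theorem continuousOn_sectionMap :
    ContinuousOn (sectionMap A x b) {c | sectionPt A x b c ∈ (A.at x).target} :=
  (OpenPartialHomeomorph.continuousOn_extend_symm (A.chart (A.idx x))).comp
    (contDiff_sectionPt (n := 0)).continuous.continuousOn fun _ hc ↦ hc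

theorem exists_sectionBall_forall {P : E3 → Prop}
    (h : ∀ᶠ c in 𝓝[{c | sectionPt A x b c ∈ (A.at x).target}] 0, P c) :
    ∃ r > 0, ∀ c ∈ sectionBall A x b r, P c := by
  obtain ⟨r, hr, hsub⟩ := Metric.mem_nhdsWithin_iff.1 h
  refine ⟨r / 2, half_pos hr, fun c hc ↦ hsub ⟨?_, hc.2.2⟩⟩
  rw [mem_ball_zero_iff]
  linarith [norm_lt_of_mem_sectionBall hc]

theorem IsNormalFrame.sectionLin_injective (hb : IsNormalFrame Ω H x b) :
    Function.Injective (sectionLin A x b) := by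
  refine (injective_iff_map_eq_zero _).2 fun c hc ↦ ?_
  rw [sectionLin_apply] at hc
  have h1 := chartD_inverse_apply (A.isDarbouxChart (A.idx x)).mem (A.mem_source x) (frameVec b c)
  rw [hc, map_zero] at h1
  rw [← norm_eq_zero, ← hb.norm_frameVec, ← h1]
  exact norm_zero

theorem IsNormalFrame.injOn_sectionMap (hb : IsNormalFrame Ω H x b) :
    InjOn (sectionMap A x b) {c | sectionPt A x b c ∈ (A.at x).target} := by
  intro c hc c' hc' h
  have h1 := (A.at x).symm.injOn hc hc' h
  rw [sectionPt_eq, sectionPt_eq, add_right_inj] at h1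
  exact hb.sectionLin_injective h1

/-- Near `x`, the Hamiltonian flow is transverse to the normal section: a linear form which
vanishes on the section increases along the flow. -/
theorem exists_transverse (A : DarbouxAtlas Ω) (hH : IsHamiltonian k H) (hk : 2 ≤ k)
    (hX : hamVF Ω H x ≠ 0) : ∃ (L : E4 →L[ℝ] ℝ) (N : Set M),
      (∀ v : TangentSpace (𝓡∂ 4) x,
        L (chartD (A.chart (A.idx x)) x v) = inner ℝ (hamVF Ω H x) v) ∧
      IsOpen N ∧ x ∈ N ∧ N ⊆ (A.chart (A.idx x)).source ∧
      ∀ z ∈ N, 0 < L (chartD (A.chart (A.idx x)) z (hamVF Ω H z)) := by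
  have hd := A.isDarbouxChart (A.idx x)
  have hx := A.mem_source x
  set h := A.chart (A.idx x)
  set L : E4 →L[ℝ] ℝ := LinearMap.toContinuousLinearMap
    ((innerₗ (TangentSpace (𝓡∂ 4) x) (hamVF Ω H x)) ∘ₗ
      ((chartD h x).inverse : E4 →ₗ[ℝ] TangentSpace (𝓡∂ 4) x)) with hL
  have hL1 : ∀ v : TangentSpace (𝓡∂ 4) x, L (chartD h x v) = inner ℝ (hamVF Ω H x) v := fun v ↦ by
    change inner ℝ (hamVF Ω H x) ((chartD h x).inverse (chartD h x v)) = _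
    rw [chartD_inverse_apply hd.mem hx]
  have hcont : ContinuousOn (fun z ↦ L (chartVF Ω h H (h.extend (𝓡∂ 4) z))) h.source :=
    L.continuous.comp_continuousOn (((hH.of_le (m := 2) hk).contDiffOn_chartVF hd (m := 1)
      (by norm_num)).continuousOn.comp (OpenPartialHomeomorph.continuousOn_extend h |>.mono (by simp))
      fun z hz ↦ extend_mem_target h hz)
  refine ⟨L, h.source ∩ (fun z ↦ L (chartVF Ω h H (h.extend (𝓡∂ 4) z))) ⁻¹' Ioi 0, hL1,
    hcont.isOpen_inter_preimage h.open_source isOpen_Ioi, ⟨hx, ?_⟩, inter_subset_left, ?_⟩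
  · rw [mem_preimage, chartVF_extend hx, hL1, real_inner_self_eq_norm_sq, mem_Ioi]
    exact pow_pos (norm_pos_iff.2 hX) 2
  · rintro z ⟨hz, hz'⟩
    rwa [mem_preimage, chartVF_extend hz] at hz'

variable [CompactSpace M] [T2Space M]

theorem exists_flow_section_mem (hH : IsHamiltonian k H) (hk : 2 ≤ k) (t₀ : ℝ) {W : Set M}
    (hW : W ∈ 𝓝 (hamFlow Ω H t₀ x)) : ∃ u > 0, ∃ r > 0, ∀ t, |t - t₀| ≤ u →
      ∀ c ∈ sectionBall A x b r, hamFlow Ω H t (sectionMap A x b c) ∈ W := by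
  have h1 : ContinuousOn (fun p : ℝ × E3 ↦ hamFlow Ω H p.1 (sectionMap A x b p.2))
      (univ ×ˢ {c | sectionPt A x b c ∈ (A.at x).target}) :=
    (hH.continuous_hamFlow A hk).comp_continuousOn (continuousOn_fst.prodMk
      (continuousOn_sectionMap.comp continuousOn_snd fun p hp ↦ hp.2))
  have h2 := h1 (t₀, 0) ⟨mem_univ _, (zero_mem_sectionBall one_pos).2.2⟩
  have h3 : W ∈ 𝓝 (hamFlow Ω H t₀ (sectionMap A x b 0)) := by rwa [sectionMap_zero]
  have h4 : ∀ᶠ p in 𝓝[univ ×ˢ {c | sectionPt A x b c ∈ (A.at x).target}] ((t₀, 0) : ℝ × E3),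
      hamFlow Ω H p.1 (sectionMap A x b p.2) ∈ W := h2 h3
  obtain ⟨ε, hε, hsub⟩ := Metric.mem_nhdsWithin_iff.1 h4
  refine ⟨ε / 2, half_pos hε, ε / 2, half_pos hε, fun t ht c hc ↦ ?_⟩
  have hc2 := sectionPt_mem_of_mem_sectionBall hc
  have hcn := norm_lt_of_mem_sectionBall hc
  have hb : ((t, c) : ℝ × E3) ∈ ball ((t₀, 0) : ℝ × E3) ε := by
    rw [mem_ball, Prod.dist_eq, max_lt_iff, Real.dist_eq, dist_zero_right]
    constructor
    · change |t - t₀| < ε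
      linarith
    · change ‖c‖ < ε
      linarith
  have h5 := hsub (mem_inter hb (mk_mem_prod (mem_univ t) hc2))
  rwa [mem_setOf_eq] at h5

theorem strictMonoOn_of_transverse (hH : IsHamiltonian k H) (hk : 2 ≤ k) {L : E4 →L[ℝ] ℝ} {N : Set M}
    (hN : N ⊆ (A.chart (A.idx x)).source)
    (hL : ∀ z ∈ N, 0 < L (chartD (A.chart (A.idx x)) z (hamVF Ω H z))) {y : M} {a b : ℝ}
    (hy : ∀ t ∈ Icc a b, hamFlow Ω H t y ∈ N) :
    StrictMonoOn (fun t ↦ L (A.at x (hamFlow Ω H t y))) (Icc a b) := by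
  have hd : ∀ t ∈ Icc a b, HasDerivAt (fun t ↦ L (A.at x (hamFlow Ω H t y)))
      (L (chartD (A.chart (A.idx x)) (hamFlow Ω H t y) (hamVF Ω H (hamFlow Ω H t y)))) t :=
    fun t ht ↦ L.hasFDerivAt.comp_hasDerivAt t (HasMFDerivAt.hasDerivAt_chart
      (A.isDarbouxChart (A.idx x)).mem (hN (hy t ht)) (hH.isMIntegralCurve_hamFlow A hk y t))
  refine strictMonoOn_of_deriv_pos (convex_Icc a b)
    (fun t ht ↦ (hd t ht).continuousAt.continuousWithinAt) fun t ht ↦ ?_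
  have ht' := interior_subset ht
  rw [(hd t ht').deriv]
  exact hL _ (hy t ht')

theorem hamVF_hamFlow_ne_zero (A : DarbouxAtlas Ω) (hH : IsHamiltonian k H) (hk : 2 ≤ k)
    (hX : hamVF Ω H x ≠ 0) (t : ℝ) : hamVF Ω H (hamFlow Ω H t x) ≠ 0 := by
  intro h0
  rw [← hH.mfderiv_hamFlow_hamVF A hk t x] at h0
  have h1 := hH.mfderiv_hamFlow_comp_neg A hk t x (hamVF Ω H x)
  rw [h0, map_zero] at h1
  exact hX h1.symm

theorem hamVF_ne_zero_of_forall (A : DarbouxAtlas Ω) (hH : IsHamiltonian k H) (hk : 2 ≤ k)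
    (hper : ∀ t ∈ Ioc (0 : ℝ) 1, hamFlow Ω H t x ≠ x) : hamVF Ω H x ≠ 0 := by
  intro h0
  have hγ : IsMIntegralCurveOn (fun _ : ℝ ↦ x) (hamVF Ω H) (Ioo (-1) 2) := fun t _ ↦ by
    have h1 : HasMFDerivAt 𝓘(ℝ, ℝ) (𝓡∂ 4) (fun _ : ℝ ↦ x) t
        (0 : TangentSpace 𝓘(ℝ, ℝ) t →L[ℝ] TangentSpace (𝓡∂ 4) x) := hasMFDerivAt_const x t
    have h2 : ((1 : ℝ →L[ℝ] ℝ).smulRight (hamVF Ω H x)) =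
        (0 : TangentSpace 𝓘(ℝ, ℝ) t →L[ℝ] TangentSpace (𝓡∂ 4) x) := by
      rw [h0]; exact ContinuousLinearMap.smulRight_zero _
    rw [h2]
    exact h1.hasMFDerivWithinAt
  exact hper 1 ⟨one_pos, le_rfl⟩
    (hH.eq_hamFlow_of_Ioo A hk hγ (t := 1) (by norm_num) (by norm_num)).symm

/-- Orbit segments of length slightly larger than one which start at the normal section are
disjoint. -/
theorem exists_section_injective (hH : IsHamiltonian k H) (hk : 2 ≤ k)
    (hper : ∀ t ∈ Ioc (0 : ℝ) 1, hamFlow Ω H t x ≠ x) (hb : IsNormalFrame Ω H x b) :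
    ∃ u > 0, ∃ r > 0, ∀ c ∈ sectionBall A x b r, ∀ c' ∈ sectionBall A x b r,
      ∀ t ∈ Icc (-u) (1 + u), ∀ t' ∈ Icc (-u) (1 + u),
        hamFlow Ω H t (sectionMap A x b c) = hamFlow Ω H t' (sectionMap A x b c') →
          c = c' ∧ t = t' := by
  have hX := hamVF_ne_zero_of_forall A hH hk hper
  obtain ⟨L, N, hL, hNo, hxN, hNs, hLN⟩ := exists_transverse A hH hk hX
  have hxN' : N ∈ 𝓝 (hamFlow Ω H 0 x) := by
    rw [hH.hamFlow_zero A hk]; exact hNo.mem_nhds hxN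
  obtain ⟨u₀, hu₀, r₀, hr₀, hflow⟩ := exists_flow_section_mem (A := A) (b := b) hH hk 0 hxN'
  have hcont := hH.continuous_hamFlow A hk
  obtain ⟨u₁, hu₁, hu₁'⟩ : ∃ u > 0, ∀ s ∈ Icc u₀ (1 + u), hamFlow Ω H s x ≠ x := by
    have ho : IsOpen {s : ℝ | hamFlow Ω H s x ≠ x} :=
      isOpen_ne_fun (hcont.comp (continuous_id.prodMk continuous_const)) continuous_const
    obtain ⟨u, hu, hsub⟩ := Metric.nhds_basis_closedBall.mem_iff.1
      (ho.mem_nhds (hper 1 ⟨one_pos, le_rfl⟩))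
    refine ⟨u, hu, fun s hs ↦ ?_⟩
    rcases le_or_gt s 1 with h | h
    · exact hper s ⟨hu₀.trans_le hs.1, h⟩
    · exact hsub (by rw [mem_closedBall, Real.dist_eq, abs_of_pos (by linarith)]; linarith [hs.2])
  have hfar : ∀ᶠ p : M × M in 𝓝 (x, x), ∀ s ∈ Icc u₀ (1 + u₁), hamFlow Ω H s p.1 ≠ p.2 := by
    refine isCompact_Icc.eventually_forall_of_forall_eventually
      (P := fun (p : M × M) s ↦ hamFlow Ω H s p.1 ≠ p.2) fun s hs ↦ ?_
    have ho : IsOpen {z : (M × M) × ℝ | hamFlow Ω H z.2 z.1.1 ≠ z.1.2} :=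
      isOpen_ne_fun (hcont.comp (by fun_prop : Continuous fun z : (M × M) × ℝ ↦ (z.2, z.1.1)))
        (by fun_prop)
    exact ho.mem_nhds (hu₁' s hs)
  rw [nhds_prod_eq] at hfar
  obtain ⟨V, hV, hVfar⟩ := Filter.mem_prod_self_iff.1 hfar
  have hV' : V ∈ 𝓝 (hamFlow Ω H 0 x) := by rwa [hH.hamFlow_zero A hk]
  obtain ⟨u₂, hu₂, r₂, hr₂, hflow₂⟩ := exists_flow_section_mem (A := A) (b := b) hH hk 0 hV'
  have hσV : ∀ c ∈ sectionBall A x b r₂, sectionMap A x b c ∈ V := fun c hc ↦ by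
    have := hflow₂ 0 (by simpa using hu₂.le) c hc
    rwa [hH.hamFlow_zero A hk] at this
  have hLσ : ∀ c, sectionPt A x b c ∈ (A.at x).target →
      L (A.at x (sectionMap A x b c)) = L (A.at x x) := fun c hc ↦ by
    have : A.at x (sectionMap A x b c) = sectionPt A x b c := extend_sectionMap hc
    rw [this, sectionPt_eq, map_add, sectionLin_apply, hL, hb.inner_frameVec, add_zero]
  refine ⟨u₁ / 2, by positivity, min r₀ r₂, by positivity, ?_⟩
  have key : ∀ c ∈ sectionBall A x b (min r₀ r₂), ∀ c' ∈ sectionBall A x b (min r₀ r₂),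
      ∀ s ∈ Icc 0 (1 + u₁), hamFlow Ω H s (sectionMap A x b c) = sectionMap A x b c' →
        c = c' ∧ s = 0 := by
    intro c hc c' hc' s hs heq
    rcases le_or_gt s u₀ with h | h
    · have hmono := strictMonoOn_of_transverse (A := A) hH hk hNs hLN (a := 0) (b := u₀)
        (y := sectionMap A x b c) fun t ht ↦ hflow t (by simpa [abs_of_nonneg ht.1] using ht.2) c
          (sectionBall_mono (min_le_left _ _) hc)
      have h0 : s = 0 := by
        refine hmono.injOn ⟨hs.1, h⟩ ⟨le_rfl, hu₀.le⟩ ?_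
        simp only [heq, hH.hamFlow_zero A hk]
        rw [hLσ c hc.2.2, hLσ c' hc'.2.2]
      subst h0
      rw [hH.hamFlow_zero A hk] at heq
      exact ⟨hb.injOn_sectionMap hc.2.2 hc'.2.2 heq, rfl⟩
    · exact absurd heq (hVfar (mk_mem_prod (hσV c (sectionBall_mono (min_le_right _ _) hc))
        (hσV c' (sectionBall_mono (min_le_right _ _) hc'))) s ⟨h.le, hs.2⟩)
  have hshift : ∀ (t t' : ℝ) (y y' : M), hamFlow Ω H t y = hamFlow Ω H t' y' →
      hamFlow Ω H (t - t') y = y' := fun t t' y y' h ↦ by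
    rw [sub_eq_neg_add, hH.hamFlow_add A hk, h, hH.hamFlow_neg_hamFlow A hk]
  intro c hc c' hc' t ht t' ht' heq
  rcases le_total t' t with h | h
  · obtain ⟨h1, h2⟩ := key c hc c' hc' (t - t') ⟨by linarith, by linarith [ht.2, ht'.1]⟩
      (hshift _ _ _ _ heq)
    exact ⟨h1, by linarith⟩
  · obtain ⟨h1, h2⟩ := key c' hc' c hc (t' - t) ⟨by linarith, by linarith [ht'.2, ht.1]⟩
      (hshift _ _ _ _ heq.symm)
    exact ⟨h1.symm, by linarith⟩

theorem mem_normalSection {L : E4 →L[ℝ] ℝ} (hL : ∀ v : TangentSpace (𝓡∂ 4) x,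
      L (chartD (A.chart (A.idx x)) x v) = inner ℝ (hamVF Ω H x) v) {z : M}
    (hz : z ∈ (A.chart (A.idx x)).source) (h : L (A.at x z) = L (A.at x x)) :
    z ∈ normalSection A H x := by
  have hd := (A.isDarbouxChart (A.idx x)).mem
  have h1 := chartD_apply_inverse hd (A.mem_source x) (A.at x z - A.at x x)
  refine ⟨by rwa [DarbouxAtlas.at, OpenPartialHomeomorph.extend_source],
    (chartD (A.chart (A.idx x)) x).inverse (A.at x z - A.at x x), ?_, by rw [h1]; abel⟩
  rw [normalFiber, Submodule.mem_orthogonal_singleton_iff_inner_right, ← hL, h1, map_sub, h, sub_self]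

/-- The Poincaré map of time one, with a flow time close to one. -/
theorem exists_poincareTime (hH : IsHamiltonian k H) (hk : 2 ≤ k)
    (hper : ∀ t ∈ Ioc (0 : ℝ) 1, hamFlow Ω H t x ≠ x) (hb : IsNormalFrame Ω H x b) :
    ∃ u > 0, u ≤ 1 / 4 ∧ ∃ r > 0, (∀ c ∈ sectionBall A x b r, ∀ c' ∈ sectionBall A x b r,
      ∀ t ∈ Icc (-u) (1 + u), ∀ t' ∈ Icc (-u) (1 + u),
        hamFlow Ω H t (sectionMap A x b c) = hamFlow Ω H t' (sectionMap A x b c') →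
          c = c' ∧ t = t') ∧
      ∀ r' > 0, r' ≤ r → ∃ τ : E3 → ℝ, IsPoincareTime A H 1 x b r' τ ∧
        ∀ c ∈ sectionBall A x b r', τ c ∈ Ioo (1 - u) (1 + u) := by
  obtain ⟨u₀, hu₀, r₀, hr₀, hinj⟩ := exists_section_injective (A := A) hH hk hper hb
  have hX := hamVF_ne_zero_of_forall A hH hk hper
  set x₁ := hamFlow Ω H 1 x with hx₁
  have hX₁ : hamVF Ω H x₁ ≠ 0 := hamVF_hamFlow_ne_zero A hH hk hX 1
  obtain ⟨L, N, hL, hNo, hxN, hNs, hLN⟩ := exists_transverse A hH hk hX₁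
  obtain ⟨u₁, hu₁, r₁, hr₁, hflow⟩ :=
    exists_flow_section_mem (A := A) (b := b) hH hk 1 (hNo.mem_nhds hxN)
  set u := min (min u₀ u₁) (1 / 4) with hu
  have hupos : 0 < u := by positivity
  have huu₀ : u ≤ u₀ := (min_le_left _ _).trans (min_le_left _ _)
  have huu₁ : u ≤ u₁ := (min_le_left _ _).trans (min_le_right _ _)
  have hinN : ∀ t ∈ Icc (1 - u) (1 + u), ∀ c ∈ sectionBall A x b r₁,
      hamFlow Ω H t (sectionMap A x b c) ∈ N := fun t ht c hc ↦
    hflow t (by rw [abs_le]; constructor <;> linarith [ht.1, ht.2]) c hc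
  set G : ℝ → E3 → ℝ := fun t c ↦ L (A.at x₁ (hamFlow Ω H t (sectionMap A x b c))) - L (A.at x₁ x₁)
    with hG
  have hmono : ∀ c ∈ sectionBall A x b r₁, StrictMonoOn (fun t ↦ G t c) (Icc (1 - u) (1 + u)) := by
    intro c hc t ht t' ht' htt
    have := strictMonoOn_of_transverse (A := A) hH hk hNs hLN (fun t ht ↦ hinN t ht c hc) ht ht' htt
    simp only [hG]
    linarith
  have hcont : ContinuousOn (fun p : ℝ × E3 ↦ G p.1 p.2)
      (Icc (1 - u) (1 + u) ×ˢ sectionBall A x b r₁) := by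
    have h1 : ContinuousOn (fun p : ℝ × E3 ↦ hamFlow Ω H p.1 (sectionMap A x b p.2))
        (Icc (1 - u) (1 + u) ×ˢ sectionBall A x b r₁) :=
      (hH.continuous_hamFlow A hk).comp_continuousOn (continuousOn_fst.prodMk
        (continuousOn_sectionMap.comp continuousOn_snd fun p hp ↦ hp.2.2.2))
    have h2 : ContinuousOn (A.at x₁) (A.chart (A.idx x₁)).source :=
      (OpenPartialHomeomorph.continuousOn_extend _).mono (by simp)
    exact (L.continuous.comp_continuousOn
      (h2.comp h1 fun p hp ↦ hNs (hinN p.1 hp.1 p.2 hp.2))).sub continuousOn_const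
  have h01 : (0 : E3) ∈ sectionBall A x b r₁ := zero_mem_sectionBall hr₁
  have hG0 : G 1 0 = 0 := by simp only [hG, sectionMap_zero]; exact sub_self _
  have hends : ∀ t ∈ Icc (1 - u) (1 + u),
      ContinuousWithinAt (fun c ↦ G t c) {c | sectionPt A x b c ∈ (A.at x).target} 0 := by
    intro t ht
    have h1 : ContinuousWithinAt (fun c ↦ hamFlow Ω H t (sectionMap A x b c))
        {c | sectionPt A x b c ∈ (A.at x).target} 0 :=
      ((hH.contMDiff_hamFlow_right A hk t).continuous).continuousAt.comp_continuousWithinAt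
        (continuousOn_sectionMap 0 h01.2.2)
    have h2 : ContinuousAt (A.at x₁) (hamFlow Ω H t (sectionMap A x b 0)) :=
      OpenPartialHomeomorph.continuousAt_extend _ (hNs (hinN t ht 0 h01))
    exact (L.continuous.continuousAt.comp_continuousWithinAt
      (ContinuousAt.comp_continuousWithinAt
        (f := fun c ↦ hamFlow Ω H t (sectionMap A x b c)) h2 h1)).sub continuousWithinAt_const
  have hl : 1 - u ∈ Icc (1 - u) (1 + u) := ⟨le_rfl, by linarith⟩
  have hm : (1 : ℝ) ∈ Icc (1 - u) (1 + u) := ⟨by linarith, by linarith⟩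
  have hr : 1 + u ∈ Icc (1 - u) (1 + u) := ⟨by linarith, le_rfl⟩
  have hneg : G (1 - u) 0 < 0 := by
    have := hmono 0 h01 hl hm (by linarith)
    simpa only [hG0] using this
  have hpos : 0 < G (1 + u) 0 := by
    have := hmono 0 h01 hm hr (by linarith)
    simpa only [hG0] using this
  obtain ⟨r₂, hr₂, hr₂'⟩ := exists_sectionBall_forall
    (((hends _ hl).eventually_lt_const hneg).and ((hends _ hr).eventually_const_lt hpos))
  refine ⟨u, hupos, min_le_right _ _, min r₀ (min r₁ r₂), by positivity, ?_, ?_⟩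
  · intro c hc c' hc' t ht t' ht' heq
    exact hinj c (sectionBall_mono (min_le_left _ _) hc) c' (sectionBall_mono (min_le_left _ _) hc')
      t ⟨by linarith [ht.1], by linarith [ht.2]⟩ t' ⟨by linarith [ht'.1], by linarith [ht'.2]⟩ heq
  · intro r' hr' hle
    have s₀ : sectionBall A x b r' ⊆ sectionBall A x b r₀ :=
      sectionBall_mono (hle.trans (min_le_left _ _))
    have s₁ : sectionBall A x b r' ⊆ sectionBall A x b r₁ :=
      sectionBall_mono (hle.trans ((min_le_right _ _).trans (min_le_left _ _)))
    have s₂ : sectionBall A x b r' ⊆ sectionBall A x b r₂ :=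
      sectionBall_mono (hle.trans ((min_le_right _ _).trans (min_le_right _ _)))
    obtain ⟨τ, hτc, hτ⟩ := exists_continuousOn_zero (G := G) (S := sectionBall A x b r')
      (a := 1 - u) (b := 1 + u) (by linarith) (fun c hc ↦ hmono c (s₁ hc))
      (hcont.mono (prod_mono le_rfl s₁)) (fun c hc ↦ (hr₂' c (s₂ hc)).1)
      fun c hc ↦ (hr₂' c (s₂ hc)).2
    have h0 := zero_mem_sectionBall (A := A) (b := b) hr'
    have hu4 : u ≤ 1 / 4 := min_le_right _ _
    refine ⟨τ, ⟨hτc, ?_, fun c hc ↦ ⟨by linarith [(hτ c hc).1.1], ?_⟩, ?_⟩, fun c hc ↦ (hτ c hc).1⟩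
    · refine (hmono 0 h01).injOn (Ioo_subset_Icc_self (hτ 0 h0).1) hm ?_
      simp only [hG0, (hτ 0 h0).2]
    · refine mem_normalSection hL (hNs (hinN _ (Ioo_subset_Icc_self (hτ c hc).1) c (s₁ hc))) ?_
      exact sub_eq_zero.1 (hτ c hc).2
    · rintro ⟨c, t⟩ ⟨hc, ht⟩ ⟨c', t'⟩ ⟨hc', ht'⟩ heq
      have e1 := (hτ c hc).1.2
      have e2 := (hτ c' hc').1.2
      obtain ⟨h1, h2⟩ := hinj c (s₀ hc) c' (s₀ hc') t ⟨by linarith [ht.1], by linarith [ht.2]⟩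
        t' ⟨by linarith [ht'.1], by linarith [ht'.2]⟩ heq
      exact Prod.ext h1 h2

end Sections

section FlowMap

variable {M : Type*} [TopologicalSpace M] [ChartedSpace (EuclideanHalfSpace 4) M]
  [IsManifold (𝓡∂ 4) ∞ M] [RiemannianBundle (fun x : M ↦ TangentSpace (𝓡∂ 4) x)]
  {Ω : SymplecticForm M} {A : DarbouxAtlas Ω} {H : M → ℝ} {x : M}
  {b : Fin 3 → TangentSpace (𝓡∂ 4) x} {k : ℕ∞}
  {h h' : OpenPartialHomeomorph M (EuclideanHalfSpace 4)}

/-- The parameters of the interior points of the normal section. -/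
def sectionInterior (A : DarbouxAtlas Ω) (x : M) (b : Fin 3 → TangentSpace (𝓡∂ 4) x) : Set E3 :=
  {c | sectionPt A x b c ∈ (A.at x).target ∧ 0 < sectionPt A x b c 0}

theorem target_mem_nhds (h : OpenPartialHomeomorph M (EuclideanHalfSpace 4)) {y : E4}
    (hy : y ∈ (h.extend (𝓡∂ 4)).target) (h0 : 0 < y 0) : (h.extend (𝓡∂ 4)).target ∈ 𝓝 y := by
  obtain ⟨R, hR, hsub⟩ := exists_halfBall_subset_target h hy
  have h1 : {z : E4 | 0 < z 0} ∈ 𝓝 y :=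
    (isOpen_lt continuous_const (by fun_prop : Continuous fun z : E4 ↦ z 0)).mem_nhds h0
  filter_upwards [ball_mem_nhds y hR, h1] with z hz hz0 using hsub ⟨hz, hz0.le⟩

theorem isOpen_sectionInterior : IsOpen (sectionInterior A x b) := by
  rw [isOpen_iff_mem_nhds]
  rintro c ⟨hc, hc0⟩
  have hcont : Continuous (sectionPt A x b) := (contDiff_sectionPt (n := 0)).continuous
  have h1 : {z : E4 | 0 < z 0} ∈ 𝓝 (sectionPt A x b c) :=
    (isOpen_lt continuous_const (by fun_prop : Continuous fun z : E4 ↦ z 0)).mem_nhds hc0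
  exact hcont.continuousAt (inter_mem (target_mem_nhds _ hc hc0) h1)

theorem isInteriorPoint_sectionMap {c : E3} (hc : c ∈ sectionInterior A x b) :
    (𝓡∂ 4).IsInteriorPoint (sectionMap A x b c) := by
  rw [isInteriorPoint_iff_chart (A.isDarbouxChart (A.idx x)).mem (sectionMap_mem_source hc.1),
    extend_sectionMap hc.1]
  exact hc.2

theorem contMDiffAt_sectionMap {c : E3} (hc : c ∈ sectionInterior A x b) :
    ContMDiffAt 𝓘(ℝ, E3) (𝓡∂ 4) ∞ (sectionMap A x b) c := by
  have h1 : ContMDiffAt 𝓘(ℝ, E4) (𝓡∂ 4) ∞ (A.at x).symm (sectionPt A x b c) :=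
    ((contMDiffOn_extend_symm (I := 𝓡∂ 4) (A.isDarbouxChart (A.idx x)).mem).contMDiffAt (by
      have := target_mem_nhds _ hc.1 hc.2
      rw [OpenPartialHomeomorph.extend_target'] at this
      exact this))
  exact h1.comp c (contDiff_sectionPt (n := ∞)).contMDiff.contMDiffAt

/-- The parametrization of the flowbox. -/
noncomputable def flowMap (A : DarbouxAtlas Ω) (H : M → ℝ) (x : M)
    (b : Fin 3 → TangentSpace (𝓡∂ 4) x) (a : E13) : M :=
  hamFlow Ω H a.1 (sectionMap A x b a.2)

/-- The differential of the parametrization of the flowbox, read in the chart `h'`. -/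
noncomputable def flowJac (A : DarbouxAtlas Ω) (H : M → ℝ) (x : M)
    (b : Fin 3 → TangentSpace (𝓡∂ 4) x) (h' : OpenPartialHomeomorph M (EuclideanHalfSpace 4))
    (a : E13) : E13 →L[ℝ] E4 :=
  chartJac Ω (A.chart (A.idx x)) h' H a.1 (sectionMap A x b a.2) ∘L
    secFrame (sectionLin A x b) (chartVF Ω (A.chart (A.idx x)) H (sectionPt A x b a.2))

variable [CompactSpace M] [T2Space M]

theorem contMDiffAt_flowMap {n : ℕ∞} (hn : 1 ≤ n) (hH : IsHamiltonian (n + 1) H) {a : E13}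
    (ha : a.2 ∈ sectionInterior A x b) :
    ContMDiffAt 𝓘(ℝ, E13) (𝓡∂ 4) n (flowMap A H x b) a := by
  obtain ⟨ε, hε, V, hV, hxV, hC⟩ := hH.exists_contMDiffOn_hamFlow A hn a.1
    (isInteriorPoint_sectionMap ha)
  have h1 : ContMDiffAt (𝓘(ℝ, ℝ).prod (𝓡∂ 4)) (𝓡∂ 4) n
      (fun p : ℝ × M ↦ hamFlow Ω H p.1 p.2) (a.1, sectionMap A x b a.2) :=
    hC.contMDiffAt (prod_mem_nhds (Ioo_mem_nhds (by linarith) (by linarith)) (hV.mem_nhds hxV))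
  have h2 : ContMDiffAt 𝓘(ℝ, E13) 𝓘(ℝ, ℝ) n (fun a : E13 ↦ a.1) a :=
    (contDiff_fst (n := n)).contMDiff.contMDiffAt
  have h3 : ContMDiffAt 𝓘(ℝ, E13) 𝓘(ℝ, E3) n (fun a : E13 ↦ a.2) a :=
    (contDiff_snd (n := n)).contMDiff.contMDiffAt
  have h4 : ContMDiffAt 𝓘(ℝ, E13) (𝓡∂ 4) n (fun a : E13 ↦ sectionMap A x b a.2) a :=
    ((contMDiffAt_sectionMap ha).of_le (by exact_mod_cast le_top)).comp a h3
  exact ContMDiffAt.comp (g := fun p : ℝ × M ↦ hamFlow Ω H p.1 p.2)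
    (f := fun a : E13 ↦ (a.1, sectionMap A x b a.2)) a h1 (h2.prodMk h4)

theorem contDiffAt_chart_flowMap {n : ℕ∞} (hn : 1 ≤ n) (hH : IsHamiltonian (n + 1) H) {a : E13}
    (ha : a.2 ∈ sectionInterior A x b) (hh : h ∈ IsManifold.maximalAtlas (𝓡∂ 4) ∞ M)
    (hz : flowMap A H x b a ∈ h.source) :
    ContDiffAt ℝ n (fun a ↦ h.extend (𝓡∂ 4) (flowMap A H x b a)) a := by
  have h1 : ContMDiffAt (𝓡∂ 4) 𝓘(ℝ, E4) ∞ (h.extend (𝓡∂ 4)) (flowMap A H x b a) :=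
    h.contMDiffAt_extend hh hz
  exact ((h1.of_le (by exact_mod_cast le_top)).comp a (contMDiffAt_flowMap hn hH ha)).contDiffAt

theorem hasFDerivAt_chart_flowMap {n : ℕ∞} (hn : 1 ≤ n) (hH : IsHamiltonian (n + 1) H) {a : E13}
    (ha : a.2 ∈ sectionInterior A x b) (hh : h ∈ IsManifold.maximalAtlas (𝓡∂ 4) ∞ M)
    (hz : flowMap A H x b a ∈ h.source) :
    HasFDerivAt (fun a ↦ h.extend (𝓡∂ 4) (flowMap A H x b a)) (flowJac A H x b h a) a := by
  have hk : 2 ≤ n + 1 := by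
    calc (2 : ℕ∞) = 1 + 1 := by norm_num
      _ ≤ n + 1 := by gcongr
  have hd := A.isDarbouxChart (A.idx x)
  set z := sectionMap A x b a.2 with hzdef
  have hzs : z ∈ (A.chart (A.idx x)).source := sectionMap_mem_source ha.1
  have hpt : (A.chart (A.idx x)).extend (𝓡∂ 4) z = sectionPt A x b a.2 := extend_sectionMap ha.1
  have hdiff := ((contDiffAt_chart_flowMap hn hH ha hh hz).differentiableAt
    (by simp; exact (zero_lt_one.trans_le hn).ne')).hasFDerivAt
  refine hdiff.congr_fderiv ?_
  set g' := fderiv ℝ (fun a ↦ h.extend (𝓡∂ 4) (flowMap A H x b a)) a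
  have hX : chartVF Ω (A.chart (A.idx x)) H (sectionPt A x b a.2) =
      chartD (A.chart (A.idx x)) z (hamVF Ω H z) := by rw [← hpt, chartVF_extend hzs]
  have e1 : g' (1, 0) = chartD h (hamFlow Ω H a.1 z) (hamVF Ω H (hamFlow Ω H a.1 z)) := by
    have h1 : HasDerivAt (fun t : ℝ ↦ (t, a.2)) ((1 : ℝ), (0 : E3)) a.1 :=
      (hasDerivAt_id a.1).prodMk (hasDerivAt_const a.1 a.2)
    have h2 := HasFDerivAt.comp_hasDerivAt (f := fun t : ℝ ↦ (t, a.2)) a.1 hdiff h1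
    have h3 := HasMFDerivAt.hasDerivAt_chart hh (γ := fun t ↦ hamFlow Ω H t z) (t := a.1) hz
      (hH.isMIntegralCurve_hamFlow A hk z a.1)
    exact h2.unique h3
  have e2 : ∀ ζ, g' (0, ζ) = chartD h (hamFlow Ω H a.1 z) (mfderiv (𝓡∂ 4) (𝓡∂ 4)
      (hamFlow Ω H a.1) z ((chartD (A.chart (A.idx x)) z).inverse (sectionLin A x b ζ))) := by
    intro ζ
    have h1 : HasFDerivAt (fun c : E3 ↦ (a.1, c)) (ContinuousLinearMap.inr ℝ ℝ E3) a.2 :=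
      hasFDerivAt_prodMk_right a.1 a.2
    have h2 := HasFDerivAt.comp (f := fun c : E3 ↦ (a.1, c)) a.2 hdiff h1
    have h3 := (hasMFDerivAt_extend hh hz).comp z (hH.hasMFDerivAt_hamFlow A hk a.1 z)
    have h4 := HasMFDerivAt.hasFDerivWithinAt_chart hd.mem hzs h3
    rw [hpt] at h4
    have h5 : HasFDerivAt (sectionPt A x b) (sectionLin A x b) a.2 :=
      (sectionLin A x b).hasFDerivAt.const_add _
    have h6 := (h4.hasFDerivAt (target_mem_nhds _ ha.1 ha.2)).comp a.2 h5
    exact congrArg (fun L ↦ L ζ) (h2.unique h6)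
  refine ContinuousLinearMap.ext fun v ↦ ?_
  have hv : v = v.1 • ((1 : ℝ), (0 : E3)) + (0, v.2) := by ext <;> simp
  have hL : g' v = v.1 • g' (1, 0) + g' (0, v.2) := by
    conv_lhs => rw [hv, map_add, map_smul]
  have hR : flowJac A H x b h a v = chartD h (hamFlow Ω H a.1 z) (mfderiv (𝓡∂ 4) (𝓡∂ 4)
      (hamFlow Ω H a.1) z ((chartD (A.chart (A.idx x)) z).inverse (v.1 •
        chartVF Ω (A.chart (A.idx x)) H (sectionPt A x b a.2) + sectionLin A x b v.2))) := rfl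
  rw [hL, hR, hX, e1, e2, map_add, map_smul, chartD_inverse_apply hd.mem hzs, map_add, map_smul,
    hH.mfderiv_hamFlow_hamVF A hk, map_add, map_smul]

theorem chartJac_leftInverse (A : DarbouxAtlas Ω) (hH : IsHamiltonian k H) (hk : 2 ≤ k)
    (hh : h ∈ IsManifold.maximalAtlas (𝓡∂ 4) ∞ M) (hh' : h' ∈ IsManifold.maximalAtlas (𝓡∂ 4) ∞ M)
    {t : ℝ} {z : M} (hz : z ∈ h.source) (hz' : hamFlow Ω H t z ∈ h'.source) (w : E4) :
    chartD h z (mfderiv (𝓡∂ 4) (𝓡∂ 4) (hamFlow Ω H (-t)) (hamFlow Ω H t z)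
      ((chartD h' (hamFlow Ω H t z)).inverse (chartJac Ω h h' H t z w))) = w := by
  change chartD h z (mfderiv (𝓡∂ 4) (𝓡∂ 4) (hamFlow Ω H (-t)) (hamFlow Ω H t z)
      ((chartD h' (hamFlow Ω H t z)).inverse (chartD h' (hamFlow Ω H t z)
        (mfderiv (𝓡∂ 4) (𝓡∂ 4) (hamFlow Ω H t) z ((chartD h z).inverse w))))) = w
  rw [chartD_inverse_apply hh' hz', hH.mfderiv_hamFlow_comp_neg A hk, chartD_apply_inverse hh hz]

theorem chartJac_isInvertible (A : DarbouxAtlas Ω) (hH : IsHamiltonian k H) (hk : 2 ≤ k)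
    (hh : h ∈ IsManifold.maximalAtlas (𝓡∂ 4) ∞ M) (hh' : h' ∈ IsManifold.maximalAtlas (𝓡∂ 4) ∞ M)
    {t : ℝ} {z : M} (hz : z ∈ h.source) (hz' : hamFlow Ω H t z ∈ h'.source) :
    (chartJac Ω h h' H t z).IsInvertible := by
  have hinj : Function.Injective (chartJac Ω h h' H t z) := fun w w' hw ↦ by
    rw [← chartJac_leftInverse A hH hk hh hh' hz hz' w, hw, chartJac_leftInverse A hH hk hh hh' hz hz']
  exact ⟨(LinearEquiv.ofInjectiveEndo (chartJac Ω h h' H t z : E4 →ₗ[ℝ] E4)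
    hinj).toContinuousLinearEquiv, rfl⟩

theorem chartJac_inverse_apply (A : DarbouxAtlas Ω) (hH : IsHamiltonian k H) (hk : 2 ≤ k)
    (hh : h ∈ IsManifold.maximalAtlas (𝓡∂ 4) ∞ M) (hh' : h' ∈ IsManifold.maximalAtlas (𝓡∂ 4) ∞ M)
    {t : ℝ} {z : M} (hz : z ∈ h.source) (hz' : hamFlow Ω H t z ∈ h'.source) (w : E4) :
    (chartJac Ω h h' H t z).inverse w = chartD h z (mfderiv (𝓡∂ 4) (𝓡∂ 4) (hamFlow Ω H (-t))
      (hamFlow Ω H t z) ((chartD h' (hamFlow Ω H t z)).inverse w)) := by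
  have h1 := (chartJac_isInvertible A hH hk hh hh' hz hz').apply_inverse w
  conv_rhs => rw [← h1, chartJac_leftInverse A hH hk hh hh' hz hz']

theorem flowJac_isInvertible (hH : IsHamiltonian k H) (hk : 2 ≤ k)
    (hh : h ∈ IsManifold.maximalAtlas (𝓡∂ 4) ∞ M) {a : E13}
    (ha : sectionPt A x b a.2 ∈ (A.at x).target) (hz : flowMap A H x b a ∈ h.source)
    (hS : (secFrame (sectionLin A x b)
      (chartVF Ω (A.chart (A.idx x)) H (sectionPt A x b a.2))).IsInvertible) :
    (flowJac A H x b h a).IsInvertible := by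
  obtain ⟨e, he⟩ := hS
  obtain ⟨e', he'⟩ := chartJac_isInvertible A hH hk (A.isDarbouxChart (A.idx x)).mem hh
    (sectionMap_mem_source ha) hz
  refine ⟨e.trans e', ?_⟩
  rw [flowJac, ← he, ← he']
  rfl

/-- On an open set of parameters where it is injective, the flowbox map is open, with an inverse
which is as regular as the flow. -/
theorem exists_flowMap_inverse {n : ℕ∞} (hn : 1 ≤ n) (hH : IsHamiltonian (n + 1) H) {S : Set E13}
    (hSo : IsOpen S) (hSi : InjOn (flowMap A H x b) S)
    (hS : ∀ a ∈ S, a.2 ∈ sectionInterior A x b ∧ (secFrame (sectionLin A x b)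
      (chartVF Ω (A.chart (A.idx x)) H (sectionPt A x b a.2))).IsInvertible) :
    ∃ G : M → E13, (∀ a ∈ S, G (flowMap A H x b a) = a) ∧
      (∀ a ∈ S, flowMap A H x b '' S ∈ 𝓝 (flowMap A H x b a)) ∧
      ∀ a ∈ S, ∀ h ∈ IsManifold.maximalAtlas (𝓡∂ 4) ∞ M, flowMap A H x b a ∈ h.source →
        ContDiffAt ℝ n (G ∘ (h.extend (𝓡∂ 4)).symm) (h.extend (𝓡∂ 4) (flowMap A H x b a)) ∧
        HasFDerivAt (G ∘ (h.extend (𝓡∂ 4)).symm) (flowJac A H x b h a).inverse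
          (h.extend (𝓡∂ 4) (flowMap A H x b a)) := by
  have hk : 2 ≤ n + 1 := by
    calc (2 : ℕ∞) = 1 + 1 := by norm_num
      _ ≤ n + 1 := by gcongr
  have hn' : (n : WithTop ℕ∞) ≠ 0 := by simp; exact (zero_lt_one.trans_le hn).ne'
  set G : M → E13 := Function.invFunOn (flowMap A H x b) S with hG
  have hGS : ∀ a ∈ S, G (flowMap A H x b a) = a := fun a ha ↦ hSi.leftInvOn_invFunOn ha
  have main : ∀ a ∈ S, ∀ h ∈ IsManifold.maximalAtlas (𝓡∂ 4) ∞ M, flowMap A H x b a ∈ h.source →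
      ∃ L : E4 → E13, ContDiffAt ℝ n L (h.extend (𝓡∂ 4) (flowMap A H x b a)) ∧
        HasFDerivAt L (flowJac A H x b h a).inverse (h.extend (𝓡∂ 4) (flowMap A H x b a)) ∧
        ∀ᶠ w in 𝓝 (h.extend (𝓡∂ 4) (flowMap A H x b a)), L w ∈ S ∧
          flowMap A H x b (L w) = (h.extend (𝓡∂ 4)).symm w := by
    intro a ha h hh hz
    have hg := contDiffAt_chart_flowMap hn hH (hS a ha).1 hh hz
    have hg1 := hasFDerivAt_chart_flowMap hn hH (hS a ha).1 hh hz
    obtain ⟨e, he⟩ := flowJac_isInvertible hH hk hh (hS a ha).1.1 hz (hS a ha).2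
    rw [← he] at hg1
    have hst := hg.hasStrictFDerivAt' hg1 hn'
    refine ⟨hst.localInverse _ e a, hg.to_localInverse hg1 hn', ?_, ?_⟩
    · rw [← he, ContinuousLinearMap.inverse_equiv]
      exact hst.to_localInverse.hasFDerivAt
    · have hLa : hst.localInverse _ e a (h.extend (𝓡∂ 4) (flowMap A H x b a)) = a :=
        hst.localInverse_apply_image
      have hLc := hst.localInverse_continuousAt
      have hfc : ContinuousAt (flowMap A H x b) a := (contMDiffAt_flowMap hn hH (hS a ha).1).continuousAt
      have h1 : ∀ᶠ a' in 𝓝 a, a' ∈ S ∧ flowMap A H x b a' ∈ h.source :=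
        Filter.Eventually.and (hSo.mem_nhds ha) (hfc (h.open_source.mem_nhds hz))
      have h2 : ∀ᶠ w in 𝓝 (h.extend (𝓡∂ 4) (flowMap A H x b a)),
          hst.localInverse _ e a w ∈ S ∧ flowMap A H x b (hst.localInverse _ e a w) ∈ h.source := by
        rw [← hLa] at h1
        exact hLc.eventually (p := fun a' ↦ a' ∈ S ∧ flowMap A H x b a' ∈ h.source) h1
      filter_upwards [h2, hst.eventually_right_inverse] with w hw hr
      refine ⟨hw.1, ?_⟩
      conv_rhs => rw [← hr]
      exact (h.extend_left_inv (I := 𝓡∂ 4) hw.2).symm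
  refine ⟨G, hGS, fun a ha ↦ ?_, fun a ha h hh hz ↦ ?_⟩
  · have hd := (A.isDarbouxChart (A.idx (flowMap A H x b a))).mem
    have hz := A.mem_source (flowMap A H x b a)
    obtain ⟨L, -, -, hL⟩ := main a ha _ hd hz
    have hc := OpenPartialHomeomorph.continuousAt_extend (I := 𝓡∂ 4)
      (A.chart (A.idx (flowMap A H x b a))) hz
    filter_upwards [hc.eventually hL, (A.chart (A.idx (flowMap A H x b a))).open_source.mem_nhds hz]
      with z hz1 hz2
    refine ⟨_, hz1.1, hz1.2.trans ?_⟩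
    exact (A.chart (A.idx (flowMap A H x b a))).extend_left_inv (I := 𝓡∂ 4) hz2
  · obtain ⟨L, hL1, hL2, hL⟩ := main a ha h hh hz
    have heq : G ∘ (h.extend (𝓡∂ 4)).symm =ᶠ[𝓝 (h.extend (𝓡∂ 4) (flowMap A H x b a))] L := by
      filter_upwards [hL] with w hw
      rw [Function.comp_apply, ← hw.2, hGS _ hw.1]
    exact ⟨hL1.congr_of_eventuallyEq heq, hL2.congr_of_eventuallyEq heq⟩

end FlowMap

section SectionMeasure

variable {M : Type*} [TopologicalSpace M] [ChartedSpace (EuclideanHalfSpace 4) M]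
  [IsManifold (𝓡∂ 4) ∞ M] [RiemannianBundle (fun x : M ↦ TangentSpace (𝓡∂ 4) x)]
  {Ω : SymplecticForm M} {A : DarbouxAtlas Ω} {H : M → ℝ} {x : M}
  {b : Fin 3 → TangentSpace (𝓡∂ 4) x} {k : ℕ∞}

theorem frameVec_single (i : Fin 3) : frameVec b (EuclideanSpace.single i 1) = b i := by
  rw [frameVec_apply]
  simp [PiLp.single_apply, ite_smul]

theorem IsNormalFrame.wedgeSq_ne_zero (hb : IsNormalFrame Ω H x b) (hX : hamVF Ω H x ≠ 0) :
    Ω.wedgeSq x (hamVF Ω H x) (b 0) (b 1) (b 2) ≠ 0 := by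
  have hd : ∀ v, v ∈ transFiber Ω H x → Ω.form x (hamVF Ω H x) v = 0 := fun v hv ↦ by
    rw [form_hamVF]; exact (Submodule.mem_inf.1 hv).2
  have h0 := hd _ hb.2.2.1
  have h1 := hd _ hb.2.2.2
  have hskew : ∀ v w : TangentSpace (𝓡∂ 4) x, Ω.form x v w = -Ω.form x w v := fun v w ↦ by
    have := Ω.alternating x (v + w)
    simp only [map_add, add_apply, Ω.alternating] at this
    linarith
  have hzero : ∀ v : TangentSpace (𝓡∂ 4) x, Ω.form x v (hamVF Ω H x) = 0 →
      (∀ i, Ω.form x v (b i) = 0) → v = 0 := fun v hv hvi ↦ by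
    refine Ω.nondegenerate x v fun w ↦ ?_
    obtain ⟨w, rfl⟩ := (hb.flowFrame_bijective hX).2 w
    rw [flowFrame_apply, map_add, map_smul, hv, frameVec_apply, map_sum]
    simp [hvi]
  have h2 : Ω.form x (hamVF Ω H x) (b 2) ≠ 0 := fun h2 ↦
    hX (hzero _ (Ω.alternating x _) fun i ↦ by fin_cases i <;> assumption)
  have h3 : Ω.form x (b 0) (b 1) ≠ 0 := by
    intro h3
    set s := Ω.form x (b 0) (b 2) / Ω.form x (hamVF Ω H x) (b 2) with hs
    have h4 := hzero (b 0 - s • hamVF Ω H x) (by simp [Ω.alternating, hskew (b 0), h0]) fun i ↦ by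
      fin_cases i
      · simp [Ω.alternating, h0]
      · simp [h3, h1]
      · simp only [map_sub, sub_apply, map_smul, smul_apply, smul_eq_mul, hs, Fin.reduceFinMk]
        field_simp
        simp
    have h5 := congrArg (fun v ↦ inner ℝ (b 0) v) h4
    simp only [inner_sub_right, inner_smul_right, inner_zero_right] at h5
    have h6 : inner ℝ (b 0) (hamVF Ω H x) = 0 := by
      rw [real_inner_comm, ← frameVec_single (b := b) 0, hb.inner_frameVec]
    rw [h6, real_inner_self_eq_norm_sq, hb.1.1 0] at h5
    norm_num at h5
  rw [SymplecticForm.wedgeSq, h0, h1]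
  simp [h2, h3]

theorem measurableSet_sectionBall {r : ℝ} : MeasurableSet (sectionBall A x b r) := by
  have hc : Continuous (sectionPt A x b) := (contDiff_sectionPt (n := 0)).continuous
  have h1 : MeasurableSet (A.at x).target := by
    rw [DarbouxAtlas.at, OpenPartialHomeomorph.extend_target]
    exact ((A.chart (A.idx x)).open_target.preimage (𝓡∂ 4).continuous_symm).measurableSet.inter
      (𝓡∂ 4).isClosed_range.measurableSet
  have h2 : IsOpen {c : E3 | √(c 0 ^ 2 + c 1 ^ 2) < r} := isOpen_lt (by fun_prop) continuous_const
  have h3 : IsOpen {c : E3 | |c 2| < r} := isOpen_lt (by fun_prop) continuous_const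
  have h4 : sectionBall A x b r = {c : E3 | √(c 0 ^ 2 + c 1 ^ 2) < r} ∩ ({c : E3 | |c 2| < r} ∩
    sectionPt A x b ⁻¹' (A.at x).target) := rfl
  rw [h4]
  exact h2.measurableSet.inter (h3.measurableSet.inter (hc.measurable h1))

theorem isOpen_inter_sectionInterior {r : ℝ} :
    IsOpen (sectionBall A x b r ∩ sectionInterior A x b) := by
  have h2 : IsOpen {c : E3 | √(c 0 ^ 2 + c 1 ^ 2) < r} := isOpen_lt (by fun_prop) continuous_const
  have h3 : IsOpen {c : E3 | |c 2| < r} := isOpen_lt (by fun_prop) continuous_const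
  have h4 : sectionBall A x b r ∩ sectionInterior A x b = ({c : E3 | √(c 0 ^ 2 + c 1 ^ 2) < r} ∩
      {c : E3 | |c 2| < r}) ∩ sectionInterior A x b := by
    ext c
    exact ⟨fun h ↦ ⟨⟨h.1.1, h.1.2.1⟩, h.2⟩, fun h ↦ ⟨⟨h.1.1, h.1.2, h.2.1⟩, h.2⟩⟩
  rw [h4]
  exact (h2.inter h3).inter isOpen_sectionInterior

/-- Near the center, the measure of the normal section is comparable to the Lebesgue measure. -/
theorem exists_density_bounds {Y : E4 → E4} (hY : Continuous Y)
    (hYX : ∀ᶠ c in 𝓝[{c | sectionPt A x b c ∈ (A.at x).target}] 0,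
      Y (sectionPt A x b c) = chartVF Ω (A.chart (A.idx x)) H (sectionPt A x b c))
    (hb : IsNormalFrame Ω H x b) (hX : hamVF Ω H x ≠ 0) :
    ∃ r > 0, ∃ d > 0, ∀ S ⊆ sectionBall A x b r, MeasurableSet S →
      transMeasure A H x b S ≤ ENNReal.ofReal (2 * d) * volume S ∧
      ENNReal.ofReal d * volume S ≤ transMeasure A H x b S := by
  have hd := A.isDarbouxChart (A.idx x)
  set h := A.chart (A.idx x)
  set B : Fin 3 → E4 := fun i ↦ chartD h x (b i)
  set w : E4 → ℝ := fun a ↦ |2 * (stdForm a (B 0) * stdForm (B 1) (B 2) -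
    stdForm a (B 1) * stdForm (B 0) (B 2) + stdForm a (B 2) * stdForm (B 0) (B 1))| with hw
  have hwc : Continuous fun c ↦ w (Y (sectionPt A x b c)) := by
    have h1 : Continuous fun c ↦ Y (sectionPt A x b c) :=
      hY.comp (contDiff_sectionPt (n := 0)).continuous
    have h2 : ∀ a, Continuous fun c ↦ stdForm (Y (sectionPt A x b c)) a := fun a ↦ by
      simp only [← stdFormL_apply]
      exact (stdFormL.continuous.comp h1).clm_apply continuous_const
    simp only [hw]
    exact (continuous_const.mul ((((h2 _).mul continuous_const).sub
      ((h2 _).mul continuous_const)).add ((h2 _).mul continuous_const))).abs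
  have hden : ∀ c, sectionPt A x b c ∈ (A.at x).target →
      Y (sectionPt A x b c) = chartVF Ω h H (sectionPt A x b c) →
      |Ω.wedgeSq (sectionMap A x b c) (hamVF Ω H (sectionMap A x b c))
        ((chartD h (sectionMap A x b c)).inverse (chartD h x (b 0)))
        ((chartD h (sectionMap A x b c)).inverse (chartD h x (b 1)))
        ((chartD h (sectionMap A x b c)).inverse (chartD h x (b 2)))| =
      w (Y (sectionPt A x b c)) := fun c hc hYc ↦ by
    have hz := sectionMap_mem_source hc
    have h1 : chartD h (sectionMap A x b c) (hamVF Ω H (sectionMap A x b c)) =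
        Y (sectionPt A x b c) := by rw [hYc]; rfl
    simp only [hw, SymplecticForm.wedgeSq, hd.form_eq _ hz, chartD_apply_inverse hd.mem hz, h1, B]
  have h00 : sectionPt A x b 0 ∈ (A.at x).target := (zero_mem_sectionBall one_pos).2.2
  have hpos : 0 < w (Y (sectionPt A x b 0)) := by
    have hx := A.mem_source x
    have h1 : w (Y (sectionPt A x b 0)) =
        |Ω.wedgeSq x (hamVF Ω H x) (b 0) (b 1) (b 2)| := by
      have h2 : Y (sectionPt A x b 0) = chartD h x (hamVF Ω H x) := by
        rw [hYX.self_of_nhdsWithin h00, sectionPt_zero]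
        exact chartVF_extend hx
      simp only [hw, SymplecticForm.wedgeSq, hd.form_eq _ hx, h2, B]
    rw [h1]
    exact abs_pos.2 (hb.wedgeSq_ne_zero hX)
  set d := 2 / 3 * w (Y (sectionPt A x b 0)) with hdd
  have hd0 : 0 < d := by positivity
  have hev : ∀ᶠ c in 𝓝[{c | sectionPt A x b c ∈ (A.at x).target}] 0,
      d ≤ w (Y (sectionPt A x b c)) ∧ w (Y (sectionPt A x b c)) ≤ 2 * d := by
    refine nhdsWithin_le_nhds ?_
    filter_upwards [hwc.continuousAt.eventually_const_lt (show d < w (Y (sectionPt A x b 0)) by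
      linarith), hwc.continuousAt.eventually_lt_const (show w (Y (sectionPt A x b 0)) < 2 * d by
      linarith)] with c h1 h2 using ⟨h1.le, h2.le⟩
  obtain ⟨r, hr, hr'⟩ := exists_sectionBall_forall (hev.and hYX)
  refine ⟨r, hr, d, hd0, fun S hS hSm ↦ ?_⟩
  rw [transMeasure, withDensity_apply _ hSm]
  constructor
  · rw [← setLIntegral_const]
    refine setLIntegral_mono' hSm fun c hc ↦ ENNReal.ofReal_le_ofReal ?_
    refine (hden c (hS hc).2.2 (hr' c (hS hc)).2).le.trans (hr' c (hS hc)).1.2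
  · rw [← setLIntegral_const]
    refine setLIntegral_mono' hSm fun c hc ↦ ENNReal.ofReal_le_ofReal ?_
    refine (hr' c (hS hc)).1.1.trans (hden c (hS hc).2.2 (hr' c (hS hc)).2).ge

/-- The boundary points of the normal section form a null set. -/
theorem exists_null_boundary (hH : IsHamiltonian k H) (hk : 2 ≤ k) (hb : IsNormalFrame Ω H x b)
    (hX : hamVF Ω H x ≠ 0) :
    ∃ r > 0, volume (sectionBall A x b r \ sectionInterior A x b) = 0 := by
  have hd := A.isDarbouxChart (A.idx x)
  have hx := A.mem_source x
  have hxt : A.at x x ∈ (A.at x).target := extend_mem_target _ hx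
  have h0 : 0 ≤ A.at x x 0 := extend_target_nonneg (A.chart (A.idx x)) hxt
  rcases h0.eq_or_lt with h0 | h0
  · refine ⟨1, one_pos, ?_⟩
    set ℓ : E3 →ₗ[ℝ] ℝ := (EuclideanSpace.proj (𝕜 := ℝ) (0 : Fin 4)).toLinearMap ∘ₗ
      (sectionLin A x b).toLinearMap with hℓ
    have hℓ0 : LinearMap.ker ℓ ≠ ⊤ := by
      intro htop
      have hS := hb.secFrame_isInvertible (A := A) hX
      have hX0 : chartD (A.chart (A.idx x)) x (hamVF Ω H x) 0 = 0 := by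
        rw [← chartVF_extend hx]
        exact hH.chartVF_tangent (one_le_two.trans hk) hd hxt h0.symm
      have h1 := hS.apply_inverse (EuclideanSpace.single 0 1)
      set v := (secFrame (sectionLin A x b) (chartD (A.chart (A.idx x)) x
        (hamVF Ω H x))).inverse (EuclideanSpace.single 0 1)
      have h2 : sectionLin A x b v.2 0 = 0 := by
        have : v.2 ∈ LinearMap.ker ℓ := by rw [htop]; trivial
        exact this
      have h3 := congrArg (fun a : E4 ↦ a 0) h1
      simp [secFrame_apply, hX0, h2] at h3
    refine measure_mono_null (fun c hc ↦ ?_) (Measure.addHaar_submodule volume _ hℓ0)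
    have h3 : 0 ≤ sectionPt A x b c 0 := extend_target_nonneg (A.chart (A.idx x)) hc.1.2.2
    have h4 : ¬ 0 < sectionPt A x b c 0 := fun h ↦ hc.2 ⟨hc.1.2.2, h⟩
    have h5 : sectionPt A x b c 0 = sectionLin A x b c 0 := by
      rw [sectionPt_eq, PiLp.add_apply, ← h0, zero_add]
    change sectionLin A x b c 0 = 0
    linarith
  · have hc : Continuous fun c ↦ sectionPt A x b c 0 :=
      (by fun_prop : Continuous fun z : E4 ↦ z 0).comp (contDiff_sectionPt (n := 0)).continuous
    have h1 : ∀ᶠ c in 𝓝[{c | sectionPt A x b c ∈ (A.at x).target}] 0, 0 < sectionPt A x b c 0 :=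
      nhdsWithin_le_nhds (hc.continuousAt.eventually_const_lt (by simpa only [sectionPt_zero] using h0))
    obtain ⟨r, hr, hr'⟩ := exists_sectionBall_forall h1
    refine ⟨r, hr, ?_⟩
    have hsub : sectionBall A x b r ⊆ sectionInterior A x b := fun c hc ↦ ⟨hc.2.2, hr' c hc⟩
    rw [diff_eq_empty.2 hsub, measure_empty]

/-- Most of a relatively open subset of the normal section is contained in an open set which is
relatively compact in its interior. -/
theorem exists_open_subset (hH : IsHamiltonian k H) (hk : 2 ≤ k) (hb : IsNormalFrame Ω H x b)
    (hX : hamVF Ω H x ≠ 0) {κ : ℝ} (hκ : 0 < κ) :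
    ∃ r₀ > 0, ∀ r ≤ r₀, ∀ O : Set E3, IsOpen O →
      ∃ W, IsOpen W ∧ IsCompact (closure W) ∧
        closure W ⊆ (O ∩ sectionBall A x b r) ∩ sectionInterior A x b ∧
        ∀ K ⊆ W, MeasurableSet K → volume (W \ K) ≤ ENNReal.ofReal (κ / 4) * volume W →
          transMeasure A H x b ((O ∩ sectionBall A x b r) \ K) ≤
            ENNReal.ofReal κ * transMeasure A H x b (O ∩ sectionBall A x b r) := by
  have hd := A.isDarbouxChart (A.idx x)
  have hxt : A.at x x ∈ (A.at x).target := extend_mem_target _ (A.mem_source x)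
  obtain ⟨R, hR, Y, hY, -, -, hYX⟩ := hH.exists_chartVF_extension hk hd hxt
  have hev : ∀ᶠ c in 𝓝[{c | sectionPt A x b c ∈ (A.at x).target}] 0,
      Y (sectionPt A x b c) = chartVF Ω (A.chart (A.idx x)) H (sectionPt A x b c) := by
    have hc : ContinuousAt (sectionPt A x b) 0 := (contDiff_sectionPt (n := 0)).continuous.continuousAt
    filter_upwards [self_mem_nhdsWithin, nhdsWithin_le_nhds (hc.preimage_mem_nhds
      (by rw [sectionPt_zero]; exact ball_mem_nhds _ hR))] with c hc hcR
    exact (hYX _ hcR (extend_target_nonneg (A.chart (A.idx x)) hc)).2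
  obtain ⟨r₁, hr₁, d, hd0, hden⟩ := exists_density_bounds hY.continuous hev hb hX
  obtain ⟨r₂, hr₂, hnull⟩ := exists_null_boundary (A := A) hH hk hb hX
  refine ⟨min r₁ r₂, by positivity, fun r hr O hO ↦ ?_⟩
  set U := O ∩ sectionBall A x b r with hU
  have hUm : MeasurableSet U := hO.measurableSet.inter measurableSet_sectionBall
  have hU1 : U ⊆ sectionBall A x b r₁ :=
    inter_subset_right.trans (sectionBall_mono (hr.trans (min_le_left _ _)))
  have hUo : IsOpen (U ∩ sectionInterior A x b) := by
    rw [hU, inter_assoc]; exact hO.inter isOpen_inter_sectionInterior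
  have hUfin : volume U ≠ ⊤ := by
    refine ((measure_mono (t := ball (0 : E3) (2 * r₁)) fun c hc ↦ ?_).trans_lt
      measure_ball_lt_top).ne
    rw [mem_ball_zero_iff]
    exact norm_lt_of_mem_sectionBall (hU1 hc)
  have hUnull : volume (U \ sectionInterior A x b) = 0 :=
    measure_mono_null (diff_subset_diff_left (inter_subset_right.trans
      (sectionBall_mono (hr.trans (min_le_right _ _))))) hnull
  obtain ⟨K₀, hK₀, hK₀c, hK₀v⟩ : ∃ K₀ ⊆ U ∩ sectionInterior A x b, IsCompact K₀ ∧
      volume ((U ∩ sectionInterior A x b) \ K₀) ≤ ENNReal.ofReal (κ / 4) * volume U := by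
    rcases eq_or_ne (volume U) 0 with h0 | h0
    · refine ⟨∅, empty_subset _, isCompact_empty, ?_⟩
      rw [h0, mul_zero, nonpos_iff_eq_zero]
      exact measure_mono_null (diff_subset.trans inter_subset_left) h0
    · obtain ⟨K₀, h1, h2, h3⟩ := hUo.measurableSet.exists_isCompact_diff_lt
        (ne_top_of_le_ne_top hUfin (measure_mono inter_subset_left))
        (ε := ENNReal.ofReal (κ / 4) * volume U) (mul_ne_zero (by simpa using hκ) h0)
      exact ⟨K₀, h1, h2, h3.le⟩
  obtain ⟨W, hW, hKW, hWU, hWc⟩ := exists_open_between_and_isCompact_closure hK₀c hUo hK₀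
  refine ⟨W, hW, hWc, hWU, fun K hKW' hKm hKv ↦ ?_⟩
  have hvol : volume (U \ K) ≤ ENNReal.ofReal (κ / 2) * volume U := by
    have hsub : U \ K ⊆ (U \ sectionInterior A x b) ∪
        (((U ∩ sectionInterior A x b) \ K₀) ∪ (W \ K)) := by
      intro c hc
      by_cases h1 : c ∈ sectionInterior A x b
      · by_cases h2 : c ∈ K₀
        · exact Or.inr (Or.inr ⟨hKW h2, hc.2⟩)
        · exact Or.inr (Or.inl ⟨⟨hc.1, h1⟩, h2⟩)
      · exact Or.inl ⟨hc.1, h1⟩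
    have hWle : volume W ≤ volume U :=
      measure_mono (subset_closure.trans (hWU.trans inter_subset_left))
    calc volume (U \ K) ≤ 0 + (ENNReal.ofReal (κ / 4) * volume U +
          ENNReal.ofReal (κ / 4) * volume U) := by
          refine (measure_mono hsub).trans ((measure_union_le _ _).trans (add_le_add hUnull.le
            ((measure_union_le _ _).trans (add_le_add hK₀v (hKv.trans (by gcongr))))))
      _ = ENNReal.ofReal (κ / 2) * volume U := by
          rw [zero_add, ← add_mul, ← ENNReal.ofReal_add (by positivity) (by positivity)]
          congr 2; ring
  calc transMeasure A H x b (U \ K) ≤ ENNReal.ofReal (2 * d) * volume (U \ K) :=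
        (hden _ (diff_subset.trans hU1) (hUm.diff hKm)).1
    _ ≤ ENNReal.ofReal (2 * d) * (ENNReal.ofReal (κ / 2) * volume U) := by gcongr
    _ = ENNReal.ofReal κ * (ENNReal.ofReal d * volume U) := by
        rw [← mul_assoc, ← mul_assoc, ← ENNReal.ofReal_mul (by positivity),
          ← ENNReal.ofReal_mul hκ.le]
        congr 2; ring
    _ ≤ _ := by gcongr; exact (hden _ hU1 hUm).2

end SectionMeasure

theorem ContinuousAt.eventually_norm_lt {X V : Type*} [TopologicalSpace X] [NormedAddCommGroup V]
    {f : X → V} {x : X} (hf : ContinuousAt f x) : ∀ᶠ z in 𝓝 x, ‖f z‖ < ‖f x‖ + 1 :=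
  hf.norm.eventually_lt_const (lt_add_one _)

theorem ContinuousAt.eventually_norm_sub_lt {X V : Type*} [TopologicalSpace X]
    [NormedAddCommGroup V] {f : X → V} {x : X} (hf : ContinuousAt f x) {δ : ℝ} (hδ : 0 < δ) :
    ∀ᶠ z in 𝓝 x, ‖f z - f x‖ < δ := by
  filter_upwards [hf.eventually (ball_mem_nhds _ hδ)] with z hz
  rwa [← dist_eq_norm]

theorem ContinuousAt.eventually_abs_sub_le {X E : Type*} [TopologicalSpace X]
    [NormedAddCommGroup E] [NormedSpace ℝ E] {f : X → E →L[ℝ] E →L[ℝ] ℝ} {x : X}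
    (hf : ContinuousAt f x) {δ : ℝ} (hδ : 0 < δ) :
    ∀ᶠ z in 𝓝 x, ∀ w, |f z w w - f x w w| ≤ δ * ‖w‖ * ‖w‖ := by
  filter_upwards [ContinuousAt.eventually_norm_sub_lt (V := E →L[ℝ] E →L[ℝ] ℝ) (f := f) hf hδ]
    with z hz w
  exact ((f z - f x).le_opNorm₂ w w).trans (by gcongr)

theorem exists_C2_bounds {E V : Type*} [NormedAddCommGroup E] [NormedSpace ℝ E]
    [NormedAddCommGroup V] [NormedSpace ℝ V] {f : E → V} {y : E} (hf : ContDiffAt ℝ 2 f y) :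
    ∃ C, 0 ≤ C ∧ ∀ᶠ z in 𝓝 y, (∀ e, ‖fderiv ℝ f z e‖ ≤ C * ‖e‖) ∧
      ∀ e e', ‖fderiv ℝ (fderiv ℝ f) z e e'‖ ≤ C * ‖e‖ * ‖e'‖ := by
  have h1 : ContDiffAt ℝ 1 (fderiv ℝ f) y := hf.fderiv_right (by norm_num)
  have h2 : ContDiffAt ℝ 0 (fderiv ℝ (fderiv ℝ f)) y := h1.fderiv_right (by norm_num)
  refine ⟨max (‖fderiv ℝ f y‖ + 1) (‖fderiv ℝ (fderiv ℝ f) y‖ + 1), by positivity, ?_⟩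
  filter_upwards [h1.continuousAt.eventually_norm_lt,
    h2.continuousAt.eventually_norm_lt] with z hz1 hz2
  refine ⟨fun e ↦ ?_, fun e e' ↦ ?_⟩
  · exact (ContinuousLinearMap.le_opNorm _ _).trans
      (by gcongr; exact hz1.le.trans (le_max_left _ _))
  · exact (ContinuousLinearMap.le_opNorm₂ _ _ _).trans
      (by gcongr; exact hz2.le.trans (le_max_right _ _))

section CompositeBounds

variable {α : ℝ} {ψ : ℝ → ℝ} {𝒢 : E3 → ℝ} {g : E4 → E13} {y : E4}

theorem fderiv_pert_comp (hψ : ContDiff ℝ ∞ ψ) (h𝒢 : ContDiff ℝ ∞ 𝒢)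
    (hg : DifferentiableAt ℝ g y) :
    fderiv ℝ (fun y ↦ α * (ψ (g y).1 * 𝒢 (g y).2)) y = dPert α ψ 𝒢 (g y) ∘L fderiv ℝ g y :=
  ((hasFDerivAt_pert (hψ.differentiable (by simp)) (h𝒢.differentiable (by simp)) (g y)).comp y
    hg.hasFDerivAt).fderiv

theorem fderiv_fderiv_pert_comp (hψ : ContDiff ℝ ∞ ψ) (h𝒢 : ContDiff ℝ ∞ 𝒢)
    (hg : ContDiffAt ℝ 2 g y) (e e' : E4) :
    fderiv ℝ (fderiv ℝ (fun y ↦ α * (ψ (g y).1 * 𝒢 (g y).2))) y e e' =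
      fderiv ℝ (dPert α ψ 𝒢) (g y) (fderiv ℝ g y e) (fderiv ℝ g y e') +
        dPert α ψ 𝒢 (g y) (fderiv ℝ (fderiv ℝ g) y e e') := by
  have h1 : fderiv ℝ (fun y ↦ α * (ψ (g y).1 * 𝒢 (g y).2)) =ᶠ[𝓝 y]
      fun z ↦ dPert α ψ 𝒢 (g z) ∘L fderiv ℝ g z := by
    filter_upwards [hg.eventually (by simp)] with z hz
    exact fderiv_pert_comp hψ h𝒢 (hz.differentiableAt (by simp))
  have hg' : DifferentiableAt ℝ (fderiv ℝ g) y :=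
    (hg.fderiv_right (m := 1) (by norm_num)).differentiableAt (by simp)
  have h2 := (((contDiff_dPert (α := α) hψ h𝒢).differentiable (by simp) (g y)).hasFDerivAt.comp y
    (hg.differentiableAt (by simp)).hasFDerivAt).clm_comp hg'.hasFDerivAt
  rw [h1.fderiv_eq]
  refine (congrArg (fun L ↦ L e e') h2.fderiv).trans ?_
  change dPert α ψ 𝒢 (g y) (fderiv ℝ (fderiv ℝ g) y e e') +
    fderiv ℝ (dPert α ψ 𝒢) (g y) (fderiv ℝ g y e) (fderiv ℝ g y e') = _
  rw [add_comm]

/-- The partial derivatives of the perturbation in a chart, if the change of coordinates has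
derivatives bounded by `Λ`, and by `ν` in the directions of the section. -/
theorem abs_iteratedFDeriv_pert_comp_lt {C Ψ R Λ ν ε : ℝ} (hψ : ContDiff ℝ ∞ ψ)
    (h𝒢 : ContDiff ℝ ∞ 𝒢) (hg : ContDiffAt ℝ 2 g y) (hα : 0 ≤ α) (hC : 0 ≤ C) (hR : 0 ≤ R)
    (hR1 : R ≤ 1) (hΛ : 0 ≤ Λ) (hν : 0 ≤ ν)
    (hψ0 : ∀ θ, |ψ θ| ≤ Ψ) (hψ1 : ∀ θ, |deriv ψ θ| ≤ Ψ) (hψ2 : ∀ θ, |deriv (deriv ψ) θ| ≤ Ψ)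
    (h0 : ∀ ζ, |𝒢 ζ| ≤ C * R ^ 2) (h1 : ∀ ζ, ‖fderiv ℝ 𝒢 ζ‖ ≤ C * R)
    (h2 : ∀ ζ a, ‖fderiv ℝ (fderiv ℝ 𝒢) ζ a‖ ≤ C * ‖a‖)
    (hg1 : ∀ e, ‖fderiv ℝ g y e‖ ≤ Λ * ‖e‖) (hgν : ∀ e, ‖(fderiv ℝ g y e).2‖ ≤ ν * ‖e‖)
    (hg2 : ∀ e e', ‖fderiv ℝ (fderiv ℝ g) y e e'‖ ≤ Λ * ‖e‖ * ‖e'‖)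
    (hε : α * Ψ * C * ν ^ 2 + α * Ψ * C * R * (1 + 3 * Λ ^ 2 + 2 * Λ) < ε)
    {k : ℕ} (hk : k ≤ 2) (i : Fin k → Fin 4) :
    |iteratedFDeriv ℝ k (fun y ↦ α * (ψ (g y).1 * 𝒢 (g y).2)) y
      (fun l ↦ EuclideanSpace.single (i l) (1 : ℝ))| < ε := by
  have hΨ : 0 ≤ Ψ := (abs_nonneg _).trans (hψ0 0)
  have h0' : ∀ ζ, |𝒢 ζ| ≤ C * R := fun ζ ↦ (h0 ζ).trans (by gcongr; nlinarith)
  have hun : ∀ i : Fin 4, ‖(EuclideanSpace.single i (1 : ℝ) : E4)‖ = 1 := fun i ↦ by simp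
  have hD : ∀ v, |dPert α ψ 𝒢 (g y) v| ≤ 2 * (α * Ψ * C * R) * ‖v‖ := by
    intro v
    have hv1 : |v.1| ≤ ‖v‖ := norm_fst_le v
    have hv2 : ‖v.2‖ ≤ ‖v‖ := norm_snd_le v
    have e1 : |fderiv ℝ 𝒢 (g y).2 v.2| ≤ C * R * ‖v‖ :=
      ((fderiv ℝ 𝒢 (g y).2).le_opNorm _).trans (by gcongr; exact h1 _)
    change |α * (deriv ψ (g y).1 * 𝒢 (g y).2 * v.1 + ψ (g y).1 * fderiv ℝ 𝒢 (g y).2 v.2)| ≤ _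
    rw [abs_mul, abs_of_nonneg hα]
    calc _ ≤ α * (Ψ * (C * R) * ‖v‖ + Ψ * (C * R * ‖v‖)) := by
          gcongr
          refine (abs_add_le _ _).trans (add_le_add ?_ ?_)
          · rw [abs_mul, abs_mul]
            gcongr
            exacts [hψ1 _, h0' _]
          · rw [abs_mul]
            gcongr
            exact hψ0 _
      _ = _ := by ring
  have hk0 : 0 ≤ α * Ψ * C * ν ^ 2 := by positivity
  have hk1 : 0 ≤ α * Ψ * C * R := by positivity
  have hk2 : 0 ≤ α * Ψ * C * R * (3 * Λ ^ 2 + 2 * Λ) := by positivity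
  interval_cases k
  · rw [iteratedFDeriv_zero_apply, abs_mul, abs_of_nonneg hα, abs_mul]
    have : α * (|ψ (g y).1| * |𝒢 (g y).2|) ≤ α * (Ψ * (C * R)) := by
      gcongr; exacts [hψ0 _, h0' _]
    nlinarith
  · rw [iteratedFDeriv_one_apply, fderiv_pert_comp hψ h𝒢 (hg.differentiableAt (by simp))]
    have e1 := hg1 (EuclideanSpace.single (i 0) 1)
    rw [hun, mul_one] at e1
    have e2 : |dPert α ψ 𝒢 (g y) (fderiv ℝ g y (EuclideanSpace.single (i 0) 1))| ≤
      2 * (α * Ψ * C * R) * Λ := (hD _).trans (by gcongr)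
    have hk3 : 0 ≤ α * Ψ * C * R * (1 + 3 * Λ ^ 2) := by positivity
    refine e2.trans_lt ?_
    nlinarith
  · rw [iteratedFDeriv_two_apply, fderiv_fderiv_pert_comp hψ h𝒢 hg]
    set e := (EuclideanSpace.single (i 0) 1 : E4)
    set e' := (EuclideanSpace.single (i 1) 1 : E4)
    have he : ‖e‖ = 1 := hun _
    have he' : ‖e'‖ = 1 := hun _
    have b1 := hg1 e
    have b1' := hg1 e'
    have b2 := hgν e
    have b2' := hgν e'
    have b3 := hg2 e e'
    rw [he, mul_one] at b1 b2
    rw [he', mul_one] at b1' b2'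
    rw [he, he', mul_one, mul_one] at b3
    have e2 : |dPert α ψ 𝒢 (g y) (fderiv ℝ (fderiv ℝ g) y e e')| ≤ 2 * (α * Ψ * C * R) * Λ :=
      (hD _).trans (by gcongr)
    set v := fderiv ℝ g y e
    set v' := fderiv ℝ g y e'
    have hv1 : |v.1| ≤ Λ := (norm_fst_le v).trans b1
    have hv2 : ‖v.2‖ ≤ Λ := (norm_snd_le v).trans b1
    have hv1' : |v'.1| ≤ Λ := (norm_fst_le v').trans b1'
    have hv2' : ‖v'.2‖ ≤ Λ := (norm_snd_le v').trans b1'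
    have d1 : ∀ w : E3, ‖w‖ ≤ Λ → |fderiv ℝ 𝒢 (g y).2 w| ≤ C * R * Λ := fun w hw ↦
      ((fderiv ℝ 𝒢 (g y).2).le_opNorm _).trans (by gcongr; exact h1 _)
    have d2 : |fderiv ℝ (fderiv ℝ 𝒢) (g y).2 v.2 v'.2| ≤ C * ν * ν := by
      refine ((fderiv ℝ (fderiv ℝ 𝒢) (g y).2 v.2).le_opNorm _).trans ?_
      have := (h2 (g y).2 v.2).trans (b := C * ‖v.2‖) (c := C * ν) (by gcongr)
      gcongr
    have e1 : |fderiv ℝ (dPert α ψ 𝒢) (g y) v v'| ≤ α * ((Ψ * Λ * (C * R) + Ψ * (C * R * Λ)) * Λ +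
        Ψ * Λ * (C * R * Λ) + Ψ * (C * ν * ν)) := by
      rw [fderiv_dPert_apply hψ h𝒢]
      change |α * (((deriv (deriv ψ) (g y).1 * v.1 * 𝒢 (g y).2 + deriv ψ (g y).1 *
        fderiv ℝ 𝒢 (g y).2 v.2) * v'.1 + deriv ψ (g y).1 * v.1 * fderiv ℝ 𝒢 (g y).2 v'.2) +
        ψ (g y).1 * fderiv ℝ (fderiv ℝ 𝒢) (g y).2 v.2 v'.2)| ≤ _
      rw [abs_mul, abs_of_nonneg hα]
      refine mul_le_mul_of_nonneg_left ?_ hα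
      refine (abs_add_le _ _).trans (add_le_add ((abs_add_le _ _).trans (add_le_add ?_ ?_)) ?_)
      · rw [abs_mul]
        refine mul_le_mul ((abs_add_le _ _).trans (add_le_add ?_ ?_)) hv1' (abs_nonneg _)
          (by positivity)
        · rw [abs_mul, abs_mul]
          exact mul_le_mul (mul_le_mul (hψ2 _) hv1 (abs_nonneg _) hΨ) (h0' _) (abs_nonneg _)
            (by positivity)
        · rw [abs_mul]
          exact mul_le_mul (hψ1 _) (d1 _ hv2) (abs_nonneg _) hΨ
      · rw [abs_mul, abs_mul]
        exact mul_le_mul (mul_le_mul (hψ1 _) hv1 (abs_nonneg _) hΨ) (d1 _ hv2') (abs_nonneg _)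
          (by positivity)
      · rw [abs_mul]
        exact mul_le_mul (hψ0 _) d2 (abs_nonneg _) hΨ
    refine (abs_add_le _ _).trans_lt ((add_le_add e1 e2).trans_lt ?_)
    linarith

end CompositeBounds

section FlowBounds

variable {M : Type*} [TopologicalSpace M] [ChartedSpace (EuclideanHalfSpace 4) M]
  [IsManifold (𝓡∂ 4) ∞ M] [RiemannianBundle (fun x : M ↦ TangentSpace (𝓡∂ 4) x)]
  [IsContMDiffRiemannianBundle (𝓡∂ 4) ∞ (EuclideanSpace ℝ (Fin 4))
      (fun x : M ↦ TangentSpace (𝓡∂ 4) x)]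
  {Ω : SymplecticForm M} {A : DarbouxAtlas Ω} {H : M → ℝ} {x : M}
  {b : Fin 3 → TangentSpace (𝓡∂ 4) x} {k : ℕ∞}

set_option maxHeartbeats 1000000 in
/-- Near the center of the section, the component in the section does not increase lengths by more
than a factor of two. -/
theorem exists_norm_secFrame_inverse_le {Y : E4 → E4} (hY : Continuous Y)
    (hb : IsNormalFrame Ω H x b) (hX : hamVF Ω H x ≠ 0)
    (hYX : Y (A.at x x) = chartD (A.chart (A.idx x)) x (hamVF Ω H x)) :
    ∃ r > 0, ∀ c ∈ sectionBall A x b r, ∀ w,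
      ‖((secFrame (sectionLin A x b) (Y (sectionPt A x b c))).inverse w).2‖ ≤
        2 * ‖(chartD (A.chart (A.idx x)) (sectionMap A x b c)).inverse w‖ := by
  have hd := (A.isDarbouxChart (A.idx x)).mem
  have hx := A.mem_source x
  set h := A.chart (A.idx x)
  obtain ⟨C, hC, hev⟩ := eventually_norm_chartD_bounds hd hx
  have hS := hb.secFrame_isInvertible (A := A) hX
  set D := {c | sectionPt A x b c ∈ (A.at x).target} with hD
  have h0D : (0 : E3) ∈ D := (zero_mem_sectionBall one_pos).2.2
  have hσ : Tendsto (sectionMap A x b) (𝓝[D] 0) (𝓝 x) := by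
    have := continuousOn_sectionMap (A := A) (b := b) 0 h0D
    rwa [ContinuousWithinAt, sectionMap_zero] at this
  set T : E3 → E4 →L[ℝ] E13 :=
    fun c ↦ (secFrame (sectionLin A x b) (Y (sectionPt A x b c))).inverse with hT
  have hTc : ContinuousAt T 0 := by
    have h1 : ContinuousAt (fun c ↦ secFrame (sectionLin A x b) (Y (sectionPt A x b c))) 0 :=
      ((contDiff_secFrame (n := 0) _).continuous.comp
        (hY.comp (contDiff_sectionPt (n := 0)).continuous)).continuousAt
    have h2 : ContinuousAt (ContinuousLinearMap.inverse : (E13 →L[ℝ] E4) → _)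
        (secFrame (sectionLin A x b) (Y (sectionPt A x b 0))) := by
      rw [sectionPt_zero, hYX]
      obtain ⟨e, he⟩ := hS
      rw [← he]
      exact (contDiffAt_map_inverse (n := 0) e).continuousAt
    exact ContinuousAt.comp (f := fun c ↦ secFrame (sectionLin A x b) (Y (sectionPt A x b c))) h2 h1
  have hT0 : ∀ w, ‖(T 0 w).2‖ ≤ ‖(chartD h x).inverse w‖ := fun w ↦ by
    have h1 : chartD h x (flowFrame Ω H b (T 0 w)) = w := by
      rw [← secFrame_sectionLin, hT]
      simp only [sectionPt_zero, hYX]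
      exact hS.apply_inverse w
    refine (hb.norm_snd_le (Ω := Ω) (H := H) (T 0 w)).trans_eq ?_
    conv_rhs => rw [← h1, chartD_inverse_apply hd hx]
  have e1 : ∀ᶠ c in 𝓝[D] 0, dist (T c) (T 0) < 1 / (2 * C) :=
    nhdsWithin_le_nhds (hTc.eventually (ball_mem_nhds _ (by positivity)))
  have e2 := hσ.eventually (((continuousOn_gram hd).continuousAt
    (h.open_source.mem_nhds hx)).eventually_abs_sub_le (δ := 1 / C ^ 2) (by positivity))
  obtain ⟨r, hr, hr'⟩ := exists_sectionBall_forall ((e1.and e2).and (hσ.eventually hev))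
  refine ⟨r, hr, fun c hc w ↦ ?_⟩
  obtain ⟨⟨h1, h2⟩, h3⟩ := hr' c hc
  have hz := sectionMap_mem_source hc.2.2
  set z := sectionMap A x b c
  set t := ‖(chartD h z).inverse w‖ with ht
  have ht0 : 0 ≤ t := norm_nonneg _
  have hw : ‖w‖ ≤ C * t := by
    have := (h3 ((chartD h z).inverse w)).2
    rwa [chartD_apply_inverse hd hz] at this
  have hgz : gram h z w w = t ^ 2 := by
    rw [ht, norm_sq_eq_gram hd hz, chartD_apply_inverse hd hz]
  have hgx : gram h x w w = ‖(chartD h x).inverse w‖ ^ 2 := by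
    rw [norm_sq_eq_gram hd hx, chartD_apply_inverse hd hx]
  have hgd : gram h x w w ≤ gram h z w w + 1 / C ^ 2 * ‖w‖ * ‖w‖ := by
    linarith [neg_le_abs (gram h z w w - gram h x w w), h2 w]
  have hx2 : ‖(chartD h x).inverse w‖ ≤ 3 / 2 * t := by
    refine (pow_le_pow_iff_left₀ (norm_nonneg _) (by positivity) two_ne_zero).1 ?_
    rw [← hgx]
    have h8 : 1 / C ^ 2 * ‖w‖ * ‖w‖ ≤ 1 / C ^ 2 * (C * t) * (C * t) := by gcongr
    have h9 : 1 / C ^ 2 * (C * t) * (C * t) = t ^ 2 := by field_simp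
    nlinarith
  have hTd : ‖(T c w).2‖ ≤ ‖(T 0 w).2‖ + 1 / (2 * C) * ‖w‖ := by
    rw [dist_eq_norm] at h1
    have h4 : (T c w).2 = (T 0 w).2 + ((T c - T 0) w).2 := by
      change _ = (T 0 w).2 + ((T c w).2 - (T 0 w).2); abel
    rw [h4]
    refine (norm_add_le _ _).trans (add_le_add le_rfl ((norm_snd_le _).trans
      ((ContinuousLinearMap.le_opNorm _ _).trans ?_)))
    gcongr
  have h10 : 1 / (2 * C) * ‖w‖ ≤ 1 / (2 * C) * (C * t) := by gcongr
  have h11 : 1 / (2 * C) * (C * t) = t / 2 := by field_simp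
  change ‖(T c w).2‖ ≤ 2 * t
  linarith [hT0 w]

variable [CompactSpace M] [T2Space M]

/-- The flow distorts lengths by a bounded amount, uniformly. -/
theorem exists_mfderiv_hamFlow_bound (A : DarbouxAtlas Ω) (hH : IsHamiltonian k H) (hk : 2 ≤ k) :
    ∃ C : ℝ, 0 ≤ C ∧ ∀ j, ∀ t ∈ Icc (0 : ℝ) 1, ∀ p ∈ A.core j, ∀ e : E4,
      ‖mfderiv (𝓡∂ 4) (𝓡∂ 4) (hamFlow Ω H (-t)) p ((chartD (A.chart j) p).inverse e)‖ ≤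
        C * ‖e‖ := by
  have hloc : ∀ j, ∃ C : ℝ, ∀ q ∈ Icc (0 : ℝ) 1 ×ˢ A.core j, 0 ≤ C ∧ ∀ e : E4,
      ‖mfderiv (𝓡∂ 4) (𝓡∂ 4) (hamFlow Ω H (-q.1)) q.2 ((chartD (A.chart j) q.2).inverse e)‖ ≤
        C * ‖e‖ := by
    intro j
    refine (isCompact_Icc.prod (A.isCompact_core j)).exists_bound_of_local
      (P := fun C q ↦ 0 ≤ C ∧ ∀ e : E4, ‖mfderiv (𝓡∂ 4) (𝓡∂ 4) (hamFlow Ω H (-q.1)) q.2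
        ((chartD (A.chart j) q.2).inverse e)‖ ≤ C * ‖e‖)
      (fun C C' q hC h ↦ ⟨h.1.trans hC, fun e ↦ (h.2 e).trans (by gcongr)⟩) ?_
    rintro ⟨t, p⟩ ⟨-, hp⟩
    set p' := hamFlow Ω H (-t) p with hp'
    have hd := (A.isDarbouxChart j).mem
    have hd' := (A.isDarbouxChart (A.idx p')).mem
    have hps := A.core_subset j hp
    have hps' := A.mem_source p'
    set h' := A.chart (A.idx p')
    obtain ⟨C, hC, hev⟩ := eventually_norm_chartD_bounds hd' hps'
    have hneg : ContinuousAt (fun q : ℝ × M ↦ (-q.1, q.2)) (t, p) := by fun_prop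
    have hJ : ContinuousAt (fun q : ℝ × M ↦ chartJac Ω (A.chart j) h' H (-q.1) q.2) (t, p) :=
      ContinuousAt.comp (f := fun q : ℝ × M ↦ (-q.1, q.2))
        (hH.continuousAt_chartJac A hk hd hd' hps hps') hneg
    have hφ : ContinuousAt (fun q : ℝ × M ↦ hamFlow Ω H (-q.1) q.2) (t, p) :=
      ContinuousAt.comp (f := fun q : ℝ × M ↦ (-q.1, q.2))
        (hH.continuous_hamFlow A hk).continuousAt hneg
    refine ⟨C * (‖chartJac Ω (A.chart j) h' H (-t) p‖ + 1), nhdsWithin_le_nhds ?_⟩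
    filter_upwards [hφ.eventually hev, hJ.norm.eventually_lt_const (lt_add_one _)] with q h1 h2
    refine ⟨by positivity, fun e ↦ (h1 _).1.trans ?_⟩
    rw [mul_assoc]
    gcongr
    exact ((chartJac Ω (A.chart j) h' H (-q.1) q.2).le_opNorm e).trans (by gcongr)
  choose C hC using hloc
  have := A.fin
  refine ⟨∑ j, |C j|, by positivity, fun j t ht p hp e ↦ ?_⟩
  refine ((hC j (t, p) ⟨ht, hp⟩).2 e).trans ?_
  gcongr
  exact (le_abs_self _).trans (Finset.single_le_sum (f := fun j ↦ |C j|)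
    (fun j _ ↦ abs_nonneg _) (Finset.mem_univ j))

end FlowBounds

section Perturbation

variable {M : Type*} [TopologicalSpace M] [ChartedSpace (EuclideanHalfSpace 4) M]
  [IsManifold (𝓡∂ 4) ∞ M] [RiemannianBundle (fun x : M ↦ TangentSpace (𝓡∂ 4) x)]
  {Ω : SymplecticForm M} {A : DarbouxAtlas Ω} {H H' : M → ℝ} {x : M}
  {b : Fin 3 → TangentSpace (𝓡∂ 4) x} {k : ℕ∞} {S : Set E13} {G : M → E13} {f : E13 → ℝ}

theorem hamVF_eq_of_eventuallyEq {y : M} (h : H' =ᶠ[𝓝 y] H) : hamVF Ω H' y = hamVF Ω H y := by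
  rw [hamVF, hamVF, dHam, dHam, h.mfderiv_eq]

theorem sameDX_of_eventuallyEq {y : M} (h : H' =ᶠ[𝓝 y] H) : SameDX Ω A H H' y := by
  have h1 : ∀ᶠ z in 𝓝 y, hamVF Ω H z = hamVF Ω H' z :=
    h.eventually_nhds.mono fun z hz ↦ (hamVF_eq_of_eventuallyEq hz).symm
  refine ⟨h1.self_of_nhds, fun j hj ↦ ?_⟩
  have hT := extend_mem_target _ hj
  have h2 := (A.chart j).continuousOn_extend_symm (I := 𝓡∂ 4) _ hT
  rw [ContinuousWithinAt, (A.chart j).extend_left_inv hj] at h2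
  have h3 : chartVF Ω (A.chart j) H =ᶠ[𝓝[((A.chart j).extend (𝓡∂ 4)).target]
      (A.chart j).extend (𝓡∂ 4) y] chartVF Ω (A.chart j) H' := by
    filter_upwards [h2.eventually h1] with z hz
    rw [chartVF, chartVF, hz]
  exact h3.fderivWithin_eq (h3.self_of_nhdsWithin hT)

/-- `G` is an inverse of the parametrization of the flowbox on the open set `S`, of class `C^k`. -/
structure IsFlowboxInverse (A : DarbouxAtlas Ω) (H : M → ℝ) (x : M)
    (b : Fin 3 → TangentSpace (𝓡∂ 4) x) (k : ℕ∞) (S : Set E13) (G : M → E13) : Prop where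
  interior : ∀ a ∈ S, a.2 ∈ sectionInterior A x b
  leftInv : ∀ a ∈ S, G (flowMap A H x b a) = a
  image_mem_nhds : ∀ a ∈ S, flowMap A H x b '' S ∈ 𝓝 (flowMap A H x b a)
  contDiffAt : ∀ a ∈ S, ∀ h ∈ IsManifold.maximalAtlas (𝓡∂ 4) ∞ M, flowMap A H x b a ∈ h.source →
    ContDiffAt ℝ k (G ∘ (h.extend (𝓡∂ 4)).symm) (h.extend (𝓡∂ 4) (flowMap A H x b a))
  hasFDerivAt : ∀ a ∈ S, ∀ h ∈ IsManifold.maximalAtlas (𝓡∂ 4) ∞ M, flowMap A H x b a ∈ h.source →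
    HasFDerivAt (G ∘ (h.extend (𝓡∂ 4)).symm) (flowJac A H x b h a).inverse
      (h.extend (𝓡∂ 4) (flowMap A H x b a))

open Classical in
/-- The function on `M` which is `f` in the coordinates of the flowbox, and zero outside. -/
noncomputable def boxPert (A : DarbouxAtlas Ω) (H : M → ℝ) (x : M)
    (b : Fin 3 → TangentSpace (𝓡∂ 4) x) (S : Set E13) (G : M → E13) (f : E13 → ℝ) (z : M) : ℝ :=
  if z ∈ flowMap A H x b '' S then f (G z) else 0

namespace IsFlowboxInverse

variable (hG : IsFlowboxInverse A H x b k S G)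
include hG

theorem boxPert_flowMap {a : E13} (ha : a ∈ S) :
    boxPert A H x b S G f (flowMap A H x b a) = f a := by
  rw [boxPert, if_pos (mem_image_of_mem _ ha), hG.leftInv a ha]

theorem boxPert_eq_zero {z : M} (hz : z ∉ flowMap A H x b '' tsupport f) :
    boxPert A H x b S G f z = 0 := by
  by_cases h : z ∈ flowMap A H x b '' S
  · obtain ⟨a, ha, rfl⟩ := h
    rw [hG.boxPert_flowMap ha]
    exact image_eq_zero_of_notMem_tsupport fun h ↦ hz (mem_image_of_mem _ h)
  · rw [boxPert, if_neg h]

theorem boxPert_chart {a : E13} (ha : a ∈ S) {h : OpenPartialHomeomorph M (EuclideanHalfSpace 4)}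
    (hz : flowMap A H x b a ∈ h.source) :
    (fun y ↦ boxPert A H x b S G f ((h.extend (𝓡∂ 4)).symm y))
      =ᶠ[𝓝 (h.extend (𝓡∂ 4) (flowMap A H x b a))]
      fun y ↦ f ((G ∘ (h.extend (𝓡∂ 4)).symm) y) := by
  have h1 := h.continuousAt_extend_symm (I := 𝓡∂ 4) hz
  rw [ContinuousAt, h.extend_left_inv hz] at h1
  filter_upwards [h1.eventually (hG.image_mem_nhds a ha)] with y (hy : _ ∈ flowMap A H x b '' S)
  rw [boxPert, if_pos hy, Function.comp_apply]

variable [CompactSpace M] [T2Space M]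

theorem boxPert_eventuallyEq_zero (hk : 1 ≤ k) (hH : IsHamiltonian (k + 1) H)
    (hf : HasCompactSupport f) (hfS : tsupport f ⊆ S) {z : M}
    (hz : z ∉ flowMap A H x b '' tsupport f) : boxPert A H x b S G f =ᶠ[𝓝 z] 0 := by
  have h1 : IsCompact (flowMap A H x b '' tsupport f) := hf.image_of_continuousOn fun a ha ↦
    (contMDiffAt_flowMap hk hH (hG.interior a (hfS ha))).continuousAt.continuousWithinAt
  filter_upwards [h1.isClosed.isOpen_compl.mem_nhds hz] with w hw using hG.boxPert_eq_zero hw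

theorem isInteriorPoint (hH : IsHamiltonian (k + 1) H) (hk : 2 ≤ k + 1) {a : E13} (ha : a ∈ S) :
    (𝓡∂ 4).IsInteriorPoint (flowMap A H x b a) :=
  hH.isInteriorPoint_hamFlow A hk a.1 (isInteriorPoint_sectionMap (hG.interior a ha))

theorem target_mem_nhds (hH : IsHamiltonian (k + 1) H) (hk : 2 ≤ k + 1) {a : E13} (ha : a ∈ S)
    {h : OpenPartialHomeomorph M (EuclideanHalfSpace 4)}
    (hh : h ∈ IsManifold.maximalAtlas (𝓡∂ 4) ∞ M) (hz : flowMap A H x b a ∈ h.source) :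
    (h.extend (𝓡∂ 4)).target ∈ 𝓝 (h.extend (𝓡∂ 4) (flowMap A H x b a)) :=
  _root_.target_mem_nhds h (extend_mem_target h hz)
    ((isInteriorPoint_iff_chart hh hz).1 (hG.isInteriorPoint hH hk ha))

theorem contMDiff_boxPert (hk : 1 ≤ k) (hH : IsHamiltonian (k + 1) H) (hfc : ContDiff ℝ ∞ f)
    (hf : HasCompactSupport f) (hfS : tsupport f ⊆ S) :
    ContMDiff (𝓡∂ 4) 𝓘(ℝ) k (boxPert A H x b S G f) := by
  intro z
  by_cases hz : z ∈ flowMap A H x b '' tsupport f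
  · obtain ⟨a, ha, rfl⟩ := hz
    have haS := hfS ha
    set z := flowMap A H x b a with hzdef
    have hd := (A.isDarbouxChart (A.idx z)).mem
    have hzs := A.mem_source z
    set h := A.chart (A.idx z)
    have h1 : ContDiffAt ℝ k (fun y ↦ f ((G ∘ (h.extend (𝓡∂ 4)).symm) y)) (h.extend (𝓡∂ 4) z) :=
      ((hfc.of_le (by exact_mod_cast le_top)).contDiffAt).comp _ (hG.contDiffAt a haS h hd hzs)
    have h2 := h1.congr_of_eventuallyEq (hG.boxPert_chart haS hzs)
    have h3 : ContMDiffAt (𝓡∂ 4) 𝓘(ℝ, E4) k (h.extend (𝓡∂ 4)) z :=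
      (h.contMDiffAt_extend hd hzs).of_le (by exact_mod_cast le_top)
    refine (h2.contMDiffAt.comp z h3).congr_of_eventuallyEq ?_
    filter_upwards [h.open_source.mem_nhds hzs] with w hw
    simp only [Function.comp_apply, h.extend_left_inv hw]
  · exact contMDiffAt_const.congr_of_eventuallyEq
      (hG.boxPert_eventuallyEq_zero hk hH hf hfS hz)

theorem isHamiltonian_add_boxPert (hk : 1 ≤ k) (hH : IsHamiltonian (k + 1) H)
    (hfc : ContDiff ℝ ∞ f) (hf : HasCompactSupport f) (hfS : tsupport f ⊆ S) :
    IsHamiltonian k (fun z ↦ H z + boxPert A H x b S G f z) := by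
  refine ⟨(hH.of_le le_self_add).1.add (hG.contMDiff_boxPert hk hH hfc hf hfS), ?_⟩
  have hk2 : 2 ≤ k + 1 := by
    calc (2 : ℕ∞) = 1 + 1 := by norm_num
      _ ≤ k + 1 := by gcongr
  have h0 : ∀ y ∈ (𝓡∂ 4).boundary M, boxPert A H x b S G f y = 0 := fun y hy ↦ by
    refine hG.boxPert_eq_zero ?_
    rintro ⟨a, ha, rfl⟩
    rw [← ModelWithCorners.compl_interior] at hy
    exact hy (hG.isInteriorPoint hH hk2 (hfS ha))
  intro y hy z hz
  simp only [h0 y hy, h0 z (connectedComponentIn_subset _ _ hz), hH.2 y hy z hz]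

theorem c2Close (hk : 2 ≤ k) (hH : IsHamiltonian (k + 1) H) (hf : HasCompactSupport f)
    (hfS : tsupport f ⊆ S) {ε : ℝ} (hε : 0 < ε)
    (hb : ∀ a ∈ tsupport f, ∀ j, flowMap A H x b a ∈ A.core j → ∀ m ≤ 2, ∀ i : Fin m → Fin 4,
      |iteratedFDeriv ℝ m (fun y ↦ f ((G ∘ ((A.chart j).extend (𝓡∂ 4)).symm) y))
        ((A.chart j).extend (𝓡∂ 4) (flowMap A H x b a))
        (fun l ↦ EuclideanSpace.single (i l) (1 : ℝ))| < ε) :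
    A.C2Close ε (fun z ↦ H z + boxPert A H x b S G f z) H := by
  intro j z hz m hm i
  simp only [add_sub_cancel_left]
  have hzs := A.core_subset j hz
  have hT := extend_mem_target _ hzs
  by_cases hz' : z ∈ flowMap A H x b '' tsupport f
  · obtain ⟨a, ha, rfl⟩ := hz'
    have h1 := hG.target_mem_nhds hH (hk.trans le_self_add) (hfS ha) (A.isDarbouxChart j).mem hzs
    rw [iteratedFDerivWithin_congr_set
      (show ((A.chart j).extend (𝓡∂ 4)).target =ᶠ[𝓝 _] univ from eventuallyEq_univ.2 h1),
      iteratedFDerivWithin_univ, ((hG.boxPert_chart (hfS ha) hzs).iteratedFDeriv ℝ m).self_of_nhds]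
    exact hb a ha j hz m hm i
  · have h2 := (A.chart j).continuousOn_extend_symm (I := 𝓡∂ 4) _ hT
    rw [ContinuousWithinAt, (A.chart j).extend_left_inv hzs] at h2
    have h3 := h2.eventually (hG.boxPert_eventuallyEq_zero ((by simp : (1 : ℕ∞) ≤ 2).trans hk)
      hH hf hfS hz')
    have h4 : (fun y ↦ boxPert A H x b S G f (((A.chart j).extend (𝓡∂ 4)).symm y))
      =ᶠ[𝓝[((A.chart j).extend (𝓡∂ 4)).target] ((A.chart j).extend (𝓡∂ 4) z)] fun _ ↦ 0 := h3
    rw [h4.iteratedFDerivWithin_eq (h4.self_of_nhdsWithin hT), iteratedFDerivWithin_zero_fun]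
    simpa using hε

/-- The derivatives of the coordinates of the flowbox are bounded over compact sets. -/
theorem exists_chart_bounds (hk : 2 ≤ k) (hH : IsHamiltonian (k + 1) H) {T : Set E13}
    (hT : IsCompact T) (hTS : T ⊆ S) :
    ∃ Λ, 0 ≤ Λ ∧ ∀ j, ∀ a ∈ T, flowMap A H x b a ∈ A.core j →
      (∀ e, ‖fderiv ℝ (G ∘ ((A.chart j).extend (𝓡∂ 4)).symm)
        ((A.chart j).extend (𝓡∂ 4) (flowMap A H x b a)) e‖ ≤ Λ * ‖e‖) ∧
      ∀ e e', ‖fderiv ℝ (fderiv ℝ (G ∘ ((A.chart j).extend (𝓡∂ 4)).symm))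
        ((A.chart j).extend (𝓡∂ 4) (flowMap A H x b a)) e e'‖ ≤ Λ * ‖e‖ * ‖e'‖ := by
  have hk1 : 1 ≤ k := (by simp : (1 : ℕ∞) ≤ 2).trans hk
  have hc : ContinuousOn (flowMap A H x b) T := fun a ha ↦
    (contMDiffAt_flowMap hk1 hH (hG.interior a (hTS ha))).continuousAt.continuousWithinAt
  have hloc : ∀ j, ∃ C : ℝ, ∀ a ∈ T ∩ flowMap A H x b ⁻¹' A.core j, 0 ≤ C ∧
      (∀ e, ‖fderiv ℝ (G ∘ ((A.chart j).extend (𝓡∂ 4)).symm)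
        ((A.chart j).extend (𝓡∂ 4) (flowMap A H x b a)) e‖ ≤ C * ‖e‖) ∧
      ∀ e e', ‖fderiv ℝ (fderiv ℝ (G ∘ ((A.chart j).extend (𝓡∂ 4)).symm))
        ((A.chart j).extend (𝓡∂ 4) (flowMap A H x b a)) e e'‖ ≤ C * ‖e‖ * ‖e'‖ := by
    intro j
    have hcpt : IsCompact (T ∩ flowMap A H x b ⁻¹' A.core j) :=
      hT.of_isClosed_subset (hc.preimage_isClosed_of_isClosed hT.isClosed
        (A.isCompact_core j).isClosed) inter_subset_left
    refine hcpt.exists_bound_of_local (P := fun C a ↦ 0 ≤ C ∧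
      (∀ e, ‖fderiv ℝ (G ∘ ((A.chart j).extend (𝓡∂ 4)).symm)
        ((A.chart j).extend (𝓡∂ 4) (flowMap A H x b a)) e‖ ≤ C * ‖e‖) ∧
      ∀ e e', ‖fderiv ℝ (fderiv ℝ (G ∘ ((A.chart j).extend (𝓡∂ 4)).symm))
        ((A.chart j).extend (𝓡∂ 4) (flowMap A H x b a)) e e'‖ ≤ C * ‖e‖ * ‖e'‖)
      (fun C C' a hC h ↦ ⟨h.1.trans hC, fun e ↦ (h.2.1 e).trans (by gcongr),
        fun e e' ↦ (h.2.2 e e').trans (by gcongr)⟩) ?_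
    rintro a ⟨haT, haj⟩
    have hzs := A.core_subset j haj
    have hd := (A.isDarbouxChart j).mem
    obtain ⟨C, hC, hev⟩ := exists_C2_bounds
      ((hG.contDiffAt a (hTS haT) _ hd hzs).of_le
        (WithTop.coe_le_coe.2 hk))
    have hcont := (contDiffAt_chart_flowMap hk1 hH (hG.interior a (hTS haT)) hd hzs).continuousAt
    exact ⟨C, nhdsWithin_le_nhds ((hcont.eventually hev).mono fun a ha ↦ ⟨hC, ha⟩)⟩
  choose C hC using hloc
  have := A.fin
  have hle : ∀ j, C j ≤ ∑ j, |C j| := fun j ↦ (le_abs_self _).trans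
    (Finset.single_le_sum (f := fun j ↦ |C j|) (fun j _ ↦ abs_nonneg _) (Finset.mem_univ j))
  refine ⟨∑ j, |C j|, by positivity, fun j a ha haj ↦ ?_⟩
  obtain ⟨-, h1, h2⟩ := hC j a ⟨ha, haj⟩
  exact ⟨fun e ↦ (h1 e).trans (by gcongr; exact hle j),
    fun e e' ↦ (h2 e e').trans (by gcongr; exact hle j)⟩

end IsFlowboxInverse

variable [CompactSpace M] [T2Space M]

/-- In the directions of the section, the differential of the coordinates of the flowbox is bounded
in terms of the flow. -/
theorem norm_flowJac_inverse_snd_le (hH : IsHamiltonian k H) (hk : 2 ≤ k) {c C : ℝ}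
    (hC : ∀ j, ∀ t ∈ Icc (0 : ℝ) 1, ∀ p ∈ A.core j, ∀ e : E4,
      ‖mfderiv (𝓡∂ 4) (𝓡∂ 4) (hamFlow Ω H (-t)) p ((chartD (A.chart j) p).inverse e)‖ ≤
        C * ‖e‖) (hc : 0 ≤ c) {a : E13} (ha1 : a.1 ∈ Icc (0 : ℝ) 1)
    (ha : sectionPt A x b a.2 ∈ (A.at x).target)
    (hS : (secFrame (sectionLin A x b)
      (chartVF Ω (A.chart (A.idx x)) H (sectionPt A x b a.2))).IsInvertible)
    (hSn : ∀ w, ‖((secFrame (sectionLin A x b)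
      (chartVF Ω (A.chart (A.idx x)) H (sectionPt A x b a.2))).inverse w).2‖ ≤
        c * ‖(chartD (A.chart (A.idx x)) (sectionMap A x b a.2)).inverse w‖) {j : A.ι}
    (hj : flowMap A H x b a ∈ A.core j) (e : E4) :
    ‖((flowJac A H x b (A.chart j) a).inverse e).2‖ ≤ c * C * ‖e‖ := by
  have hd := (A.isDarbouxChart (A.idx x)).mem
  have hd' := (A.isDarbouxChart j).mem
  have hz := sectionMap_mem_source ha
  have hz' := A.core_subset j hj
  have hJ := flowJac_isInvertible hH hk hd' ha hz' hS
  have hc := chartJac_isInvertible A hH hk hd hd' hz hz'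
  set u := (chartJac Ω (A.chart (A.idx x)) (A.chart j) H a.1 (sectionMap A x b a.2)).inverse e
    with hu
  set w := (secFrame (sectionLin A x b)
      (chartVF Ω (A.chart (A.idx x)) H (sectionPt A x b a.2))).inverse u with hw
  have h1 : flowJac A H x b (A.chart j) a w = e := by
    change chartJac Ω (A.chart (A.idx x)) (A.chart j) H a.1 (sectionMap A x b a.2)
      (secFrame (sectionLin A x b) _ w) = e
    rw [hw, hS.apply_inverse, hu, hc.apply_inverse]
  rw [← h1, hJ.inverse_apply, h1]
  refine (hSn u).trans ?_
  rw [mul_assoc]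
  refine mul_le_mul_of_nonneg_left ?_ ‹0 ≤ c›
  rw [hu, chartJac_inverse_apply A hH hk hd hd' hz hz']
  have key : ∀ z', z' = sectionMap A x b a.2 → ∀ v : TangentSpace (𝓡∂ 4) z', ‖v‖ ≤ C * ‖e‖ →
      ‖(chartD (A.chart (A.idx x)) (sectionMap A x b a.2)).inverse
        (chartD (A.chart (A.idx x)) (sectionMap A x b a.2) v)‖ ≤ C * ‖e‖ := by
    rintro _ rfl v hv
    rwa [chartD_inverse_apply hd hz]
  exact key _ (hH.hamFlow_neg_hamFlow A hk _ _) _ (hC j a.1 ha1 _ hj e)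

end Perturbation

theorem exists_flow_of_hasCompactSupport_sub {E : Type} [NormedAddCommGroup E] [NormedSpace ℝ E]
    [FiniteDimensional ℝ E] {Y : E → E} {e : E} (hY : ContDiff ℝ 1 Y)
    (hs : HasCompactSupport fun y ↦ Y y - e) : ∃ φ : ℝ → E → E, (∀ y, φ 0 y = y) ∧
      (∀ t y, HasDerivAt (fun t ↦ φ t y) (Y (φ t y)) t) ∧
      ContDiff ℝ 1 fun p : ℝ × E ↦ φ p.1 p.2 := by
  have : CompleteSpace E := FiniteDimensional.complete ℝ E
  obtain ⟨⟨L, hL⟩, B, hB⟩ := exists_lipschitz_bound (hY.sub contDiff_const) hs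
  have hL' : LipschitzWith L Y := LipschitzWith.of_dist_le_mul fun y z ↦ by
    simpa using hL.dist_le_mul y z
  obtain ⟨φ, h0, hφ⟩ := exists_flow (B := B + ‖e‖) hL' fun y ↦ by
    have := norm_add_le (Y y - e) e
    rw [sub_add_cancel] at this
    exact this.trans (by gcongr; exact hB y)
  exact ⟨φ, h0, hφ, contDiff_flow (n := 1) le_rfl hL' hY h0 hφ⟩

section FlatField

variable {𝓑 : E3 → (E13 →L[ℝ] ℝ) →L[ℝ] E13} {α : ℝ} {ψ : ℝ → ℝ} {𝒢 : E3 → ℝ} {r₁ : ℝ}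

theorem dPert_eq_zero {a : E13} (ha : a.2 ∉ tsupport 𝒢) : dPert α ψ 𝒢 a = 0 := by
  have h1 : 𝒢 =ᶠ[𝓝 a.2] 0 := notMem_tsupport_iff_eventuallyEq.1 ha
  have h2 : fderiv ℝ 𝒢 a.2 = 0 := by rw [h1.fderiv_eq]; exact fderiv_const_apply 0
  rw [dPert, h1.self_of_nhds, h2]
  simp

theorem dPert_eq_zero' {a : E13} (ha : a.1 ∉ tsupport ψ) : dPert α ψ 𝒢 a = 0 := by
  have h1 : ψ =ᶠ[𝓝 a.1] 0 := notMem_tsupport_iff_eventuallyEq.1 ha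
  have h2 : deriv ψ a.1 = 0 := by rw [h1.deriv_eq]; exact deriv_const _ 0
  rw [dPert, h1.self_of_nhds, h2]
  simp

theorem contDiff_flatVF (h𝓑 : ContDiffOn ℝ 1 𝓑 (ball 0 r₁)) (hψ : ContDiff ℝ ∞ ψ)
    (h𝒢 : ContDiff ℝ ∞ 𝒢) (hs : tsupport 𝒢 ⊆ ball 0 r₁) : ContDiff ℝ 1 (flatVF 𝓑 α ψ 𝒢) := by
  rw [contDiff_iff_contDiffAt]
  intro a
  by_cases ha : a.2 ∈ ball (0 : E3) r₁
  · exact contDiffAt_const.add (((h𝓑.contDiffAt (isOpen_ball.mem_nhds ha)).comp a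
      contDiffAt_snd).clm_apply ((contDiff_dPert hψ h𝒢).of_le (by simp)).contDiffAt)
  · have h1 : flatVF 𝓑 α ψ 𝒢 =ᶠ[𝓝 a] fun _ ↦ (1, 0) := by
      filter_upwards [((isClosed_tsupport 𝒢).isOpen_compl.preimage continuous_snd).mem_nhds
        (show a ∈ Prod.snd ⁻¹' (tsupport 𝒢)ᶜ from fun h ↦ ha (hs h))] with c hc
      rw [flatVF, dPert_eq_zero hc, map_zero, add_zero]
    exact contDiffAt_const.congr_of_eventuallyEq h1

theorem hasCompactSupport_flatVF_sub (hψ : HasCompactSupport ψ) (h𝒢 : HasCompactSupport 𝒢) :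
    HasCompactSupport fun a ↦ flatVF 𝓑 α ψ 𝒢 a - (1, 0) := by
  refine HasCompactSupport.intro (hψ.isCompact.prod h𝒢.isCompact) fun a ha ↦ ?_
  rw [flatVF, add_sub_cancel_left]
  by_cases h : a.1 ∈ tsupport ψ
  · rw [dPert_eq_zero fun h' ↦ ha ⟨h, h'⟩, map_zero]
  · rw [dPert_eq_zero' h, map_zero]

theorem tsupport_pert_subset :
    tsupport (fun a : E13 ↦ α * (ψ a.1 * 𝒢 a.2)) ⊆ tsupport ψ ×ˢ tsupport 𝒢 := by
  refine closure_minimal (fun a ha ↦ ?_) ((isClosed_tsupport ψ).prod (isClosed_tsupport 𝒢))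
  rw [Function.mem_support] at ha
  exact ⟨subset_tsupport ψ fun h ↦ ha (by rw [h]; simp),
    subset_tsupport 𝒢 fun h ↦ ha (by rw [h]; simp)⟩

end FlatField

section PerturbedFlow

variable {M : Type*} [TopologicalSpace M] [ChartedSpace (EuclideanHalfSpace 4) M]
  [IsManifold (𝓡∂ 4) ∞ M] [RiemannianBundle (fun x : M ↦ TangentSpace (𝓡∂ 4) x)]
  [CompactSpace M] [T2Space M]
  {Ω : SymplecticForm M} {A : DarbouxAtlas Ω} {H : M → ℝ} {x : M}
  {b : Fin 3 → TangentSpace (𝓡∂ 4) x} {k : ℕ∞} {S : Set E13} {G : M → E13} {f : E13 → ℝ}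
  {h h' : OpenPartialHomeomorph M (EuclideanHalfSpace 4)}

theorem stdForm_chartJac (A : DarbouxAtlas Ω) (hH : IsHamiltonian k H) (hk : 2 ≤ k) (hh : IsDarbouxChart Ω h)
    (hh' : IsDarbouxChart Ω h') {t : ℝ} {z : M} (hz : z ∈ h.source)
    (hz' : hamFlow Ω H t z ∈ h'.source) (v w : E4) :
    stdForm (chartJac Ω h h' H t z v) (chartJac Ω h h' H t z w) = stdForm v w := by
  have h1 := hh'.form_eq _ hz' (mfderiv (𝓡∂ 4) (𝓡∂ 4) (hamFlow Ω H t) z ((chartD h z).inverse v))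
    (mfderiv (𝓡∂ 4) (𝓡∂ 4) (hamFlow Ω H t) z ((chartD h z).inverse w))
  rw [IsHamiltonian.form_mfderiv_hamFlow A hH hk, hh.form_eq _ hz, chartD_apply_inverse hh.mem hz,
    chartD_apply_inverse hh.mem hz] at h1
  exact h1.symm

theorem chartJac_zero (A : DarbouxAtlas Ω) (hH : IsHamiltonian k H) (hk : 2 ≤ k)
    (hh : h ∈ IsManifold.maximalAtlas (𝓡∂ 4) ∞ M) {z : M} (hz : z ∈ h.source) (v : E4) :
    chartJac Ω h h H 0 z v = v := by
  have h1 : hamFlow Ω H 0 = id := funext (hH.hamFlow_zero A hk)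
  have key : ∀ φ : M → M, φ = id → chartD h (φ z) (mfderiv (𝓡∂ 4) (𝓡∂ 4) φ z
      ((chartD h z).inverse v)) = v := by
    rintro _ rfl
    rw [mfderiv_id]
    exact chartD_apply_inverse hh hz v
  exact key _ h1

namespace IsFlowboxInverse

variable (hG : IsFlowboxInverse A H x b k S G)
include hG

/-- The field `flatVF` is the perturbed Hamiltonian field in the coordinates of the flowbox. -/
theorem flowJac_flatVF (hk : 2 ≤ k) (hH : IsHamiltonian (k + 1) H) {Y : E4 → E4} {α : ℝ}
    {ψ : ℝ → ℝ} {𝒢 : E3 → ℝ} (hψ : ContDiff ℝ ∞ ψ) (h𝒢 : ContDiff ℝ ∞ 𝒢)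
    (hH' : IsHamiltonian k
      (fun z ↦ H z + boxPert A H x b S G (fun a ↦ α * (ψ a.1 * 𝒢 a.2)) z))
    {a : E13} (ha : a ∈ S)
    (hY : Y (sectionPt A x b a.2) = chartVF Ω (A.chart (A.idx x)) H (sectionPt A x b a.2))
    (hS : (secFrame (sectionLin A x b) (Y (sectionPt A x b a.2))).IsInvertible)
    (hh : IsDarbouxChart Ω h) (hz : flowMap A H x b a ∈ h.source) :
    flowJac A H x b h a (flatVF (flowPoisson A x b Y) α ψ 𝒢 a) =
      chartD h (flowMap A H x b a) (hamVF Ω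
        (fun z ↦ H z + boxPert A H x b S G (fun a ↦ α * (ψ a.1 * 𝒢 a.2)) z)
        (flowMap A H x b a)) := by
  set P := boxPert A H x b S G (fun a ↦ α * (ψ a.1 * 𝒢 a.2)) with hP
  have hk1 : 1 ≤ k := (by simp : (1 : ℕ∞) ≤ 2).trans hk
  have hk2 := hk.trans (le_self_add (b := (1 : ℕ∞)))
  have hc := (hG.interior a ha).1
  have hd := A.isDarbouxChart (A.idx x)
  have hzs := sectionMap_mem_source hc
  have hSv : (secFrame (sectionLin A x b)
      (chartVF Ω (A.chart (A.idx x)) H (sectionPt A x b a.2))).IsInvertible := hY ▸ hS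
  have hJ := flowJac_isInvertible hH hk2 hh.mem hc hz hSv
  set z := flowMap A H x b a with hzdef
  have hHd := hH.mdifferentiableAt le_add_self z
  have hPd : MDifferentiableAt (𝓡∂ 4) 𝓘(ℝ) P z := by
    have h1 := (hH'.mdifferentiableAt hk1 z).sub hHd
    have h2 : (fun z ↦ H z + P z) - H = P := by ext; simp
    rwa [h2] at h1
  have hdP : (mfderiv (𝓡∂ 4) 𝓘(ℝ) P z : TangentSpace (𝓡∂ 4) z →L[ℝ] ℝ) ∘L (chartD h z).inverse =
      dPert α ψ 𝒢 a ∘L (flowJac A H x b h a).inverse := by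
    have h1 := (hPd.hasMFDerivAt.hasFDerivWithinAt_chart hh.mem hz).hasFDerivAt
      (hG.target_mem_nhds hH hk2 ha hh.mem hz)
    have h2 : (G ∘ (h.extend (𝓡∂ 4)).symm) (h.extend (𝓡∂ 4) z) = a := by
      rw [Function.comp_apply, h.extend_left_inv hz, hG.leftInv a ha]
    have h3 := hasFDerivAt_pert (α := α) (hψ.differentiable (by simp)) (h𝒢.differentiable (by simp))
      ((G ∘ (h.extend (𝓡∂ 4)).symm) (h.extend (𝓡∂ 4) z))
    have h4 := (h3.comp _ (hG.hasFDerivAt a ha h hh.mem hz)).congr_of_eventuallyEq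
      (hG.boxPert_chart (f := fun a ↦ α * (ψ a.1 * 𝒢 a.2)) ha hz)
    rw [h2] at h4
    exact h1.unique h4
  have hsum : chartD h z (hamVF Ω (fun z ↦ H z + P z) z) = chartD h z (hamVF Ω H z) +
      stdSharp (dPert α ψ 𝒢 a ∘L (flowJac A H x b h a).inverse) := by
    rw [chartD_hamVF hh hz, chartD_hamVF hh hz, ← hdP]
    refine (congrArg stdSharp ?_).trans (map_add stdSharp _ _)
    exact congrArg (fun L : TangentSpace (𝓡∂ 4) z →L[ℝ] ℝ ↦ L ∘L (chartD h z).inverse)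
      (mfderiv_add hHd hPd)
  have hX : flowJac A H x b h a (1, 0) = chartD h z (hamVF Ω H z) := by
    have h1 : secFrame (sectionLin A x b) (chartVF Ω (A.chart (A.idx x)) H (sectionPt A x b a.2))
        (1, 0) = chartD (A.chart (A.idx x)) (sectionMap A x b a.2)
          (hamVF Ω H (sectionMap A x b a.2)) := by
      rw [secFrame_apply, map_zero, add_zero, one_smul, ← extend_sectionMap hc, chartVF_extend hzs]
    change chartD h _ (mfderiv (𝓡∂ 4) (𝓡∂ 4) (hamFlow Ω H a.1) _ ((chartD (A.chart (A.idx x))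
      (sectionMap A x b a.2)).inverse (secFrame (sectionLin A x b) _ (1, 0)))) = _
    rw [h1, chartD_inverse_apply hd.mem hzs, hH.mfderiv_hamFlow_hamVF A hk2]
    rfl
  rw [hsum, flatVF, map_add, hX]
  congr 1
  refine eq_of_stdForm_eq fun w ↦ ?_
  rw [stdForm_stdSharp, ← hJ.apply_inverse w, flowPoisson, hY]
  set v := (flowJac A H x b h a).inverse w
  change stdForm (chartJac Ω _ h H a.1 _ (secFrame _ _ _)) (chartJac Ω _ h H a.1 _
    (secFrame _ _ v)) = dPert α ψ 𝒢 a ((flowJac A H x b h a).inverse (flowJac A H x b h a v))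
  rw [stdForm_chartJac A hH hk2 hd hh hzs hz, stdForm_secPoisson hSv, hJ.inverse_apply]

/-- Integral curves of `flatVF` in the flowbox are mapped to integral curves of the perturbed
Hamiltonian field. -/
theorem hasMFDerivAt_flowMap_comp (hk : 2 ≤ k) (hH : IsHamiltonian (k + 1) H) {Y : E4 → E4} {α : ℝ}
    {ψ : ℝ → ℝ} {𝒢 : E3 → ℝ} (hψ : ContDiff ℝ ∞ ψ) (h𝒢 : ContDiff ℝ ∞ 𝒢)
    (hH' : IsHamiltonian k
      (fun z ↦ H z + boxPert A H x b S G (fun a ↦ α * (ψ a.1 * 𝒢 a.2)) z))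
    (hY : ∀ a ∈ S, Y (sectionPt A x b a.2) =
      chartVF Ω (A.chart (A.idx x)) H (sectionPt A x b a.2) ∧
      (secFrame (sectionLin A x b) (Y (sectionPt A x b a.2))).IsInvertible)
    {a : ℝ → E13} {t : ℝ} (hat : a t ∈ S)
    (ha : HasDerivAt a (flatVF (flowPoisson A x b Y) α ψ 𝒢 (a t)) t) :
    HasMFDerivAt 𝓘(ℝ, ℝ) (𝓡∂ 4) (fun t ↦ flowMap A H x b (a t)) t ((1 : ℝ →L[ℝ] ℝ).smulRight
      (hamVF Ω (fun z ↦ H z + boxPert A H x b S G (fun a ↦ α * (ψ a.1 * 𝒢 a.2)) z)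
        (flowMap A H x b (a t)))) := by
  have hk1 : 1 ≤ k := (by simp : (1 : ℕ∞) ≤ 2).trans hk
  set z := flowMap A H x b (a t) with hz
  have hh := A.isDarbouxChart (A.idx z)
  have hzs := A.mem_source z
  set h := A.chart (A.idx z)
  have h1 := (hasFDerivAt_chart_flowMap hk1 hH (hG.interior _ hat) hh.mem hzs).comp_hasDerivAt t ha
  rw [hG.flowJac_flatVF hk hH hψ h𝒢 hH' hat (hY _ hat).1 (hY _ hat).2 hh hzs] at h1
  have hcont : ContinuousAt (fun t ↦ flowMap A H x b (a t)) t :=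
    ContinuousAt.comp (f := a) (contMDiffAt_flowMap hk1 hH (hG.interior _ hat)).continuousAt
      ha.continuousAt
  have hev : ∀ᶠ s in 𝓝 t, flowMap A H x b (a s) ∈ h.source :=
    hcont.eventually (h.open_source.mem_nhds hzs)
  have h2 := HasDerivAt.hasMFDerivAt_extend_symm hh.mem h1
    (hev.mono fun s hs ↦ extend_mem_target h hs)
  refine (h2.congr_of_eventuallyEq (hev.mono fun s hs ↦ (h.extend_left_inv hs).symm)).congr_mfderiv ?_
  simp only [Function.comp_apply]
  rw [h.extend_left_inv hzs]
  exact congrArg _ (chartD_inverse_apply hh.mem hzs _)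

/-- The perturbed flow, and its derivative, in the coordinates of the flowbox. -/
theorem exists_perturbed_curve (hk : 2 ≤ k) (hH : IsHamiltonian (k + 1) H) (hSo : IsOpen S)
    {Y : E4 → E4} {α r₁ : ℝ} {ψ : ℝ → ℝ} {𝒢 : E3 → ℝ} (hψ : ContDiff ℝ ∞ ψ) (h𝒢 : ContDiff ℝ ∞ 𝒢)
    (hψs : HasCompactSupport ψ) (h𝒢s : HasCompactSupport 𝒢) (h𝒢r : tsupport 𝒢 ⊆ ball 0 r₁)
    (h𝓑 : ContDiffOn ℝ 1 (flowPoisson A x b Y) (ball 0 r₁))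
    (hH' : IsHamiltonian k
      (fun z ↦ H z + boxPert A H x b S G (fun a ↦ α * (ψ a.1 * 𝒢 a.2)) z))
    (hY : ∀ a ∈ S, Y (sectionPt A x b a.2) =
      chartVF Ω (A.chart (A.idx x)) H (sectionPt A x b a.2) ∧
      (secFrame (sectionLin A x b) (Y (sectionPt A x b a.2))).IsInvertible) (c : E3) :
    ∃ (a : ℝ → E13) (V : ℝ → E13 →L[ℝ] E13), a 0 = (0, c) ∧
      (∀ t, HasDerivAt a (flatVF (flowPoisson A x b Y) α ψ 𝒢 (a t)) t) ∧ V 0 = 1 ∧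
      (∀ t, HasDerivAt V (fderiv ℝ (flatVF (flowPoisson A x b Y) α ψ 𝒢) (a t) ∘L V t) t) ∧
      ((∀ t ∈ Icc (0 : ℝ) 1, a t ∈ S) →
        hamFlow Ω (fun z ↦ H z + boxPert A H x b S G (fun a ↦ α * (ψ a.1 * 𝒢 a.2)) z) 1
          (sectionMap A x b c) = flowMap A H x b (a 1) ∧
        ∀ h' ∈ IsManifold.maximalAtlas (𝓡∂ 4) ∞ M, flowMap A H x b (a 1) ∈ h'.source → ∀ v,
          chartJac Ω (A.chart (A.idx x)) h'
            (fun z ↦ H z + boxPert A H x b S G (fun a ↦ α * (ψ a.1 * 𝒢 a.2)) z) 1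
            (sectionMap A x b c)
            (secFrame (sectionLin A x b) (Y (sectionPt A x b c)) v) =
          flowJac A H x b h' (a 1) (V 1 v)) := by
  set H' : M → ℝ := fun z ↦ H z + boxPert A H x b S G (fun a ↦ α * (ψ a.1 * 𝒢 a.2)) z with hHdef
  have hk1 : 1 ≤ k := (by simp : (1 : ℕ∞) ≤ 2).trans hk
  have hk2 := hk.trans (le_self_add (b := (1 : ℕ∞)))
  have hF := contDiff_flatVF (α := α) h𝓑 hψ h𝒢 h𝒢r
  obtain ⟨φ, h0, hφ, hφ1⟩ := exists_flow_of_hasCompactSupport_sub hF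
    (hasCompactSupport_flatVF_sub hψs h𝒢s)
  have hφd : ∀ t, Differentiable ℝ (φ t) := fun t ↦
    (hφ1.comp (contDiff_const.prodMk contDiff_id)).differentiable one_ne_zero
  have hφ0 : φ 0 = id := funext h0
  refine ⟨fun t ↦ φ t (0, c), fun t ↦ fderiv ℝ (φ t) (0, c), h0 _, fun t ↦ hφ t _, ?_,
    fun t ↦ hasDerivAt_fderiv_flow hF hφ1 h0 hφ t _, fun hS ↦ ?_⟩
  · change fderiv ℝ (φ 0) (0, c) = 1
    rw [hφ0]; exact fderiv_id
  have h0S : ((0 : ℝ), c) ∈ S := by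
    simpa only [h0] using hS 0 ⟨le_rfl, zero_le_one⟩
  obtain ⟨I, N, hIo, hNo, hI, hN, hIN⟩ := generalized_tube_lemma (isCompact_Icc (a := (0 : ℝ)) (b := 1))
    (isCompact_singleton (x := ((0 : ℝ), c))) (hSo.preimage hφ1.continuous)
    (by rintro ⟨t, _⟩ ⟨ht, rfl⟩; exact hS t ht)
  obtain ⟨δ, hδ, hδI⟩ : ∃ δ > 0, Ioo (-δ) (1 + δ) ⊆ I := by
    obtain ⟨δ, hδ, h⟩ := isCompact_Icc.exists_thickening_subset_open hIo hI
    refine ⟨δ, hδ, fun t ht ↦ h (mem_thickening_iff.2 ⟨max 0 (min t 1), ?_, ?_⟩)⟩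
    · exact ⟨le_max_left _ _, max_le zero_le_one (min_le_right _ _)⟩
    · rw [Real.dist_eq, abs_lt]
      have := ht.1; have := ht.2
      constructor <;> rcases le_total t 1 with h | h <;> rcases le_total 0 (min t 1) with h2 | h2 <;>
        simp_all <;> linarith
  have hflow : ∀ a ∈ N, hamFlow Ω H' 1 (flowMap A H x b a) = flowMap A H x b (φ 1 a) := by
    intro a ha
    have h1 := hH'.eq_hamFlow_of_Ioo A hk (γ := fun t ↦ flowMap A H x b (φ t a)) (a := -δ)
      (b := 1 + δ) (t := 1) (fun t ht ↦ (hG.hasMFDerivAt_flowMap_comp hk hH hψ h𝒢 hH' hY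
        (hIN (mk_mem_prod (hδI ht) ha)) (hφ t a)).hasMFDerivWithinAt)
      ⟨by linarith, by linarith⟩ ⟨by linarith, by linarith⟩
    simp only [h0] at h1
    exact h1.symm
  have hc0 : flowMap A H x b (0, c) = sectionMap A x b c := hH.hamFlow_zero A hk2 _
  have hcN : ((0 : ℝ), c) ∈ N := hN rfl
  have hflow0 := hflow _ hcN
  rw [hc0] at hflow0
  refine ⟨hflow0, fun h' hh' hz' v ↦ ?_⟩
  have hcI := hG.interior _ h0S
  have hd := (A.isDarbouxChart (A.idx x)).mem
  have hzs : sectionMap A x b c ∈ (A.chart (A.idx x)).source := sectionMap_mem_source hcI.1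
  set h := A.chart (A.idx x)
  set a₁ := φ 1 (0, c) with ha₁
  have ha₁S : a₁ ∈ S := hS 1 ⟨zero_le_one, le_rfl⟩
  -- the derivative of the perturbed flow, in the charts
  have e1 : HasFDerivAt (fun a ↦ h.extend (𝓡∂ 4) (flowMap A H x b a)) (flowJac A H x b h (0, c))
      (0, c) := hasFDerivAt_chart_flowMap hk1 hH hcI hd (by rw [hc0]; exact hzs)
  have e2 := (hasMFDerivAt_extend hh' (by rw [hflow0]; exact hz')).comp _
    (hH'.hasMFDerivAt_hamFlow A hk 1 (sectionMap A x b c))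
  have e3 := (e2.hasFDerivWithinAt_chart hd hzs).hasFDerivAt (_root_.target_mem_nhds h
    (extend_mem_target h hzs) (by rw [extend_sectionMap hcI.1]; exact hcI.2))
  rw [← hc0] at e3
  have e4 := HasFDerivAt.comp (f := fun a ↦ h.extend (𝓡∂ 4) (flowMap A H x b a)) (0, c) e3 e1
  have e5 := (hasFDerivAt_chart_flowMap hk1 hH (hG.interior _ ha₁S) hh' hz').comp ((0 : ℝ), c)
    (hφd 1 (0, c)).hasFDerivAt
  have hcont : ContinuousAt (flowMap A H x b) (0, c) :=
    (contMDiffAt_flowMap hk1 hH hcI).continuousAt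
  have e6 := e5.congr_of_eventuallyEq (f₁ := ((h'.extend (𝓡∂ 4) ∘ hamFlow Ω H' 1) ∘
      (h.extend (𝓡∂ 4)).symm) ∘ fun a ↦ h.extend (𝓡∂ 4) (flowMap A H x b a)) (by
    filter_upwards [hNo.mem_nhds hcN, hcont.eventually (h.open_source.mem_nhds
      (by rw [hc0]; exact hzs))] with a ha ha'
    simp only [Function.comp_apply]
    rw [h.extend_left_inv ha', hflow a ha])
  have e7 := congrArg (fun L ↦ L v) (e4.unique e6)
  have e8 : flowJac A H x b h (0, c) v =
      secFrame (sectionLin A x b) (Y (sectionPt A x b c)) v := by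
    change chartJac Ω h h H 0 _ (secFrame _ _ v) = _
    rw [chartJac_zero A hH hk2 hd hzs, (hY _ h0S).1]
  rw [← e8, ← hc0]
  exact e7

end IsFlowboxInverse

end PerturbedFlow

section Realization

variable {M : Type*} [TopologicalSpace M] [ChartedSpace (EuclideanHalfSpace 4) M]
  [IsManifold (𝓡∂ 4) ∞ M] [RiemannianBundle (fun x : M ↦ TangentSpace (𝓡∂ 4) x)]
  {Ω : SymplecticForm M} {A : DarbouxAtlas Ω} {H H' : M → ℝ} {x : M}
  {b : Fin 3 → TangentSpace (𝓡∂ 4) x} {k : ℕ∞}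
  {h h' : OpenPartialHomeomorph M (EuclideanHalfSpace 4)}

theorem form_comm (z : M) (v w : TangentSpace (𝓡∂ 4) z) : Ω.form z v w = -Ω.form z w v := by
  have := Ω.alternating z (v + w)
  simp only [map_add, add_apply, Ω.alternating] at this
  linarith

theorem form_transRotation (B : Module.Basis (Fin 2) ℝ (transFiber Ω H x)) (α : ℝ)
    (v w : transFiber Ω H x) :
    Ω.form x (transRotation Ω B α v : TangentSpace (𝓡∂ 4) x) (transRotation Ω B α w) =
      Ω.form x v w := by
  have h1 : ∀ v : transFiber Ω H x, (v : TangentSpace (𝓡∂ 4) x) =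
      B.repr v 0 • (B 0 : TangentSpace (𝓡∂ 4) x) + B.repr v 1 • (B 1 : TangentSpace (𝓡∂ 4) x) := by
    intro v
    have h0 := congrArg Subtype.val (B.sum_repr v)
    rw [Fin.sum_univ_two] at h0
    exact h0.symm
  have h2 : ∀ v : transFiber Ω H x, (transRotation Ω B α v : TangentSpace (𝓡∂ 4) x) =
      (Real.cos α * B.repr v 0 - Real.sin α * B.repr v 1) • (B 0 : TangentSpace (𝓡∂ 4) x) +
      (Real.sin α * B.repr v 0 + Real.cos α * B.repr v 1) • (B 1 : TangentSpace (𝓡∂ 4) x) := by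
    intro v
    rw [transRotation, Matrix.toLin_apply]
    simp [Matrix.mulVec, dotProduct, Fin.sum_univ_two, sub_eq_add_neg]
  rw [h2, h2]
  conv_rhs => rw [h1 v, h1 w]
  simp only [map_add, map_smul, add_apply, smul_apply, smul_eq_mul, Ω.alternating,
    form_comm x (B 1 : TangentSpace (𝓡∂ 4) x) (B 0)]
  linear_combination (B.repr v 0 * B.repr w 1 - B.repr v 1 * B.repr w 0) *
    Ω.form x (B 0 : TangentSpace (𝓡∂ 4) x) (B 1) * Real.sin_sq_add_cos_sq α

theorem exists_starProjection_normalFiber_eq (z : M) (u : TangentSpace (𝓡∂ 4) z) :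
    ∃ c : ℝ, (normalFiber Ω H z).starProjection u = u - c • hamVF Ω H z := by
  rw [normalFiber, Submodule.starProjection_orthogonal_val, Submodule.starProjection_singleton]
  exact ⟨_, rfl⟩

theorem transPoincare_apply (t : ℝ) (v : transFiber Ω H x) :
    transPoincare Ω H t x v = (normalFiber Ω H (hamFlow Ω H t x)).starProjection
      (mfderiv (𝓡∂ 4) (𝓡∂ 4) (hamFlow Ω H t) x v) := rfl

/-- The orthogonal projection onto the normal fiber, in a chart. -/
noncomputable def normalProj (Ω : SymplecticForm M)
    (h : OpenPartialHomeomorph M (EuclideanHalfSpace 4)) (H : M → ℝ) (z : M) : E4 →L[ℝ] E4 :=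
  projN (gram h z) (chartD h z (hamVF Ω H z))

/-- The orthogonal projection onto the transversal fiber, in a chart. -/
noncomputable def transProj (Ω : SymplecticForm M)
    (h : OpenPartialHomeomorph M (EuclideanHalfSpace 4)) (H : M → ℝ) (z : M) : E4 →L[ℝ] E4 :=
  projT (gram h z) (chartD h z (hamVF Ω H z)) (chartForm h H z)

theorem chartForm_eq_stdFormL (hh : IsDarbouxChart Ω h) {z : M} (hz : z ∈ h.source) :
    chartForm h H z = stdFormL (chartD h z (hamVF Ω H z)) := by
  refine ContinuousLinearMap.ext fun w ↦ ?_
  have h1 := hh.form_eq z hz (hamVF Ω H z) ((chartD h z).inverse w)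
  rw [form_hamVF, chartD_apply_inverse hh.mem hz] at h1
  rw [stdFormL_apply]
  exact h1

theorem transProj_congr (hh : IsDarbouxChart Ω h) {z : M} (hz : z ∈ h.source)
    (hX : hamVF Ω H' z = hamVF Ω H z) : transProj Ω h H' z = transProj Ω h H z := by
  rw [transProj, transProj, chartForm_eq_stdFormL hh hz, chartForm_eq_stdFormL hh hz, hX]

variable [IsContMDiffRiemannianBundle (𝓡∂ 4) ∞ (EuclideanSpace ℝ (Fin 4))
      (fun x : M ↦ TangentSpace (𝓡∂ 4) x)]

/-- The transversal linear Poincaré flow in charts. -/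
theorem inCharts_transPoincare_comp (hh : h ∈ IsManifold.maximalAtlas (𝓡∂ 4) ∞ M)
    (hh' : h' ∈ IsManifold.maximalAtlas (𝓡∂ 4) ∞ M) {t : ℝ} {y : M} (hy : y ∈ h.source)
    (hz : hamFlow Ω H t y ∈ h'.source) (hX : hamVF Ω H y ≠ 0)
    (R : transFiber Ω H y →ₗ[ℝ] transFiber Ω H y) (R' : E4 →L[ℝ] E4)
    (hR : ∀ v : transFiber Ω H y, R' (chartD h y v) = chartD h y (R v)) :
    inCharts h h' H y (hamFlow Ω H t y) (transPoincare Ω H t y ∘ₗ R) =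
      normalProj Ω h' H (hamFlow Ω H t y) ∘L chartJac Ω h h' H t y ∘L R' ∘L
        transProj Ω h H y := by
  refine ContinuousLinearMap.ext fun w ↦ ?_
  set v := (transFiber Ω H y).orthogonalProjectionOnto ((chartD h y).inverse w) with hv
  have h1 : transProj Ω h H y w = chartD h y v := by
    rw [hv, chartD_projection_transFiber hh hy hX, chartD_apply_inverse hh hy]
    rfl
  change chartD h' (hamFlow Ω H t y) (transPoincare Ω H t y (R v)) =
    projN _ _ (chartD h' _ (mfderiv (𝓡∂ 4) (𝓡∂ 4) (hamFlow Ω H t) y ((chartD h y).inverse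
      (R' (transProj Ω h H y w)))))
  rw [h1, hR, chartD_inverse_apply hh hy, transPoincare_apply,
    chartD_starProjection_normalFiber hh' hz]

theorem continuousAt_chartD_hamVF (hH : IsHamiltonian k H) (hk : 2 ≤ k) (hh : IsDarbouxChart Ω h)
    {z : M} (hz : z ∈ h.source) : ContinuousAt (fun z ↦ chartD h z (hamVF Ω H z)) z := by
  have h1 : ContinuousOn (chartVF Ω h H) (h.extend (𝓡∂ 4)).target :=
    (hH.contDiffOn_chartVF hh (m := 1) (by simpa [one_add_one_eq_two] using hk)).continuousOn
  have h2 : ContinuousOn (fun z ↦ chartVF Ω h H (h.extend (𝓡∂ 4) z)) h.source :=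
    h1.comp ((h.continuousOn_extend (I := 𝓡∂ 4)).mono (by simp)) fun z hz ↦ extend_mem_target h hz
  exact (h2.congr fun z hz ↦ (chartVF_extend hz).symm).continuousAt (h.open_source.mem_nhds hz)

theorem chartD_hamVF_ne_zero (hh : h ∈ IsManifold.maximalAtlas (𝓡∂ 4) ∞ M) {z : M}
    (hz : z ∈ h.source) (hX : hamVF Ω H z ≠ 0) : chartD h z (hamVF Ω H z) ≠ 0 := fun h0 ↦ hX (by
  rw [← chartD_inverse_apply hh hz (hamVF Ω H z), h0, map_zero])

theorem continuousAt_normalProj (hH : IsHamiltonian k H) (hk : 2 ≤ k) (hh : IsDarbouxChart Ω h)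
    {z : M} (hz : z ∈ h.source) (hX : hamVF Ω H z ≠ 0) : ContinuousAt (normalProj Ω h H) z :=
  ContinuousAt.projN ((continuousOn_gram hh.mem).continuousAt (h.open_source.mem_nhds hz))
    (continuousAt_chartD_hamVF hH hk hh hz)
    (gram_self_pos hh.mem hz (chartD_hamVF_ne_zero hh.mem hz hX)).ne'

theorem continuousAt_transProj (hH : IsHamiltonian k H) (hk : 2 ≤ k) (hh : IsDarbouxChart Ω h)
    {z : M} (hz : z ∈ h.source) (hX : hamVF Ω H z ≠ 0) : ContinuousAt (transProj Ω h H) z := by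
  have h1 := continuousAt_chartD_hamVF hH hk hh hz
  have h2 : ContinuousAt (chartForm h H) z := by
    refine (ContinuousAt.comp (f := fun z ↦ chartD h z (hamVF Ω H z))
      stdFormL.continuous.continuousAt h1).congr ?_
    filter_upwards [h.open_source.mem_nhds hz] with w hw
    exact (chartForm_eq_stdFormL hh hw).symm
  exact ContinuousAt.projT ((continuousOn_gram hh.mem).continuousAt (h.open_source.mem_nhds hz))
    h1 h2 (gram_self_pos hh.mem hz (chartD_hamVF_ne_zero hh.mem hz hX)).ne'
    (gram_isInvertible hh.mem hz) (chartForm_inverse_pos hh.mem hz hX).ne'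

variable [CompactSpace M] [T2Space M]

theorem transPoincare_mem_transFiber (A : DarbouxAtlas Ω) (hH : IsHamiltonian k H) (hk : 2 ≤ k)
    (t : ℝ) (v : transFiber Ω H x) :
    transPoincare Ω H t x v ∈ transFiber Ω H (hamFlow Ω H t x) := by
  refine Submodule.mem_inf.2 ⟨Submodule.starProjection_apply_mem _ _, ?_⟩
  rw [transPoincare_apply, LinearMap.mem_ker]
  obtain ⟨c, hc⟩ := exists_starProjection_normalFiber_eq (Ω := Ω) (H := H) (hamFlow Ω H t x)
    (mfderiv (𝓡∂ 4) (𝓡∂ 4) (hamFlow Ω H t) x v)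
  rw [hc, map_sub, map_smul, dHam_hamVF, smul_zero, sub_zero, hH.dHam_mfderiv_hamFlow A hk]
  exact (Submodule.mem_inf.1 v.2).2

theorem form_transPoincare (A : DarbouxAtlas Ω) (hH : IsHamiltonian k H) (hk : 2 ≤ k)
    (t : ℝ) (v w : transFiber Ω H x) :
    Ω.form (hamFlow Ω H t x) (transPoincare Ω H t x v) (transPoincare Ω H t x w) =
      Ω.form x v w := by
  rw [← hH.form_mfderiv_hamFlow A hk t x v w, transPoincare_apply, transPoincare_apply]
  have hv : dHam H (hamFlow Ω H t x) (mfderiv (𝓡∂ 4) (𝓡∂ 4) (hamFlow Ω H t) x v) = 0 := by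
    rw [hH.dHam_mfderiv_hamFlow A hk]; exact (Submodule.mem_inf.1 v.2).2
  have hw : dHam H (hamFlow Ω H t x) (mfderiv (𝓡∂ 4) (𝓡∂ 4) (hamFlow Ω H t) x w) = 0 := by
    rw [hH.dHam_mfderiv_hamFlow A hk]; exact (Submodule.mem_inf.1 w.2).2
  obtain ⟨c, hc⟩ := exists_starProjection_normalFiber_eq (Ω := Ω) (H := H) (hamFlow Ω H t x)
    (mfderiv (𝓡∂ 4) (𝓡∂ 4) (hamFlow Ω H t) x v)
  obtain ⟨d, hd⟩ := exists_starProjection_normalFiber_eq (Ω := Ω) (H := H) (hamFlow Ω H t x)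
    (mfderiv (𝓡∂ 4) (𝓡∂ 4) (hamFlow Ω H t) x w)
  rw [hc, hd]
  generalize mfderiv (𝓡∂ 4) (𝓡∂ 4) (hamFlow Ω H t) x v = v' at *
  generalize mfderiv (𝓡∂ 4) (𝓡∂ 4) (hamFlow Ω H t) x w = w' at *
  rw [← form_hamVF Ω H] at hv hw
  simp only [map_sub, map_smul, sub_apply, smul_apply, Ω.alternating, hw, form_comm _ v', hv]
  simp

/-- Near `x`, the maps which are close to `R` in the coordinates of the flowbox are close to `R`
after projection to the transversal fibers. -/
theorem exists_inCharts_close (A : DarbouxAtlas Ω) (hH : IsHamiltonian k H) (hk : 2 ≤ k)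
    (hX : hamVF Ω H x ≠ 0) (hb : IsNormalFrame Ω H x b)
    (hh' : IsDarbouxChart Ω h') (hx' : hamFlow Ω H 1 x ∈ h'.source) (R : E13 →L[ℝ] E13) {γ : ℝ}
    (hγ : 0 < γ) :
    ∃ δ > 0, ∃ r > 0, ∀ a : E13, |a.1 - 1| ≤ δ → a.2 ∈ sectionBall A x b r →
      flowMap A H x b a ∈ h'.source ∧ ∀ c ∈ sectionBall A x b r, ∀ V : E13 →L[ℝ] E13, ‖V - R‖ ≤ δ →
        ‖(normalProj Ω h' H (flowMap A H x b a) ∘L flowJac A H x b h' a) ∘L V ∘L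
            ((secFrame (sectionLin A x b) (chartVF Ω (A.chart (A.idx x)) H
              (sectionPt A x b c))).inverse ∘L
              transProj Ω (A.chart (A.idx x)) H (sectionMap A x b c)) -
          (normalProj Ω h' H (hamFlow Ω H 1 x) ∘L chartJac Ω (A.chart (A.idx x)) h' H 1 x ∘L
            secFrame (sectionLin A x b) (chartD (A.chart (A.idx x)) x (hamVF Ω H x))) ∘L R ∘L
            ((secFrame (sectionLin A x b) (chartD (A.chart (A.idx x)) x (hamVF Ω H x))).inverse ∘L
              transProj Ω (A.chart (A.idx x)) H x)‖ < γ := by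
  have hd := A.isDarbouxChart (A.idx x)
  have hx := A.mem_source x
  have hS := hb.secFrame_isInvertible (A := A) hX
  set h := A.chart (A.idx x)
  set D : Set E3 := {c | sectionPt A x b c ∈ (A.at x).target} with hD
  have h0D : (0 : E3) ∈ D := (zero_mem_sectionBall one_pos).2.2
  have hσ : Tendsto (sectionMap A x b) (𝓝[D] 0) (𝓝 x) := by
    have := continuousOn_sectionMap (A := A) (b := b) 0 h0D
    rwa [ContinuousWithinAt, sectionMap_zero] at this
  set S : E3 → E13 →L[ℝ] E4 := fun c ↦ secFrame (sectionLin A x b) (chartVF Ω h H (sectionPt A x b c))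
    with hSdef
  set S₀ := secFrame (sectionLin A x b) (chartD h x (hamVF Ω H x)) with hS₀
  have hSc : Tendsto S (𝓝[D] 0) (𝓝 S₀) := by
    have h1 : Tendsto (fun c ↦ chartD h (sectionMap A x b c) (hamVF Ω H (sectionMap A x b c)))
        (𝓝[D] 0) (𝓝 (chartD h x (hamVF Ω H x))) :=
      (continuousAt_chartD_hamVF hH hk hd hx).tendsto.comp hσ
    refine (((contDiff_secFrame (n := 0) _).continuous.tendsto _).comp h1).congr' ?_
    filter_upwards [self_mem_nhdsWithin] with c hc
    rfl
  have hSi : Tendsto (fun c ↦ (S c).inverse) (𝓝[D] 0) (𝓝 S₀.inverse) := by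
    have h1 : ContinuousAt (ContinuousLinearMap.inverse : (E13 →L[ℝ] E4) → _) S₀ :=
      (hS.contDiffAt_map_inverse (n := 0)).continuousAt
    exact h1.tendsto.comp hSc
  have hT : Tendsto (fun c ↦ (S c).inverse ∘L transProj Ω h H (sectionMap A x b c)) (𝓝[D] 0)
      (𝓝 (S₀.inverse ∘L transProj Ω h H x)) :=
    (isBoundedBilinearMap_comp (𝕜 := ℝ)).continuous.tendsto _ |>.comp
      (hSi.prodMk_nhds ((continuousAt_transProj hH hk hd hx hX).tendsto.comp hσ))
  have hpair : Tendsto (fun p : ℝ × E3 ↦ (p.1, sectionMap A x b p.2)) (𝓝 1 ×ˢ 𝓝[D] 0)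
      (𝓝 (1, x)) := tendsto_fst.prodMk_nhds (hσ.comp tendsto_snd)
  have hφ : Tendsto (flowMap A H x b) (𝓝 1 ×ˢ 𝓝[D] 0) (𝓝 (hamFlow Ω H 1 x)) :=
    ((hH.continuous_hamFlow A hk).tendsto (1, x)).comp hpair
  have hJ : Tendsto (fun a : E13 ↦ normalProj Ω h' H (flowMap A H x b a) ∘L
      flowJac A H x b h' a) (𝓝 1 ×ˢ 𝓝[D] 0)
      (𝓝 (normalProj Ω h' H (hamFlow Ω H 1 x) ∘L chartJac Ω h h' H 1 x ∘L S₀)) := by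
    have hX1 := hamVF_hamFlow_ne_zero A hH hk hX 1
    have e1 := (continuousAt_normalProj hH hk hh' hx' hX1).tendsto.comp hφ
    have e2 := (hH.continuousAt_chartJac A hk hd.mem hh'.mem hx hx').tendsto.comp hpair
    have e3 := ((isBoundedBilinearMap_comp (𝕜 := ℝ)).continuous.tendsto _).comp
      (e2.prodMk_nhds (hSc.comp tendsto_snd))
    exact ((isBoundedBilinearMap_comp (𝕜 := ℝ)).continuous.tendsto _).comp (e1.prodMk_nhds e3)
  have hall := ((isBoundedBilinearMap_comp (𝕜 := ℝ)).continuous.tendsto _).comp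
    ((hJ.comp tendsto_fst).prodMk_nhds (((isBoundedBilinearMap_comp (𝕜 := ℝ)).continuous.tendsto
      _).comp ((tendsto_fst.comp tendsto_snd).prodMk_nhds (hT.comp (tendsto_snd.comp tendsto_snd)))) :
      Tendsto _ ((𝓝 (1 : ℝ) ×ˢ 𝓝[D] (0 : E3)) ×ˢ (𝓝 R ×ˢ 𝓝[D] (0 : E3))) _)
  have hev := hall.eventually (ball_mem_nhds _ hγ)
  obtain ⟨p, hp, q, hq, hpq⟩ := eventually_prod_iff.1 hev
  obtain ⟨p₁, hp₁, p₂, hp₂, hp₁₂⟩ := eventually_prod_iff.1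
    (hp.and (hφ.eventually (h'.open_source.mem_nhds hx')))
  obtain ⟨q₁, hq₁, q₂, hq₂, hq₁₂⟩ := eventually_prod_iff.1 hq
  obtain ⟨δ₁, hδ₁, hb₁⟩ := Metric.nhds_basis_closedBall.eventually_iff.1 hp₁
  obtain ⟨δ₂, hδ₂, hb₂⟩ := Metric.nhds_basis_closedBall.eventually_iff.1 hq₁
  obtain ⟨r, hr, hb₃⟩ := exists_sectionBall_forall (hp₂.and hq₂)
  refine ⟨min δ₁ δ₂, lt_min hδ₁ hδ₂, r, hr, fun a ha1 ha2 ↦ ?_⟩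
  have ha := hp₁₂ (hb₁ (by rw [mem_closedBall, Real.dist_eq]; exact ha1.trans (min_le_left _ _)))
    (hb₃ _ ha2).1
  refine ⟨ha.2, fun c hc V hV ↦ ?_⟩
  have hV' : V ∈ closedBall R δ₂ := by
    rw [mem_closedBall, dist_eq_norm]
    exact hV.trans (min_le_right _ _)
  have := hpq ha.1 (hq₁₂ (hb₂ hV') (hb₃ c hc).2)
  rw [← dist_eq_norm]
  exact this

end Realization

theorem exists_time_bump : ∃ ψ : ℝ → ℝ, ContDiff ℝ ∞ ψ ∧ HasCompactSupport ψ ∧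
    tsupport ψ ⊆ Icc (1 / 4) (1 / 2) ∧ (∫ t in (0 : ℝ)..1, ψ t = 1) ∧ ∃ Ψ, 0 ≤ Ψ ∧
      (∀ θ, |ψ θ| ≤ Ψ) ∧ (∀ θ, |deriv ψ θ| ≤ Ψ) ∧ ∀ θ, |deriv (deriv ψ) θ| ≤ Ψ := by
  let χ : ContDiffBump (3 / 8 : ℝ) := ⟨1 / 16, 1 / 8, by norm_num, by norm_num⟩
  set ψ : ℝ → ℝ := χ.normed volume with hψ
  have hc : ContDiff ℝ ∞ ψ := χ.contDiff_normed
  have hs : HasCompactSupport ψ := χ.hasCompactSupport_normed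
  have ht : tsupport ψ ⊆ Icc (1 / 4) (1 / 2) := by
    rw [χ.tsupport_normed_eq, Real.closedBall_eq_Icc]
    exact Icc_subset_Icc (by norm_num [χ]) (by norm_num [χ])
  have hc1 : ContDiff ℝ ∞ (deriv ψ) := (contDiff_infty_iff_deriv.1 hc).2
  obtain ⟨B0, h0⟩ := hs.exists_bound_of_continuous hc.continuous
  obtain ⟨B1, h1⟩ := hs.deriv.exists_bound_of_continuous hc1.continuous
  obtain ⟨B2, h2⟩ := hs.deriv.deriv.exists_bound_of_continuous
    (contDiff_infty_iff_deriv.1 hc1).2.continuous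
  refine ⟨ψ, hc, hs, ht, ?_, max B0 (max B1 B2), ((norm_nonneg _).trans (h0 0)).trans
    (le_max_left _ _), fun θ ↦ (h0 θ).trans (le_max_left _ _), fun θ ↦ (h1 θ).trans
    ((le_max_left _ _).trans (le_max_right _ _)), fun θ ↦ (h2 θ).trans
    ((le_max_right _ _).trans (le_max_right _ _))⟩
  have hz : ∀ t ∉ Ioc (0 : ℝ) 1, ψ t = 0 := fun t ht' ↦ image_eq_zero_of_notMem_tsupport
    fun h ↦ ht' ⟨by linarith [(ht h).1], by linarith [(ht h).2]⟩
  rw [intervalIntegral.integral_of_le zero_le_one,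
    setIntegral_eq_integral_of_forall_compl_eq_zero hz]
  exact χ.integral_normed

/-- A function supported in `W`, with small values, whose second derivative is `q` near most points
of `W`. -/
theorem exists_packed_quadratic {η : ℝ} (hη : 0 < η) (hη1 : η ≤ 1 / 4) : ∃ C₀ > 0, ∀ (Q : ℝ)
    (q : E3 →L[ℝ] E3 →L[ℝ] ℝ), (∀ a b, q a b = q b a) → (∀ a b, |q a b| ≤ Q * ‖a‖ * ‖b‖) →
    ∀ W : Set E3, IsOpen W → volume W ≠ ⊤ → ∀ R > 0,
    ∃ (𝒢 : E3 → ℝ) (K : Set E3), ContDiff ℝ ∞ 𝒢 ∧ HasCompactSupport 𝒢 ∧ tsupport 𝒢 ⊆ W ∧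
      (∀ ζ, |𝒢 ζ| ≤ C₀ * Q * R ^ 2) ∧ (∀ ζ, ‖fderiv ℝ 𝒢 ζ‖ ≤ C₀ * Q * R) ∧
      (∀ ζ a, ‖fderiv ℝ (fderiv ℝ 𝒢) ζ a‖ ≤ C₀ * Q * ‖a‖) ∧ K ⊆ W ∧ MeasurableSet K ∧
      volume (W \ K) ≤ ENNReal.ofReal (7 * η) * volume W ∧
      ∀ c ∈ K, ∃ ρ, 0 < ρ ∧ ρ < R ∧ closedBall c (η * ρ) ⊆ W ∧
        (∀ ζ ∈ closedBall c (η * ρ), |𝒢 ζ| ≤ C₀ * Q * ρ ^ 2 ∧ ‖fderiv ℝ 𝒢 ζ‖ ≤ C₀ * Q * ρ) ∧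
        ∀ ζ ∈ ball c (η * ρ), ∀ ξ, fderiv ℝ (fderiv ℝ 𝒢) ζ ξ = q ξ := by
  obtain ⟨C₀, hC₀, hg⟩ := exists_quadratic_bump hη (by linarith)
  refine ⟨C₀, hC₀, fun Q q hsym hq W hW hfin R hR ↦ ?_⟩
  obtain ⟨g, hgc, hgs, hg0, hg1, hg2, hgq⟩ := hg Q q hsym hq
  obtain ⟨𝒢, t, r, hc, hs, hsW, h0, h1, h2, ht, hv⟩ := exists_packed_function hgc hgs hg0 hg1 hg2
    hW hfin (l := 1 - 2 * η) (by linarith) (by linarith) hη (by linarith) hR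
  refine ⟨𝒢, ⋃ c ∈ t, ball c ((1 - 2 * η) * r c), hc, hs, hsW, h0, h1, h2, ?_,
    (isOpen_biUnion fun _ _ ↦ isOpen_ball).measurableSet, hv.trans ?_, fun c hcK ↦ ?_⟩
  · refine iUnion₂_subset fun c hc ↦ (ball_subset_closedBall.trans
      (closedBall_subset_closedBall ?_)).trans (ht c hc).2.2.1
    nlinarith [(ht c hc).1]
  · gcongr
    nlinarith [pow_pos hη 2, pow_pos hη 3, mul_pos hη (pow_pos hη 3)]
  · simp only [mem_iUnion, exists_prop] at hcK
    obtain ⟨c', hc', hcc⟩ := hcK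
    obtain ⟨hr, hrR, hrW, hrB⟩ := ht c' hc'
    rw [mem_ball] at hcc
    have hsub : closedBall c (η * r c') ⊆ closedBall c' (r c') := closedBall_subset_closedBall' (by
      nlinarith)
    refine ⟨r c', hr, hrR, hsub.trans hrW, fun ζ hζ ↦ ⟨(hrB ζ (hsub hζ)).1, (hrB ζ (hsub hζ)).2.1⟩,
      fun ζ hζ ξ ↦ ?_⟩
    rw [(hrB ζ (hsub (ball_subset_closedBall hζ))).2.2 ξ]
    refine hgq _ ?_ ξ
    rw [mem_ball_zero_iff, norm_smul, norm_inv, Real.norm_of_nonneg hr.le, inv_mul_lt_iff₀ hr,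
      ← dist_eq_norm]
    rw [mem_ball] at hζ
    linarith [dist_triangle ζ c c']

section Assembly

variable {M : Type*} [TopologicalSpace M] [ChartedSpace (EuclideanHalfSpace 4) M]
  [IsManifold (𝓡∂ 4) ∞ M] [RiemannianBundle (fun x : M ↦ TangentSpace (𝓡∂ 4) x)]
  [IsContMDiffRiemannianBundle (𝓡∂ 4) ∞ (EuclideanSpace ℝ (Fin 4))
      (fun x : M ↦ TangentSpace (𝓡∂ 4) x)]
  {Ω : SymplecticForm M} {H H' : M → ℝ} {x : M}
  {b : Fin 3 → TangentSpace (𝓡∂ 4) x} {k : ℕ∞}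
  {h h' : OpenPartialHomeomorph M (EuclideanHalfSpace 4)}

/-- An extension of the Hamiltonian field near the section, and the bounds it satisfies. -/
theorem exists_section_extension (A : DarbouxAtlas Ω) (hH : IsHamiltonian k H) (hk : 2 ≤ k)
    (hX : hamVF Ω H x ≠ 0) (hb : IsNormalFrame Ω H x b) {r₀ : ℝ} (hr₀ : 0 < r₀) :
    ∃ Y : E4 → E4, Y (A.at x x) = chartD (A.chart (A.idx x)) x (hamVF Ω H x) ∧
      ∃ r₁ > 0, ∃ B, 0 ≤ B ∧ ContDiffOn ℝ 1 (flowPoisson A x b Y) (ball 0 r₁) ∧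
      (∀ c ∈ ball (0 : E3) r₁, ∀ β, ‖flowPoisson A x b Y c β‖ ≤ B * ‖β‖) ∧
      (∀ c ∈ ball (0 : E3) r₁, ∀ v β, ‖fderiv ℝ (flowPoisson A x b Y) c v β‖ ≤ B * ‖v‖ * ‖β‖) ∧
      (∀ c ∈ ball (0 : E3) r₁, ∀ β,
        ‖flowPoisson A x b Y c β - flowPoisson A x b Y 0 β‖ ≤ B * ‖c‖ * ‖β‖) ∧
      ∃ r > 0, r ≤ r₀ ∧ ∀ c ∈ sectionBall A x b r, c ∈ ball (0 : E3) r₁ ∧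
        Y (sectionPt A x b c) = chartVF Ω (A.chart (A.idx x)) H (sectionPt A x b c) ∧
        (secFrame (sectionLin A x b) (Y (sectionPt A x b c))).IsInvertible ∧
        ∀ w, ‖((secFrame (sectionLin A x b) (Y (sectionPt A x b c))).inverse w).2‖ ≤
          2 * ‖(chartD (A.chart (A.idx x)) (sectionMap A x b c)).inverse w‖ := by
  have hd := A.isDarbouxChart (A.idx x)
  have hxt : A.at x x ∈ (A.at x).target := extend_mem_target _ (A.mem_source x)
  obtain ⟨R, hR, Y, hY, -, -, hYX⟩ := hH.exists_chartVF_extension hk hd hxt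
  have hYx : Y (A.at x x) = chartD (A.chart (A.idx x)) x (hamVF Ω H x) := by
    rw [(hYX _ (mem_ball_self hR) (extend_target_nonneg _ hxt)).2]
    exact chartVF_extend (A.mem_source x)
  obtain ⟨r₁, hr₁, B, hB, hinv, hc, h1, h2, h3⟩ := exists_flowPoisson_bounds (A := A) (b := b) hY
    (by rw [hYx]; exact hb.secFrame_isInvertible hX)
  obtain ⟨r₂, hr₂, hn⟩ := exists_norm_secFrame_inverse_le (A := A) hY.continuous hb hX hYx
  have hev : ∀ᶠ c in 𝓝[{c | sectionPt A x b c ∈ (A.at x).target}] 0, c ∈ ball (0 : E3) r₁ ∧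
      Y (sectionPt A x b c) = chartVF Ω (A.chart (A.idx x)) H (sectionPt A x b c) := by
    have hcont : ContinuousAt (sectionPt A x b) 0 :=
      (contDiff_sectionPt (n := 0)).continuous.continuousAt
    filter_upwards [self_mem_nhdsWithin, nhdsWithin_le_nhds (hcont.preimage_mem_nhds
      (by rw [sectionPt_zero]; exact ball_mem_nhds _ hR)),
      nhdsWithin_le_nhds (ball_mem_nhds (0 : E3) hr₁)] with c hcT hcR hc1
    exact ⟨hc1, (hYX _ hcR (extend_target_nonneg _ hcT)).2⟩
  obtain ⟨r₃, hr₃, hr₃'⟩ := exists_sectionBall_forall hev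
  refine ⟨Y, hYx, r₁, hr₁, B, hB, hc, h1, h2, h3, min r₀ (min r₂ r₃), by positivity,
    min_le_left _ _, fun c hc ↦ ?_⟩
  have hc2 := sectionBall_mono ((min_le_right _ _).trans (min_le_left _ _)) hc
  obtain ⟨hc1, hcY⟩ := hr₃' c (sectionBall_mono ((min_le_right _ _).trans (min_le_right _ _)) hc)
  exact ⟨hc1, hcY, hinv c hc1, hn c hc2⟩

variable [CompactSpace M] [T2Space M]

/-- The rotation of the transversal fiber, followed by the transversal linear Poincaré flow. -/
theorem inCharts_transPoincare_rotation {A : DarbouxAtlas Ω} (hX : hamVF Ω H x ≠ 0)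
    (hb : IsNormalFrame Ω H x b) {Y : E4 → E4}
    (hY : Y (A.at x x) = chartD (A.chart (A.idx x)) x (hamVF Ω H x))
    (B : Module.Basis (Fin 2) ℝ (transFiber Ω H x)) (hB : Ω.form x (B 0) (B 1) = 1) (α : ℝ)
    (hh' : h' ∈ IsManifold.maximalAtlas (𝓡∂ 4) ∞ M) (hx' : hamFlow Ω H 1 x ∈ h'.source) :
    inCharts (A.chart (A.idx x)) h' H x (hamFlow Ω H 1 x)
        (transPoincare Ω H 1 x ∘ₗ transRotation Ω B α) =
      (normalProj Ω h' H (hamFlow Ω H 1 x) ∘L chartJac Ω (A.chart (A.idx x)) h' H 1 x ∘L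
        secFrame (sectionLin A x b) (chartD (A.chart (A.idx x)) x (hamVF Ω H x))) ∘L
      rotExp (flatGen (flowPoisson A x b Y)
        (rotHessian Ω b (B 0 : TangentSpace (𝓡∂ 4) x) (B 1 : TangentSpace (𝓡∂ 4) x))) α ∘L
      ((secFrame (sectionLin A x b) (chartD (A.chart (A.idx x)) x (hamVF Ω H x))).inverse ∘L
        transProj Ω (A.chart (A.idx x)) H x) := by
  have hd := (A.isDarbouxChart (A.idx x)).mem
  have hS := hb.secFrame_isInvertible (A := A) hX
  set S₀ := secFrame (sectionLin A x b) (chartD (A.chart (A.idx x)) x (hamVF Ω H x)) with hS₀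
  set N := flatGen (flowPoisson A x b Y)
    (rotHessian Ω b (B 0 : TangentSpace (𝓡∂ 4) x) (B 1 : TangentSpace (𝓡∂ 4) x)) with hN
  refine (inCharts_transPoincare_comp hd hh' (A.mem_source x) hx' hX (transRotation Ω B α)
    (S₀ ∘L rotExp N α ∘L S₀.inverse) fun v ↦ ?_).trans (by simp only [ContinuousLinearMap.comp_assoc])
  obtain ⟨u, hu⟩ := (hb.flowFrame_bijective hX).2 (v : TangentSpace (𝓡∂ 4) x)
  have e1 : S₀ (rotExp N α u) = chartD (A.chart (A.idx x)) x (transRotation Ω B α v) :=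
    (secFrame_sectionLin (A := A) _).trans (congrArg (chartD (A.chart (A.idx x)) x)
      (hb.flowFrame_rotExp (A := A) hX hY B hB α v u hu))
  have e2 : S₀ u = chartD (A.chart (A.idx x)) x v :=
    (secFrame_sectionLin u).trans (congrArg (chartD (A.chart (A.idx x)) x) hu)
  refine Eq.trans ?_ e1
  refine (congrArg (fun y ↦ S₀ (rotExp N α (S₀.inverse y))) e2.symm).trans ?_
  exact congrArg (fun y ↦ S₀ (rotExp N α y)) (hS.inverse_apply u)

theorem inCharts_perturbed {A : DarbouxAtlas Ω} (hh' : h' ∈ IsManifold.maximalAtlas (𝓡∂ 4) ∞ M)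
    {c : E3} (hc : sectionPt A x b c ∈ (A.at x).target) {a : E13} {V : E13 →L[ℝ] E13}
    (hX : hamVF Ω H (sectionMap A x b c) ≠ 0)
    (hXc : hamVF Ω H' (sectionMap A x b c) = hamVF Ω H (sectionMap A x b c))
    (hXa : hamVF Ω H' (flowMap A H x b a) = hamVF Ω H (flowMap A H x b a))
    (ha : flowMap A H x b a ∈ h'.source)
    (hflow : hamFlow Ω H' 1 (sectionMap A x b c) = flowMap A H x b a)
    (hS : (secFrame (sectionLin A x b)
      (chartVF Ω (A.chart (A.idx x)) H (sectionPt A x b c))).IsInvertible)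
    (hV : ∀ v, chartJac Ω (A.chart (A.idx x)) h' H' 1 (sectionMap A x b c)
      (secFrame (sectionLin A x b) (chartVF Ω (A.chart (A.idx x)) H (sectionPt A x b c)) v) =
        flowJac A H x b h' a (V v)) :
    inCharts (A.chart (A.idx x)) h' H' (sectionMap A x b c) (hamFlow Ω H' 1 (sectionMap A x b c))
        (transPoincare Ω H' 1 (sectionMap A x b c)) =
      (normalProj Ω h' H (flowMap A H x b a) ∘L flowJac A H x b h' a) ∘L V ∘L
        ((secFrame (sectionLin A x b) (chartVF Ω (A.chart (A.idx x)) H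
          (sectionPt A x b c))).inverse ∘L
          transProj Ω (A.chart (A.idx x)) H (sectionMap A x b c)) := by
  have hd := A.isDarbouxChart (A.idx x)
  have hz := sectionMap_mem_source hc
  have h1 := inCharts_transPoincare_comp hd.mem hh' (t := 1) (H := H') hz (by rw [hflow]; exact ha)
    (by rw [hXc]; exact hX) LinearMap.id (ContinuousLinearMap.id ℝ E4) fun v ↦ rfl
  rw [LinearMap.comp_id] at h1
  rw [h1, hflow, transProj_congr hd hz hXc,
    show normalProj Ω h' H' (flowMap A H x b a) = normalProj Ω h' H (flowMap A H x b a) by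
      rw [normalProj, hXa, normalProj]]
  refine ContinuousLinearMap.ext fun w ↦ ?_
  set u := transProj Ω (A.chart (A.idx x)) H (sectionMap A x b c) w
  change normalProj Ω h' H _ (chartJac Ω _ h' H' 1 _ u) = normalProj Ω h' H _
    (flowJac A H x b h' a (V ((secFrame (sectionLin A x b) (chartVF Ω (A.chart (A.idx x)) H
      (sectionPt A x b c))).inverse u)))
  rw [← hV, hS.apply_inverse]

end Assembly

theorem exists_pos_le_one_mul_lt {Z e r : ℝ} (hZ : 0 ≤ Z) (he : 0 < e) (hr : 0 < r) :
    ∃ R, 0 < R ∧ R ≤ 1 ∧ R ≤ r ∧ Z * R < e := by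
  refine ⟨min 1 (min r (e / (Z + 1))), by positivity, min_le_left _ _,
    (min_le_right _ _).trans (min_le_left _ _), ?_⟩
  have h1 : min 1 (min r (e / (Z + 1))) ≤ e / (Z + 1) := (min_le_right _ _).trans (min_le_right _ _)
  refine (mul_le_mul_of_nonneg_left h1 hZ).trans_lt ?_
  rw [mul_div_assoc', div_lt_iff₀ (by positivity)]
  nlinarith

section Assembly

variable {M : Type*} [TopologicalSpace M] [ChartedSpace (EuclideanHalfSpace 4) M]
  [IsManifold (𝓡∂ 4) ∞ M] [RiemannianBundle (fun x : M ↦ TangentSpace (𝓡∂ 4) x)]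
  [CompactSpace M] [T2Space M]
  {Ω : SymplecticForm M} {H : M → ℝ} {x : M}
  {b : Fin 3 → TangentSpace (𝓡∂ 4) x} {s : ℕ∞}

set_option maxHeartbeats 1000000 in
/-- The perturbation supported in the flowbox. -/
theorem exists_flowbox_perturbation (A : DarbouxAtlas Ω) (hs : 2 ≤ s) (hH : IsHamiltonian (s + 1) H)
    {ψ : ℝ → ℝ} {Ψ : ℝ} (hψ : ContDiff ℝ ∞ ψ) (hψs : HasCompactSupport ψ)
    (hψt : tsupport ψ ⊆ Icc (1 / 4) (1 / 2)) (hψ0 : ∀ θ, |ψ θ| ≤ Ψ) (hψ1 : ∀ θ, |deriv ψ θ| ≤ Ψ)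
    (hψ2 : ∀ θ, |deriv (deriv ψ) θ| ≤ Ψ) {C : ℝ} (hC : 0 ≤ C)
    (hflow : ∀ j, ∀ t ∈ Icc (0 : ℝ) 1, ∀ p ∈ A.core j, ∀ e : E4,
      ‖mfderiv (𝓡∂ 4) (𝓡∂ 4) (hamFlow Ω H (-t)) p ((chartD (A.chart j) p).inverse e)‖ ≤ C * ‖e‖)
    {u r r₁ r₀ : ℝ} (hu : 0 < u) (hu4 : u ≤ 1 / 4) (hr₀ : 0 < r₀)
    (hinj : ∀ c ∈ sectionBall A x b r, ∀ c' ∈ sectionBall A x b r,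
      ∀ t ∈ Icc (-u) (1 + u), ∀ t' ∈ Icc (-u) (1 + u),
        hamFlow Ω H t (sectionMap A x b c) = hamFlow Ω H t' (sectionMap A x b c') → c = c' ∧ t = t')
    {τ : E3 → ℝ} (hτ : ∀ c ∈ sectionBall A x b r, τ c ∈ Ioo (1 - u) (1 + u)) {Y : E4 → E4}
    (h𝓑 : ContDiffOn ℝ 1 (flowPoisson A x b Y) (ball 0 r₁))
    (hY : ∀ c ∈ sectionBall A x b r, c ∈ ball (0 : E3) r₁ ∧
      Y (sectionPt A x b c) = chartVF Ω (A.chart (A.idx x)) H (sectionPt A x b c) ∧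
      (secFrame (sectionLin A x b) (Y (sectionPt A x b c))).IsInvertible ∧
      ∀ w, ‖((secFrame (sectionLin A x b) (Y (sectionPt A x b c))).inverse w).2‖ ≤
        2 * ‖(chartD (A.chart (A.idx x)) (sectionMap A x b c)).inverse w‖)
    {U W : Set E3} (hU : U ⊆ sectionBall A x b r) (hWc : IsCompact (closure W))
    (hWU : closure W ⊆ U ∩ sectionInterior A x b) {α ε Cq η : ℝ} (hα : 0 ≤ α) (hε : 0 < ε)
    (hCq : 0 ≤ Cq) (hαε : α * Ψ * Cq * (2 * C) ^ 2 ≤ ε / 2) {q : E3 →L[ℝ] E3 →L[ℝ] ℝ}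
    (hpack : ∀ R > 0, ∃ (𝒢 : E3 → ℝ) (K : Set E3), ContDiff ℝ ∞ 𝒢 ∧ HasCompactSupport 𝒢 ∧
      tsupport 𝒢 ⊆ W ∧
      (∀ ζ, |𝒢 ζ| ≤ Cq * R ^ 2) ∧ (∀ ζ, ‖fderiv ℝ 𝒢 ζ‖ ≤ Cq * R) ∧
      (∀ ζ a, ‖fderiv ℝ (fderiv ℝ 𝒢) ζ a‖ ≤ Cq * ‖a‖) ∧ K ⊆ W ∧ MeasurableSet K ∧
      volume (W \ K) ≤ ENNReal.ofReal (7 * η) * volume W ∧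
      ∀ c ∈ K, ∃ ρ, 0 < ρ ∧ ρ < R ∧ closedBall c (η * ρ) ⊆ W ∧
        (∀ ζ ∈ closedBall c (η * ρ), |𝒢 ζ| ≤ Cq * ρ ^ 2 ∧ ‖fderiv ℝ 𝒢 ζ‖ ≤ Cq * ρ) ∧
        ∀ ζ ∈ ball c (η * ρ), ∀ ξ, fderiv ℝ (fderiv ℝ 𝒢) ζ ξ = q ξ) :
    ∃ K ⊆ W, MeasurableSet K ∧ volume (W \ K) ≤ ENNReal.ofReal (7 * η) * volume W ∧
    ∃ H' : M → ℝ, IsHamiltonian s H' ∧ A.C2Close ε H' H ∧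
      (∀ z ∉ flowbox A H x b τ U, H' z = H z) ∧
      (∀ c ∈ sectionBall A x b r, ∀ t ∈ Icc (-u) (1 + u), t ∉ Icc (1 / 4 : ℝ) (1 / 2) →
        H' =ᶠ[𝓝 (hamFlow Ω H t (sectionMap A x b c))] H) ∧
      ∃ 𝒢 : E3 → ℝ, ContDiff ℝ ∞ 𝒢 ∧ ∀ c ∈ K, ∃ ρ, 0 < ρ ∧ ρ < r₀ ∧ closedBall c (η * ρ) ⊆ W ∧
        (∀ ζ ∈ closedBall c (η * ρ), |𝒢 ζ| ≤ Cq * ρ ^ 2 ∧ ‖fderiv ℝ 𝒢 ζ‖ ≤ Cq * ρ) ∧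
        (∀ ζ ∈ ball c (η * ρ), ∀ ξ, fderiv ℝ (fderiv ℝ 𝒢) ζ ξ = q ξ) ∧
        ∃ (a : ℝ → E13) (V : ℝ → E13 →L[ℝ] E13), a 0 = (0, c) ∧
          (∀ t, HasDerivAt a (flatVF (flowPoisson A x b Y) α ψ 𝒢 (a t)) t) ∧ V 0 = 1 ∧
          (∀ t, HasDerivAt V (fderiv ℝ (flatVF (flowPoisson A x b Y) α ψ 𝒢) (a t) ∘L V t) t) ∧
          ((∀ t ∈ Icc (0 : ℝ) 1, (a t).1 ∈ Ioo (-u) (1 + u) ∧ (a t).2 ∈ W) →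
            hamFlow Ω H' 1 (sectionMap A x b c) = flowMap A H x b (a 1) ∧
            ∀ h' ∈ IsManifold.maximalAtlas (𝓡∂ 4) ∞ M, flowMap A H x b (a 1) ∈ h'.source → ∀ v,
              chartJac Ω (A.chart (A.idx x)) h' H' 1 (sectionMap A x b c)
                (secFrame (sectionLin A x b) (chartVF Ω (A.chart (A.idx x)) H
                  (sectionPt A x b c)) v) = flowJac A H x b h' (a 1) (V 1 v)) := by
  have hs1 : 1 ≤ s := (by simp : (1 : ℕ∞) ≤ 2).trans hs
  have hk := hs.trans (le_self_add (b := (1 : ℕ∞)))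
  have hΨ : 0 ≤ Ψ := (abs_nonneg _).trans (hψ0 0)
  set S : Set E13 := Ioo (-u) (1 + u) ×ˢ (sectionBall A x b r ∩ sectionInterior A x b) with hS
  have hSo : IsOpen S := isOpen_Ioo.prod isOpen_inter_sectionInterior
  have hWsub : closure W ⊆ sectionBall A x b r ∩ sectionInterior A x b := fun c hc ↦
    ⟨hU (hWU hc).1, (hWU hc).2⟩
  have hSinj : InjOn (flowMap A H x b) S := fun a ha a' ha' haa ↦ by
    obtain ⟨h1, h2⟩ := hinj a.2 ha.2.1 a'.2 ha'.2.1 a.1 (Ioo_subset_Icc_self ha.1) a'.1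
      (Ioo_subset_Icc_self ha'.1) haa
    exact Prod.ext h2 h1
  have hSY : ∀ a ∈ S, Y (sectionPt A x b a.2) =
      chartVF Ω (A.chart (A.idx x)) H (sectionPt A x b a.2) ∧
      (secFrame (sectionLin A x b) (Y (sectionPt A x b a.2))).IsInvertible := fun a ha ↦
    ⟨(hY _ ha.2.1).2.1, (hY _ ha.2.1).2.2.1⟩
  obtain ⟨G, hG⟩ : ∃ G, IsFlowboxInverse A H x b s S G := by
    obtain ⟨G, h1, h2, h3⟩ := exists_flowMap_inverse hs1 hH hSo hSinj fun a ha ↦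
      ⟨ha.2.2, (hSY a ha).1 ▸ (hSY a ha).2⟩
    exact ⟨G, fun a ha ↦ ha.2.2, h1, h2, fun a ha h hh hz ↦ (h3 a ha h hh hz).1,
      fun a ha h hh hz ↦ (h3 a ha h hh hz).2⟩
  set T : Set E13 := Icc (1 / 4) (1 / 2) ×ˢ closure W with hT
  have hTS : T ⊆ S := prod_mono (fun t ht ↦ ⟨by linarith [ht.1], by linarith [ht.2]⟩) hWsub
  obtain ⟨Λ, hΛ, hbd⟩ := hG.exists_chart_bounds hs hH (isCompact_Icc.prod hWc) hTS
  obtain ⟨R, hR, hR1, hRr, hRe⟩ := exists_pos_le_one_mul_lt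
    (Z := α * Ψ * Cq * (1 + 3 * Λ ^ 2 + 2 * Λ)) (by positivity) (half_pos hε) hr₀
  obtain ⟨𝒢, K, h𝒢, h𝒢s, h𝒢W, h0, h1, h2, hKW, hKm, hvol, hK⟩ := hpack R hR
  set f : E13 → ℝ := fun a ↦ α * (ψ a.1 * 𝒢 a.2) with hf
  have hfT : tsupport f ⊆ T :=
    tsupport_pert_subset.trans (prod_mono hψt (h𝒢W.trans subset_closure))
  have hfS := hfT.trans hTS
  have hfs : HasCompactSupport f :=
    (isCompact_Icc.prod hWc).of_isClosed_subset (isClosed_tsupport f) hfT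
  have hfc : ContDiff ℝ ∞ f := contDiff_const.mul ((hψ.comp contDiff_fst).mul (h𝒢.comp contDiff_snd))
  have hH' := hG.isHamiltonian_add_boxPert hs1 hH hfc hfs hfS
  refine ⟨K, hKW, hKm, hvol, _, hH', hG.c2Close hs hH hfs hfS hε ?_, ?_, ?_, 𝒢, h𝒢, ?_⟩
  · intro a ha j haj m hm i
    have haT := hfT ha
    have haS := hTS haT
    have hd := (A.isDarbouxChart j).mem
    have hz := A.core_subset j haj
    obtain ⟨hb1, hb2⟩ := hbd j a haT haj
    have hJ := hG.hasFDerivAt a haS _ hd hz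
    obtain ⟨-, hYa, hinv, hn⟩ := hY a.2 haS.2.1
    rw [hYa] at hinv hn
    refine abs_iteratedFDeriv_pert_comp_lt (C := Cq) (Ψ := Ψ) (R := R) (Λ := Λ) (ν := 2 * C) hψ h𝒢
      ((hG.contDiffAt a haS _ hd hz).of_le (WithTop.coe_le_coe.2 hs)) hα hCq hR.le hR1 hΛ
      (by positivity) hψ0 hψ1 hψ2 h0 h1 h2 hb1 (fun e ↦ ?_) hb2 ?_ hm i
    · rw [hJ.fderiv]
      exact norm_flowJac_inverse_snd_le hH hk hflow zero_le_two
        ⟨by linarith [haT.1.1], by linarith [haT.1.2]⟩ haS.2.2.1 hinv hn haj e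
    · have h3 : α * Ψ * Cq * R * (1 + 3 * Λ ^ 2 + 2 * Λ) =
        α * Ψ * Cq * (1 + 3 * Λ ^ 2 + 2 * Λ) * R := by ring
      rw [h3]
      linarith
  · intro z hz
    have : boxPert A H x b S G f z = 0 := hG.boxPert_eq_zero fun ⟨a, ha, haz⟩ ↦ hz (by
      obtain ⟨h3, h4⟩ := hfT ha
      have h5 := (hWU h4).1
      exact ⟨a.2, h5, a.1, ⟨by linarith [h3.1], by linarith [h3.2, (hτ _ (hU h5)).1]⟩, haz.symm⟩)
    simp only [this, add_zero]
  · intro c hc t ht ht'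
    have h3 := hG.boxPert_eventuallyEq_zero (f := f) hs1 hH hfs hfS
      (z := hamFlow Ω H t (sectionMap A x b c)) (by
        rintro ⟨a, ha, haz⟩
        have haS := hfS ha
        have := hinj a.2 haS.2.1 c hc a.1 (Ioo_subset_Icc_self haS.1) t ht haz
        exact ht' (this.2 ▸ (hfT ha).1))
    filter_upwards [h3] with w hw
    rw [hw, Pi.zero_apply, add_zero]
  · intro c hc
    obtain ⟨ρ, hρ, hρR, hρW, hρ1, hρ2⟩ := hK c hc
    obtain ⟨a, V, ha0, ha, hV0, hV, hend⟩ := hG.exists_perturbed_curve hs hH hSo hψ h𝒢 hψs h𝒢s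
      (h𝒢W.trans fun ζ hζ ↦ (hY ζ (hWsub (subset_closure hζ)).1).1) h𝓑 hH' hSY c
    refine ⟨ρ, hρ, hρR.trans_le hRr, hρW, hρ1, hρ2, a, V, ha0, ha, hV0, hV, fun h3 ↦ ?_⟩
    rw [← (hY c (hWsub (subset_closure (hKW hc))).1).2.1]
    exact hend fun t ht ↦ ⟨(h3 t ht).1, hWsub (subset_closure (h3 t ht).2)⟩

variable [IsContMDiffRiemannianBundle (𝓡∂ 4) ∞ (EuclideanSpace ℝ (Fin 4))
      (fun x : M ↦ TangentSpace (𝓡∂ 4) x)]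

set_option maxHeartbeats 1000000 in
theorem isRealizable_rotation (A : DarbouxAtlas Ω) (hs : 2 ≤ s) (hH : IsHamiltonian (s + 1) H)
    {ψ : ℝ → ℝ} {Ψ : ℝ} (hψ : ContDiff ℝ ∞ ψ) (hψs : HasCompactSupport ψ)
    (hψt : tsupport ψ ⊆ Icc (1 / 4) (1 / 2)) (hψ0 : ∀ θ, |ψ θ| ≤ Ψ) (hψ1 : ∀ θ, |deriv ψ θ| ≤ Ψ)
    (hψ2 : ∀ θ, |deriv (deriv ψ) θ| ≤ Ψ) (hψi : ∫ t in (0 : ℝ)..1, ψ t = 1) {C : ℝ} (hC : 0 ≤ C)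
    (hflow : ∀ j, ∀ t ∈ Icc (0 : ℝ) 1, ∀ p ∈ A.core j, ∀ e : E4,
      ‖mfderiv (𝓡∂ 4) (𝓡∂ 4) (hamFlow Ω H (-t)) p ((chartD (A.chart j) p).inverse e)‖ ≤ C * ‖e‖)
    {K L : ℝ} (hK : 0 ≤ K) (hω : ∀ x : M,
      (∀ v w : TangentSpace (𝓡∂ 4) x, |Ω.form x v w| ≤ K * ‖v‖ * ‖w‖) ∧
      ∀ (v : TangentSpace (𝓡∂ 4) x) (k : ℝ), 0 ≤ k → (∀ w, |Ω.form x v w| ≤ k * ‖w‖) → ‖v‖ ≤ K * k)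
    {α ε κ η C₀ : ℝ} (hα : 0 ≤ α) (hε : 0 < ε) (hκ : 0 < κ) (hη : 0 < η) (hηκ : 7 * η = κ / 4)
    (hη1 : η < 1) (hC₀ : 0 < C₀)
    (hpack : ∀ (Q : ℝ)
    (q : E3 →L[ℝ] E3 →L[ℝ] ℝ), (∀ a b, q a b = q b a) → (∀ a b, |q a b| ≤ Q * ‖a‖ * ‖b‖) →
    ∀ W : Set E3, IsOpen W → volume W ≠ ⊤ → ∀ R > 0,
    ∃ (𝒢 : E3 → ℝ) (K : Set E3), ContDiff ℝ ∞ 𝒢 ∧ HasCompactSupport 𝒢 ∧ tsupport 𝒢 ⊆ W ∧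
      (∀ ζ, |𝒢 ζ| ≤ C₀ * Q * R ^ 2) ∧ (∀ ζ, ‖fderiv ℝ 𝒢 ζ‖ ≤ C₀ * Q * R) ∧
      (∀ ζ a, ‖fderiv ℝ (fderiv ℝ 𝒢) ζ a‖ ≤ C₀ * Q * ‖a‖) ∧ K ⊆ W ∧ MeasurableSet K ∧
      volume (W \ K) ≤ ENNReal.ofReal (7 * η) * volume W ∧
      ∀ c ∈ K, ∃ ρ, 0 < ρ ∧ ρ < R ∧ closedBall c (η * ρ) ⊆ W ∧
        (∀ ζ ∈ closedBall c (η * ρ), |𝒢 ζ| ≤ C₀ * Q * ρ ^ 2 ∧ ‖fderiv ℝ 𝒢 ζ‖ ≤ C₀ * Q * ρ) ∧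
        ∀ ζ ∈ ball c (η * ρ), ∀ ξ, fderiv ℝ (fderiv ℝ 𝒢) ζ ξ = q ξ)
    (hαε : α * Ψ * (C₀ * (2 * (K * L) ^ 2)) * (2 * C) ^ 2 ≤ ε / 2)
    (hαη : α * Ψ * (C₀ * (2 * (K * L) ^ 2)) * K ≤ η / 4)
    (hper : ∀ t ∈ Ioc (0 : ℝ) 1, hamFlow Ω H t x ≠ x)
    (B : Module.Basis (Fin 2) ℝ (transFiber Ω H x)) (hB : IsCanonicalBasis Ω B L) :
    IsRealizable A H s 1 ε κ x (fun t ↦ transPoincare Ω H t x ∘ₗ transRotation Ω B α) := by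
  have hk := hs.trans (le_self_add (b := (1 : ℕ∞)))
  have hX := hamVF_ne_zero_of_forall A hH hk hper
  refine ⟨fun t _ ↦ ⟨fun v ↦ transPoincare_mem_transFiber A hH hk t _, fun v w ↦
    (form_transPoincare A hH hk t _ _).trans (form_transRotation B α v w)⟩, fun b hb γ hγ ↦ ?_⟩
  set x₁ := hamFlow Ω H 1 x with hx₁
  have hd' := A.isDarbouxChart (A.idx x₁)
  have hx₁s := A.mem_source x₁
  set h' := A.chart (A.idx x₁)
  set q := rotHessian Ω b (B 0 : TangentSpace (𝓡∂ 4) x) (B 1 : TangentSpace (𝓡∂ 4) x) with hq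
  set Q := 2 * (K * L) ^ 2 with hQ
  have hqQ : ∀ ζ ξ, |q ζ ξ| ≤ Q * ‖ζ‖ * ‖ξ‖ :=
    hb.abs_rotHessian_le hK (hω x).1 (hB.2 0) (hB.2 1)
  have hdB : ∀ i, dHam H x (B i : TangentSpace (𝓡∂ 4) x) = 0 := fun i ↦
    (Submodule.mem_inf.1 (B i).2).2
  obtain ⟨u, hu, hu4, r₂, hr₂, hinj, hτ⟩ := exists_poincareTime (A := A) hH hk hper hb
  obtain ⟨r₃, hr₃, hW⟩ := exists_open_subset (A := A) hH hk hb hX hκ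
  obtain ⟨Y, hYx, r₁, hr₁, B₁, hB₁, h𝓑, hb1, hb2, hb3, r₄, hr₄, hr₄₂, hsec⟩ :=
    exists_section_extension A hH hk hX hb (lt_min hr₂ hr₃)
  set N := flatGen (flowPoisson A x b Y) q with hN
  obtain ⟨δ, hδ, r₅, hr₅, hclose⟩ := exists_inCharts_close A hH hk hX hb hd' hx₁s (rotExp N α) hγ
  have hbounds : FlatBounds (flowPoisson A x b Y) q ψ r₁ B₁ Q (C₀ * Q) K α Ψ :=
    { contDiff := h𝓑
      hB := hB₁
      hQ := by positivity
      hC := by positivity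
      hα := hα
      norm_le := hb1
      norm_fderiv_le := hb2
      norm_sub_le := hb3
      norm_mixed_le := hb.norm_flowPoisson_snd_le hX hYx (hω x).2
      norm_q_le := fun a ↦ ContinuousLinearMap.opNorm_le_bound _ (by positivity) (hqQ a)
      contDiff_bump := hψ
      bump_le := hψ0
      deriv_bump_le := hψ1
      deriv2_bump_le := hψ2 }
  obtain ⟨r₀, hr₀, hlin⟩ := hbounds.exists_linearization hr₁ hK hη hη1 hαη
    (hb.flatGen_cube hX hYx (hdB 0) (hdB 1) hB.1 ((form_comm x _ _).trans (by rw [hB.1]))) hψi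
    (δ := min δ (u / 2)) (by positivity)
  obtain ⟨r₆, hr₆, hX6⟩ := exists_sectionBall_forall (A := A) (b := b) (x := x)
    (P := fun c ↦ hamVF Ω H (sectionMap A x b c) ≠ 0) (by
      have h1 : Tendsto (sectionMap A x b) (𝓝[{c | sectionPt A x b c ∈ (A.at x).target}] 0) (𝓝 x) := by
        have := continuousOn_sectionMap (A := A) (b := b) 0 (zero_mem_sectionBall one_pos).2.2
        rwa [ContinuousWithinAt, sectionMap_zero] at this
      have h2 : ∀ᶠ z in 𝓝 x, chartD (A.chart (A.idx x)) z (hamVF Ω H z) ≠ 0 :=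
        (continuousAt_chartD_hamVF hH hk (A.isDarbouxChart (A.idx x))
          (A.mem_source x)).eventually_ne
          (chartD_hamVF_ne_zero (A.isDarbouxChart (A.idx x)).mem (A.mem_source x) hX)
      exact (h1.eventually h2).mono fun c hc h0 ↦ hc (by rw [h0, map_zero]))
  set r := min (min r₄ r₅) (min (r₀ / 2) r₆) with hr
  have hrpos : 0 < r := by positivity
  have hr4 : r ≤ r₄ := (min_le_left _ _).trans (min_le_left _ _)
  have hr5 : r ≤ r₅ := (min_le_left _ _).trans (min_le_right _ _)
  have hr0 : r ≤ r₀ / 2 := (min_le_right _ _).trans (min_le_left _ _)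
  have hr6 : r ≤ r₆ := (min_le_right _ _).trans (min_le_right _ _)
  have hr2 : r ≤ r₂ := hr4.trans (hr₄₂.trans (min_le_left _ _))
  have hr3 : r ≤ r₃ := hr4.trans (hr₄₂.trans (min_le_right _ _))
  obtain ⟨τ, hτ1, hτ2⟩ := hτ r hrpos hr2
  refine ⟨r, hrpos, τ, hτ1, ?_⟩
  rintro U ⟨O, hO, rfl⟩
  obtain ⟨W, hWo, hWc, hWU, hWK⟩ := hW r hr3 O hO
  have hinj' : ∀ c ∈ sectionBall A x b r, ∀ c' ∈ sectionBall A x b r,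
      ∀ t ∈ Icc (-u) (1 + u), ∀ t' ∈ Icc (-u) (1 + u),
        hamFlow Ω H t (sectionMap A x b c) = hamFlow Ω H t' (sectionMap A x b c') →
          c = c' ∧ t = t' := fun c hc c' hc' ↦
    hinj c (sectionBall_mono hr2 hc) c' (sectionBall_mono hr2 hc')
  obtain ⟨K', hK'W, hK'm, hvol, H', hH', hclose2, hout, hnear, 𝒢, h𝒢, hK'⟩ :=
    exists_flowbox_perturbation A hs hH hψ hψs hψt hψ0 hψ1 hψ2 hC hflow hu hu4 hr₀ hinj' hτ2 h𝓑
      (fun c hc ↦ hsec c (sectionBall_mono hr4 hc)) inter_subset_right hWc hWU hα hε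
      (by positivity) hαε (hpack Q q (rotHessian_comm _ _) hqQ W hWo
        ((measure_mono subset_closure).trans_lt hWc.measure_lt_top).ne)
  have hWr : ∀ c ∈ W, c ∈ sectionBall A x b r := fun c hc ↦ (hWU (subset_closure hc)).1.2
  rw [hηκ] at hvol
  refine ⟨K', fun c hc ↦ (hWU (subset_closure (hK'W hc))).1, hK'm, hWK K' hK'W hK'm hvol,
    H', hH', hclose2, hout, fun c hc ↦ ⟨?_, ?_⟩, fun c hc ↦ ?_⟩
  · have h1 := hnear c hc.2 0 ⟨by linarith, by linarith⟩ (fun h ↦ by norm_num at h)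
    rw [hH.hamFlow_zero A hk] at h1
    exact sameDX_of_eventuallyEq h1
  · have h1 := hτ2 c hc.2
    exact sameDX_of_eventuallyEq (hnear c hc.2 (τ c) ⟨by linarith [h1.1], h1.2.le⟩
      fun h ↦ by linarith [h1.1, h.2])
  have hcr := hWr c (hK'W hc)
  obtain ⟨ρ, hρ, hρr, hρW, hρ1, hρ2, a, V, ha0, ha, hV0, hV, hend⟩ := hK' c hc
  obtain ⟨htr, hV1⟩ := hlin 𝒢 c ρ h𝒢 ((norm_lt_of_mem_sectionBall hcr).trans_le (by linarith)) hρ hρr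
    hρ1 hρ2 a V ha0 ha hV0 hV
  have htr1 : ∀ t ∈ Icc (0 : ℝ) 1, (a t).1 ∈ Ioo (-u) (1 + u) ∧ (a t).2 ∈ W := fun t ht ↦ by
    obtain ⟨h1, h2⟩ := htr t ht
    obtain ⟨h3, h4⟩ := abs_le.1 (h2.trans (min_le_right _ _))
    exact ⟨⟨by linarith [ht.1], by linarith [ht.2]⟩, hρW (ball_subset_closedBall h1)⟩
  obtain ⟨hflow1, hjac⟩ := hend htr1
  have h1I : (1 : ℝ) ∈ Icc (0 : ℝ) 1 := ⟨zero_le_one, le_rfl⟩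
  obtain ⟨h3, h4⟩ := abs_le.1 ((htr 1 h1I).2.trans (min_le_right _ _))
  obtain ⟨h5, h6⟩ := htr1 1 h1I
  have ha1r := hWr _ h6
  obtain ⟨hsrc, hfin⟩ := hclose (a 1) ((htr 1 h1I).2.trans (min_le_left _ _))
    (sectionBall_mono hr5 ha1r)
  have hXc : hamVF Ω H' (sectionMap A x b c) = hamVF Ω H (sectionMap A x b c) := by
    have h1 := hnear c hcr 0 ⟨by linarith, by linarith⟩ (fun h ↦ by norm_num at h)
    rw [hH.hamFlow_zero A hk] at h1
    exact hamVF_eq_of_eventuallyEq h1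
  have hXa : hamVF Ω H' (flowMap A H x b (a 1)) = hamVF Ω H (flowMap A H x b (a 1)) :=
    hamVF_eq_of_eventuallyEq (hnear (a 1).2 ha1r (a 1).1 (Ioo_subset_Icc_self h5)
      fun h ↦ by linarith [h.2])
  have hYc := hsec c (sectionBall_mono hr4 hcr)
  refine ⟨?_, ?_⟩
  · rw [hflow1, DarbouxAtlas.at, OpenPartialHomeomorph.extend_source]
    exact hsrc
  · rw [inCharts_perturbed hd'.mem hcr.2.2 (hX6 c (sectionBall_mono hr6 hcr)) hXc hXa hsrc hflow1
      (hYc.2.1 ▸ hYc.2.2.1) (hjac h' hd'.mem hsrc),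
      inCharts_transPoincare_rotation hX hb hYx B hB.1 α hd'.mem hx₁s]
    exact hfin c (sectionBall_mono hr5 hcr) (V 1) (hV1.trans (min_le_left _ _))

end Assembly

theorem mainTheorem8
    {M : Type*} [TopologicalSpace M] [ChartedSpace (EuclideanHalfSpace 4) M]
    [IsManifold (𝓡∂ 4) ∞ M] [CompactSpace M] [T2Space M]
    [RiemannianBundle (fun x : M ↦ TangentSpace (𝓡∂ 4) x)]
    [IsContMDiffRiemannianBundle (𝓡∂ 4) ∞ (EuclideanSpace ℝ (Fin 4))
      (fun x : M ↦ TangentSpace (𝓡∂ 4) x)]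
    (Ω : SymplecticForm M) (A : DarbouxAtlas Ω)
    (s : ℕ∞) (hs : 2 ≤ s) (H : M → ℝ) (hH : IsHamiltonian (s + 1) H)
    (ε κ : ℝ) (hε : 0 < ε) (hκ0 : 0 < κ) (hκ1 : κ < 1) (C : ℝ) :
    ∃ α₀ : ℝ, 0 < α₀ ∧
      ∀ x : M, (∀ t ∈ Ioc (0 : ℝ) 1, hamFlow Ω H t x ≠ x) →
      ∀ b : Module.Basis (Fin 2) ℝ (transFiber Ω H x), IsCanonicalBasis Ω b C →
      ∀ α : ℝ, 0 < α → α ≤ α₀ →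
        IsRealizable A H s 1 ε κ x (fun t ↦ transPoincare Ω H t x ∘ₗ transRotation Ω b α) := by
  obtain ⟨ψ, hψ, hψs, hψt, hψi, Ψ, hΨ, hψ0, hψ1, hψ2⟩ := exists_time_bump
  obtain ⟨K, hK, hform⟩ := IsCompact.exists_form_bound A
  obtain ⟨D, hD, hflow⟩ := exists_mfderiv_hamFlow_bound A hH (hs.trans le_self_add)
  have hη : 0 < κ / 28 := by positivity
  obtain ⟨C₀, hC₀, hpack⟩ := exists_packed_quadratic hη (by linarith)
  set Z := Ψ * (C₀ * (2 * (K * C) ^ 2)) with hZ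
  have hZ0 : 0 ≤ Z := by positivity
  obtain ⟨a₁, h1, -, -, h1'⟩ := exists_pos_le_one_mul_lt (Z := Z * (2 * D) ^ 2) (by positivity)
    (half_pos hε) one_pos
  obtain ⟨a₂, h2, -, h2', h2''⟩ := exists_pos_le_one_mul_lt (Z := Z * K) (e := κ / 28 / 4)
    (by positivity) (by positivity) h1
  refine ⟨a₂, h2, fun x hper b hb α hα hα' ↦ ?_⟩
  refine isRealizable_rotation A hs hH hψ hψs hψt hψ0 hψ1 hψ2 hψi hD hflow hK hform hα.le hε hκ0
    hη (by ring) (by linarith) hC₀ hpack ?_ ?_ hper b hb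
  · calc α * Ψ * (C₀ * (2 * (K * C) ^ 2)) * (2 * D) ^ 2 = Z * (2 * D) ^ 2 * α := by rw [hZ]; ring
      _ ≤ Z * (2 * D) ^ 2 * a₁ := by gcongr; exact hα'.trans h2'
      _ ≤ ε / 2 := h1'.le
  · calc α * Ψ * (C₀ * (2 * (K * C) ^ 2)) * K = Z * K * α := by rw [hZ]; ring
      _ ≤ Z * K * a₂ := by gcongr
      _ ≤ κ / 28 / 4 := h2''.le
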